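/- Let $k$ be an algebraically closed field. All algebras are finite dimensional, basic, connected $k$-algebras; modules are finite dimensional left modules. A $\Lambda$-module $T$ is called tilting (respectively cotilting) if $\operatorname{pd}_\Lambda T\le 1$ (respectively $\operatorname{id}_\Lambda T\le 1$), $\operatorname{Ext}^1_\Lambda(T,T)=0$, and $T$ is a direct sum of precisely $\operatorname{rk}K_0(\Lambda)$ pairwise nonisomorphic indecomposable modules, where $K_0(\Lambda)$ is the Grothendieck group of the category of $\Lambda$-modules. Two algebras $\Lambda,\Lambda'$ are tilting-cotilting equivalent if there is a finite sequence of algebras $\Lambda=\Lambda_0,\Lambda_1,\dots,\Lambda_n=\Lambda'$ such that for each $1\le i\le n$ there is a tilting or cotilting $\Lambda_{i-1}$-module $T_{i-1}$ with $\Lambda_i\cong\operatorname{End}_{\Lambda_{i-1}}(T_{i-1})^{\mathrm{op}}$. Paths in quivers are composed like functions: $\alpha\beta$ means first $\beta$, then $\alpha$; in a path $\alpha_1\cdots\alpha_p$ the arrow $\alpha_i$ starts where $\alpha_{i+1}$ terminates, the path runs from the start of $\alpha_p$ to the end of $\alpha_1$, and the interior vertices of different paths below are distinct new vertices. The algebra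 of a quiver bound by a set of paths is the path algebra modulo the two-sided ideal generated by these paths. Consider the following algebras. * $\Lambda_0(p,r)$, for $p\ge 1$ and $0\le r\le p-1$: the quiver has a path $\alpha_1\cdots\alpha_p$ from $x$ to $y$ and two arrows $\beta,\gamma$ from $y$ to $x$, where $x\ne y$; it is bound by $\alpha_p\beta$, $\alpha_i\alpha_{i+1}$ for $1\le i\le r$, and $\gamma\alpha_1$. * $\Lambda_0'(p,0)$, for $p\ge 1$: the quiver has three distinct vertices $x,y,z$, a path $\alpha_1\cdots\alpha_p$ and an arrow $\beta$, both from $y$ to $x$, and two arrows $\gamma,\delta$ from $z$ to $y$; it is bound by $\alpha_p\gamma$ and $\beta\delta$. * $\Lambda_1(p_1,p_2,p_3,p_4,r_1)$, for $p_1,p_2\ge 1$, $p_3,p_4\ge 0$, $0\le r_1\le p_1-1$ with $p_2+p_3\ge 2$ and $p_4+r_1\ge 1$: the quiver has vertices $x,y,z$, a path $\alpha_1\cdots\alpha_{p_1}$ from $x$ to $y$, a path $\beta_1\cdots\beta_{p_2}$ from $y$ to $x$, a path $\gamma_1\cdots\gamma_{p_3}$ from $y$ to $z$, and a path $\delta_1\cdots\delta_{p_4}$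 from $x$ to $z$ (so $y=z$ if $p_3=0$, $x=z$ if $p_4=0$, and there are no other coincidences); it is bound by $\alpha_i\alpha_{i+1}$ for $p_1-r_1\le i\le p_1-1$, $\alpha_{p_1}\beta_1$, $\beta_i\beta_{i+1}$ for $1\le i\le p_2-1$, and $\beta_{p_2}\alpha_1$. * $\Lambda_2(p_1,p_2,p_3,r_1,r_2)$, for $p_1,p_2\ge 1$, $p_3\ge 0$, $0\le r_1\le p_1-1$, $0\le r_2\le p_2-1$ with $p_3+r_1+r_2\ge 1$: the quiver has a path $\gamma_1\cdots\gamma_{p_3}$ from $b$ to $a$ (so $a=b$ exactly if $p_3=0$), a cyclic path $\alpha_1\cdots\alpha_{p_1}$ from $a$ to $a$, and a cyclic path $\beta_1\cdots\beta_{p_2}$ from $b$ to $b$; it is bound by $\alpha_i\alpha_{i+1}$ for $p_1-r_1\le i\le p_1-1$, $\alpha_{p_1}\alpha_1$, $\beta_i\beta_{i+1}$ for $p_2-r_2\le i\le p_2-1$, and $\beta_{p_2}\beta_1$. Let $\Lambda$ be one of the following algebras: 1. $\Lambda_1(p_1,p_2,p_3,p_4,r_1)$ with parameters as above such that either $p_3>p_4$,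 or $p_3=p_4$ and $p_2>r_1$; 2. $\Lambda_2(p_1,p_2,p_3,r_1,r_2)$ with parameters as above such that either $p_1>p_2$, or $p_1=p_2$ and $r_1\ge r_2$; 3. $\Lambda_0(p,r)$ with $p\ge 1$ and $0\le r\le p-1$; 4. $\Lambda_0'(p,0)$ with $p\ge 1$. Then $\Lambda$ and its opposite algebra $\Lambda^{\mathrm{op}}$ are tilting-cotilting equivalent. -/

import Mathlib

open scoped ModuleCat DirectSum

universe u

/-! ## Bound quivers with quadratic zero relations and their algebras -/

/-- A quiver with finitely many vertices, with a set of relations each of which is a product `α β` of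
two arrows.  Paths are composed like functions, so that `α β` means "first `β`, then `α`";
`rel α β` says that the product `α β` is one of the relations. -/
structure ZeroRelQuiver where
  /-- vertices -/
  V : Type
  /-- arrows -/
  E : Type
  [fintypeV : Fintype V]
  /-- starting vertex of an arrow -/
  s : E → V
  /-- terminating vertex of an arrow -/
  t : E → V
  /-- `rel α β`: the product `α β` is one of the relations -/
  rel : E → E → Prop

namespace ZeroRelQuiver

attribute [instance] ZeroRelQuiver.fintypeV

variable (k : Type u) [Field k] (Q : ZeroRelQuiver)

instance quiver : Quiver Q.V where
  Hom x y := {e : Q.E // Q.s e = x ∧ Q.t e = y}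

/-- All paths of the quiver, including the trivial path at each vertex; `⟨x, y, p⟩` starts at `x` and
terminates at `y`. -/
abbrev AnyPath : Type := Σ x y : Q.V, Quiver.Path x y

variable {Q} in
open Classical in
/-- The product `p q` of two paths (first `q`, then `p`), if `q` terminates where `p` starts. -/
noncomputable def AnyPath.mul? (p q : Q.AnyPath) : Option Q.AnyPath :=
  if h : q.2.1 = p.1 then some ⟨q.1, p.2.1, (q.2.2.cast rfl h).comp p.2.2⟩ else none

/-- The path algebra: the `k`-vector space with basis all paths. -/
def PathAlgebra : Type u := Q.AnyPath →₀ k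

namespace PathAlgebra

noncomputable instance : AddCommGroup (Q.PathAlgebra k) :=
  inferInstanceAs (AddCommGroup (Q.AnyPath →₀ k))

noncomputable instance : Module k (Q.PathAlgebra k) :=
  inferInstanceAs (Module k (Q.AnyPath →₀ k))

variable {Q}

/-- The basis of the path algebra consisting of all paths. -/
noncomputable def basis : Module.Basis Q.AnyPath k (Q.PathAlgebra k) :=
  .ofRepr (LinearEquiv.refl k (Q.AnyPath →₀ k))

/-- The basis element of the path algebra given by a path. -/
noncomputable def ofPath (p : Q.AnyPath) : Q.PathAlgebra k := basis k p

/-- The product of two basis elements: the composed path, or zero if the paths do not compose. -/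
noncomputable def pathMul (p q : Q.AnyPath) : Q.PathAlgebra k :=
  (p.mul? q).elim 0 (ofPath k)

/-- The multiplication of the path algebra: the bilinear extension of the composition of paths. -/
noncomputable def mulHom : Q.PathAlgebra k →ₗ[k] Q.PathAlgebra k →ₗ[k] Q.PathAlgebra k :=
  (basis k).constr k fun p => (basis k).constr k fun q => pathMul k p q

noncomputable instance : Mul (Q.PathAlgebra k) := ⟨fun f g => mulHom k f g⟩

noncomputable instance : One (Q.PathAlgebra k) := ⟨∑ x : Q.V, ofPath k ⟨x, x, Quiver.Path.nil⟩⟩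

theorem mul_def (f g : Q.PathAlgebra k) : f * g = mulHom k f g := rfl

theorem one_def : (1 : Q.PathAlgebra k) = ∑ x : Q.V, ofPath k ⟨x, x, Quiver.Path.nil⟩ := rfl

theorem ofPath_mul_ofPath (p q : Q.AnyPath) : ofPath k p * ofPath k q = pathMul k p q := by
  simp only [mul_def, mulHom, ofPath, Module.Basis.constr_basis]

theorem ofPath_mul_ofPath_of_eq {x y z : Q.V} (p : Quiver.Path y z) (q : Quiver.Path x y) :
    ofPath k (⟨y, z, p⟩ : Q.AnyPath) * ofPath k ⟨x, y, q⟩ = ofPath k ⟨x, z, q.comp p⟩ := by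
  simp [ofPath_mul_ofPath, pathMul, AnyPath.mul?]

theorem ofPath_mul_ofPath_of_ne {p q : Q.AnyPath} (h : q.2.1 ≠ p.1) :
    ofPath k p * ofPath k q = 0 := by
  simp [ofPath_mul_ofPath, pathMul, AnyPath.mul?, h]

variable {k} in
theorem induction {P : Q.PathAlgebra k → Prop} (f : Q.PathAlgebra k) (zero : P 0)
    (add : ∀ f g, P f → P g → P (f + g)) (basis' : ∀ (c : k) p, P (c • ofPath k p)) : P f := by
  have hf : f ∈ Submodule.span k (Set.range (basis k)) := (basis k).mem_span f
  induction hf using Submodule.closure_induction with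
  | zero => exact zero
  | add f g _ _ hf hg => exact add f g hf hg
  | smul_mem c x hx =>
    obtain ⟨p, rfl⟩ := hx
    exact basis' c p

theorem mul_add' (f g h : Q.PathAlgebra k) : f * (g + h) = f * g + f * h := by simp [mul_def]
theorem add_mul' (f g h : Q.PathAlgebra k) : (f + g) * h = f * h + g * h := by simp [mul_def]
theorem mul_zero' (f : Q.PathAlgebra k) : f * 0 = 0 := by simp [mul_def]
theorem zero_mul' (f : Q.PathAlgebra k) : 0 * f = 0 := by simp [mul_def]
theorem smul_mul' (c : k) (f g : Q.PathAlgebra k) : (c • f) * g = c • (f * g) := by simp [mul_def]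
theorem mul_smul' (c : k) (f g : Q.PathAlgebra k) : f * (c • g) = c • (f * g) := by simp [mul_def]
theorem sum_mul' {ι : Type*} (S : Finset ι) (F : ι → Q.PathAlgebra k) (f : Q.PathAlgebra k) :
    (∑ i ∈ S, F i) * f = ∑ i ∈ S, F i * f := by simp [mul_def]
theorem mul_sum' {ι : Type*} (S : Finset ι) (F : ι → Q.PathAlgebra k) (f : Q.PathAlgebra k) :
    f * (∑ i ∈ S, F i) = ∑ i ∈ S, f * F i := by simp [mul_def]

theorem mul_assoc_ofPath (p q r : Q.AnyPath) :
    ofPath k p * ofPath k q * ofPath k r = ofPath k p * (ofPath k q * ofPath k r) := by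
  obtain ⟨x, y, p⟩ := p
  obtain ⟨x', y', q⟩ := q
  obtain ⟨x'', y'', r⟩ := r
  by_cases h : y' = x
  · subst h
    by_cases h' : y'' = x'
    · subst h'
      simp only [ofPath_mul_ofPath_of_eq, Quiver.Path.comp_assoc]
    · rw [ofPath_mul_ofPath_of_eq, ofPath_mul_ofPath_of_ne k (q := ⟨x'', y'', r⟩) h',
        ofPath_mul_ofPath_of_ne k (q := ⟨x'', y'', r⟩) h', mul_zero']
  · by_cases h' : y'' = x'
    · subst h'
      rw [ofPath_mul_ofPath_of_eq, ofPath_mul_ofPath_of_ne k (p := ⟨x, y, p⟩) h,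
        ofPath_mul_ofPath_of_ne k (p := ⟨x, y, p⟩) h, zero_mul']
    · rw [ofPath_mul_ofPath_of_ne k (p := ⟨x, y, p⟩) h,
        ofPath_mul_ofPath_of_ne k (q := ⟨x'', y'', r⟩) h', mul_zero', zero_mul']

theorem mul_assoc' (f g h : Q.PathAlgebra k) : f * g * h = f * (g * h) := by
  induction f using induction with
  | zero => simp only [zero_mul']
  | add f f' hf hf' => simp only [add_mul', hf, hf']
  | basis' a p =>
    induction g using induction with
    | zero => simp only [zero_mul', mul_zero']
    | add g g' hg hg' => simp only [add_mul', mul_add', hg, hg']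
    | basis' b q =>
      induction h using induction with
      | zero => simp only [mul_zero']
      | add h h' hh hh' => simp only [mul_add', hh, hh']
      | basis' c r => simp only [smul_mul', mul_smul', mul_assoc_ofPath]

theorem one_mul' (f : Q.PathAlgebra k) : 1 * f = f := by
  classical
  induction f using induction with
  | zero => exact mul_zero' k _
  | add f f' hf hf' => rw [mul_add', hf, hf']
  | basis' c p =>
    obtain ⟨x, y, p⟩ := p
    rw [mul_smul', one_def, sum_mul', Finset.sum_eq_single y]
    · rw [ofPath_mul_ofPath_of_eq, Quiver.Path.comp_nil]
    · intro z _ hz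
      exact ofPath_mul_ofPath_of_ne k (p := ⟨z, z, Quiver.Path.nil⟩) (Ne.symm hz)
    · intro h
      exact absurd (Finset.mem_univ _) h

theorem mul_one' (f : Q.PathAlgebra k) : f * 1 = f := by
  classical
  induction f using induction with
  | zero => exact zero_mul' k _
  | add f f' hf hf' => rw [add_mul', hf, hf']
  | basis' c p =>
    obtain ⟨x, y, p⟩ := p
    rw [smul_mul', one_def, mul_sum', Finset.sum_eq_single x]
    · rw [ofPath_mul_ofPath_of_eq, Quiver.Path.nil_comp]
    · intro z _ hz
      exact ofPath_mul_ofPath_of_ne k (q := ⟨z, z, Quiver.Path.nil⟩) hz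
    · intro h
      exact absurd (Finset.mem_univ _) h

noncomputable instance : Ring (Q.PathAlgebra k) where
  mul_assoc := mul_assoc' k
  one_mul := one_mul' k
  mul_one := mul_one' k
  left_distrib := mul_add' k
  right_distrib := add_mul' k
  zero_mul := zero_mul' k
  mul_zero := mul_zero' k
  neg_add_cancel := neg_add_cancel
  zsmul := fun n f => n • f
  zsmul_zero' := SubNegMonoid.zsmul_zero'
  zsmul_succ' := SubNegMonoid.zsmul_succ'
  zsmul_neg' := SubNegMonoid.zsmul_neg'
  nsmul := fun n f => n • f
  nsmul_zero := AddMonoid.nsmul_zero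
  nsmul_succ := AddMonoid.nsmul_succ
  sub_eq_add_neg := sub_eq_add_neg

noncomputable instance : Algebra k (Q.PathAlgebra k) :=
  Algebra.ofModule (smul_mul' k) (mul_smul' k)

/-- The arrow `α` as an element of the path algebra. -/
noncomputable def arrow (α : Q.E) : Q.PathAlgebra k :=
  ofPath k ⟨Q.s α, Q.t α, Quiver.Hom.toPath ⟨α, rfl, rfl⟩⟩

end PathAlgebra

/-- The two-sided ideal of the path algebra generated by the relations. -/
noncomputable def relIdeal : TwoSidedIdeal (Q.PathAlgebra k) :=
  TwoSidedIdeal.span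
    {f | ∃ α β : Q.E, Q.rel α β ∧ f = PathAlgebra.arrow k α * PathAlgebra.arrow k β}

/-- The algebra of the quiver bound by the given relations: the path algebra modulo the two-sided
ideal generated by the relations. -/
abbrev BoundAlgebra : Type u := (Q.relIdeal k).ringCon.Quotient

end ZeroRelQuiver

/-! ## The families of algebras -/

/-- The vertices along a path `α₁ ⋯ α_p`, where the starting vertex of `α_p` is `last`, the
terminating vertex of `α₁` is `first`, and for `0 < i < p` the vertex between `α_i` and `α_{i+1}` is
`mid i`.  Thus `α_i` starts at vertex `i` and terminates at vertex `i - 1`. -/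
def lineVertex {V : Type} (p : ℕ) (first last : V) (mid : Set.Ioo 0 p → V) (i : ℕ) : V :=
  if h : 0 < i ∧ i < p then mid ⟨i, h⟩ else if i = 0 then first else last

/-- The arrows `α₁, …, α_p, β, γ`. -/
inductive Arrow₀ (p : ℕ) : Type
  | α (i : Set.Icc 1 p)
  | β
  | γ

/-- The quiver of `Λ₀(p, r)`: besides the interior vertices of the path `α₁ ⋯ α_p`, it has the
vertices `inl 0` (where `α_p` starts) and `inl 1` (where `α₁` terminates). -/
def quiverΛ₀ (p r : ℕ) : ZeroRelQuiver where
  V := Fin 2 ⊕ Set.Ioo 0 p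
  E := Arrow₀ p
  s
    | .α i => lineVertex p (.inl 1) (.inl 0) .inr i
    | .β => .inl 1
    | .γ => .inl 1
  t
    | .α i => lineVertex p (.inl 1) (.inl 0) .inr (i - 1)
    | .β => .inl 0
    | .γ => .inl 0
  rel
    | .α i, .α j => (j : ℕ) = i + 1 ∧ (i : ℕ) ∈ Set.Icc 1 r
    | .α i, .β => (i : ℕ) = p
    | .γ, .α i => (i : ℕ) = 1
    | _, _ => False

/-- The arrows `α₁, …, α_p, β, γ, δ`. -/
inductive Arrow₀' (p : ℕ) : Type
  | α (i : Set.Icc 1 p)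
  | β
  | γ
  | δ

/-- The quiver of `Λ₀'(p, r)`: besides the interior vertices of the path `α₁ ⋯ α_p`, it has the
vertices `inl 0` (where `α₁` and `β` terminate), `inl 1` (where `α_p` and `β` start, and `γ` and `δ`
terminate), and `inl 2` (where `γ` and `δ` start). -/
def quiverΛ₀' (p r : ℕ) : ZeroRelQuiver where
  V := Fin 3 ⊕ Set.Ioo 0 p
  E := Arrow₀' p
  s
    | .α i => lineVertex p (.inl 0) (.inl 1) .inr i
    | .β => .inl 1
    | .γ => .inl 2
    | .δ => .inl 2
  t
    | .α i => lineVertex p (.inl 0) (.inl 1) .inr (i - 1)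
    | .β => .inl 0
    | .γ => .inl 1
    | .δ => .inl 1
  rel
    | .α i, .α j => (j : ℕ) = i + 1 ∧ (i : ℕ) ∈ Set.Icc 1 r
    | .α i, .γ => (i : ℕ) = p
    | .β, .δ => True
    | _, _ => False

/-- The arrows `α₁, …, α_{p₁}`, `β₁, …, β_{p₂}`, `γ₁, …, γ_{p₃}`, `δ₁, …, δ_{p₄}`. -/
inductive Arrow₁ (p₁ p₂ p₃ p₄ : ℕ) : Type
  | α (i : Set.Icc 1 p₁)
  | β (i : Set.Icc 1 p₂)
  | γ (i : Set.Icc 1 p₃)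
  | δ (i : Set.Icc 1 p₄)

/-- The quiver of `Λ₁(p₁, p₂, p₃, p₄, r₁)`.  The vertices along the `γ`- and `δ`-arrows are the
integers in `[-p₄, p₃]`, where `0` is the vertex at which `γ₁ ⋯ γ_{p₃}` and `δ₁ ⋯ δ_{p₄}` terminate,
`i` is the starting vertex of `γ_i`, and `-i` is the starting vertex of `δ_i`.  The path
`α₁ ⋯ α_{p₁}` runs from `-p₄` to `p₃`, and the path `β₁ ⋯ β_{p₂}` runs from `p₃` to `-p₄`. -/
noncomputable def quiverΛ₁ (p₁ p₂ p₃ p₄ r₁ : ℕ) : ZeroRelQuiver where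
  V := Set.Icc (-p₄ : ℤ) (p₃ : ℤ) ⊕ Set.Ioo 0 p₁ ⊕ Set.Ioo 0 p₂
  E := Arrow₁ p₁ p₂ p₃ p₄
  s
    | .α i => lineVertex p₁ (.inl ⟨p₃, by simp⟩) (.inl ⟨-p₄, by simp⟩) (fun v => .inr (.inl v)) i
    | .β i => lineVertex p₂ (.inl ⟨-p₄, by simp⟩) (.inl ⟨p₃, by simp⟩) (fun v => .inr (.inr v)) i
    | .γ i => .inl ⟨(i : ℕ), by have := i.2.1; have := i.2.2; constructor <;> omega⟩
    | .δ i => .inl ⟨-(i : ℕ), by have := i.2.1; have := i.2.2; constructor <;> omega⟩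
  t
    | .α i =>
      lineVertex p₁ (.inl ⟨p₃, by simp⟩) (.inl ⟨-p₄, by simp⟩) (fun v => .inr (.inl v)) (i - 1)
    | .β i =>
      lineVertex p₂ (.inl ⟨-p₄, by simp⟩) (.inl ⟨p₃, by simp⟩) (fun v => .inr (.inr v)) (i - 1)
    | .γ i => .inl ⟨(i : ℕ) - 1, by have := i.2.1; have := i.2.2; constructor <;> omega⟩
    | .δ i => .inl ⟨-((i : ℕ) - 1), by have := i.2.1; have := i.2.2; constructor <;> omega⟩
  rel
    | .α i, .α j => (j : ℕ) = i + 1 ∧ (i : ℕ) ∈ Set.Icc (p₁ - r₁) (p₁ - 1)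
    | .α i, .β j => (i : ℕ) = p₁ ∧ (j : ℕ) = 1
    | .β i, .β j => (j : ℕ) = i + 1
    | .β i, .α j => (i : ℕ) = p₂ ∧ (j : ℕ) = 1
    | _, _ => False

/-- The arrows `α₁, …, α_{p₁}`, `β₁, …, β_{p₂}`, `γ₁, …, γ_{p₃}`. -/
inductive Arrow₂ (p₁ p₂ p₃ : ℕ) : Type
  | α (i : Set.Icc 1 p₁)
  | β (i : Set.Icc 1 p₂)
  | γ (i : Set.Icc 1 p₃)

/-- The quiver of `Λ₂(p₁, p₂, p₃, r₁, r₂)`.  The vertices along the path `γ₁ ⋯ γ_{p₃}` are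
`0, …, p₃`, where `γ_i` starts at `i` and terminates at `i - 1`.  The path `α₁ ⋯ α_{p₁}` is a cycle
at the vertex `0`, and the path `β₁ ⋯ β_{p₂}` is a cycle at the vertex `p₃`. -/
def quiverΛ₂ (p₁ p₂ p₃ r₁ r₂ : ℕ) : ZeroRelQuiver where
  V := Set.Icc 0 p₃ ⊕ Set.Ioo 0 p₁ ⊕ Set.Ioo 0 p₂
  E := Arrow₂ p₁ p₂ p₃
  s
    | .α i => lineVertex p₁ (.inl ⟨0, by simp⟩) (.inl ⟨0, by simp⟩) (fun v => .inr (.inl v)) i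
    | .β i => lineVertex p₂ (.inl ⟨p₃, by simp⟩) (.inl ⟨p₃, by simp⟩) (fun v => .inr (.inr v)) i
    | .γ i => .inl ⟨i, by have := i.2.2; constructor <;> omega⟩
  t
    | .α i =>
      lineVertex p₁ (.inl ⟨0, by simp⟩) (.inl ⟨0, by simp⟩) (fun v => .inr (.inl v)) (i - 1)
    | .β i =>
      lineVertex p₂ (.inl ⟨p₃, by simp⟩) (.inl ⟨p₃, by simp⟩) (fun v => .inr (.inr v)) (i - 1)
    | .γ i => .inl ⟨i - 1, by have := i.2.2; constructor <;> omega⟩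
  rel
    | .α i, .α j =>
      (j : ℕ) = i + 1 ∧ (i : ℕ) ∈ Set.Icc (p₁ - r₁) (p₁ - 1) ∨ (i : ℕ) = p₁ ∧ (j : ℕ) = 1
    | .β i, .β j =>
      (j : ℕ) = i + 1 ∧ (i : ℕ) ∈ Set.Icc (p₂ - r₂) (p₂ - 1) ∨ (i : ℕ) = p₂ ∧ (j : ℕ) = 1
    | _, _ => False

section Families

variable (k : Type u) [Field k]

/-- The algebra `Λ₀(p, r)`. -/
abbrev Λ₀ (p r : ℕ) : Type u := (quiverΛ₀ p r).BoundAlgebra k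

/-- The algebra `Λ₀'(p, r)`. -/
abbrev Λ₀' (p r : ℕ) : Type u := (quiverΛ₀' p r).BoundAlgebra k

/-- The algebra `Λ₁(p₁, p₂, p₃, p₄, r₁)`. -/
abbrev Λ₁ (p₁ p₂ p₃ p₄ r₁ : ℕ) : Type u := (quiverΛ₁ p₁ p₂ p₃ p₄ r₁).BoundAlgebra k

/-- The algebra `Λ₂(p₁, p₂, p₃, r₁, r₂)`. -/
abbrev Λ₂ (p₁ p₂ p₃ r₁ r₂ : ℕ) : Type u := (quiverΛ₂ p₁ p₂ p₃ r₁ r₂).BoundAlgebra k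

end Families

/-! ## Tilting-cotilting equivalence -/

section Tilting

open CategoryTheory

/-- Finitely generated left modules; for a finite dimensional algebra these are the finite
dimensional left modules. -/
abbrev FGMod (A : Type u) [Ring A] : Type (u + 1) := {M : ModuleCat.{u} A // Module.Finite A M}

/-- The relations `[Y] - [X] - [Z]` for the short exact sequences `0 → X → Y → Z → 0`. -/
def K₀Relations (A : Type u) [Ring A] : Set (FreeAbelianGroup (FGMod A)) :=
  {w | ∃ (X Y Z : FGMod A) (f : X.1 →ₗ[A] Y.1) (g : Y.1 →ₗ[A] Z.1),
    Function.Injective f ∧ Function.Exact f g ∧ Function.Surjective g ∧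
      w = FreeAbelianGroup.of Y - FreeAbelianGroup.of X - FreeAbelianGroup.of Z}

/-- The Grothendieck group of the category of finitely generated `A`-modules. -/
abbrev K₀ (A : Type u) [Ring A] : Type (u + 1) :=
  FreeAbelianGroup (FGMod A) ⧸ AddSubgroup.closure (K₀Relations A)

/-- `M` is a direct sum of precisely `n` pairwise nonisomorphic indecomposable modules. -/
def IsSumOfNonisoIndec {A : Type u} [Ring A] (M : ModuleCat.{u} A) (n : ℕ) : Prop :=
  ∃ X : Fin n → ModuleCat.{u} A, (∀ i, Indecomposable (X i)) ∧
    (∀ i j, i ≠ j → IsEmpty (X i ≅ X j)) ∧ Nonempty (M ≃ₗ[A] ⨁ i, X i)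

/-- `T` is a tilting module. -/
structure IsTilting {A : Type u} [Ring A] (T : ModuleCat.{u} A) : Prop where
  finite : Module.Finite A T
  pd_le_one : HasProjectiveDimensionLE T 1
  ext_eq_zero : Subsingleton (Abelian.Ext T T 1)
  isSum : IsSumOfNonisoIndec T (Module.finrank ℤ (K₀ A))

/-- `T` is a cotilting module. -/
structure IsCotilting {A : Type u} [Ring A] (T : ModuleCat.{u} A) : Prop where
  finite : Module.Finite A T
  id_le_one : HasInjectiveDimensionLE T 1
  ext_eq_zero : Subsingleton (Abelian.Ext T T 1)
  isSum : IsSumOfNonisoIndec T (Module.finrank ℤ (K₀ A))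

variable (k : Type u) [Field k]

/-- `A` is a finite dimensional basic connected `k`-algebra. Basic means that `A`, as a left module
over itself, is a direct sum of pairwise nonisomorphic indecomposable modules; connected means that
`A` is nonzero and has no central idempotents besides `0` and `1`. -/
structure IsBasicConnected (A : Type u) [Ring A] [Algebra k A] : Prop where
  finiteDimensional : FiniteDimensional k A
  nontrivial : Nontrivial A
  connected : ∀ e : A, e * e = e → (∀ a, e * a = a * e) → e = 0 ∨ e = 1
  basic : ∃ n, IsSumOfNonisoIndec (ModuleCat.of A A) n

/-- One step of a tilting-cotilting equivalence: `B` is isomorphic to the opposite of the endomorphism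
algebra of a tilting or cotilting `A`-module. -/
def TiltingCotiltingStep (A B : AlgCat.{u} k) : Prop :=
  IsBasicConnected k A ∧ IsBasicConnected k B ∧
    ∃ T : ModuleCat.{u} A, (IsTilting T ∨ IsCotilting T) ∧
      Nonempty (B ≃ₐ[k] (Module.End A T)ᵐᵒᵖ)

/-- `A` and `B` are tilting-cotilting equivalent: they are joined by a finite sequence of algebras in
which each is isomorphic to the opposite of the endomorphism algebra of a tilting or cotilting module
over the preceding one. -/
def TiltingCotiltingEquivalent (A B : Type u) [Ring A] [Algebra k A] [Ring B] [Algebra k B] : Prop :=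
  Relation.ReflTransGen (TiltingCotiltingStep k) (AlgCat.of k A) (AlgCat.of k B)

end Tilting

/-! All algebras of the theorem are gentle, and a gentle algebra is an algebra of triangular
matrices. Give every vertex `v` two ends `(v, false)` and `(v, true)`, and let every arrow lead from
an end of its source to an end of its target, in such a way that a product of two consecutive arrows
is nonzero exactly when they meet in the same end. The ends then form chains, the maximal nonzero
paths, and the algebra consists of the matrices supported on the resulting order whose diagonal
entries at the two ends of each vertex agree (`EndOrder.alg`, `Presentation.nonempty_equiv`). It is
therefore encoded by a list of ends cut into blocks. The opposite algebra belongs to the reversed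
list, and renaming vertices, exchanging the ends of a vertex or permuting blocks changes nothing up
to isomorphism. The theorem becomes a puzzle: transform a list into its reverse by moves that are
tilts.

The move is mutation at a vertex `x`. Let the end `x` come right behind an end `p`. The quotient of
`A e_p` by the multiples of the arrow from `p` to `x` loses the column of `p` above the diagonal,
and what remains is the column of the other end of `p`. Replacing `A e_x` by this cokernel gives a
tilting module, over whose endomorphism algebra `x` has jumped from behind `p` to the front of the
other end of `p` (`Slide`). This is `Slide.steps_of_lone` if the other end of `x` is isolated, and
`DoubleSlide.steps` if both ends of `x` jump, over different ends; in the second case the shared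
diagonal entry of the two columns of `x` leaves one additional scalar in the cokernel. Vector space
duality turns such a tilting module into a cotilting module over the opposite algebra, and a slide
read backwards is a slide of the reversed orders, so that every move can be undone (`Slide.equi`,
`Slide.equi₂`).

Counting summands needs no tilting theory. An algebra with orthogonal idempotents indexed by `V`,
characters separating them and nilpotent common kernel of the characters (`SplitBasic`) has a
Grothendieck group of rank `|V|` (`SplitBasic.finrank_K₀`), and a module with such an opposite
endomorphism ring is a sum of `|V|` pairwise nonisomorphic indecomposables
(`isSumOfNonisoIndec_of_end`). Self-extensions vanish because a two-term resolution is at hand.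

The puzzle is solved by the lemmas `sim_reverse_…`. Lone ends pass freely through relations
(`Sim.thread_lone`) and can be carried from behind an end to the front of its partner (`Sim.shift`).
For two chains with a common last vertex, or two cycles joined by a path, a double slide of one
vertex does the essential work, unless both cycles are loops; if a block closes up into a cycle, it
suffices to cut the cycle elsewhere (`Sim.cut`). In the comments on lists, `v` and `v'` stand for
`fstEnd v` and `sndEnd v`, a capital letter for a list of lone ends or a thread, and `|` for a break
between blocks. -/

set_option linter.unusedSectionVars false
set_option linter.unusedSimpArgs false

/-! ## Split basic algebras -/

/-- A complete set of orthogonal idempotents `e v` together with characters `χ v` separating them, such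
that the common kernel of the characters is nilpotent. -/
structure SplitBasic (k : Type u) [Field k] (A : Type u) [Ring A] [Algebra k A]
    (V : Type) [Fintype V] where
  e : V → A
  χ : V → (A →ₐ[k] k)
  mul_self : ∀ v, e v * e v = e v
  mul_of_ne : ∀ v w, v ≠ w → e v * e w = 0
  sum_e : ∑ v, e v = 1
  χ_e : ∀ v, χ v (e v) = 1
  nilp : ∃ n : ℕ, ∀ l : List A, l.length = n → (∀ a ∈ l, ∀ v, χ v a = 0) → l.prod = 0

namespace SplitBasic

variable {k : Type u} [Field k] {A : Type u} [Ring A] [Algebra k A] {V : Type} [Fintype V]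

theorem χ_e_ne (B : SplitBasic k A V) {v w : V} (h : v ≠ w) : B.χ v (B.e w) = 0 := by
  have := congrArg (B.χ v) (B.mul_of_ne v w h)
  simpa [B.χ_e] using this

theorem isNilpotent (B : SplitBasic k A V) {a : A} (ha : ∀ v, B.χ v a = 0) : IsNilpotent a := by
  obtain ⟨n, hn⟩ := B.nilp
  refine ⟨n, ?_⟩
  have := hn (List.replicate n a) (by simp) (by
    intro b hb v
    rw [List.eq_of_mem_replicate hb]
    exact ha v)
  simpa using this

theorem idem_eq_zero (B : SplitBasic k A V) {a : A} (h : a * a = a) (ha : ∀ v, B.χ v a = 0) :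
    a = 0 := by
  obtain ⟨n, hn⟩ := B.isNilpotent ha
  have h2 : IsIdempotentElem a := h
  rcases n with _ | n
  · simpa using congrArg (a * ·) hn
  · rwa [h2.pow_succ_eq] at hn

/-- The character at `v` is 0 or 1 on `a`, and all other characters vanish on the corner. So `a` or
`e v - a` is an idempotent in the nilpotent common kernel, hence zero. In other words, `e v` is
primitive. -/
theorem corner_idem (B : SplitBasic k A V) {a : A} {v : V} (h : a * a = a) (h1 : B.e v * a = a)
    (h2 : a * B.e v = a) : a = 0 ∨ a = B.e v := by
  have hχ : B.χ v a = 0 ∨ B.χ v a = 1 := by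
    have := congrArg (B.χ v) h
    rw [map_mul] at this
    rcases eq_or_ne (B.χ v a) 0 with h0 | h0
    · exact Or.inl h0
    · exact Or.inr (mul_right_cancel₀ h0 (by rw [this, one_mul]))
  have hne : ∀ w, w ≠ v → B.χ w a = 0 := by
    intro w hw
    rw [← h1, map_mul, B.χ_e_ne hw, zero_mul]
  rcases hχ with h0 | h0
  · refine Or.inl (B.idem_eq_zero h fun w => ?_)
    by_cases hw : w = v
    · rw [hw, h0]
    · exact hne w hw
  · refine Or.inr ?_
    have : B.e v - a = 0 := by
      refine B.idem_eq_zero ?_ fun w => ?_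
      · rw [sub_mul, mul_sub, mul_sub, B.mul_self, h1, h2, h, sub_self, sub_zero]
      · by_cases hw : w = v
        · rw [hw, map_sub, h0, B.χ_e, sub_self]
        · rw [map_sub, B.χ_e_ne hw, hne w hw, sub_self]
    exact (sub_eq_zero.1 this).symm

/-- The character at `v` kills everything that passes through `e w`. This will distinguish the
summands that belong to different vertices. -/
theorem not_factor (B : SplitBasic k A V) {v w : V} (hvw : v ≠ w) {a b : A} (h : a * b = B.e v)
    (h2 : B.e w * b = b) : False := by
  have h3 := congrArg (B.χ v) h
  rw [map_mul, ← h2, map_mul, B.χ_e_ne hvw, B.χ_e, zero_mul, mul_zero] at h3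
  exact zero_ne_one h3

theorem e_ne_zero (B : SplitBasic k A V) (v : V) : B.e v ≠ 0 := by
  intro h
  have := B.χ_e v
  rw [h, map_zero] at this
  exact zero_ne_one this

/-- The opposite algebra of a split basic algebra. -/
def op (B : SplitBasic k A V) : SplitBasic k Aᵐᵒᵖ V where
  e v := .op (B.e v)
  χ v := (AlgEquiv.toOpposite k k).symm.toAlgHom.comp (AlgHom.op (B.χ v))
  mul_self v := by rw [← MulOpposite.op_mul, B.mul_self]
  mul_of_ne v w h := by rw [← MulOpposite.op_mul, B.mul_of_ne w v h.symm, MulOpposite.op_zero]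
  sum_e := by
    have := congrArg MulOpposite.op B.sum_e
    simpa using this
  χ_e v := by simp [B.χ_e]
  nilp := by
    obtain ⟨n, hn⟩ := B.nilp
    refine ⟨n, fun l hl hχ => ?_⟩
    have := hn (l.map MulOpposite.unop).reverse (by simpa using hl) (by
      intro a ha v
      simp only [List.mem_reverse, List.mem_map] at ha
      obtain ⟨b, hb, rfl⟩ := ha
      simpa using hχ b hb v)
    apply MulOpposite.unop_injective
    rw [MulOpposite.unop_list_prod, this, MulOpposite.unop_zero]

/-- Transport of the structure along an isomorphism. -/
def ofEquiv {A' : Type u} [Ring A'] [Algebra k A'] (B : SplitBasic k A V) (f : A ≃ₐ[k] A') :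
    SplitBasic k A' V where
  e v := f (B.e v)
  χ v := (B.χ v).comp f.symm.toAlgHom
  mul_self v := by rw [← map_mul, B.mul_self]
  mul_of_ne v w h := by rw [← map_mul, B.mul_of_ne v w h, map_zero]
  sum_e := by rw [← map_sum, B.sum_e, map_one]
  χ_e v := by simp [B.χ_e]
  nilp := by
    obtain ⟨n, hn⟩ := B.nilp
    refine ⟨n, fun l hl hχ => ?_⟩
    have := hn (l.map f.symm) (by simpa using hl) (by
      intro a ha v
      simp only [List.mem_map] at ha
      obtain ⟨b, hb, rfl⟩ := ha
      simpa using hχ b hb v)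
    rw [← map_list_prod] at this
    simpa using this

end SplitBasic

/-! ## Decomposition of modules with split basic endomorphism ring -/

open CategoryTheory

theorem directSum_ranges {A : Type u} [Ring A] {M : Type u} [AddCommGroup M] [Module A M] {V : Type}
    [Fintype V] (ε : V → Module.End A M) (h1 : ∀ v, ε v * ε v = ε v)
    (h2 : ∀ v w, v ≠ w → ε v * ε w = 0) (h3 : ∑ v, ε v = 1) :
    Nonempty (M ≃ₗ[A] ⨁ v, LinearMap.range (ε v)) := by
  classical
  have e1 : M ≃ₗ[A] ((v : V) → LinearMap.range (ε v)) := by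
    refine LinearEquiv.ofLinearMap (LinearMap.pi fun v => (ε v).rangeRestrict)
      (∑ v, (LinearMap.range (ε v)).subtype ∘ₗ LinearMap.proj v) ?_ ?_
    · refine LinearMap.ext fun x => funext fun v => Subtype.ext ?_
      change ε v ((∑ w, (LinearMap.range (ε w)).subtype ∘ₗ LinearMap.proj w) x) = x v
      simp only [LinearMap.comp_apply, LinearMap.sum_apply, map_sum, Submodule.subtype_apply,
        LinearMap.proj_apply]
      rw [Finset.sum_eq_single v]
      · obtain ⟨y, hy⟩ := (x v).2
        rw [← hy, ← Module.End.mul_apply, h1]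
      · intro w _ hw
        obtain ⟨y, hy⟩ := (x w).2
        rw [← hy, ← Module.End.mul_apply, h2 _ _ hw.symm, LinearMap.zero_apply]
      · simp
    · ext m
      have := LinearMap.congr_fun h3 m
      simpa [LinearMap.sum_apply] using this
  exact ⟨e1.trans (DirectSum.linearEquivFunOnFintype A V fun v => LinearMap.range (ε v)).symm⟩

section

variable {k : Type u} [Field k] {A : Type u} [Ring A] {V : Type} [Fintype V]
  {B : Type u} [Ring B] [Algebra k B]

/-- The images of the idempotents of `B` decompose `T`; `corner_idem` makes them indecomposable and
`not_factor` pairwise nonisomorphic. This reduces the count of summands of a tilting module to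
knowledge of its endomorphism algebra. -/
theorem isSumOfNonisoIndec_of_end (S : SplitBasic k B V) (T : ModuleCat.{u} A)
    (φ : B ≃+* (Module.End A T)ᵐᵒᵖ) : IsSumOfNonisoIndec T (Fintype.card V) := by
  classical
  set ε : V → Module.End A T := fun v => (φ (S.e v)).unop with hε
  have h1 : ∀ v, ε v * ε v = ε v := fun v => by
    rw [hε]
    simp only [← MulOpposite.unop_mul, ← map_mul, S.mul_self]
  have h2 : ∀ v w, v ≠ w → ε v * ε w = 0 := fun v w h => by
    rw [hε]
    simp only [← MulOpposite.unop_mul, ← map_mul, S.mul_of_ne w v h.symm, map_zero,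
      MulOpposite.unop_zero]
  have h3 : ∑ v, ε v = 1 := by
    have := congrArg (fun b => (φ b).unop) S.sum_e
    simpa [hε] using this
  obtain ⟨D⟩ := directSum_ranges ε h1 h2 h3
  have hfix : ∀ v (x : LinearMap.range (ε v)), ε v x = x := by
    rintro v ⟨_, y, rfl⟩
    exact LinearMap.congr_fun (h1 v) y
  -- Maps between summands are viewed as endomorphisms of `T`, where they form the corners cut out
  -- by the `ε v`.
  let lift : ∀ v w, (LinearMap.range (ε v) →ₗ[A] LinearMap.range (ε w)) → Module.End A T :=
    fun v w g => (LinearMap.range (ε w)).subtype ∘ₗ g ∘ₗ (ε v).rangeRestrict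
  have lift_mul : ∀ u v w (g : LinearMap.range (ε v) →ₗ[A] LinearMap.range (ε w))
      (g' : LinearMap.range (ε u) →ₗ[A] LinearMap.range (ε v)),
      lift v w g * lift u v g' = lift u w (g.comp g') := by
    intro u v w g g'
    ext x
    change ((g ((ε v).rangeRestrict (g' ((ε u).rangeRestrict x) : T)) : _) : T) = _
    rw [show (ε v).rangeRestrict (g' ((ε u).rangeRestrict x) : T) = g' ((ε u).rangeRestrict x) from
      Subtype.ext (hfix v _)]
    rfl
  have lift_id : ∀ v, lift v v LinearMap.id = ε v := by
    intro v
    ext x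
    simp [lift]
  have lift_left : ∀ v w g, ε w * lift v w g = lift v w g := by
    intro v w g
    rw [← lift_id w, lift_mul, LinearMap.id_comp]
  have lift_right : ∀ v w g, lift v w g * ε v = lift v w g := by
    intro v w g
    rw [← lift_id v, lift_mul, LinearMap.comp_id]
  have lift_inj : ∀ v w g g', lift v w g = lift v w g' → g = g' := by
    intro v w g g' h
    ext x
    have := LinearMap.congr_fun h x
    simp only [lift, LinearMap.comp_apply, Submodule.subtype_apply] at this
    have hx : (ε v).rangeRestrict (x : T) = x := Subtype.ext (hfix v x)
    rwa [hx] at this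
  -- The opposite in the type of `φ` makes this map reverse products.
  let toB : Module.End A T → B := fun g => φ.symm (.op g)
  have toB_mul : ∀ f g, toB f * toB g = toB (g * f) := by
    intro f g
    simp only [toB, ← map_mul, ← MulOpposite.op_mul]
  have toB_ε : ∀ v, toB (ε v) = S.e v := by
    intro v
    simp [toB, hε]
  have toB_inj : Function.Injective toB := fun f g h => by
    simpa [toB] using h
  let eV := (Fintype.equivFin V).symm
  refine ⟨fun i => ModuleCat.of A (LinearMap.range (ε (eV i))), fun i => ?_, fun i j hij => ?_,
    ⟨D.trans (DirectSum.lequivCongrLeft A eV.symm)⟩⟩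
  · set v := eV i
    constructor
    · intro hz
      have hs : Subsingleton (LinearMap.range (ε v)) := ModuleCat.subsingleton_of_isZero hz
      have h0 : ε v = 0 := by
        rw [← lift_id v, show (LinearMap.id : LinearMap.range (ε v) →ₗ[A] _) = 0 from
          LinearMap.ext fun x => Subsingleton.elim _ _]
        ext x
        simp [lift]
      refine S.e_ne_zero v ?_
      rw [← toB_ε, h0]
      simp [toB]
    · intro Y Z a
      -- The projection onto the summand `Y`. As an idempotent of a corner it is zero or the
      -- identity, and accordingly `Y` or `Z` vanishes.
      let π : ModuleCat.of A (LinearMap.range (ε v)) ⟶ ModuleCat.of A (LinearMap.range (ε v)) :=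
        a.hom ≫ Limits.biprod.fst ≫ Limits.biprod.inl ≫ a.inv
      have hπ : π ≫ π = π := by simp [π]
      have hb := S.corner_idem (a := toB (lift v v π.hom)) (v := v)
        (by rw [toB_mul, lift_mul, ← ModuleCat.hom_comp, hπ])
        (by rw [← toB_ε, toB_mul, lift_right]) (by rw [← toB_ε, toB_mul, lift_left])
      rcases hb with hb | hb
      · left
        have h0 : π = 0 := by
          have h4 : lift v v π.hom = lift v v 0 := by
            apply toB_inj
            rw [hb]
            have : lift v v 0 = 0 := by ext x; simp [lift]
            rw [this]
            simp [toB]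
          ext1
          exact lift_inj v v _ _ h4
        have h5 : 𝟙 Y = Limits.biprod.inl ≫ a.inv ≫ π ≫ a.hom ≫ Limits.biprod.fst := by
          simp [π]
        rw [Limits.IsZero.iff_id_eq_zero, h5, h0]
        simp
      · right
        have h0 : π = 𝟙 _ := by
          have h4 : lift v v π.hom = lift v v LinearMap.id := by
            apply toB_inj
            rw [hb, lift_id, toB_ε]
          ext1
          exact lift_inj v v _ _ h4
        have h5 : 𝟙 Z = Limits.biprod.inr ≫ a.inv ≫ 𝟙 _ ≫ a.hom ≫ Limits.biprod.snd := by
          simp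
        rw [Limits.IsZero.iff_id_eq_zero, h5, ← h0]
        simp [π]
  · refine ⟨fun a => ?_⟩
    have hne : eV i ≠ eV j := fun h => hij (eV.injective h)
    refine S.not_factor hne (a := toB (lift (eV i) (eV j) a.hom.hom))
      (b := toB (lift (eV j) (eV i) a.inv.hom)) ?_ ?_
    · rw [toB_mul, lift_mul, ← ModuleCat.hom_comp, a.hom_inv_id, ModuleCat.hom_id, lift_id, toB_ε]
    · rw [← toB_ε, toB_mul, lift_right]
end

/-! ## The rank of the Grothendieck group -/

section K0

variable {k : Type u} [Field k] {A : Type u} [Ring A] [Algebra k A] {V : Type} [Fintype V]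

/-- The dimension of the component of a module at an idempotent. -/
noncomputable def dimAt (a : A) (M : ModuleCat.{u} A) : ℕ :=
  Module.finrank k (LinearMap.range (Algebra.lsmul k k M a))

theorem dimAt_add {e : A} (he : e * e = e) (X Y Z : ModuleCat.{u} A) [Module.Finite k Y]
    (f : X →ₗ[A] Y) (g : Y →ₗ[A] Z) (hf : Function.Injective f) (hfg : Function.Exact f g)
    (hg : Function.Surjective g) :
    dimAt (k := k) e Y = dimAt (k := k) e X + dimAt (k := k) e Z := by
  have mem : ∀ {M : ModuleCat.{u} A} (m : M),
      m ∈ LinearMap.range (Algebra.lsmul k k M e) ↔ e • m = m := by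
    intro M m
    constructor
    · rintro ⟨n, rfl⟩
      change e • e • n = e • n
      rw [smul_smul, he]
    · intro h
      exact ⟨m, h⟩
  let f' : LinearMap.range (Algebra.lsmul k k X e) →ₗ[k] LinearMap.range (Algebra.lsmul k k Y e) :=
    (f.restrictScalars k).restrict fun x hx => by
      rw [mem] at hx ⊢
      change e • f x = f x
      rw [← map_smul, hx]
  let g' : LinearMap.range (Algebra.lsmul k k Y e) →ₗ[k] LinearMap.range (Algebra.lsmul k k Z e) :=
    (g.restrictScalars k).restrict fun x hx => by
      rw [mem] at hx ⊢
      change e • g x = g x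
      rw [← map_smul, hx]
  have hf' : Function.Injective f' := fun x y h => Subtype.ext (hf (congrArg Subtype.val h))
  have hg' : LinearMap.range g' = ⊤ := by
    rw [LinearMap.range_eq_top]
    rintro ⟨z, hz⟩
    obtain ⟨y, rfl⟩ := hg z
    refine ⟨⟨e • y, y, rfl⟩, Subtype.ext ?_⟩
    change g (e • y) = g y
    rw [map_smul, (mem _).1 hz]
  have hk : LinearMap.ker g' = LinearMap.range f' := by
    ext ⟨y, hy⟩
    rw [LinearMap.mem_ker, LinearMap.mem_range]
    constructor
    · intro h
      obtain ⟨x, hx⟩ := (hfg y).1 (congrArg Subtype.val h)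
      refine ⟨⟨e • x, x, rfl⟩, Subtype.ext ?_⟩
      change f (e • x) = y
      rw [map_smul, hx, (mem _).1 hy]
    · rintro ⟨x, hx⟩
      refine Subtype.ext ?_
      have : f x = y := congrArg Subtype.val hx
      exact (hfg y).2 ⟨x, this⟩
  have h1 := LinearMap.finrank_range_add_finrank_ker g'
  rw [hk, LinearMap.finrank_range_of_inj hf', hg', finrank_top] at h1
  unfold dimAt
  omega

/-- The simple module given by a character. -/
noncomputable def charModule (χ : A →ₐ[k] k) : ModuleCat.{u} A :=
  @ModuleCat.of A _ k _ (Module.compHom k χ.toRingHom)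

theorem charModule_smul (χ : A →ₐ[k] k) (a : A) (c : k) :
    a • (show charModule χ from c) = (show charModule χ from χ a * c) := rfl

theorem charModule_smul' (χ : A →ₐ[k] k) (a : k) (c : k) :
    a • (show charModule χ from c) = (show charModule χ from a * c) := by
  rw [← algebraMap_smul A a (show charModule χ from c), charModule_smul, AlgHom.commutes]
  rfl

/-- `k` as the underlying vector space of the simple module given by a character. -/
noncomputable def charModuleEquiv (χ : A →ₐ[k] k) : k ≃ₗ[k] charModule χ where
  toFun c := c
  invFun c := c
  map_add' _ _ := rfl
  map_smul' a c := (charModule_smul' χ a c).symm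
  left_inv _ := rfl
  right_inv _ := rfl

instance (χ : A →ₐ[k] k) : Module.Finite k (charModule χ) :=
  Module.Finite.equiv (charModuleEquiv χ)

theorem finite_of_finite_restrict (M : ModuleCat.{u} A) [Module.Finite k M] : Module.Finite A M :=
  Module.Finite.of_restrictScalars_finite k A M

/-- Apply elements of the common kernel of the characters to a nonzero vector as long as the result
is nonzero; nilpotence stops this at a vector `m` killed by the kernel. A nonzero component `e v •
m` is then a common eigenvector, because `a * e v - χ v a • e v` lies in the kernel. -/
theorem SplitBasic.exists_socle (S : SplitBasic k A V) (M : ModuleCat.{u} A) [Nontrivial M] :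
    ∃ (v : V) (m : M), m ≠ 0 ∧ ∀ a : A, a • m = S.χ v a • m := by
  classical
  obtain ⟨n, hn⟩ := S.nilp
  have key : ∀ (n : ℕ) (m : M), m ≠ 0 →
      (∀ l : List A, l.length = n → (∀ a ∈ l, ∀ v, S.χ v a = 0) → l.prod • m = 0) →
      ∃ m : M, m ≠ 0 ∧ ∀ a : A, (∀ v, S.χ v a = 0) → a • m = 0 := by
    intro n
    induction n with
    | zero =>
      intro m hm h
      exact absurd (by simpa using h [] rfl (by simp)) hm
    | succ n ih =>
      intro m hm h
      by_cases h1 : ∀ a : A, (∀ v, S.χ v a = 0) → a • m = 0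
      · exact ⟨m, hm, h1⟩
      · push Not at h1
        obtain ⟨a, ha, ham⟩ := h1
        refine ih (a • m) ham fun l hl hl' => ?_
        have := h (l ++ [a]) (by simp [hl]) (by
          intro b hb
          rcases List.mem_append.1 hb with hb | hb
          · exact hl' b hb
          · rw [List.mem_singleton.1 hb]; exact ha)
        simpa [mul_smul] using this
  obtain ⟨m0, hm0⟩ := exists_ne (0 : M)
  obtain ⟨m, hm, hJ⟩ := key n m0 hm0 fun l hl hl' => by rw [hn l hl hl', zero_smul]
  have : ∃ v, S.e v • m ≠ 0 := by
    by_contra! h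
    apply hm
    rw [← one_smul A m, ← S.sum_e, Finset.sum_smul]
    exact Finset.sum_eq_zero fun v _ => h v
  obtain ⟨v, hv⟩ := this
  refine ⟨v, S.e v • m, hv, fun a => ?_⟩
  have h0 : (a * S.e v - S.χ v a • S.e v) • m = 0 := by
    refine hJ _ fun w => ?_
    by_cases hw : w = v
    · subst hw
      simp [S.χ_e]
    · simp [S.χ_e_ne hw]
  rw [sub_smul, sub_eq_zero, mul_smul, smul_assoc] at h0
  exact h0

/-- The class of a module in the Grothendieck group. -/
noncomputable def K₀.mk (M : FGMod A) : K₀ A := QuotientAddGroup.mk (FreeAbelianGroup.of M)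

theorem K₀.mk_add (X Y Z : FGMod A) (f : X.1 →ₗ[A] Y.1) (g : Y.1 →ₗ[A] Z.1)
    (hf : Function.Injective f) (hfg : Function.Exact f g) (hg : Function.Surjective g) :
    K₀.mk Y = K₀.mk X + K₀.mk Z := by
  have : (QuotientAddGroup.mk (FreeAbelianGroup.of Y - FreeAbelianGroup.of X -
      FreeAbelianGroup.of Z) : K₀ A) = 0 :=
    (QuotientAddGroup.eq_zero_iff _).2
      (AddSubgroup.subset_closure ⟨X, Y, Z, f, g, hf, hfg, hg, rfl⟩)
  rw [QuotientAddGroup.mk_sub, QuotientAddGroup.mk_sub, sub_sub, sub_eq_zero] at this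
  exact this

/-- The simple modules as finitely generated modules. -/
noncomputable def SplitBasic.simple (S : SplitBasic k A V) (v : V) : FGMod A :=
  ⟨charModule (S.χ v), finite_of_finite_restrict (k := k) _⟩

/-- Induction on the dimension: `exists_socle` embeds a simple module, and the quotient has
dimension one less. -/
theorem SplitBasic.mk_mem_span (S : SplitBasic k A V) [Module.Finite k A] (n : ℕ) (M : FGMod A)
    (hM : Module.finrank k M.1 = n) :
    K₀.mk M ∈ Submodule.span ℤ (Set.range fun v => K₀.mk (S.simple v)) := by
  induction n using Nat.strong_induction_on generalizing M with
  | _ n ih =>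
    have := M.2
    have hfin : Module.Finite k M.1 := Module.Finite.trans A M.1
    rcases subsingleton_or_nontrivial M.1 with hs | hs
    · have h0 := K₀.mk_add M M M LinearMap.id LinearMap.id (fun _ _ h => h)
        (fun y => ⟨fun _ => ⟨y, rfl⟩, fun _ => Subsingleton.elim _ _⟩) (fun y => ⟨y, rfl⟩)
      rw [right_eq_add] at h0
      rw [h0]
      exact Submodule.zero_mem _
    · obtain ⟨v, m, hm, hv⟩ := S.exists_socle M.1
      let f : (S.simple v).1 →ₗ[A] M.1 :=
        { toFun := fun c => (show k from c) • m
          map_add' := fun c d => add_smul (show k from c) (show k from d) m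
          map_smul' := fun a c => by
            change (S.χ v a * (show k from c)) • m = a • (show k from c) • m
            rw [smul_comm a, hv, smul_smul, mul_comm] }
      have hf : Function.Injective f := by
        intro c d h
        exact smul_left_injective k hm h
      let Q : FGMod A := ⟨ModuleCat.of A (M.1 ⧸ LinearMap.range f), inferInstanceAs
        (Module.Finite A (M.1 ⧸ LinearMap.range f))⟩
      have hfg : Function.Exact f (LinearMap.range f).mkQ := by
        rw [LinearMap.exact_iff, Submodule.ker_mkQ]
      rw [K₀.mk_add (S.simple v) M Q f (LinearMap.range f).mkQ hf hfg
        (Submodule.mkQ_surjective _)]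
      refine Submodule.add_mem _ (Submodule.subset_span ⟨v, rfl⟩) (ih _ ?_ Q rfl)
      let q : M.1 →ₗ[k] Q.1 := LinearMap.restrictScalars k
        (show M.1 →ₗ[A] Q.1 from (LinearMap.range f).mkQ)
      have hq : LinearMap.range q = ⊤ :=
        LinearMap.range_eq_top.2 (Submodule.mkQ_surjective (LinearMap.range f))
      have hk : LinearMap.ker q = LinearMap.range (f.restrictScalars k) := by
        ext x
        exact hfg x
      have h1 := LinearMap.finrank_range_add_finrank_ker q
      rw [hq, hk, finrank_top] at h1
      have h2 : Module.finrank k (LinearMap.range (f.restrictScalars k)) = 1 := by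
        rw [LinearMap.finrank_range_of_inj (f := f.restrictScalars k) hf]
        exact ((charModuleEquiv (S.χ v)).finrank_eq).symm.trans (Module.finrank_self k)
      omega

/-- The simple modules generate the group, and the dimension vector, which is additive, maps them to
the standard basis of `V → ℤ`. Hence they form a basis. -/
theorem SplitBasic.finrank_K₀ (S : SplitBasic k A V) [Module.Finite k A] :
    Module.finrank ℤ (K₀ A) = Fintype.card V := by
  classical
  let δ : K₀ A →+ (V → ℤ) := QuotientAddGroup.lift _
    (FreeAbelianGroup.lift fun M : FGMod A => fun v => (dimAt (k := k) (S.e v) M.1 : ℤ)) (by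
      rw [AddSubgroup.closure_le]
      rintro _ ⟨X, Y, Z, f, g, hf, hfg, hg, rfl⟩
      have := Y.2
      have hfin : Module.Finite k Y.1 := Module.Finite.trans A Y.1
      rw [SetLike.mem_coe, AddMonoidHom.mem_ker]
      funext v
      have := dimAt_add (k := k) (S.mul_self v) X.1 Y.1 Z.1 f g hf hfg hg
      simp [this])
  let s : (V → ℤ) →ₗ[ℤ] K₀ A := Fintype.linearCombination ℤ fun v => K₀.mk (S.simple v)
  have hs : Function.Surjective s := by
    rw [← LinearMap.range_eq_top, Fintype.range_linearCombination, eq_top_iff]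
    rintro x -
    obtain ⟨x, rfl⟩ := QuotientAddGroup.mk_surjective x
    induction x using FreeAbelianGroup.induction_on with
    | zero => exact Submodule.zero_mem _
    | of M => exact S.mk_mem_span _ M rfl
    | neg M h => exact Submodule.neg_mem _ h
    | add x y hx hy => exact Submodule.add_mem _ hx hy
  have hδ : ∀ v, δ (K₀.mk (S.simple v)) = Pi.single v 1 := by
    intro v
    change (FreeAbelianGroup.lift fun M : FGMod A => fun v => (dimAt (k := k) (S.e v) M.1 : ℤ))
      (FreeAbelianGroup.of (S.simple v)) = _
    rw [FreeAbelianGroup.lift_apply_of]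
    funext w
    by_cases h : w = v
    · subst h
      have : LinearMap.range (Algebra.lsmul k k (S.simple w).1 (S.e w)) = ⊤ := by
        rw [LinearMap.range_eq_top]
        intro c
        refine ⟨c, ?_⟩
        change S.χ w (S.e w) * (show k from c) = c
        rw [S.χ_e, one_mul]
      rw [dimAt, this, finrank_top, Pi.single_eq_same]
      exact_mod_cast ((charModuleEquiv (S.χ w)).finrank_eq).symm.trans (Module.finrank_self k)
    · have : LinearMap.range (Algebra.lsmul k k (S.simple v).1 (S.e w)) = ⊥ := by
        rw [LinearMap.range_eq_bot]
        ext c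
        change S.χ v (S.e w) * (show k from c) = (0 : k)
        rw [S.χ_e_ne (Ne.symm h), zero_mul]
      rw [dimAt, this, finrank_bot, Pi.single_eq_of_ne h, Nat.cast_zero]
  have hs' : Function.Injective s := by
    apply Function.LeftInverse.injective (g := δ)
    intro x
    have : δ.toIntLinearMap ∘ₗ s = LinearMap.id := by
      refine LinearMap.pi_ext' fun v => ?_
      ext1
      simp only [LinearMap.comp_apply, s]
      rw [LinearMap.single_apply, Fintype.linearCombination_apply_single, one_smul]
      exact hδ v
    exact LinearMap.congr_fun this x
  rw [← (LinearEquiv.ofBijective s ⟨hs', hs⟩).finrank_eq, Module.finrank_fintype_fun_eq_card]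

end K0

/-! ## Basic connected algebras -/

section BasicConnected

variable {k : Type u} [Field k] {A : Type u} [Ring A] [Algebra k A] {V : Type} [Fintype V]

/-- Two vertices are linked if there is a nonzero element between them. -/
def SplitBasic.Linked (S : SplitBasic k A V) (v w : V) : Prop := ∃ a, S.e w * a * S.e v ≠ 0

/-- Any two vertices are joined by a chain of links. -/
def SplitBasic.IsConnected (S : SplitBasic k A V) : Prop :=
  Nonempty V ∧ ∀ v w, Relation.EqvGen S.Linked v w

/-- At each vertex `c * e v` is 0 or `e v`. A nonzero element between two vertices commutes with
`c`, so the alternative is the same at linked vertices and, by connectedness, at all of them. -/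
theorem SplitBasic.eq_zero_or_one_of_central (S : SplitBasic k A V) (hS : S.IsConnected) (c : A)
    (hc : c * c = c) (hcomm : ∀ a, c * a = a * c) : c = 0 ∨ c = 1 := by
  have corner : ∀ v, c * S.e v = 0 ∨ c * S.e v = S.e v := fun v => by
    refine S.corner_idem ?_ ?_ ?_
    · rw [mul_assoc, ← mul_assoc (S.e v), ← hcomm, mul_assoc, S.mul_self, ← mul_assoc, hc]
    · rw [← mul_assoc, ← hcomm, mul_assoc, S.mul_self]
    · rw [mul_assoc, S.mul_self]
  have key : ∀ v w, Relation.EqvGen S.Linked v w → (c * S.e v = 0 ↔ c * S.e w = 0) := by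
    intro v w h
    induction h with
    | refl => rfl
    | symm _ _ _ h => exact h.symm
    | trans _ _ _ _ _ h1 h2 => exact h1.trans h2
    | rel v w h =>
      obtain ⟨a, ha⟩ := h
      have h1 : c * S.e w * (a * S.e v) = S.e w * a * (c * S.e v) := by
        rw [← mul_assoc (S.e w * a), ← hcomm (S.e w * a)]
        simp only [mul_assoc]
      constructor
      · intro h0
        refine (corner w).resolve_right fun h2 => ha ?_
        rwa [h2, h0, mul_zero, ← mul_assoc] at h1
      · intro h0
        refine (corner v).resolve_right fun h2 => ha ?_
        rwa [h2, h0, zero_mul, eq_comm] at h1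
  obtain ⟨⟨v⟩, hS⟩ := hS
  have sum : c = ∑ w, c * S.e w := by rw [← Finset.mul_sum, S.sum_e, mul_one]
  rcases corner v with h | h
  · left
    rw [sum]
    exact Finset.sum_eq_zero fun w _ => (key v w (hS v w)).1 h
  · right
    rw [sum, ← S.sum_e]
    refine Finset.sum_congr rfl fun w _ => (corner w).resolve_left fun h0 => ?_
    rw [(key v w (hS v w)).2 h0] at h
    exact S.e_ne_zero v h.symm

theorem SplitBasic.isBasicConnected (S : SplitBasic k A V) [Module.Finite k A]
    (hS : S.IsConnected) : IsBasicConnected k A where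
  finiteDimensional := inferInstance
  nontrivial := by
    obtain ⟨⟨v⟩, _⟩ := hS
    exact ⟨S.e v, 0, S.e_ne_zero v⟩
  connected := S.eq_zero_or_one_of_central hS
  basic := ⟨_, isSumOfNonisoIndec_of_end S (ModuleCat.of A A)
    ((RingEquiv.opOp A).trans (RingEquiv.op (RingEquiv.moduleEndSelf A)))⟩

theorem SplitBasic.IsConnected.op {S : SplitBasic k A V} (hS : S.IsConnected) :
    S.op.IsConnected := by
  refine ⟨hS.1, fun v w => ?_⟩
  induction hS.2 v w with
  | refl => exact .refl _
  | symm _ _ _ h => exact .symm _ _ h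
  | trans _ _ _ _ _ h1 h2 => exact .trans _ _ _ h1 h2
  | rel v w h =>
    obtain ⟨a, ha⟩ := h
    refine .symm _ _ (.rel _ _ ⟨.op a, fun h => ha ?_⟩)
    change MulOpposite.op (S.e v) * .op a * .op (S.e w) = 0 at h
    rwa [← MulOpposite.op_mul, ← MulOpposite.op_mul, MulOpposite.op_eq_zero_iff, ← mul_assoc] at h

theorem SplitBasic.IsConnected.ofEquiv {S : SplitBasic k A V} (hS : S.IsConnected) {A' : Type u}
    [Ring A'] [Algebra k A'] (f : A ≃ₐ[k] A') : (S.ofEquiv f).IsConnected := by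
  refine ⟨hS.1, fun v w => Relation.EqvGen.mono ?_ v w (hS.2 v w)⟩
  rintro v w ⟨a, ha⟩
  refine ⟨f a, ?_⟩
  change f _ * f a * f _ ≠ 0
  rw [← map_mul, ← map_mul]
  exact fun h => ha (f.injective (h.trans (map_zero f).symm))

end BasicConnected

/-! ## Tilting modules from presentations -/

open CategoryTheory

section Ext

universe v w
variable {C : Type w} [Category.{v} C] [Abelian C] [HasExt.{v} C]

/-- An extension class restricts to zero on the projective middle term, so it is the product of the
class of the sequence with a map `g` from `X₁` to `Y`. If `g` extends to `X₂`, this product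
vanishes. -/
theorem ext_one_eq_zero_of_projective {S : ShortComplex C} (hS : S.ShortExact) [Projective S.X₂]
    {Y : C} (h : ∀ g : S.X₁ ⟶ Y, ∃ h : S.X₂ ⟶ Y, S.f ≫ h = g) :
    Subsingleton (Abelian.Ext S.X₃ Y 1) := by
  refine subsingleton_of_forall_eq 0 fun x => ?_
  obtain ⟨x₁, rfl⟩ := Abelian.Ext.contravariant_sequence_exact₃ hS Y x
    (Abelian.Ext.eq_zero_of_projective _) (add_zero 1)
  obtain ⟨g, rfl⟩ := (Abelian.Ext.mk₀_bijective _ _).2 x₁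
  obtain ⟨h, rfl⟩ := h g
  rw [← Abelian.Ext.mk₀_comp_mk₀, ← Abelian.Ext.comp_assoc_of_second_deg_zero, hS.extClass_comp,
    Abelian.Ext.zero_comp]

theorem ext_one_eq_zero_of_injective {S : ShortComplex C} (hS : S.ShortExact) [Injective S.X₂]
    {Y : C} (h : ∀ g : Y ⟶ S.X₃, ∃ h : Y ⟶ S.X₂, h ≫ S.g = g) :
    Subsingleton (Abelian.Ext Y S.X₁ 1) := by
  refine subsingleton_of_forall_eq 0 fun x => ?_
  obtain ⟨x₁, rfl⟩ := Abelian.Ext.covariant_sequence_exact₁ Y hS x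
    (Abelian.Ext.eq_zero_of_injective _) (zero_add 1)
  obtain ⟨g, rfl⟩ := (Abelian.Ext.mk₀_bijective _ _).2 x₁
  obtain ⟨h, rfl⟩ := h g
  rw [← Abelian.Ext.mk₀_comp_mk₀, Abelian.Ext.comp_assoc_of_second_deg_zero, hS.comp_extClass,
    Abelian.Ext.comp_zero]

end Ext

section Presentation

variable {k : Type u} [Field k] {A : Type u} [Ring A] [Algebra k A] {B : Type u} [Ring B]
  [Algebra k B] {V : Type} [Fintype V]

theorem shortExact_of {X Y Z : Type u} [AddCommGroup X] [Module A X] [AddCommGroup Y] [Module A Y]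
    [AddCommGroup Z] [Module A Z] (f : X →ₗ[A] Y) (g : Y →ₗ[A] Z) (hf : Function.Injective f)
    (hfg : Function.Exact f g) (hg : Function.Surjective g) :
    (ShortComplex.mk (ModuleCat.ofHom f) (ModuleCat.ofHom g) (by
      ext x; exact hfg.apply_apply_eq_zero x)).ShortExact where
  exact := (ShortComplex.ShortExact.moduleCat_exact_iff_function_exact _).2 hfg
  mono_f := (ModuleCat.mono_iff_injective _).2 hf
  epi_g := (ModuleCat.epi_iff_surjective _).2 hg

/-- A ring isomorphism to the opposite endomorphism ring which is compatible with scalars gives an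
isomorphism of algebras. -/
noncomputable def endEquiv (T : ModuleCat.{u} A) (φ : B ≃+* (Module.End A T)ᵐᵒᵖ)
    (hφ : ∀ (c : k) (t : T), (φ (algebraMap k B c)).unop t = algebraMap k A c • t) :
    B ≃ₐ[k] (Module.End A T)ᵐᵒᵖ :=
  AlgEquiv.ofRingEquiv (f := φ) fun c => by
    apply MulOpposite.unop_injective
    ext t
    rw [hφ]
    rfl

/-- The resolution bounds the projective dimension and `hl` kills the self-extensions. The right
number of summands is automatic, since the idempotents of `A` and those of `B` are indexed by the
same set `V`. -/
theorem step_of_tilting_presentation (S : SplitBasic k A V) (hS : S.IsConnected)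
    (S' : SplitBasic k B V) (hS' : S'.IsConnected) [Module.Finite k A] [Module.Finite k B]
    {T P₀ P₁ : Type u} [AddCommGroup T] [Module A T] [AddCommGroup P₀] [Module A P₀]
    [AddCommGroup P₁] [Module A P₁] [Module.Finite A T] [Module.Projective A P₀]
    [Module.Projective A P₁] (i : P₁ →ₗ[A] P₀) (π : P₀ →ₗ[A] T) (hi : Function.Injective i)
    (hiπ : Function.Exact i π) (hπ : Function.Surjective π)
    (hl : ∀ g : P₁ →ₗ[A] T, ∃ h : P₀ →ₗ[A] T, h ∘ₗ i = g)
    (φ : B ≃+* (Module.End A T)ᵐᵒᵖ)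
    (hφ : ∀ (c : k) (t : T), (φ (algebraMap k B c)).unop t = algebraMap k A c • t) :
    TiltingCotiltingStep k (AlgCat.of k A) (AlgCat.of k B) := by
  refine ⟨S.isBasicConnected hS, S'.isBasicConnected hS', ModuleCat.of A T, Or.inl ?_,
    ⟨endEquiv (ModuleCat.of A T) φ hφ⟩⟩
  have hse := shortExact_of i π hi hiπ hπ
  have h0 : Projective (ModuleCat.of A P₀) := (IsProjective.iff_projective P₀).1 inferInstance
  have h1 : Projective (ModuleCat.of A P₁) := (IsProjective.iff_projective P₁).1 inferInstance
  refine ⟨inferInstanceAs (Module.Finite A T), ?_, ?_, ?_⟩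
  · exact hse.hasProjectiveDimensionLT_X₃ 1
      (inferInstanceAs (HasProjectiveDimensionLT (ModuleCat.of A P₁) 1))
      (inferInstanceAs (HasProjectiveDimensionLT (ModuleCat.of A P₀) (1 + 1)))
  · refine @ext_one_eq_zero_of_projective _ _ _ _ _ hse h0 _ fun g => ?_
    obtain ⟨h, hh⟩ := hl g.hom
    refine ⟨ModuleCat.ofHom h, ?_⟩
    ext1
    exact hh
  · have : IsSumOfNonisoIndec (ModuleCat.of A T) (Fintype.card V) :=
      isSumOfNonisoIndec_of_end S' (ModuleCat.of A T) φ
    rwa [← S.finrank_K₀] at this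

theorem step_of_cotilting_presentation (S : SplitBasic k A V) (hS : S.IsConnected)
    (S' : SplitBasic k B V) (hS' : S'.IsConnected) [Module.Finite k A] [Module.Finite k B]
    {T I₀ I₁ : Type u} [AddCommGroup T] [Module A T] [AddCommGroup I₀] [Module A I₀]
    [AddCommGroup I₁] [Module A I₁] [Module.Finite A T] [Module.Injective A I₀]
    [Module.Injective A I₁] (i : T →ₗ[A] I₀) (π : I₀ →ₗ[A] I₁) (hi : Function.Injective i)
    (hiπ : Function.Exact i π) (hπ : Function.Surjective π)
    (hl : ∀ g : T →ₗ[A] I₁, ∃ h : T →ₗ[A] I₀, π ∘ₗ h = g)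
    (φ : B ≃+* (Module.End A T)ᵐᵒᵖ)
    (hφ : ∀ (c : k) (t : T), (φ (algebraMap k B c)).unop t = algebraMap k A c • t) :
    TiltingCotiltingStep k (AlgCat.of k A) (AlgCat.of k B) := by
  refine ⟨S.isBasicConnected hS, S'.isBasicConnected hS', ModuleCat.of A T, Or.inr ?_,
    ⟨endEquiv (ModuleCat.of A T) φ hφ⟩⟩
  have hse := shortExact_of i π hi hiπ hπ
  have h0 : Injective (ModuleCat.of A I₀) :=
    (Module.injective_iff_injective_object A I₀).1 inferInstance
  have h1 : Injective (ModuleCat.of A I₁) :=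
    (Module.injective_iff_injective_object A I₁).1 inferInstance
  refine ⟨inferInstanceAs (Module.Finite A T), ?_, ?_, ?_⟩
  · exact hse.hasInjectiveDimensionLT_X₁ 1
      (inferInstanceAs (HasInjectiveDimensionLT (ModuleCat.of A I₁) 1))
      (inferInstanceAs (HasInjectiveDimensionLT (ModuleCat.of A I₀) (1 + 1)))
  · refine @ext_one_eq_zero_of_injective _ _ _ _ _ hse h0 _ fun g => ?_
    obtain ⟨h, hh⟩ := hl g.hom
    refine ⟨ModuleCat.ofHom h, ?_⟩
    ext1
    exact hh
  · have : IsSumOfNonisoIndec (ModuleCat.of A T) (Fintype.card V) :=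
      isSumOfNonisoIndec_of_end S' (ModuleCat.of A T) φ
    rwa [← S.finrank_K₀] at this

/-- Isomorphic algebras are related by the tilting module `A`. -/
theorem step_of_equiv (S : SplitBasic k A V) (hS : S.IsConnected) [Module.Finite k A]
    (f : A ≃ₐ[k] B) : TiltingCotiltingStep k (AlgCat.of k A) (AlgCat.of k B) := by
  have : Module.Finite k B := Module.Finite.equiv f.toLinearEquiv
  refine step_of_tilting_presentation S hS (S.ofEquiv f) (hS.ofEquiv f) (T := A) (P₀ := A)
    (P₁ := PUnit) 0 LinearMap.id (fun _ _ _ => rfl) (fun y => ⟨fun h => ⟨0, h.symm⟩, ?_⟩)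
    (fun y => ⟨y, rfl⟩) (fun g => ⟨0, ?_⟩)
    (f.symm.toRingEquiv.trans
      ((RingEquiv.opOp A).trans (RingEquiv.op (RingEquiv.moduleEndSelf A)))) ?_
  · rintro ⟨_, rfl⟩; rfl
  · ext x
    rw [show x = 0 from rfl, map_zero, map_zero]
  · intro c t
    have : f.symm (algebraMap k B c) = algebraMap k A c := f.symm.commutes c
    change t * f.symm (algebraMap k B c) = algebraMap k A c * t
    rw [this, Algebra.commutes]

end Presentation

/-! ## Duality -/

/-- The dual space of a module, as a module over the opposite ring. -/
def DualMod (k : Type u) [Field k] (T : Type u) [AddCommGroup T] [Module k T] : Type u :=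
  Module.Dual k T

section Duality

variable (k : Type u) [Field k] {A : Type u} [Ring A] [Algebra k A]
variable (T : Type u) [AddCommGroup T] [Module k T]

noncomputable instance : AddCommGroup (DualMod k T) := inferInstanceAs (AddCommGroup (Module.Dual k T))
noncomputable instance : Module k (DualMod k T) := inferInstanceAs (Module k (Module.Dual k T))
instance [Module.Finite k T] : Module.Finite k (DualMod k T) :=
  inferInstanceAs (Module.Finite k (Module.Dual k T))
instance : FunLike (DualMod k T) T k := inferInstanceAs (FunLike (Module.Dual k T) T k)
instance : LinearMapClass (DualMod k T) k T k :=
  inferInstanceAs (LinearMapClass (Module.Dual k T) k T k)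

variable {k T}

@[ext] theorem DualMod.ext {f g : DualMod k T} (h : ∀ t, f t = g t) : f = g := DFunLike.ext _ _ h
@[simp] theorem DualMod.add_apply (f g : DualMod k T) (t : T) : (f + g) t = f t + g t := rfl
@[simp] theorem DualMod.zero_apply (t : T) : (0 : DualMod k T) t = 0 := rfl
@[simp] theorem DualMod.smul_apply (c : k) (f : DualMod k T) (t : T) : (c • f) t = c * f t := rfl

theorem DualMod.eq_of_forall {t t' : T} (h : ∀ f : DualMod k T, f t = f t') : t = t' := by
  rw [← sub_eq_zero, ← Module.forall_dual_apply_eq_zero_iff k]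
  intro f
  rw [map_sub, sub_eq_zero]
  exact h f

variable [Module A T] [IsScalarTower k A T]

noncomputable instance : Module Aᵐᵒᵖ (DualMod k T) where
  smul a f := LinearMap.comp (show T →ₗ[k] k from f) (Algebra.lsmul k k T a.unop)
  one_smul f := DualMod.ext fun t => congrArg f (one_smul A t)
  mul_smul a b f := DualMod.ext fun t => congrArg f (mul_smul b.unop a.unop t)
  smul_zero _ := rfl
  smul_add _ _ _ := rfl
  add_smul a b f := DualMod.ext fun t =>
    (congrArg f (add_smul a.unop b.unop t)).trans (map_add f _ _)
  zero_smul f := DualMod.ext fun t => (congrArg f (zero_smul A t)).trans (map_zero f)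

@[simp] theorem DualMod.op_smul_apply (a : Aᵐᵒᵖ) (f : DualMod k T) (t : T) :
    (a • f) t = f (a.unop • t) := rfl

instance : IsScalarTower k Aᵐᵒᵖ (DualMod k T) where
  smul_assoc c a f := DualMod.ext fun t => by
    rw [DualMod.op_smul_apply, DualMod.smul_apply, DualMod.op_smul_apply, MulOpposite.unop_smul,
      smul_assoc, map_smul, smul_eq_mul]

variable {T' : Type u} [AddCommGroup T'] [Module k T'] [Module A T'] [IsScalarTower k A T']

/-- The dual of a module homomorphism. -/
noncomputable def DualMod.map (f : T →ₗ[A] T') : DualMod k T' →ₗ[Aᵐᵒᵖ] DualMod k T where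
  toFun φ := LinearMap.comp (show T' →ₗ[k] k from φ) (f.restrictScalars k)
  map_add' _ _ := rfl
  map_smul' a φ := DualMod.ext fun t => congrArg φ (map_smul f a.unop t).symm

@[simp] theorem DualMod.map_apply (f : T →ₗ[A] T') (φ : DualMod k T') (t : T) :
    DualMod.map f φ t = φ (f t) := rfl

/-- For fixed `t` the functional `φ ↦ g φ t` on the dual of `T'` is evaluation at a vector of `T'`,
by finite dimension. This vector is the image of `t`. -/
theorem DualMod.exists_map_eq [Module.Finite k T'] (g : DualMod k T' →ₗ[Aᵐᵒᵖ] DualMod k T) :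
    ∃ f : T →ₗ[A] T', DualMod.map f = g := by
  have hk : ∀ (c : k) (φ : DualMod k T'), g (c • φ) = c • g φ := by
    intro c φ
    rw [← algebraMap_smul Aᵐᵒᵖ c φ, map_smul, algebraMap_smul]
  have key : ∀ t, ∃ t', ∀ φ : DualMod k T', φ t' = g φ t := by
    intro t
    let ev : Module.Dual k (Module.Dual k T') :=
      { toFun := fun φ => g φ t
        map_add' := fun φ ψ => DFunLike.congr_fun
          (map_add g (show DualMod k T' from φ) (show DualMod k T' from ψ)) t
        map_smul' := fun c φ => DFunLike.congr_fun (hk c (show DualMod k T' from φ)) t }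
    refine ⟨(Module.evalEquiv k T').symm ev, fun φ => ?_⟩
    exact LinearMap.congr_fun ((Module.evalEquiv k T').apply_symm_apply ev) φ
  choose f hf using key
  refine ⟨{ toFun := f, map_add' := fun x y => ?_, map_smul' := fun a x => ?_ }, ?_⟩
  · refine DualMod.eq_of_forall (k := k) fun φ => ?_
    rw [hf, map_add, map_add, hf, hf]
  · refine DualMod.eq_of_forall (k := k) fun φ => ?_
    rw [hf, RingHom.id_apply]
    have := DFunLike.congr_fun (map_smul g (MulOpposite.op a) φ) x
    rw [DualMod.op_smul_apply, MulOpposite.unop_op] at this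
    rw [← this, ← hf]
    rfl
  · ext φ t
    exact hf t φ

theorem DualMod.map_injective : Function.Injective
    (DualMod.map (k := k) : (T →ₗ[A] T') → (DualMod k T' →ₗ[Aᵐᵒᵖ] DualMod k T)) := by
  intro f g h
  ext t
  refine DualMod.eq_of_forall (k := k) fun φ => ?_
  exact DFunLike.congr_fun (LinearMap.congr_fun h φ) t

theorem DualMod.injective_of_surjective {f : T →ₗ[A] T'} (hf : Function.Surjective f) :
    Function.Injective (DualMod.map (k := k) f) :=
  LinearMap.dualMap_injective_of_surjective (f := f.restrictScalars k) hf

theorem DualMod.surjective_of_injective {f : T →ₗ[A] T'} (hf : Function.Injective f) :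
    Function.Surjective (DualMod.map (k := k) f) :=
  LinearMap.dualMap_surjective_of_injective (f := f.restrictScalars k) hf

theorem DualMod.exact {T'' : Type u} [AddCommGroup T''] [Module k T''] [Module A T'']
    [IsScalarTower k A T''] {f : T →ₗ[A] T'} {g : T' →ₗ[A] T''} (hfg : Function.Exact f g) :
    Function.Exact (DualMod.map (k := k) g) (DualMod.map (k := k) f) := by
  have h := LinearMap.range_dualMap_eq_dualAnnihilator_ker (g.restrictScalars k)
  intro φ
  have h2 : φ ∈ Set.range (DualMod.map (k := k) g) ↔
      ∀ w ∈ LinearMap.ker (g.restrictScalars k), φ w = 0 := by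
    have h3 := Submodule.mem_dualAnnihilator (W := LinearMap.ker (g.restrictScalars k))
      (show Module.Dual k T' from φ)
    rw [← h] at h3
    exact h3
  rw [h2]
  constructor
  · intro h0 t ht
    obtain ⟨s, rfl⟩ := (hfg t).1 ht
    exact DFunLike.congr_fun h0 s
  · intro h0
    ext s
    exact h0 (f s) ((hfg _).2 ⟨s, rfl⟩)

/-- By adjunction, a map from `X` to the dual of `T` is a map from `T` to the dual of `X`. Extending
it along an injection `X → Y` means lifting the latter through the surjection from the dual of `Y`,
which projectivity of `T` permits. -/
theorem DualMod.injective [Module.Projective A T] : Module.Injective Aᵐᵒᵖ (DualMod k T) := by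
  refine ⟨fun X Y _ _ _ _ f hf g => ?_⟩
  let _ : Module k X := Module.compHom X (algebraMap k Aᵐᵒᵖ)
  let _ : Module k Y := Module.compHom Y (algebraMap k Aᵐᵒᵖ)
  have : IsScalarTower k Aᵐᵒᵖ X := .of_algebraMap_smul fun _ _ => rfl
  have : IsScalarTower k Aᵐᵒᵖ Y := .of_algebraMap_smul fun _ _ => rfl
  -- The dual of an `Aᵐᵒᵖ`-module is a module over the double opposite, which is identified with
  -- `A`.
  let _ : Module A (DualMod k X) := Module.compHom _ (RingEquiv.opOp A).toRingHom
  let _ : Module A (DualMod k Y) := Module.compHom _ (RingEquiv.opOp A).toRingHom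
  have smulX : ∀ (a : A) (φ : DualMod k X) (x : X), (a • φ) x = φ (MulOpposite.op a • x) :=
    fun _ _ _ => rfl
  have hk : ∀ (c : k) (x : X), g (c • x) = c • g x := by
    intro c x
    rw [← algebraMap_smul Aᵐᵒᵖ c x, map_smul, algebraMap_smul]
  let f' : DualMod k Y →ₗ[A] DualMod k X :=
    { toFun := DualMod.map (k := k) f
      map_add' := map_add _
      map_smul' := fun a φ => map_smul (DualMod.map (k := k) f) (.op (.op a)) φ }
  have hf' : Function.Surjective f' := DualMod.surjective_of_injective hf
  let g' : T →ₗ[A] DualMod k X :=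
    { toFun := fun t => show Module.Dual k X from
        { toFun := fun x => g x t
          map_add' := fun x y => by rw [map_add]; rfl
          map_smul' := fun c x => by rw [hk]; rfl }
      map_add' := fun s t => DualMod.ext fun x => map_add (g x) s t
      map_smul' := fun a t => DualMod.ext fun x => by
        change g x (a • t) = g (MulOpposite.op a • x) t
        rw [LinearMap.map_smul g]
        rfl }
  obtain ⟨h, hh⟩ := Module.projective_lifting_property f' g' hf'
  have hkT : ∀ (c : k) (t : T), h (c • t) = c • h t := by
    intro c t
    rw [← algebraMap_smul A c t, map_smul]
    ext y
    change h t (MulOpposite.op (algebraMap k A c) • y) = c * h t y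
    rw [← MulOpposite.algebraMap_apply, algebraMap_smul, map_smul, smul_eq_mul]
  refine ⟨{ toFun := fun y => show Module.Dual k T from
              { toFun := fun t => h t y
                map_add' := fun s t => by rw [map_add]; rfl
                map_smul' := fun c t => by rw [hkT]; rfl }
            map_add' := fun x y => DualMod.ext fun t => map_add (h t) x y
            map_smul' := fun a y => DualMod.ext fun t => ?_ }, fun x => DualMod.ext fun t => ?_⟩
  · change h t (a • y) = h (a.unop • t) y
    rw [LinearMap.map_smul h]
    rfl
  · exact DFunLike.congr_fun (LinearMap.congr_fun hh t) x

variable {B : Type u} [Ring B] [Algebra k B] {V : Type} [Fintype V]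

/-- The dual of a tilting module is cotilting over the opposite algebra: the resolution dualizes to
an injective coresolution, and `f ↦ DualMod.map f` is an anti-isomorphism of endomorphism rings. -/
theorem step_op_of_tilting_presentation (S : SplitBasic k A V) (hS : S.IsConnected)
    (S' : SplitBasic k B V) (hS' : S'.IsConnected) [Module.Finite k A] [Module.Finite k B]
    {P₀ P₁ : Type u} [AddCommGroup P₀] [Module k P₀] [Module A P₀] [IsScalarTower k A P₀]
    [AddCommGroup P₁] [Module k P₁] [Module A P₁] [IsScalarTower k A P₁] [Module.Finite k T]
    [Module.Projective A P₀]
    [Module.Projective A P₁] (i : P₁ →ₗ[A] P₀) (π : P₀ →ₗ[A] T) (hi : Function.Injective i)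
    (hiπ : Function.Exact i π) (hπ : Function.Surjective π)
    (hl : ∀ g : P₁ →ₗ[A] T, ∃ h : P₀ →ₗ[A] T, h ∘ₗ i = g)
    (φ : B ≃+* (Module.End A T)ᵐᵒᵖ)
    (hφ : ∀ (c : k) (t : T), (φ (algebraMap k B c)).unop t = algebraMap k A c • t) :
    TiltingCotiltingStep k (AlgCat.of k Aᵐᵒᵖ) (AlgCat.of k Bᵐᵒᵖ) := by
  have fA : Module.Finite k Aᵐᵒᵖ := Module.Finite.equiv (MulOpposite.opLinearEquiv k (M := A))
  have fB : Module.Finite k Bᵐᵒᵖ := Module.Finite.equiv (MulOpposite.opLinearEquiv k (M := B))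
  have fT : Module.Finite Aᵐᵒᵖ (DualMod k T) := Module.Finite.of_restrictScalars_finite k _ _
  have i0 : Module.Injective Aᵐᵒᵖ (DualMod k P₀) := DualMod.injective
  have i1 : Module.Injective Aᵐᵒᵖ (DualMod k P₁) := DualMod.injective
  let ψ : Module.End A T ≃+* (Module.End Aᵐᵒᵖ (DualMod k T))ᵐᵒᵖ :=
    RingEquiv.ofBijective
      ({ toFun := fun f => .op (DualMod.map f)
         map_one' := rfl
         map_mul' := fun f g => rfl
         map_zero' := by
          congr 1
          ext f t
          exact map_zero f
         map_add' := fun f g => by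
          rw [← MulOpposite.op_add]
          congr 1
          ext φ t
          exact map_add φ _ _ } : Module.End A T →+* (Module.End Aᵐᵒᵖ (DualMod k T))ᵐᵒᵖ)
      ⟨fun f g h => DualMod.map_injective (k := k) (MulOpposite.op_injective h), fun g => by
        obtain ⟨f, hf⟩ := DualMod.exists_map_eq g.unop
        exact ⟨f, MulOpposite.unop_injective hf⟩⟩
  refine step_of_cotilting_presentation S.op hS.op S'.op hS'.op (DualMod.map (k := k) π)
    (DualMod.map (k := k) i) (DualMod.injective_of_surjective hπ) (DualMod.exact hiπ)
    (DualMod.surjective_of_injective hi) (fun g => ?_)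
    ((RingEquiv.op φ).trans ((RingEquiv.opOp _).symm.trans ψ)) ?_
  · obtain ⟨f, rfl⟩ := DualMod.exists_map_eq g
    obtain ⟨h, rfl⟩ := hl f
    exact ⟨DualMod.map h, rfl⟩
  · intro c f
    ext t
    change f ((φ (algebraMap k B c)).unop t) = f (algebraMap k A c • t)
    rw [hφ]

end Duality
-- Mutation at an idempotent
section Mutation

variable {k : Type u} [Field k] {A : Type u} [Ring A] [Algebra k A] {B : Type u} [Ring B]
  [Algebra k B] {V : Type} [Fintype V]

/-- The left ideal `A e`, for an idempotent `e`. -/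
def leftIdeal (e : A) : Submodule A A where
  carrier := {a | a * e = a}
  add_mem' {a b} ha hb := (add_mul a b e).trans (congrArg₂ _ ha hb)
  zero_mem' := zero_mul e
  smul_mem' a b hb := (mul_assoc a b e).trans (congrArg _ hb)

theorem mem_leftIdeal {e a : A} : a ∈ leftIdeal e ↔ a * e = a := Iff.rfl

theorem leftIdeal_projective {e : A} (he : e * e = e) : Module.Projective A (leftIdeal e) := by
  refine Module.Projective.of_split (leftIdeal e).subtype
    (LinearMap.codRestrict (leftIdeal e) (LinearMap.toSpanSingleton A A e) fun a => ?_) ?_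
  · change a * e * e = a * e
    rw [mul_assoc, he]
  · ext ⟨a, ha⟩
    exact ha

/-- Tilting steps obtained by replacing the projective module `A e` by the cokernel of a map from
`A e` to `A e₁ ⊕ A e₂`. -/
theorem steps_of_mutation (S : SplitBasic k A V) (hS : S.IsConnected)
    (S' : SplitBasic k B V) (hS' : S'.IsConnected) [Module.Finite k A] [Module.Finite k B]
    {T : Type u} [AddCommGroup T] [Module k T] [Module A T] [IsScalarTower k A T]
    [Module.Finite k T] (e e₁ e₂ u₁ u₂ : A) (t₀ τ₁ τ₂ : T)
    (he : e * e = e) (he₁ : e₁ * e₁ = e₁) (he₂ : e₂ * e₂ = e₂)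
    (hu₁ : u₁ * e₁ = u₁) (hu₂ : u₂ * e₂ = u₂)
    (gen : ∀ t : T, ∃ a a₁ a₂ : A, t = a • t₀ + a₁ • τ₁ + a₂ • τ₂)
    (ht₀ : (1 - e) • t₀ = t₀) (hτ₁ : e₁ • τ₁ = τ₁) (hτ₂ : e₂ • τ₂ = τ₂)
    (rel : u₁ • τ₁ + u₂ • τ₂ = 0)
    (inj : ∀ m : A, m * e = m → m * u₁ = 0 → m * u₂ = 0 → m = 0)
    (ker : ∀ a a₁ a₂ : A, a * (1 - e) = a → a₁ * e₁ = a₁ → a₂ * e₂ = a₂ →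
      a • t₀ + a₁ • τ₁ + a₂ • τ₂ = 0 → a = 0 ∧ ∃ m, m * e = m ∧ a₁ = m * u₁ ∧ a₂ = m * u₂)
    (lift : ∀ t : T, e • t = t → ∃ t₁ t₂ : T, u₁ • t₁ + u₂ • t₂ = t)
    (φ : B ≃+* (Module.End A T)ᵐᵒᵖ)
    (hφ : ∀ (c : k) (t : T), (φ (algebraMap k B c)).unop t = algebraMap k A c • t) :
    TiltingCotiltingStep k (AlgCat.of k A) (AlgCat.of k B) ∧
      TiltingCotiltingStep k (AlgCat.of k Aᵐᵒᵖ) (AlgCat.of k Bᵐᵒᵖ) := by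
  have hf : (1 - e) * (1 - e) = 1 - e := by
    rw [mul_sub, mul_one, sub_mul, he, one_mul, sub_self, sub_zero]
  have p := leftIdeal_projective he
  have p0 := leftIdeal_projective hf
  have p1 := leftIdeal_projective he₁
  have p2 := leftIdeal_projective he₂
  have fT : Module.Finite A T := Module.Finite.of_restrictScalars_finite k _ _
  -- The component in `A (1 - e)` is zero, since this summand of `A` is kept unchanged. The other
  -- two are right multiplication by `u₁` and `u₂`.
  let i : leftIdeal e →ₗ[A] leftIdeal (1 - e) × leftIdeal e₁ × leftIdeal e₂ :=
    LinearMap.prod 0 (LinearMap.prod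
      (((LinearMap.toSpanSingleton A A u₁).comp (leftIdeal e).subtype).codRestrict _ fun m => by
        change m.1 * u₁ * e₁ = m.1 * u₁
        rw [mul_assoc, hu₁])
      (((LinearMap.toSpanSingleton A A u₂).comp (leftIdeal e).subtype).codRestrict _ fun m => by
        change m.1 * u₂ * e₂ = m.1 * u₂
        rw [mul_assoc, hu₂]))
  let ev (f : A) (t : T) : leftIdeal f →ₗ[A] T :=
    (LinearMap.toSpanSingleton A T t).comp (leftIdeal f).subtype
  let π (s₀ s₁ s₂ : T) : leftIdeal (1 - e) × leftIdeal e₁ × leftIdeal e₂ →ₗ[A] T :=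
    LinearMap.coprod (ev _ s₀) (LinearMap.coprod (ev _ s₁) (ev _ s₂))
  have hπ : ∀ s₀ s₁ s₂ x, π s₀ s₁ s₂ x = x.1.1 • s₀ + (x.2.1.1 • s₁ + x.2.2.1 • s₂) :=
    fun _ _ _ _ => rfl
  have hi1 : ∀ m, (i m).1.1 = 0 := fun _ => rfl
  have hi2 : ∀ m, (i m).2.1.1 = m.1 * u₁ := fun _ => rfl
  have hi3 : ∀ m, (i m).2.2.1 = m.1 * u₂ := fun _ => rfl
  have hi : Function.Injective i := by
    rw [injective_iff_map_eq_zero]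
    intro m hm
    refine Subtype.ext (inj m.1 m.2 ?_ ?_)
    · rw [← hi2, hm]; rfl
    · rw [← hi3, hm]; rfl
  have hiπ : Function.Exact i (π t₀ τ₁ τ₂) := by
    rintro ⟨⟨a, ha⟩, ⟨a₁, ha₁⟩, ⟨a₂, ha₂⟩⟩
    rw [hπ]
    constructor
    · intro h
      obtain ⟨rfl, m, hm, rfl, rfl⟩ := ker a a₁ a₂ ha ha₁ ha₂ (by rw [add_assoc]; exact h)
      exact ⟨⟨m, hm⟩, rfl⟩
    · rintro ⟨m, hm⟩
      rw [← hm, hi1, hi2, hi3, zero_smul, zero_add, mul_smul, mul_smul, ← smul_add, rel, smul_zero]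
  have hπs : Function.Surjective (π t₀ τ₁ τ₂) := by
    intro t
    obtain ⟨a, a₁, a₂, rfl⟩ := gen t
    refine ⟨⟨⟨a * (1 - e), ?_⟩, ⟨a₁ * e₁, ?_⟩, ⟨a₂ * e₂, ?_⟩⟩, ?_⟩
    · rw [mem_leftIdeal, mul_assoc, hf]
    · rw [mem_leftIdeal, mul_assoc, he₁]
    · rw [mem_leftIdeal, mul_assoc, he₂]
    · rw [hπ, mul_smul, mul_smul, mul_smul, ht₀, hτ₁, hτ₂, add_assoc]
  -- A map from `A e` to `T` is given by the image of `e`, a vector `t` with `e • t = t`. Extending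
  -- it along `i` means writing `t` as `u₁ • t₁ + u₂ • t₂`.
  have hl : ∀ g : leftIdeal e →ₗ[A] T,
      ∃ h : leftIdeal (1 - e) × leftIdeal e₁ × leftIdeal e₂ →ₗ[A] T, h ∘ₗ i = g := by
    intro g
    obtain ⟨t₁, t₂, h⟩ := lift (g ⟨e, he⟩) (by
      rw [← map_smul]
      exact congrArg g (Subtype.ext he))
    refine ⟨π 0 t₁ t₂, LinearMap.ext fun m => ?_⟩
    rw [LinearMap.comp_apply, hπ, hi1, hi2, hi3, zero_smul, zero_add, mul_smul, mul_smul,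
      ← smul_add, h, ← map_smul]
    exact congrArg g (Subtype.ext m.2)
  exact ⟨step_of_tilting_presentation S hS S' hS' i (π t₀ τ₁ τ₂) hi hiπ hπs hl φ hφ,
    step_op_of_tilting_presentation S hS S' hS' i (π t₀ τ₁ τ₂) hi hiπ hπs hl φ hφ⟩

end Mutation

/-! ## Gentle algebras as algebras of matrices -/

/-- A strict order on the ends `(v, false)`, `(v, true)` of the vertices. -/
structure EndOrder (V : Type) where
  lt : V × Bool → V × Bool → Prop
  trans : ∀ {i j l}, lt i j → lt j l → lt i l
  irrefl : ∀ i, ¬ lt i i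

/-- The other end of a vertex. -/
def otherEnd {V : Type} (i : V × Bool) : V × Bool := (i.1, !i.2)

section otherEnd
variable {V : Type}
@[simp] theorem otherEnd_fst (i : V × Bool) : (otherEnd i).1 = i.1 := rfl
@[simp] theorem otherEnd_otherEnd (i : V × Bool) : otherEnd (otherEnd i) = i := by simp [otherEnd]
theorem otherEnd_ne (i : V × Bool) : otherEnd i ≠ i := by
  intro h; simpa [otherEnd] using congrArg Prod.snd h
theorem eq_or_eq_otherEnd {i j : V × Bool} (h : i.1 = j.1) : i = j ∨ i = otherEnd j := by
  obtain ⟨v, a⟩ := i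
  obtain ⟨w, b⟩ := j
  cases h
  cases a <;> cases b <;> simp [otherEnd]
theorem otherEnd_inj {i j : V × Bool} : otherEnd i = otherEnd j ↔ i = j :=
  ⟨fun h => by rw [← otherEnd_otherEnd i, h, otherEnd_otherEnd], fun h => h ▸ rfl⟩
theorem eq_otherEnd_comm {i j : V × Bool} : i = otherEnd j ↔ j = otherEnd i :=
  ⟨fun h => by rw [h, otherEnd_otherEnd], fun h => by rw [h, otherEnd_otherEnd]⟩
end otherEnd

namespace EndOrder

variable {V : Type} (O : EndOrder V)

/-- The weak order. -/
def le (i j : V × Bool) : Prop := i = j ∨ O.lt i j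

variable {O} in
theorem le_trans {i j l} (h : O.le i j) (h' : O.le j l) : O.le i l := by
  rcases h with rfl | h
  · exact h'
  · rcases h' with rfl | h'
    · exact Or.inr h
    · exact Or.inr (O.trans h h')

variable {O} in
theorem le_antisymm {i j} (h : O.le i j) (h' : O.le j i) : i = j := by
  rcases h with h | h
  · exact h
  · rcases h' with h' | h'
    · exact h'.symm
    · exact absurd (O.trans h h') (O.irrefl _)

/-- The reversed order. -/
def rev : EndOrder V where
  lt i j := O.lt j i
  trans h h' := O.trans h' h
  irrefl := O.irrefl

/-- Any two vertices are joined by a chain of pairs of comparable ends. -/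
def Connected : Prop :=
  Nonempty V ∧ ∀ v w, Relation.EqvGen (fun v w => ∃ i j, O.lt i j ∧ i.1 = v ∧ j.1 = w) v w

variable [Fintype V]

theorem mul_support (k : Type u) [Field k] {M N : Matrix (V × Bool) (V × Bool) k} {i j : V × Bool}
    (h : (M * N) j i ≠ 0) : ∃ l, M j l ≠ 0 ∧ N l i ≠ 0 := by
  rw [Matrix.mul_apply] at h
  obtain ⟨l, -, hl⟩ := Finset.exists_ne_zero_of_sum_ne_zero h
  exact ⟨l, left_ne_zero_of_mul hl, right_ne_zero_of_mul hl⟩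

/-- In most products below the order squeezes the intermediate end, so that only one or two summands
survive. This lemma and the next one isolate them. -/
theorem mul_apply_eq {k : Type u} [Field k] {M N : Matrix (V × Bool) (V × Bool) k}
    {i j : V × Bool} (l : V × Bool) (h : ∀ l', M j l' ≠ 0 → N l' i ≠ 0 → l' = l) :
    (M * N) j i = M j l * N l i := by
  rw [Matrix.mul_apply]
  refine Finset.sum_eq_single l (fun l' _ hl' => ?_) (fun h => absurd (Finset.mem_univ _) h)
  by_contra h0
  exact hl' (h l' (left_ne_zero_of_mul h0) (right_ne_zero_of_mul h0))

theorem mul_apply_eq₂ {k : Type u} [Field k] {M N : Matrix (V × Bool) (V × Bool) k}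
    {i j : V × Bool} (l m : V × Bool) (hlm : l ≠ m)
    (h : ∀ l', M j l' ≠ 0 → N l' i ≠ 0 → l' = l ∨ l' = m) :
    (M * N) j i = M j l * N l i + M j m * N m i := by
  rw [Matrix.mul_apply]
  refine Finset.sum_eq_add l m hlm (fun l' _ hl' => ?_) (fun h => absurd (Finset.mem_univ _) h)
    (fun h => absurd (Finset.mem_univ _) h)
  by_contra h0
  rcases h l' (left_ne_zero_of_mul h0) (right_ne_zero_of_mul h0) with h | h
  · exact hl'.1 h
  · exact hl'.2 h

open Classical in
/-- The number of ends below a given one. -/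
noncomputable def rank (i : V × Bool) : ℕ := (Finset.univ.filter fun l => O.lt l i).card

variable {O} in
theorem rank_lt {i j : V × Bool} (h : O.lt i j) : O.rank i < O.rank j := by
  classical
  refine Finset.card_lt_card ⟨fun l hl => ?_, fun h' => ?_⟩
  · simp only [Finset.mem_filter, Finset.mem_univ, true_and] at hl ⊢
    exact O.trans hl h
  · have := h' (Finset.mem_filter.2 ⟨Finset.mem_univ i, h⟩)
    exact O.irrefl i (Finset.mem_filter.1 this).2

theorem rank_le_card (i : V × Bool) : O.rank i ≤ Fintype.card (V × Bool) := Finset.card_le_univ _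

variable [DecidableEq V] (k : Type u) [Field k]

/-- The algebra of matrices whose entries vanish away from the order relation, with equal diagonal
entries at the two ends of each vertex. -/
def alg : Subalgebra k (Matrix (V × Bool) (V × Bool) k) where
  carrier := {M | (∀ i j, M j i ≠ 0 → O.le i j) ∧ ∀ i, M (otherEnd i) (otherEnd i) = M i i}
  mul_mem' := by
    rintro M N ⟨hM, hM'⟩ ⟨hN, hN'⟩
    refine ⟨fun i j h => ?_, fun i => ?_⟩
    · obtain ⟨l, h1, h2⟩ := mul_support k h
      exact le_trans (hN _ _ h2) (hM _ _ h1)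
    · have : ∀ i, (M * N) i i = M i i * N i i := fun i =>
        mul_apply_eq i fun l h1 h2 => le_antisymm (hM _ _ h1) (hN _ _ h2)
      rw [this, this, hM', hN']
  add_mem' := by
    rintro M N ⟨hM, hM'⟩ ⟨hN, hN'⟩
    refine ⟨fun i j h => ?_, fun i => ?_⟩
    · by_contra h0
      apply h
      rw [Matrix.add_apply, by_contra fun h => h0 (hM _ _ h), by_contra fun h => h0 (hN _ _ h),
        add_zero]
    · rw [Matrix.add_apply, Matrix.add_apply, hM', hN']
  algebraMap_mem' c := by
    refine ⟨fun i j h => ?_, fun i => ?_⟩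
    · left
      by_contra h0
      exact h (by rw [Matrix.algebraMap_matrix_apply, if_neg (Ne.symm h0)])
    · simp [Matrix.algebraMap_matrix_apply]

variable {O k}

theorem supp (M : O.alg k) {i j : V × Bool} (h : M.1 j i ≠ 0) : O.le i j := M.2.1 i j h

theorem eq_zero (M : O.alg k) {i j : V × Bool} (h : ¬ O.le i j) : M.1 j i = 0 :=
  by_contra fun h0 => h (supp M h0)

theorem diag (M : O.alg k) (i : V × Bool) : M.1 (otherEnd i) (otherEnd i) = M.1 i i := M.2.2 i

theorem diag_of_fst (M : O.alg k) {i j : V × Bool} (h : i.1 = j.1) : M.1 i i = M.1 j j := by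
  rcases eq_or_eq_otherEnd h with rfl | rfl
  · rfl
  · exact diag M j

theorem mul_diag (M N : O.alg k) (i : V × Bool) : (M * N).1 i i = M.1 i i * N.1 i i :=
  mul_apply_eq i fun _ h1 h2 => le_antisymm (supp M h1) (supp N h2)

variable (O k) in
/-- The idempotent at a vertex. -/
def idem (v : V) : O.alg k :=
  ⟨Matrix.diagonal fun i => if i.1 = v then 1 else 0, fun i j h => by
      left
      by_contra h0
      exact h (Matrix.diagonal_apply_ne _ (Ne.symm h0)), fun i => by
    rw [Matrix.diagonal_apply_eq, Matrix.diagonal_apply_eq]; rfl⟩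

theorem idem_mul_apply (v : V) (M : Matrix (V × Bool) (V × Bool) k) (j i : V × Bool) :
    ((O.idem k v).1 * M) j i = if j.1 = v then M j i else 0 := by
  simp [idem, Matrix.diagonal_mul]

theorem mul_idem_apply (v : V) (M : Matrix (V × Bool) (V × Bool) k) (j i : V × Bool) :
    (M * (O.idem k v).1) j i = if i.1 = v then M j i else 0 := by
  simp [idem, Matrix.mul_diagonal]

theorem idem_apply (v : V) (j i : V × Bool) :
    (O.idem k v).1 j i = if j = i ∧ i.1 = v then 1 else 0 := by
  simp only [idem, Matrix.diagonal_apply]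
  split_ifs <;> simp_all

theorem idem_mul_idem (v : V) : O.idem k v * O.idem k v = O.idem k v := by
  refine Subtype.ext (Matrix.ext fun j i => ?_)
  rw [MulMemClass.coe_mul, idem_mul_apply, idem_apply]
  split_ifs <;> simp_all

variable (k) in
/-- The matrix unit at a pair of comparable ends. -/
def unit {i j : V × Bool} (h : O.lt i j) : O.alg k :=
  ⟨Matrix.single j i 1, fun a b h' => by
    rw [Matrix.single_apply] at h'
    by_cases h0 : j = b ∧ i = a
    · rw [← h0.1, ← h0.2]; exact Or.inr h
    · exact absurd (if_neg h0) h', fun a => by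
    have : ∀ a, Matrix.single j i (1 : k) a a = 0 := fun a => by
      rw [Matrix.single_apply, if_neg]
      rintro ⟨rfl, rfl⟩
      exact O.irrefl _ h
    rw [this, this]⟩

theorem unit_mul_apply {i j : V × Bool} (h : O.lt i j) (M : Matrix (V × Bool) (V × Bool) k)
    (a b : V × Bool) : ((unit k h).1 * M) a b = if a = j then M i b else 0 := by
  simp only [unit, Matrix.mul_apply, Matrix.single_apply, ite_mul, one_mul, zero_mul]
  split_ifs with h1
  · subst h1
    simp
  · exact Finset.sum_eq_zero fun l _ => if_neg fun h => h1 h.1.symm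

theorem mul_unit_apply {i j : V × Bool} (h : O.lt i j) (M : Matrix (V × Bool) (V × Bool) k)
    (a b : V × Bool) : (M * (unit k h).1) a b = if b = i then M a j else 0 := by
  simp only [unit, Matrix.mul_apply, Matrix.single_apply, mul_ite, mul_one, mul_zero]
  split_ifs with h1
  · subst h1
    simp
  · exact Finset.sum_eq_zero fun l _ => if_neg fun h => h1 h.2.symm

theorem unit_apply {i j : V × Bool} (h : O.lt i j) (a b : V × Bool) :
    (unit k h).1 a b = if j = a ∧ i = b then 1 else 0 :=
  Matrix.single_apply ..

/-- A factor with zero diagonal leads strictly upwards in the order, so each factor raises the rank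
by at least one. -/
theorem prod_supp (l : List (O.alg k)) (hl : ∀ M ∈ l, ∀ i, M.1 i i = 0) (i j : V × Bool)
    (h : l.prod.1 j i ≠ 0) : O.rank i + l.length ≤ O.rank j := by
  induction l generalizing j with
  | nil =>
    have : j = i := by
      by_contra h0
      exact h (Matrix.one_apply_ne h0)
    simp [this]
  | cons M l ih =>
    rw [List.prod_cons] at h
    obtain ⟨m, h1, h2⟩ := mul_support k h
    have h3 := ih (fun N hN => hl N (List.mem_cons_of_mem _ hN)) m h2
    rcases supp M h1 with rfl | h4
    · exact absurd (hl M List.mem_cons_self _) h1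
    · have := rank_lt h4
      rw [List.length_cons]
      omega

variable (O k) in
/-- The split basic structure of the algebra. -/
noncomputable def splitBasic : SplitBasic k (O.alg k) V where
  e := O.idem k
  χ v :=
    { toFun := fun M => M.1 (v, false) (v, false)
      map_one' := Matrix.one_apply_eq _
      map_mul' := fun M N => mul_diag M N _
      map_zero' := rfl
      map_add' := fun _ _ => rfl
      commutes' := fun c => by
        change (algebraMap k (Matrix (V × Bool) (V × Bool) k) c) _ _ = _
        simp [Matrix.algebraMap_matrix_apply] }
  mul_self := idem_mul_idem
  mul_of_ne v w h := by
    refine Subtype.ext (Matrix.ext fun j i => ?_)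
    rw [MulMemClass.coe_mul, idem_mul_apply, idem_apply]
    split_ifs <;> simp_all
  sum_e := by
    refine Subtype.ext (Matrix.ext fun j i => ?_)
    rw [AddSubmonoidClass.coe_finsetSum, Matrix.sum_apply]
    simp only [idem_apply, OneMemClass.coe_one, Matrix.one_apply]
    by_cases h : j = i <;> simp [h]
  χ_e v := by
    change (O.idem k v).1 _ _ = 1
    rw [idem_apply, if_pos ⟨rfl, rfl⟩]
  nilp := by
    -- Ranks are bounded by the number of ends, so a product of more factors than that must vanish.
    refine ⟨Fintype.card (V × Bool) + 1, fun l hl hχ => ?_⟩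
    refine Subtype.ext (Matrix.ext fun j i => ?_)
    by_contra h
    have h1 := prod_supp l (fun M hM i => by
      rw [diag_of_fst M (show i.1 = (i.1, false).1 from rfl)]
      exact hχ M hM i.1) i j h
    have := rank_le_card (O := O) j
    omega

theorem Connected.splitBasic (h : O.Connected) : (O.splitBasic k).IsConnected := by
  refine ⟨h.1, fun v w => Relation.EqvGen.mono ?_ v w (h.2 v w)⟩
  rintro _ _ ⟨i, j, hij, rfl, rfl⟩
  refine ⟨unit k hij, fun h0 => ?_⟩
  have h1 := congrFun (congrFun (congrArg Subtype.val h0) j) i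
  change ((O.idem k j.1).1 * (unit k hij).1 * (O.idem k i.1).1) j i = 0 at h1
  rw [mul_idem_apply, if_pos rfl, idem_mul_apply, if_pos rfl, unit_apply, if_pos ⟨rfl, rfl⟩] at h1
  exact one_ne_zero h1

variable (O k) in
/-- The opposite algebra belongs to the reversed order. -/
def opEquiv : O.rev.alg k ≃ₐ[k] (O.alg k)ᵐᵒᵖ where
  toFun M := .op ⟨M.1.transpose, fun i j h => by
    rcases supp M h with h | h
    · exact Or.inl h.symm
    · exact Or.inr h, diag M⟩
  invFun M := ⟨M.unop.1.transpose, fun i j h => by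
    rcases supp M.unop h with h | h
    · exact Or.inl h.symm
    · exact Or.inr h, diag M.unop⟩
  left_inv M := rfl
  right_inv M := rfl
  map_mul' M N := MulOpposite.unop_injective (Subtype.ext (Matrix.transpose_mul M.1 N.1))
  map_add' M N := rfl
  commutes' c := by
    refine MulOpposite.unop_injective (Subtype.ext ?_)
    change (algebraMap k (Matrix (V × Bool) (V × Bool) k) c).transpose = algebraMap k _ c
    rw [Matrix.algebraMap_eq_diagonal, Matrix.diagonal_transpose]

/-- Renaming of the ends. -/
def relabelEquiv {V' : Type} [Fintype V'] [DecidableEq V'] (O : EndOrder V) (O' : EndOrder V')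
    (f : V × Bool ≃ V' × Bool)
    (hf : ∀ i, f (otherEnd i) = otherEnd (f i)) (hlt : ∀ i j, O'.lt (f i) (f j) ↔ O.lt i j) :
    O.alg k ≃ₐ[k] O'.alg k where
  toFun M := ⟨M.1.submatrix f.symm f.symm, fun i j h => by
    rcases supp M h with h | h
    · exact Or.inl (f.symm.injective h)
    · right
      rw [← hlt] at h
      simpa using h, fun i => by
    obtain ⟨i, rfl⟩ := f.surjective i
    simp only [Matrix.submatrix_apply, ← hf, Equiv.symm_apply_apply]
    exact diag M i⟩
  invFun M := ⟨M.1.submatrix f f, fun i j h => by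
    rcases supp M h with h | h
    · exact Or.inl (f.injective h)
    · exact Or.inr ((hlt _ _).1 h), fun i => by
    simp only [Matrix.submatrix_apply, hf]
    exact diag M (f i)⟩
  left_inv M := by
    refine Subtype.ext (Matrix.ext fun i j => ?_)
    simp
  right_inv M := by
    refine Subtype.ext (Matrix.ext fun i j => ?_)
    simp
  map_mul' M N := Subtype.ext (by simp [Matrix.submatrix_mul_equiv])
  map_add' M N := rfl
  commutes' c := by
    refine Subtype.ext (Matrix.ext fun i j => ?_)
    change (algebraMap k (Matrix (V × Bool) (V × Bool) k) c) _ _ =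
      (algebraMap k (Matrix (V' × Bool) (V' × Bool) k) c) _ _
    simp [Matrix.algebraMap_matrix_apply]

end EndOrder

namespace EndOrder

/-! ## Slides -/

/-- The order `O'` arises from `O` by sliding the end `x`, which comes immediately after the end `p` in
`O`, to the position immediately before the other end of the vertex of `p`. -/
structure Slide {V : Type} (O O' : EndOrder V) (p x : V × Bool) : Prop where
  ne : p.1 ≠ x.1
  off : ∀ {i j}, i ≠ x → j ≠ x → (O'.lt i j ↔ O.lt i j)
  lt_x : ∀ i, O.lt i x ↔ O.le i p
  p_lt : ∀ j, O.lt p j ↔ O.le x j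
  x_lt : ∀ j, O'.lt x j ↔ O'.le (otherEnd p) j
  lt_q : ∀ i, O'.lt i (otherEnd p) ↔ O'.le i x

namespace Slide

variable {V : Type} {O O' : EndOrder V} {p x : V × Bool}

theorem p_ne (h : Slide O O' p x) : p ≠ x := ne_of_apply_ne Prod.fst h.ne
theorem q_ne (h : Slide O O' p x) : otherEnd p ≠ x :=
  ne_of_apply_ne Prod.fst (show (otherEnd p).1 ≠ x.1 from h.ne)
theorem p_ne' (h : Slide O O' p x) : p ≠ otherEnd x :=
  ne_of_apply_ne Prod.fst (show p.1 ≠ (otherEnd x).1 from h.ne)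
theorem q_ne' (h : Slide O O' p x) : otherEnd p ≠ otherEnd x :=
  ne_of_apply_ne Prod.fst (show (otherEnd p).1 ≠ (otherEnd x).1 from h.ne)

theorem x_lt' (h : Slide O O' p x) {j : V × Bool} (hj : j ≠ x) :
    O'.lt x j ↔ O.le (otherEnd p) j := by
  rw [h.x_lt, le, le, h.off h.q_ne hj]

theorem lt_x' (h : Slide O O' p x) {i : V × Bool} (hi : i ≠ x) :
    O'.lt i x ↔ O.lt i (otherEnd p) := by
  rw [← h.off hi h.q_ne, h.lt_q, le, or_iff_right hi]

/-- Read backwards in the new order, `x` stands right behind `otherEnd p`, and the old position is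
right in front of `p`. So the inverse of a slide is again a slide, of reversed orders. -/
theorem rev (h : Slide O O' p x) : Slide O'.rev O.rev (otherEnd p) x where
  ne := h.ne
  off hi hj := (h.off hj hi).symm
  lt_x i := (h.x_lt i).trans (or_congr_left eq_comm)
  p_lt j := (h.lt_q j).trans (or_congr_left eq_comm)
  x_lt j := by
    rw [otherEnd_otherEnd]
    exact (h.lt_x j).trans (or_congr_left eq_comm)
  lt_q i := by
    rw [otherEnd_otherEnd]
    exact (h.p_lt i).trans (or_congr_left eq_comm)

/-- All comparisons that `x` loses can be replaced by comparisons with `p`, and `x` remains linked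
to the vertex of `p` through `otherEnd p`. -/
theorem connected (h : Slide O O' p x) (hO : O.Connected) : O'.Connected := by
  refine ⟨hO.1, fun v w => ?_⟩
  have link : ∀ i j, O'.le i j →
      Relation.EqvGen (fun v w => ∃ i j, O'.lt i j ∧ i.1 = v ∧ j.1 = w) i.1 j.1 := by
    rintro i j (rfl | h)
    · exact .refl _
    · exact .rel _ _ ⟨i, j, h, rfl, rfl⟩
  have hx : Relation.EqvGen (fun v w => ∃ i j, O'.lt i j ∧ i.1 = v ∧ j.1 = w) x.1 p.1 :=
    link x (otherEnd p) (Or.inr ((h.x_lt _).2 (Or.inl rfl)))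
  have key : ∀ i j, i ≠ x → j ≠ x → O.le i j →
      Relation.EqvGen (fun v w => ∃ i j, O'.lt i j ∧ i.1 = v ∧ j.1 = w) i.1 j.1 := by
    rintro i j hi hj (rfl | hij)
    · exact .refl _
    · exact link i j (Or.inr ((h.off hi hj).2 hij))
  induction hO.2 v w with
  | refl => exact .refl _
  | symm _ _ _ h => exact .symm _ _ h
  | trans _ _ _ _ _ h1 h2 => exact .trans _ _ _ h1 h2
  | rel v w hvw =>
    obtain ⟨i, j, hij, rfl, rfl⟩ := hvw
    by_cases hj : j = x
    · subst hj
      have hi : i ≠ j := fun h0 => O.irrefl j (h0 ▸ hij)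
      exact .trans _ _ _ (key i p hi h.p_ne ((h.lt_x i).1 hij)) (.symm _ _ hx)
    · by_cases hi : i = x
      · subst hi
        exact .trans _ _ _ hx (key p j h.p_ne hj (Or.inr ((h.p_lt j).2 (Or.inr hij))))
      · exact key i j hi hj (Or.inr hij)

end Slide

/-! ### Sliding an end whose partner is isolated -/

section Lone

variable {V : Type} [Fintype V] [DecidableEq V] {O O' : EndOrder V} {p x : V × Bool}
  (k : Type u) [Field k]

/-- The bimodule of matrices realizing the slide of a lone end `x`. -/
def loneModule (O : EndOrder V) (p x : V × Bool) :
    Submodule (O.alg k) (Matrix (V × Bool) (V × Bool) k) where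
  -- The column `x` holds what is left of `A e_p` modulo the multiples of the arrow from `p` to `x`,
  -- namely the column of `otherEnd p`. The column of the isolated end is empty.
  carrier := {N | (∀ i j, N j i ≠ 0 → i ≠ otherEnd x ∧ O.le (if i = x then otherEnd p else i) j) ∧
    ∀ i : V × Bool, i.1 ≠ x.1 → N (otherEnd i) (otherEnd i) = N i i}
  add_mem' := by
    rintro M N ⟨hM, hM'⟩ ⟨hN, hN'⟩
    refine ⟨fun i j h => ?_, fun i hi => ?_⟩
    · by_contra h0
      apply h
      rw [Matrix.add_apply, by_contra fun h => h0 (hM _ _ h), by_contra fun h => h0 (hN _ _ h),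
        add_zero]
    · rw [Matrix.add_apply, Matrix.add_apply, hM' i hi, hN' i hi]
  zero_mem' := ⟨fun i j h => absurd rfl h, fun i _ => rfl⟩
  smul_mem' := by
    rintro M N ⟨hN, hN'⟩
    change (∀ i j, (M.1 * N) j i ≠ 0 → _) ∧ ∀ i : V × Bool, i.1 ≠ x.1 →
      (M.1 * N) (otherEnd i) (otherEnd i) = (M.1 * N) i i
    refine ⟨fun i j h => ?_, fun i hi => ?_⟩
    · obtain ⟨l, h1, h2⟩ := mul_support k h
      exact ⟨(hN _ _ h2).1, le_trans (hN _ _ h2).2 (supp M h1)⟩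
    · have : ∀ i : V × Bool, i.1 ≠ x.1 → (M.1 * N) i i = M.1 i i * N i i := fun i hi =>
        mul_apply_eq i fun l h1 h2 => by
          have h3 := (hN _ _ h2).2
          rw [if_neg (fun h => hi (congrArg Prod.fst h))] at h3
          exact le_antisymm (supp M h1) h3
      rw [this i hi, this (otherEnd i) hi, hN' i hi, diag]

variable {k}

theorem loneModule_supp (N : O.loneModule k p x) {i j : V × Bool} (h : N.1 j i ≠ 0) :
    i ≠ otherEnd x ∧ O.le (if i = x then otherEnd p else i) j := N.2.1 i j h

theorem loneModule_diag (N : O.loneModule k p x) {i : V × Bool} (h : i.1 ≠ x.1) :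
    N.1 (otherEnd i) (otherEnd i) = N.1 i i := N.2.2 i h

instance : Module.Finite k (O.loneModule k p x) :=
  Module.Finite.of_injective (((O.loneModule k p x).subtype).restrictScalars k)
    Subtype.val_injective

set_option maxHeartbeats 2000000 in
-- As `otherEnd x` is isolated, `A e_x` is determined by its column `x`. Right multiplication by the
-- matrix unit `u` carries this column bijectively onto the part of the column `p` above the
-- diagonal, because `x` is the immediate successor of `p`. The cokernel of `A e_x → A (1 - e_x) ⊕ A
-- e_p` is therefore `loneModule`, and its endomorphisms are the right multiplications by `O'.alg`.
theorem Slide.steps_of_lone (h : Slide O O' p x) (hO : O.Connected)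
    (h1 : ∀ j, ¬ O.lt (otherEnd x) j) (h2 : ∀ j, ¬ O.lt j (otherEnd x)) :
    TiltingCotiltingStep k (AlgCat.of k (O.alg k)) (AlgCat.of k (O'.alg k)) ∧
      TiltingCotiltingStep k (AlgCat.of k (O.alg k)ᵐᵒᵖ) (AlgCat.of k (O'.alg k)ᵐᵒᵖ) := by
  have hO' := h.connected hO
  have hpx := h.p_ne
  have hqx := h.q_ne
  have hpx' := h.p_ne'
  have hqx' := h.q_ne'
  have hqp := otherEnd_ne p
  have hxx := otherEnd_ne x
  have h1' : ∀ j, ¬ O'.lt (otherEnd x) j := by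
    intro j hj
    by_cases hjx : j = x
    · subst hjx
      exact h1 _ ((h.lt_x' hxx).1 hj)
    · exact h1 _ ((h.off hxx hjx).1 hj)
  have h2' : ∀ j, ¬ O'.lt j (otherEnd x) := by
    intro j hj
    by_cases hjx : j = x
    · subst hjx
      rcases (h.x_lt' hxx).1 hj with h | h
      · exact hqx' h
      · exact h2 _ h
    · exact h2 _ ((h.off hjx hxx).1 hj)
  have ne_x : ∀ {i : V × Bool}, i.1 ≠ x.1 → i ≠ x := fun hi h => hi (congrArg Prod.fst h)
  have ne_x' : ∀ {i : V × Bool}, i.1 ≠ x.1 → i ≠ otherEnd x := fun hi h => hi (by rw [h]; rfl)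
  -- The column `x` behaves like a column of `otherEnd p`. That `f` is monotone from `O'` to `O`
  -- makes the module stable under right multiplication.
  let f : V × Bool → V × Bool := fun i => if i = x then otherEnd p else i
  have fx : f x = otherEnd p := if_pos rfl
  have fne : ∀ {i}, i ≠ x → f i = i := fun hi => if_neg hi
  have lt_of : ∀ {i l}, i ≠ x → O'.lt i l → O.lt i (f l) := by
    intro i l hi hil
    by_cases hl : l = x
    · subst hl
      rw [fx]
      exact (h.lt_x' hi).1 hil
    · rw [fne hl]
      exact (h.off hi hl).1 hil
  have mono : ∀ {i l}, O'.le i l → O.le (f i) (f l) := by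
    rintro i l (rfl | hil)
    · exact Or.inl rfl
    · by_cases hi : i = x
      · subst hi
        have hl : l ≠ i := fun h0 => O'.irrefl i (h0 ▸ hil)
        rw [fx, fne hl]
        exact (h.x_lt' hl).1 hil
      · rw [fne hi]
        exact Or.inr (lt_of hi hil)
  have le_of : ∀ {i l}, l ≠ x → O.le (f i) l → O'.le i l := by
    intro i l hl hil
    by_cases hi : i = x
    · subst hi
      rw [fx] at hil
      exact Or.inr ((h.x_lt' hl).2 hil)
    · rw [fne hi] at hil
      exact hil.imp_right (h.off hi hl).2
  have Tsupp : ∀ (N : O.loneModule k p x) {i j : V × Bool}, N.1 j i ≠ 0 →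
      i ≠ otherEnd x ∧ O.le (f i) j := fun N _ _ h => loneModule_supp N h
  -- the right action
  have act_mem : ∀ (b : O'.alg k) (N : O.loneModule k p x), N.1 * b.1 ∈ O.loneModule k p x := by
    intro b N
    refine ⟨fun i j hij => ?_, fun i hi => ?_⟩
    · obtain ⟨l, h3, h4⟩ := mul_support k hij
      have h5 := Tsupp N h3
      have h6 := supp b h4
      refine ⟨?_, le_trans (mono h6) h5.2⟩
      rintro rfl
      rcases h6 with h6 | h6
      · exact h5.1 h6.symm
      · exact h1' _ h6
    · have : ∀ i : V × Bool, i.1 ≠ x.1 → (N.1 * b.1) i i = N.1 i i * b.1 i i := fun i hi =>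
        mul_apply_eq i fun l h3 h4 => by
          have hix : i ≠ x := fun h => hi (congrArg Prod.fst h)
          rcases supp b h4 with h5 | h5
          · exact h5.symm
          · rcases le_antisymm (Or.inr (lt_of hix h5)) (Tsupp N h3).2 with h6
            exact absurd (h6 ▸ lt_of hix h5) (O.irrefl _)
      rw [this i hi, this (otherEnd i) hi, loneModule_diag N hi, diag]
  let act : O'.alg k →+* (Module.End (O.alg k) (O.loneModule k p x))ᵐᵒᵖ :=
    { toFun := fun b => .op
        { toFun := fun N => ⟨N.1 * b.1, act_mem b N⟩
          map_add' := fun N N' => Subtype.ext (add_mul N.1 N'.1 b.1)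
          map_smul' := fun M N => Subtype.ext (mul_assoc M.1 N.1 b.1) }
      map_one' := MulOpposite.unop_injective (LinearMap.ext fun N => Subtype.ext (mul_one N.1))
      map_mul' := fun b b' => MulOpposite.unop_injective
        (LinearMap.ext fun N => Subtype.ext (mul_assoc N.1 b.1 b'.1).symm)
      map_zero' := MulOpposite.unop_injective (LinearMap.ext fun N => Subtype.ext (mul_zero N.1))
      map_add' := fun b b' => MulOpposite.unop_injective
        (LinearMap.ext fun N => Subtype.ext (mul_add N.1 b.1 b'.1)) }
  have act_apply : ∀ b N, ((act b).unop N).1 = N.1 * b.1 := fun _ _ => rfl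
  -- generators
  let t₀ : O.loneModule k p x := ⟨Matrix.diagonal fun i => if i.1 = x.1 then 0 else 1, by
    refine ⟨fun i j hij => ?_, fun i _ => ?_⟩
    · by_cases hji : j = i
      · subst hji
        rw [Matrix.diagonal_apply_eq] at hij
        have h0 : j.1 ≠ x.1 := fun h0 => hij (if_pos h0)
        exact ⟨fun h => h0 (h ▸ rfl), Or.inl (fne fun h => h0 (h ▸ rfl))⟩
      · exact absurd (Matrix.diagonal_apply_ne _ hji) hij
    · rw [Matrix.diagonal_apply_eq, Matrix.diagonal_apply_eq]; rfl⟩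
  let τ : O.loneModule k p x := ⟨Matrix.single (otherEnd p) x 1, by
    refine ⟨fun i j hij => ?_, fun i hi => ?_⟩
    · rw [Matrix.single_apply] at hij
      have h0 : otherEnd p = j ∧ x = i := by
        by_contra h0
        exact hij (if_neg h0)
      obtain ⟨rfl, rfl⟩ := h0
      exact ⟨hxx.symm, Or.inl (if_pos rfl)⟩
    · rw [Matrix.single_apply, Matrix.single_apply, if_neg, if_neg]
      · rintro ⟨-, rfl⟩; exact hi rfl
      · rintro ⟨-, rfl⟩; exact hi rfl⟩
  have mul_t₀ : ∀ (M : Matrix (V × Bool) (V × Bool) k) j i,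
      (M * t₀.1) j i = if i.1 = x.1 then 0 else M j i := by
    intro M j i
    change (M * Matrix.diagonal _ : Matrix _ _ k) j i = _
    rw [Matrix.mul_diagonal]
    split_ifs <;> simp
  have t₀_mul : ∀ (M : Matrix (V × Bool) (V × Bool) k) j i,
      (t₀.1 * M) j i = if j.1 = x.1 then 0 else M j i := by
    intro M j i
    change (Matrix.diagonal _ * M : Matrix _ _ k) j i = _
    rw [Matrix.diagonal_mul]
    split_ifs <;> simp
  have mul_τ : ∀ (M : Matrix (V × Bool) (V × Bool) k) j i,
      (M * τ.1) j i = if i = x then M j (otherEnd p) else 0 := by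
    intro M j i
    change (M * Matrix.single (otherEnd p) x 1 : Matrix _ _ k) j i = _
    by_cases hi : i = x
    · subst hi
      rw [Matrix.mul_single_apply_same, mul_one, if_pos rfl]
    · rw [Matrix.mul_single_apply_of_ne _ _ _ _ _ hi, if_neg hi]
  have τ_mul : ∀ (M : Matrix (V × Bool) (V × Bool) k) j i,
      (τ.1 * M) j i = if j = otherEnd p then M x i else 0 := by
    intro M j i
    change (Matrix.single (otherEnd p) x 1 * M : Matrix _ _ k) j i = _
    by_cases hj : j = otherEnd p
    · subst hj
      rw [Matrix.single_mul_apply_same, one_mul, if_pos rfl]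
    · rw [Matrix.single_mul_apply_of_ne _ _ _ _ _ hj, if_neg hj]
  have hlt : O.lt p x := (h.lt_x p).2 (Or.inl rfl)
  let u : O.alg k := unit k hlt
  -- The only entry of `u` lies in the column `p`, whereas `τ` has its only entry in the row
  -- `otherEnd p`.
  have uτ : u • τ = 0 := by
    refine Subtype.ext (Matrix.ext fun j i => ?_)
    change (u.1 * τ.1) j i = 0
    rw [mul_τ, unit_apply]
    split_ifs with h3 h4
    · exact absurd h4.2.symm hqp
    · rfl
    · rfl
  have hgen : ∀ N : O.loneModule k p x, ∃ a a₁ : O.alg k, N = a • t₀ + a₁ • τ := by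
    intro N
    -- The coefficient of `τ` carries the column `x` of `N` in its column `otherEnd p`. Its entry at
    -- `(p, p)` has no effect on `τ` and only makes the two diagonal entries agree.
    refine ⟨⟨Matrix.of fun j i => if i.1 = x.1 then 0 else N.1 j i, fun i j hij => ?_, fun i => ?_⟩,
      ⟨Matrix.of fun j i => if i = otherEnd p then N.1 j x else if i = p ∧ j = p then
        N.1 (otherEnd p) x else 0, fun i j hij => ?_, fun i => ?_⟩, ?_⟩
    · rw [Matrix.of_apply] at hij
      by_cases hi : i.1 = x.1
      · exact absurd (if_pos hi) hij
      · rw [if_neg hi] at hij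
        have := (Tsupp N hij).2
        rwa [fne fun h => hi (h ▸ rfl)] at this
    · rw [Matrix.of_apply, Matrix.of_apply]
      by_cases hi : i.1 = x.1
      · rw [if_pos hi, if_pos (show (otherEnd i).1 = x.1 from hi)]
      · rw [if_neg hi, if_neg (show ¬ (otherEnd i).1 = x.1 from hi), loneModule_diag N hi]
    · rw [Matrix.of_apply] at hij
      split_ifs at hij with h3 h4
      · have := (Tsupp N hij).2
        rwa [fx, ← h3] at this
      · exact Or.inl (h4.1.trans h4.2.symm)
      · exact absurd rfl hij
    · rw [Matrix.of_apply, Matrix.of_apply]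
      by_cases h3 : i = p
      · subst h3
        rw [if_pos rfl, if_neg hqp.symm, if_pos ⟨rfl, rfl⟩]
      · by_cases h4 : i = otherEnd p
        · subst h4
          rw [otherEnd_otherEnd, if_neg hqp.symm, if_pos rfl, if_pos ⟨rfl, rfl⟩]
        · rw [if_neg (fun h => h3 (otherEnd_inj.1 h)), if_neg h4, if_neg, if_neg]
          · exact fun h => h3 h.1
          · exact fun h => h4 (eq_otherEnd_comm.1 h.1.symm)
    · refine Subtype.ext (Matrix.ext fun j i => ?_)
      change N.1 j i = ((Matrix.of fun j i => if i.1 = x.1 then 0 else N.1 j i) * t₀.1) j i +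
        ((Matrix.of fun j i => if i = otherEnd p then N.1 j x else if i = p ∧ j = p then
          N.1 (otherEnd p) x else 0) * τ.1) j i
      rw [mul_t₀, mul_τ, Matrix.of_apply, Matrix.of_apply]
      by_cases hi : i.1 = x.1
      · rw [if_pos hi, zero_add, if_pos rfl]
        split_ifs with h3
        · rw [h3]
        · rcases eq_or_eq_otherEnd hi with h4 | h4
          · exact absurd h4 h3
          · by_contra h5
            exact (Tsupp N h5).1 h4
      · rw [if_neg hi, if_neg hi, if_neg (ne_x hi), add_zero]
  have he₀ : (1 - O.idem k x.1) • t₀ = t₀ := by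
    refine Subtype.ext (Matrix.ext fun j i => ?_)
    change ((1 - (O.idem k x.1).1) * t₀.1) j i = t₀.1 j i
    have h3 : t₀.1 j i = if i.1 = x.1 then 0 else if j = i then 1 else 0 := by
      rw [← one_mul t₀.1, mul_t₀, Matrix.one_apply]
    rw [sub_mul, one_mul, Matrix.sub_apply, idem_mul_apply, h3]
    split_ifs <;> simp_all
  have he₁ : O.idem k p.1 • τ = τ := by
    refine Subtype.ext (Matrix.ext fun j i => ?_)
    change ((O.idem k p.1).1 * τ.1) j i = τ.1 j i
    rw [idem_mul_apply, ← mul_one τ.1, τ_mul]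
    split_ifs with h3 h4 h4
    · rfl
    · rfl
    · exact absurd (by rw [h4]; rfl) h3
    · rfl
  have inj : Function.Injective act := by
    rw [injective_iff_map_eq_zero]
    intro b hb
    have h0 : ∀ N : O.loneModule k p x, N.1 * b.1 = 0 := fun N => by
      rw [← act_apply, hb]; rfl
    have hx0 : ∀ i, b.1 x i = 0 := fun i => by
      have := congrFun (congrFun (h0 τ) (otherEnd p)) i
      rwa [τ_mul, if_pos rfl] at this
    refine Subtype.ext (Matrix.ext fun j i => ?_)
    by_cases hj : j.1 = x.1
    · rcases eq_or_eq_otherEnd hj with rfl | rfl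
      · exact hx0 i
      · by_contra h3
        rcases supp b h3 with rfl | h4
        · rw [diag, hx0] at h3
          exact h3 rfl
        · exact h2' _ h4
    · have := congrFun (congrFun (h0 t₀) j) i
      rwa [t₀_mul, if_neg hj] at this
  have surj : Function.Surjective act := by
    intro g
    set G : O.loneModule k p x →ₗ[O.alg k] O.loneModule k p x := g.unop with hG
    -- From `u • τ = 0` the row `p` of `G τ` vanishes. As the diagonal entries at `p` and `otherEnd
    -- p` agree, the latter vanishes too, so the row `otherEnd p` is supported on `x` and on ends
    -- strictly below `otherEnd p`. These are the ends that a row `x` of `O'.alg` allows.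
    have hGp : ∀ i, (G τ).1 p i = 0 := fun i => by
      have h3 : u • G τ = 0 := by rw [← map_smul, uτ, map_zero]
      have h4 := congrFun (congrFun (congrArg Subtype.val h3) x) i
      change (u.1 * (G τ).1) x i = 0 at h4
      rwa [unit_mul_apply, if_pos rfl] at h4
    have hGq : (G τ).1 (otherEnd p) (otherEnd p) = 0 := by
      rw [loneModule_diag _ h.ne, hGp]
    have hGτ : ∀ j i, j ≠ otherEnd p → (G τ).1 j i = 0 := fun j i hj => by
      by_cases hjp : j = p
      · rw [hjp, hGp]
      · rw [← he₁, map_smul]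
        change ((O.idem k p.1).1 * (G τ).1) j i = 0
        rw [idem_mul_apply, if_neg]
        intro h3
        rcases eq_or_eq_otherEnd h3 with h4 | h4
        · exact hjp h4
        · exact hj h4
    have hGt : ∀ j i, j.1 = x.1 → (G t₀).1 j i = 0 := fun j i hj => by
      rw [← he₀, map_smul]
      change ((1 - (O.idem k x.1).1) * (G t₀).1) j i = 0
      rw [sub_mul, one_mul, Matrix.sub_apply, idem_mul_apply, if_pos hj, sub_self]
    -- The images of the generators are the rows of `b`: the row `x` comes from `G τ`, the rows away
    -- from the vertex of `x` from `G t₀`. The isolated end only receives the diagonal entry that is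
    -- forced.
    let b : O'.alg k := ⟨Matrix.of fun j i => if j = x then (G τ).1 (otherEnd p) i else
      if j = otherEnd x then (if i = otherEnd x then (G τ).1 (otherEnd p) x else 0) else
        (G t₀).1 j i, fun i j hij => by
          rw [Matrix.of_apply] at hij
          split_ifs at hij with h3 h4 h5
          · subst h3
            by_cases hi : i = j
            · exact Or.inl hi
            · have h6 := (Tsupp _ hij).2
              rw [fne hi] at h6
              rcases h6 with h6 | h6
              · rw [h6] at hij
                exact absurd hGq hij
              · exact Or.inr ((h.lt_x' hi).2 h6)
          · exact Or.inl (h5.trans h4.symm)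
          · exact absurd rfl hij
          · exact le_of h3 (Tsupp _ hij).2, fun i => by
          rw [Matrix.of_apply, Matrix.of_apply]
          by_cases hi : i.1 = x.1
          · rcases eq_or_eq_otherEnd hi with rfl | rfl
            · rw [if_neg hxx, if_pos rfl, if_pos rfl, if_pos rfl]
            · rw [otherEnd_otherEnd, if_neg hxx, if_pos rfl, if_pos rfl, if_pos rfl]
          · have hi' : ∀ i : V × Bool, i.1 ≠ x.1 → i ≠ x ∧ i ≠ otherEnd x := fun i hi =>
              ⟨fun h => hi (h ▸ rfl), fun h => hi (h ▸ rfl)⟩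
            rw [if_neg (hi' i hi).1, if_neg (hi' i hi).2, if_neg (hi' (otherEnd i) hi).1,
              if_neg (hi' (otherEnd i) hi).2, loneModule_diag _ hi]⟩
    have hb : ∀ j i, b.1 j i = if j = x then (G τ).1 (otherEnd p) i else
      if j = otherEnd x then (if i = otherEnd x then (G τ).1 (otherEnd p) x else 0) else
        (G t₀).1 j i := fun _ _ => rfl
    have hbτ : (act b).unop τ = G τ := by
      refine Subtype.ext (Matrix.ext fun j i => ?_)
      rw [act_apply, τ_mul, hb, if_pos rfl]
      split_ifs with h3
      · rw [h3]
      · exact (hGτ j i h3).symm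
    have hbt : (act b).unop t₀ = G t₀ := by
      refine Subtype.ext (Matrix.ext fun j i => ?_)
      rw [act_apply, t₀_mul, hb]
      by_cases hj : j.1 = x.1
      · rw [if_pos hj, hGt j i hj]
      · rw [if_neg hj, if_neg (ne_x hj), if_neg (ne_x' hj)]
    refine ⟨b, MulOpposite.unop_injective (LinearMap.ext fun N => ?_)⟩
    obtain ⟨a, a₁, rfl⟩ := hgen N
    rw [map_add, map_smul, map_smul, hbτ, hbt, ← map_smul, ← map_smul, ← map_add]
  refine steps_of_mutation (O.splitBasic k) hO.splitBasic (O'.splitBasic k) hO'.splitBasic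
    (O.idem k x.1) (O.idem k p.1) 0 u 0 t₀ τ 0 (idem_mul_idem _) (idem_mul_idem _) (mul_zero 0)
    ?_ (mul_zero 0) (fun N => ?_) he₀ he₁ (zero_smul _ 0) ?_ ?_ ?_ ?_
    (RingEquiv.ofBijective act ⟨inj, surj⟩) ?_
  · refine Subtype.ext (Matrix.ext fun j i => ?_)
    change (u.1 * (O.idem k p.1).1) j i = u.1 j i
    rw [mul_idem_apply, unit_apply]
    split_ifs with h3 h4 h4
    · rfl
    · rfl
    · exact absurd (by rw [← h4.2]) h3
    · rfl
  · obtain ⟨a, a₁, ha⟩ := hgen N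
    exact ⟨a, a₁, 0, by rw [ha, smul_zero, add_zero]⟩
  · rw [uτ, zero_smul, zero_add]
  · intro m hm h3 _
    have hcol : ∀ j, m.1 j x = 0 := fun j => by
      have := congrFun (congrFun (congrArg Subtype.val h3) j) p
      change (m.1 * u.1) j p = 0 at this
      rwa [mul_unit_apply, if_pos rfl] at this
    refine Subtype.ext (Matrix.ext fun j i => ?_)
    rw [← hm]
    change (m.1 * (O.idem k x.1).1) j i = 0
    rw [mul_idem_apply]
    split_ifs with h4
    · rcases eq_or_eq_otherEnd h4 with rfl | rfl
      · exact hcol j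
      · by_contra h5
        rcases supp m h5 with rfl | h6
        · rw [diag, hcol] at h5
          exact h5 rfl
        · exact h1 _ h6
    · rfl
  · intro a a₁ a₂ ha ha₁ ha₂ h3
    have h4 : ∀ j i, (a.1 * t₀.1) j i + (a₁.1 * τ.1) j i = 0 := fun j i => by
      rw [smul_zero, add_zero] at h3
      exact congrFun (congrFun (congrArg Subtype.val h3) j) i
    have ha0 : a = 0 := by
      refine Subtype.ext (Matrix.ext fun j i => ?_)
      have h5 := congrFun (congrFun (congrArg Subtype.val ha) j) i
      change (a.1 * (1 - (O.idem k x.1).1)) j i = a.1 j i at h5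
      rw [mul_sub, mul_one, Matrix.sub_apply, mul_idem_apply] at h5
      by_cases hi : i.1 = x.1
      · rw [if_pos hi, sub_self] at h5
        exact h5.symm
      · have h6 := h4 j i
        rwa [mul_t₀, mul_τ, if_neg hi, if_neg (ne_x hi), add_zero] at h6
    have hq : ∀ j, a₁.1 j (otherEnd p) = 0 := fun j => by
      have h6 := h4 j x
      rwa [mul_t₀, mul_τ, if_pos rfl, if_pos rfl, zero_add] at h6
    have hp : ∀ j i, i ≠ p → a₁.1 j i = 0 := fun j i hi => by
      by_cases hiq : i = otherEnd p
      · rw [hiq, hq]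
      · have h5 := congrFun (congrFun (congrArg Subtype.val ha₁) j) i
        change (a₁.1 * (O.idem k p.1).1) j i = a₁.1 j i at h5
        rw [mul_idem_apply, if_neg] at h5
        · exact h5.symm
        · intro h6
          exact (eq_or_eq_otherEnd h6).elim hi hiq
    have hpp : a₁.1 p p = 0 := by rw [← diag, hq]
    -- The relation leaves of `a₁` only the column `p` strictly above the diagonal, that is, from
    -- `x` upwards; it becomes the column `x` of `m`. The second case supplies the forced diagonal
    -- entry at the isolated end.
    let m : O.alg k := ⟨Matrix.of fun j i => if i = x then a₁.1 j p else
      if i = otherEnd x ∧ j = otherEnd x then a₁.1 x p else 0, fun i j hij => by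
        rw [Matrix.of_apply] at hij
        split_ifs at hij with h5 h6
        · subst h5
          rcases supp a₁ hij with h7 | h7
          · rw [← h7, hpp] at hij
            exact absurd rfl hij
          · exact (h.p_lt j).1 h7
        · exact Or.inl (h6.1.trans h6.2.symm)
        · exact absurd rfl hij, fun i => by
        rw [Matrix.of_apply, Matrix.of_apply]
        by_cases h5 : i = x
        · subst h5
          rw [if_neg hxx, if_pos ⟨rfl, rfl⟩, if_pos rfl]
        · by_cases h6 : i = otherEnd x
          · subst h6
            rw [otherEnd_otherEnd, if_pos rfl, if_neg hxx, if_pos ⟨rfl, rfl⟩]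
          · rw [if_neg (fun h => h6 (eq_otherEnd_comm.1 h.symm)), if_neg, if_neg h5, if_neg]
            · exact fun h => h6 h.1
            · exact fun h => h5 (otherEnd_inj.1 h.1)⟩
    have hm : ∀ j i, m.1 j i = if i = x then a₁.1 j p else
      if i = otherEnd x ∧ j = otherEnd x then a₁.1 x p else 0 := fun _ _ => rfl
    refine ⟨ha0, m, Subtype.ext (Matrix.ext fun j i => ?_), Subtype.ext (Matrix.ext fun j i => ?_),
      ?_⟩
    · change (m.1 * (O.idem k x.1).1) j i = m.1 j i
      rw [mul_idem_apply]
      by_cases hi : i.1 = x.1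
      · rw [if_pos hi]
      · rw [if_neg hi, hm, if_neg (ne_x hi), if_neg fun h => ne_x' hi h.1]
    · change a₁.1 j i = (m.1 * u.1) j i
      rw [mul_unit_apply, hm, if_pos rfl]
      split_ifs with h5
      · rw [h5]
      · exact hp j i h5
    · rw [← ha₂, mul_zero, mul_zero]
  · intro N hN
    have hrow : ∀ j i, j ≠ x → N.1 j i = 0 := fun j i hj => by
      by_contra h3
      have h4 := congrFun (congrFun (congrArg Subtype.val hN) j) i
      change ((O.idem k x.1).1 * N.1) j i = N.1 j i at h4
      rw [idem_mul_apply] at h4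
      split_ifs at h4 with h5
      · rcases eq_or_eq_otherEnd h5 with h6 | rfl
        · exact hj h6
        · obtain ⟨h6, h7⟩ := Tsupp N h3
          rcases h7 with h7 | h7
          · by_cases h8 : i = x
            · rw [h8, fx] at h7
              exact hqx' h7
            · rw [fne h8] at h7
              exact h6 h7
          · exact h2 _ h7
      · exact h3 h4.symm
    -- Multiplication by `u` moves the row `p` to the row `x`, so the row `x` of `N` is put into the
    -- row `p`. The entry at `otherEnd p` balances the diagonal entry at `p`.
    let N' : Matrix (V × Bool) (V × Bool) k := Matrix.of fun j i => if j = p then N.1 x i else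
      if j = otherEnd p ∧ i = otherEnd p then N.1 x p else 0
    have hN' : ∀ j i, N' j i = if j = p then N.1 x i else
      if j = otherEnd p ∧ i = otherEnd p then N.1 x p else 0 := fun _ _ => rfl
    refine ⟨⟨N', fun i j hij => ?_, fun i hi => ?_⟩, 0, ?_⟩
    · rw [hN'] at hij
      split_ifs at hij with h5 h6
      · obtain ⟨h7, h8⟩ := Tsupp N hij
        refine ⟨h7, ?_⟩
        rw [h5]
        rcases h8 with h8 | h8
        · by_cases h9 : i = x
          · rw [h9, fx] at h8
            exact absurd h8 hqx
          · rw [fne h9] at h8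
            exact absurd h8 h9
        · exact (h.lt_x _).1 h8
      · rw [h6.1, h6.2]
        exact ⟨hqx', Or.inl (fne hqx)⟩
      · exact absurd rfl hij
    · rw [hN', hN']
      by_cases h3 : i = p
      · subst h3
        rw [if_neg hqp, if_pos ⟨rfl, rfl⟩, if_pos rfl]
      · by_cases h4 : i = otherEnd p
        · subst h4
          rw [otherEnd_otherEnd, if_pos rfl, if_neg hqp, if_pos ⟨rfl, rfl⟩]
        · rw [if_neg (fun h => h4 (eq_otherEnd_comm.1 h.symm)), if_neg, if_neg h3, if_neg]
          · exact fun h => h4 h.1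
          · exact fun h => h3 (otherEnd_inj.1 h.1)
    · rw [smul_zero, add_zero]
      refine Subtype.ext (Matrix.ext fun j i => ?_)
      change (u.1 * N') j i = N.1 j i
      rw [unit_mul_apply, hN', if_pos rfl]
      split_ifs with h5
      · rw [h5]
      · exact (hrow j i h5).symm
  · intro c N
    refine Subtype.ext ?_
    change N.1 * (algebraMap k (Matrix (V × Bool) (V × Bool) k) c) = algebraMap k _ c * N.1
    exact (Algebra.commutes c N.1).symm

end Lone

end EndOrder

/-! ### Sliding both ends of a vertex -/

namespace EndOrder

/-- Both ends `x` and `otherEnd x` of a vertex slide, over the distinct ends `p₁` and `p₂`. -/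
structure DoubleSlide {V : Type} (O O' : EndOrder V) (p₁ p₂ x : V × Bool) : Prop where
  ne₁ : p₁.1 ≠ x.1
  ne₂ : p₂.1 ≠ x.1
  ne : p₁ ≠ p₂
  lt_x : ∀ i, O.lt i x ↔ O.le i p₁
  p_lt : ∀ j, O.lt p₁ j ↔ O.le x j
  lt_y : ∀ i, O.lt i (otherEnd x) ↔ O.le i p₂
  p_lt' : ∀ j, O.lt p₂ j ↔ O.le (otherEnd x) j
  off : ∀ {i j : V × Bool}, i.1 ≠ x.1 → j.1 ≠ x.1 → (O'.lt i j ↔ O.lt i j)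
  x_lt : ∀ {j : V × Bool}, j.1 ≠ x.1 → (O'.lt x j ↔ O.le (otherEnd p₁) j)
  lt_x' : ∀ {i : V × Bool}, i.1 ≠ x.1 → (O'.lt i x ↔ O.lt i (otherEnd p₁))
  y_lt : ∀ {j : V × Bool}, j.1 ≠ x.1 → (O'.lt (otherEnd x) j ↔ O.le (otherEnd p₂) j)
  lt_y' : ∀ {i : V × Bool}, i.1 ≠ x.1 → (O'.lt i (otherEnd x) ↔ O.lt i (otherEnd p₂))
  x_lt_y : O'.lt x (otherEnd x) ↔ O.lt (otherEnd p₁) (otherEnd p₂)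
  y_lt_x : O'.lt (otherEnd x) x ↔ O.lt (otherEnd p₂) (otherEnd p₁)

theorem fst_ne_iff {V : Type} {i x : V × Bool} (h : i.1 ≠ x.1) : i ≠ x ∧ i ≠ otherEnd x :=
  ⟨fun h' => h (h' ▸ rfl), fun h' => h (by rw [h']; rfl)⟩

/-- The intermediate order is eliminated. Its role for the second slide can be taken over by `O`: as
`p₁ ≠ p₂`, the end `x` does not stand between `p₂` and `otherEnd x` in `O`, so these two are
neighbours there as well. -/
theorem DoubleSlide.of_slides {V : Type} {O O₁ O' : EndOrder V} {p₁ p₂ x : V × Bool}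
    (h₁ : Slide O O₁ p₁ x) (h₂ : Slide O₁ O' p₂ (otherEnd x)) (hp : p₁ ≠ p₂) :
    DoubleSlide O O' p₁ p₂ x := by
  have hx : ∀ {i : V × Bool}, i.1 ≠ x.1 → i ≠ x := fun h => (fst_ne_iff h).1
  have hy : ∀ {i : V × Bool}, i.1 ≠ x.1 → i ≠ otherEnd x := fun h => (fst_ne_iff h).2
  have hyx := otherEnd_ne x
  have n₁ := h₁.ne
  have n₂ : p₂.1 ≠ x.1 := h₂.ne
  have n₂' : (otherEnd p₂).1 ≠ x.1 := h₂.ne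
  have hq : otherEnd p₁ ≠ otherEnd p₂ := fun h => hp (otherEnd_inj.1 h)
  have off₁ : ∀ {i j}, i ≠ x → j ≠ x → (O₁.le i j ↔ O.le i j) := fun hi hj =>
    or_congr_right (h₁.off hi hj)
  have ne_lt : ∀ {i j}, i ≠ j → (O.le i j ↔ O.lt i j) := fun h => or_iff_right h
  have ne_lt₁ : ∀ {i j}, i ≠ j → (O₁.le i j ↔ O₁.lt i j) := fun h => or_iff_right h
  refine ⟨n₁, n₂, hp, h₁.lt_x, h₁.p_lt, fun i => ?_, fun j => ?_, fun hi hj => ?_, fun hj => ?_,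
    fun hi => ?_, fun hj => ?_, fun hi => ?_, ?_, ?_⟩
  · by_cases hi : i.1 = x.1
    · rcases eq_or_eq_otherEnd hi with rfl | rfl
      · rw [← ne_lt hyx.symm, ← h₁.p_lt, ← h₁.p_lt, ← h₁.off h₁.p_ne hyx,
          ← h₁.off h₁.p_ne (hx n₂), h₂.lt_x, ne_lt₁ hp]
      · refine iff_of_false (O.irrefl _) fun h => ?_
        rw [ne_lt (hy n₂).symm, ← h₁.off hyx (hx n₂)] at h
        exact O₁.irrefl _ (O₁.trans h ((h₂.lt_x _).2 (Or.inl rfl)))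
    · rw [← h₁.off (hx hi) hyx, ← off₁ (hx hi) (hx n₂), h₂.lt_x]
  · by_cases hj : j.1 = x.1
    · rcases eq_or_eq_otherEnd hj with rfl | rfl
      · rw [h₁.lt_x, ne_lt hp.symm, ← h₁.off (hx n₂) h₁.p_ne, h₂.p_lt, off₁ hyx h₁.p_ne,
          ← h₁.lt_x, ne_lt hyx]
      · rw [← h₁.off (hx n₂) hyx]
        exact iff_of_true ((h₂.lt_x _).2 (Or.inl rfl)) (Or.inl rfl)
    · rw [← h₁.off (hx n₂) (hx hj), h₂.p_lt, off₁ hyx (hx hj)]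
  · rw [h₂.off (hy hi) (hy hj), h₁.off (hx hi) (hx hj)]
  · rw [h₂.off hyx.symm (hy hj), h₁.x_lt' (hx hj)]
  · rw [h₂.off (hy hi) hyx.symm, h₁.lt_x' (hx hi)]
  · rw [h₂.x_lt' (hy hj), off₁ (hx n₂') (hx hj)]
  · rw [h₂.lt_x' (hy hi), h₁.off (hx hi) (hx n₂')]
  · rw [h₂.lt_x' hyx.symm, h₁.x_lt' (hx n₂'), ne_lt hq]
  · rw [h₂.x_lt' hyx.symm, ne_lt₁ (hx n₂'), h₁.lt_x' (hx n₂')]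

section Double

variable {V : Type} [Fintype V] [DecidableEq V]

/-- The target of the sliding ends. -/
def slideTarget (p₁ p₂ x i : V × Bool) : V × Bool :=
  if i = x then otherEnd p₁ else if i = otherEnd x then otherEnd p₂ else i

variable (k : Type u) [Field k] (O : EndOrder V) (p₁ p₂ x : V × Bool)

/-- The pairs of a matrix and a scalar realizing a double slide. -/
def doubleSubmodule : Submodule k (Matrix (V × Bool) (V × Bool) k × k) where
  -- The matrix holds the columns of `otherEnd p₁` and `otherEnd p₂`, now in the places of `x` and
  -- `otherEnd x`. The scalar is the extra dimension of the cokernel of `A e_x → A e_{p₁} ⊕ A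
  -- e_{p₂}`: the two columns of `A e_x` share their diagonal entry, so of the entries at `(x, p₁)`
  -- and `(otherEnd x, p₂)` the difference survives.
  carrier := {N | (∀ i j, N.1 j i ≠ 0 → O.le (slideTarget p₁ p₂ x i) j) ∧
    ∀ i : V × Bool, i.1 ≠ x.1 → N.1 (otherEnd i) (otherEnd i) = N.1 i i}
  add_mem' := by
    rintro M N ⟨hM, hM'⟩ ⟨hN, hN'⟩
    refine ⟨fun i j h => ?_, fun i hi => ?_⟩
    · by_contra h0
      apply h
      rw [Prod.fst_add, Matrix.add_apply, by_contra fun h => h0 (hM _ _ h),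
        by_contra fun h => h0 (hN _ _ h), add_zero]
    · rw [Prod.fst_add, Matrix.add_apply, Matrix.add_apply, hM' i hi, hN' i hi]
  zero_mem' := ⟨fun i j h => absurd rfl h, fun i _ => rfl⟩
  smul_mem' := by
    rintro c N ⟨hN, hN'⟩
    refine ⟨fun i j h => hN i j fun h0 => h ?_, fun i hi => ?_⟩
    · rw [Prod.smul_fst, Matrix.smul_apply, h0, smul_zero]
    · rw [Prod.smul_fst, Matrix.smul_apply, Matrix.smul_apply, hN' i hi]

/-- The bimodule realizing a double slide. -/
def DoubleModule : Type u := O.doubleSubmodule k p₁ p₂ x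

namespace DoubleModule

noncomputable instance : AddCommGroup (O.DoubleModule k p₁ p₂ x) :=
  inferInstanceAs (AddCommGroup (O.doubleSubmodule k p₁ p₂ x))

noncomputable instance : Module k (O.DoubleModule k p₁ p₂ x) :=
  inferInstanceAs (Module k (O.doubleSubmodule k p₁ p₂ x))

instance : Module.Finite k (O.DoubleModule k p₁ p₂ x) :=
  inferInstanceAs (Module.Finite k (O.doubleSubmodule k p₁ p₂ x))

variable {k O p₁ p₂ x}

/-- The matrix of an element. -/
def mat (N : O.DoubleModule k p₁ p₂ x) : Matrix (V × Bool) (V × Bool) k := N.1.1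

/-- The scalar of an element. -/
def scal (N : O.DoubleModule k p₁ p₂ x) : k := N.1.2

theorem ext {N N' : O.DoubleModule k p₁ p₂ x} (h : ∀ j i, N.mat j i = N'.mat j i)
    (h' : N.scal = N'.scal) : N = N' :=
  Subtype.ext (Prod.ext (Matrix.ext h) h')

theorem mat_add (N N' : O.DoubleModule k p₁ p₂ x) : (N + N').mat = N.mat + N'.mat := rfl
theorem scal_add (N N' : O.DoubleModule k p₁ p₂ x) : (N + N').scal = N.scal + N'.scal := rfl
theorem mat_zero : (0 : O.DoubleModule k p₁ p₂ x).mat = 0 := rfl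
theorem scal_zero : (0 : O.DoubleModule k p₁ p₂ x).scal = 0 := rfl
theorem mat_ksmul (c : k) (N : O.DoubleModule k p₁ p₂ x) : (c • N).mat = c • N.mat := rfl
theorem scal_ksmul (c : k) (N : O.DoubleModule k p₁ p₂ x) : (c • N).scal = c * N.scal := rfl

theorem supp (N : O.DoubleModule k p₁ p₂ x) {i j : V × Bool} (h : N.mat j i ≠ 0) :
    O.le (slideTarget p₁ p₂ x i) j := N.2.1 i j h

theorem diag (N : O.DoubleModule k p₁ p₂ x) {i : V × Bool} (h : i.1 ≠ x.1) :
    N.mat (otherEnd i) (otherEnd i) = N.mat i i := N.2.2 i h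

theorem supp_x (N : O.DoubleModule k p₁ p₂ x) {j : V × Bool} (h : N.mat j x ≠ 0) :
    O.le (otherEnd p₁) j := by
  have := N.supp h
  rwa [slideTarget, if_pos rfl] at this

theorem supp_y (N : O.DoubleModule k p₁ p₂ x) {j : V × Bool} (h : N.mat j (otherEnd x) ≠ 0) :
    O.le (otherEnd p₂) j := by
  have := N.supp h
  rwa [slideTarget, if_neg (otherEnd_ne x), if_pos rfl] at this

theorem supp_of_ne (N : O.DoubleModule k p₁ p₂ x) {i j : V × Bool} (hi : i.1 ≠ x.1)
    (h : N.mat j i ≠ 0) : O.le i j := by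
  have := N.supp h
  rwa [slideTarget, if_neg (fst_ne_iff hi).1, if_neg (fst_ne_iff hi).2] at this

theorem mem_of {N : Matrix (V × Bool) (V × Bool) k} {c : k}
    (hx : ∀ j, N j x ≠ 0 → O.le (otherEnd p₁) j)
    (hy : ∀ j, N j (otherEnd x) ≠ 0 → O.le (otherEnd p₂) j)
    (h : ∀ i j : V × Bool, i.1 ≠ x.1 → N j i ≠ 0 → O.le i j)
    (hd : ∀ i : V × Bool, i.1 ≠ x.1 → N (otherEnd i) (otherEnd i) = N i i) :
    (N, c) ∈ O.doubleSubmodule k p₁ p₂ x := by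
  refine ⟨fun i j hij => ?_, hd⟩
  by_cases hi : i.1 = x.1
  · rcases eq_or_eq_otherEnd hi with rfl | rfl
    · rw [slideTarget, if_pos rfl]
      exact hx j hij
    · rw [slideTarget, if_neg (otherEnd_ne x), if_pos rfl]
      exact hy j hij
  · rw [slideTarget, if_neg (fst_ne_iff hi).1, if_neg (fst_ne_iff hi).2]
    exact h i j hi hij

/-- An element given by its matrix and its scalar. -/
def mk (N : Matrix (V × Bool) (V × Bool) k) (c : k)
    (hx : ∀ j, N j x ≠ 0 → O.le (otherEnd p₁) j)
    (hy : ∀ j, N j (otherEnd x) ≠ 0 → O.le (otherEnd p₂) j)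
    (h : ∀ i j : V × Bool, i.1 ≠ x.1 → N j i ≠ 0 → O.le i j)
    (hd : ∀ i : V × Bool, i.1 ≠ x.1 → N (otherEnd i) (otherEnd i) = N i i) :
    O.DoubleModule k p₁ p₂ x := ⟨(N, c), mem_of hx hy h hd⟩

theorem mat_mk (N : Matrix (V × Bool) (V × Bool) k) (c : k) (hx hy h hd) :
    (mk N c hx hy h hd : O.DoubleModule k p₁ p₂ x).mat = N := rfl
theorem scal_mk (N : Matrix (V × Bool) (V × Bool) k) (c : k) (hx hy h hd) :
    (mk N c hx hy h hd : O.DoubleModule k p₁ p₂ x).scal = c := rfl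

end DoubleModule

variable {k O p₁ p₂ x}

namespace DoubleSlide

variable {O' : EndOrder V}

section order

theorem target_ne (h : DoubleSlide O O' p₁ p₂ x) (i : V × Bool) :
    (slideTarget p₁ p₂ x i).1 ≠ x.1 := by
  unfold slideTarget
  split_ifs with h1 h2
  · exact h.ne₁
  · exact h.ne₂
  · exact fun h3 => (eq_or_eq_otherEnd h3).elim h1 h2

theorem target_of_ne {i : V × Bool} (hi : i.1 ≠ x.1) : slideTarget p₁ p₂ x i = i := by
  rw [slideTarget, if_neg (fst_ne_iff hi).1, if_neg (fst_ne_iff hi).2]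

theorem target_x : slideTarget p₁ p₂ x x = otherEnd p₁ := if_pos rfl

theorem target_y : slideTarget p₁ p₂ x (otherEnd x) = otherEnd p₂ := by
  rw [slideTarget, if_neg (otherEnd_ne x), if_pos rfl]

theorem lt_target (h : DoubleSlide O O' p₁ p₂ x) {i j : V × Bool} (hi : i.1 ≠ x.1)
    (hij : O'.lt i j) : O.lt i (slideTarget p₁ p₂ x j) := by
  by_cases hj : j.1 = x.1
  · rcases eq_or_eq_otherEnd hj with rfl | rfl
    · rw [target_x]
      exact (h.lt_x' hi).1 hij
    · rw [target_y]
      exact (h.lt_y' hi).1 hij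
  · rw [target_of_ne hj]
    exact (h.off hi hj).1 hij

/-- This monotonicity makes the matrix part stable under right multiplication by `O'.alg`. -/
theorem mono (h : DoubleSlide O O' p₁ p₂ x) {i j : V × Bool} (hij : O'.le i j) :
    O.le (slideTarget p₁ p₂ x i) (slideTarget p₁ p₂ x j) := by
  rcases hij with rfl | hij
  · exact Or.inl rfl
  by_cases hi : i.1 = x.1
  · rcases eq_or_eq_otherEnd hi with rfl | rfl
    · rw [target_x]
      by_cases hj : j.1 = i.1
      · rcases eq_or_eq_otherEnd hj with rfl | rfl
        · exact absurd hij (O'.irrefl _)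
        · rw [target_y]
          exact Or.inr (h.x_lt_y.1 hij)
      · rw [target_of_ne hj]
        exact (h.x_lt hj).1 hij
    · rw [target_y]
      by_cases hj : j.1 = x.1
      · rcases eq_or_eq_otherEnd hj with rfl | rfl
        · rw [target_x]
          exact Or.inr (h.y_lt_x.1 hij)
        · exact absurd hij (O'.irrefl _)
      · rw [target_of_ne hj]
        exact (h.y_lt hj).1 hij
  · rw [target_of_ne hi]
    exact Or.inr (h.lt_target hi hij)

theorem p_lt_x (h : DoubleSlide O O' p₁ p₂ x) : O.lt p₁ x := (h.lt_x _).2 (Or.inl rfl)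
theorem p_lt_y (h : DoubleSlide O O' p₁ p₂ x) : O.lt p₂ (otherEnd x) := (h.lt_y _).2 (Or.inl rfl)

theorem target_eq_q₁ (h : DoubleSlide O O' p₁ p₂ x) {l : V × Bool}
    (hl : slideTarget p₁ p₂ x l = otherEnd p₁) : l = x ∨ l = otherEnd p₁ := by
  unfold slideTarget at hl
  split_ifs at hl with h1 h2
  · exact Or.inl h1
  · exact absurd (otherEnd_inj.1 hl).symm h.ne
  · exact Or.inr hl

theorem target_eq_q₂ (h : DoubleSlide O O' p₁ p₂ x) {l : V × Bool}
    (hl : slideTarget p₁ p₂ x l = otherEnd p₂) : l = otherEnd x ∨ l = otherEnd p₂ := by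
  unfold slideTarget at hl
  split_ifs at hl with h1 h2
  · exact absurd (otherEnd_inj.1 hl) h.ne
  · exact Or.inl h2
  · exact Or.inr hl

end order

/-! Products at the critical entries. -/

/-- No end lies strictly between `p₁` and `x`, so only these two contribute. The scalar of a product
depends on the entries treated here and in the following lemmas, and on diagonal entries. -/
theorem alg_mul_x (h : DoubleSlide O O' p₁ p₂ x) (M M' : O.alg k) :
    (M * M').1 x p₁ = M.1 x x * M'.1 x p₁ + M.1 x p₁ * M'.1 p₁ p₁ :=
  mul_apply_eq₂ _ _ (fst_ne_iff h.ne₁).1.symm fun l h1 h2 => by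
    rcases EndOrder.supp M h1 with h3 | h3
    · exact Or.inl h3
    · exact Or.inr (le_antisymm ((h.lt_x l).1 h3) (EndOrder.supp M' h2))

theorem alg_mul_y (h : DoubleSlide O O' p₁ p₂ x) (M M' : O.alg k) :
    (M * M').1 (otherEnd x) p₂ = M.1 (otherEnd x) (otherEnd x) * M'.1 (otherEnd x) p₂ +
      M.1 (otherEnd x) p₂ * M'.1 p₂ p₂ :=
  mul_apply_eq₂ _ _ (fst_ne_iff h.ne₂).2.symm fun l h1 h2 => by
    rcases EndOrder.supp M h1 with h3 | h3
    · exact Or.inl h3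
    · exact Or.inr (le_antisymm ((h.lt_y l).1 h3) (EndOrder.supp M' h2))

theorem mul_mat_x (h : DoubleSlide O O' p₁ p₂ x) (M : O.alg k) (N : O.DoubleModule k p₁ p₂ x) :
    (M.1 * N.mat) x p₁ = M.1 x x * N.mat x p₁ + M.1 x p₁ * N.mat p₁ p₁ :=
  mul_apply_eq₂ _ _ (fst_ne_iff h.ne₁).1.symm fun l h1 h2 => by
    rcases EndOrder.supp M h1 with h3 | h3
    · exact Or.inl h3
    · exact Or.inr (le_antisymm ((h.lt_x l).1 h3) (N.supp_of_ne h.ne₁ h2))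

theorem mul_mat_y (h : DoubleSlide O O' p₁ p₂ x) (M : O.alg k) (N : O.DoubleModule k p₁ p₂ x) :
    (M.1 * N.mat) (otherEnd x) p₂ = M.1 (otherEnd x) (otherEnd x) * N.mat (otherEnd x) p₂ +
      M.1 (otherEnd x) p₂ * N.mat p₂ p₂ :=
  mul_apply_eq₂ _ _ (fst_ne_iff h.ne₂).2.symm fun l h1 h2 => by
    rcases EndOrder.supp M h1 with h3 | h3
    · exact Or.inl h3
    · exact Or.inr (le_antisymm ((h.lt_y l).1 h3) (N.supp_of_ne h.ne₂ h2))

theorem mul_mat_qx (M : O.alg k) (N : O.DoubleModule k p₁ p₂ x) :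
    (M.1 * N.mat) (otherEnd p₁) x = M.1 p₁ p₁ * N.mat (otherEnd p₁) x := by
  rw [← EndOrder.diag M p₁]
  exact mul_apply_eq _ fun l h1 h2 => le_antisymm (EndOrder.supp M h1) (N.supp_x h2)

theorem mul_mat_qy (M : O.alg k) (N : O.DoubleModule k p₁ p₂ x) :
    (M.1 * N.mat) (otherEnd p₂) (otherEnd x) = M.1 p₂ p₂ * N.mat (otherEnd p₂) (otherEnd x) := by
  rw [← EndOrder.diag M p₂]
  exact mul_apply_eq _ fun l h1 h2 => le_antisymm (EndOrder.supp M h1) (N.supp_y h2)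

theorem mat_mul_qx (h : DoubleSlide O O' p₁ p₂ x) (N : O.DoubleModule k p₁ p₂ x) (b : O'.alg k) :
    (N.mat * b.1) (otherEnd p₁) x =
      N.mat (otherEnd p₁) x * b.1 x x + N.mat p₁ p₁ * b.1 (otherEnd p₁) x := by
  rw [← N.diag h.ne₁]
  refine mul_apply_eq₂ _ _ (fst_ne_iff (show (otherEnd p₁).1 ≠ x.1 from h.ne₁)).1.symm
    fun l h1 h2 => h.target_eq_q₁ ?_
  have h3 := h.mono (EndOrder.supp b h2)
  rw [target_x] at h3
  exact le_antisymm (N.supp h1) h3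

theorem mat_mul_qy (h : DoubleSlide O O' p₁ p₂ x) (N : O.DoubleModule k p₁ p₂ x) (b : O'.alg k) :
    (N.mat * b.1) (otherEnd p₂) (otherEnd x) =
      N.mat (otherEnd p₂) (otherEnd x) * b.1 x x + N.mat p₂ p₂ * b.1 (otherEnd p₂) (otherEnd x) := by
  rw [← N.diag h.ne₂, ← EndOrder.diag b x]
  refine mul_apply_eq₂ _ _ (fst_ne_iff (show (otherEnd p₂).1 ≠ x.1 from h.ne₂)).2.symm
    fun l h1 h2 => h.target_eq_q₂ ?_
  have h3 := h.mono (EndOrder.supp b h2)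
  rw [target_y] at h3
  exact le_antisymm (N.supp h1) h3

/-- An intermediate end strictly above `p₁` would have its target squeezed onto `x`, but targets
avoid the vertex of `x`. -/
theorem mat_mul_x (h : DoubleSlide O O' p₁ p₂ x) (N : O.DoubleModule k p₁ p₂ x) (b : O'.alg k) :
    (N.mat * b.1) x p₁ = N.mat x p₁ * b.1 p₁ p₁ :=
  mul_apply_eq _ fun l h1 h2 => by
    rcases EndOrder.supp b h2 with h3 | h3
    · exact h3.symm
    · exact absurd (congrArg Prod.fst (le_antisymm (N.supp h1)
        ((h.p_lt _).1 (h.lt_target h.ne₁ h3)))) (h.target_ne l)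

theorem mat_mul_y (h : DoubleSlide O O' p₁ p₂ x) (N : O.DoubleModule k p₁ p₂ x) (b : O'.alg k) :
    (N.mat * b.1) (otherEnd x) p₂ = N.mat (otherEnd x) p₂ * b.1 p₂ p₂ :=
  mul_apply_eq _ fun l h1 h2 => by
    rcases EndOrder.supp b h2 with h3 | h3
    · exact h3.symm
    · exact absurd (congrArg Prod.fst (le_antisymm (N.supp h1)
        ((h.p_lt' _).1 (h.lt_target h.ne₂ h3)))) (h.target_ne l)

theorem alg'_mul_qx (h : DoubleSlide O O' p₁ p₂ x) (b b' : O'.alg k) :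
    (b * b').1 (otherEnd p₁) x = b.1 p₁ p₁ * b'.1 (otherEnd p₁) x +
      b.1 (otherEnd p₁) x * b'.1 x x := by
  rw [← EndOrder.diag b p₁]
  refine mul_apply_eq₂ _ _ (fst_ne_iff (show (otherEnd p₁).1 ≠ x.1 from h.ne₁)).1 fun l h1 h2 => ?_
  rw [or_comm]
  refine h.target_eq_q₁ ?_
  have h3 := h.mono (EndOrder.supp b h1)
  have h4 := h.mono (EndOrder.supp b' h2)
  rw [target_of_ne (show (otherEnd p₁).1 ≠ x.1 from h.ne₁)] at h3
  rw [target_x] at h4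
  exact le_antisymm h3 h4

theorem alg'_mul_qy (h : DoubleSlide O O' p₁ p₂ x) (b b' : O'.alg k) :
    (b * b').1 (otherEnd p₂) (otherEnd x) = b.1 p₂ p₂ * b'.1 (otherEnd p₂) (otherEnd x) +
      b.1 (otherEnd p₂) (otherEnd x) * b'.1 x x := by
  rw [← EndOrder.diag b p₂, ← EndOrder.diag b' x]
  refine mul_apply_eq₂ _ _ (fst_ne_iff (show (otherEnd p₂).1 ≠ x.1 from h.ne₂)).2 fun l h1 h2 => ?_
  rw [or_comm]
  refine h.target_eq_q₂ ?_
  have h3 := h.mono (EndOrder.supp b h1)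
  have h4 := h.mono (EndOrder.supp b' h2)
  rw [target_of_ne (show (otherEnd p₂).1 ≠ x.1 from h.ne₂)] at h3
  rw [target_y] at h4
  exact le_antisymm h3 h4

theorem smul_mem (M : O.alg k) (N : O.DoubleModule k p₁ p₂ x) (c : k) :
    (M.1 * N.mat, c) ∈ O.doubleSubmodule k p₁ p₂ x := by
  refine ⟨fun i j hij => ?_, fun i hi => ?_⟩
  · obtain ⟨l, h1, h2⟩ := mul_support k hij
    exact le_trans (N.supp h2) (EndOrder.supp M h1)
  · have : ∀ i : V × Bool, i.1 ≠ x.1 → (M.1 * N.mat) i i = M.1 i i * N.mat i i := fun i hi =>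
      mul_apply_eq i fun l h1 h2 => le_antisymm (EndOrder.supp M h1) (N.supp_of_ne hi h2)
    exact (this (otherEnd i) hi).trans (.trans (by rw [N.diag hi, EndOrder.diag]) (this i hi).symm)

/-- The left action. -/
noncomputable def smul (M : O.alg k) (N : O.DoubleModule k p₁ p₂ x) : O.DoubleModule k p₁ p₂ x :=
  -- The entries of `N` at `(otherEnd p₁, x)` and `(otherEnd p₂, otherEnd x)` stand for the diagonal
  -- entries at `p₁` and `p₂`. Multiplied by the entries of `M` along the two arrows into the vertex
  -- of `x`, they give the new entries whose difference is added to the scalar.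
  ⟨(M.1 * N.mat, M.1 x x * N.scal + M.1 x p₁ * N.mat (otherEnd p₁) x -
    M.1 (otherEnd x) p₂ * N.mat (otherEnd p₂) (otherEnd x)), smul_mem M N _⟩

/-- The module structure. -/
@[reducible] noncomputable def module (h : DoubleSlide O O' p₁ p₂ x) :
    Module (O.alg k) (O.DoubleModule k p₁ p₂ x) where
  smul := smul
  one_smul N := by
    refine Subtype.ext (Prod.ext (one_mul N.mat) ?_)
    change (1 : Matrix (V × Bool) (V × Bool) k) x x * N.scal +
      (1 : Matrix (V × Bool) (V × Bool) k) x p₁ * N.mat (otherEnd p₁) x -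
      (1 : Matrix (V × Bool) (V × Bool) k) (otherEnd x) p₂ * N.mat (otherEnd p₂) (otherEnd x) =
        N.scal
    rw [Matrix.one_apply_eq, Matrix.one_apply_ne (fst_ne_iff h.ne₁).1.symm,
      Matrix.one_apply_ne (fst_ne_iff h.ne₂).2.symm]
    ring
  mul_smul M M' N := by
    refine Subtype.ext (Prod.ext (mul_assoc M.1 M'.1 N.mat) ?_)
    change (M * M').1 x x * N.scal + (M * M').1 x p₁ * N.mat (otherEnd p₁) x -
      (M * M').1 (otherEnd x) p₂ * N.mat (otherEnd p₂) (otherEnd x) =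
      M.1 x x * (M'.1 x x * N.scal + M'.1 x p₁ * N.mat (otherEnd p₁) x -
        M'.1 (otherEnd x) p₂ * N.mat (otherEnd p₂) (otherEnd x)) +
        M.1 x p₁ * (M'.1 * N.mat) (otherEnd p₁) x -
        M.1 (otherEnd x) p₂ * (M'.1 * N.mat) (otherEnd p₂) (otherEnd x)
    rw [mul_diag, h.alg_mul_x, h.alg_mul_y, mul_mat_qx, mul_mat_qy, EndOrder.diag M x]
    ring
  smul_zero M := by
    refine Subtype.ext (Prod.ext (mul_zero M.1) ?_)
    change M.1 x x * 0 + M.1 x p₁ * 0 - M.1 (otherEnd x) p₂ * 0 = 0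
    ring
  smul_add M N N' := by
    refine Subtype.ext (Prod.ext (mul_add M.1 N.mat N'.mat) ?_)
    change M.1 x x * (N.scal + N'.scal) +
      M.1 x p₁ * (N.mat (otherEnd p₁) x + N'.mat (otherEnd p₁) x) -
      M.1 (otherEnd x) p₂ *
        (N.mat (otherEnd p₂) (otherEnd x) + N'.mat (otherEnd p₂) (otherEnd x)) =
      M.1 x x * N.scal + M.1 x p₁ * N.mat (otherEnd p₁) x -
        M.1 (otherEnd x) p₂ * N.mat (otherEnd p₂) (otherEnd x) +
      (M.1 x x * N'.scal + M.1 x p₁ * N'.mat (otherEnd p₁) x -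
        M.1 (otherEnd x) p₂ * N'.mat (otherEnd p₂) (otherEnd x))
    ring
  add_smul M M' N := by
    refine Subtype.ext (Prod.ext (add_mul M.1 M'.1 N.mat) ?_)
    change (M.1 x x + M'.1 x x) * N.scal +
      (M.1 x p₁ + M'.1 x p₁) * N.mat (otherEnd p₁) x -
      (M.1 (otherEnd x) p₂ + M'.1 (otherEnd x) p₂) * N.mat (otherEnd p₂) (otherEnd x) =
      M.1 x x * N.scal + M.1 x p₁ * N.mat (otherEnd p₁) x -
        M.1 (otherEnd x) p₂ * N.mat (otherEnd p₂) (otherEnd x) +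
      (M'.1 x x * N.scal + M'.1 x p₁ * N.mat (otherEnd p₁) x -
        M'.1 (otherEnd x) p₂ * N.mat (otherEnd p₂) (otherEnd x))
    ring
  zero_smul N := by
    refine Subtype.ext (Prod.ext (zero_mul N.mat) ?_)
    change 0 * N.scal + 0 * N.mat (otherEnd p₁) x -
      0 * N.mat (otherEnd p₂) (otherEnd x) = 0
    ring

theorem act_mem (h : DoubleSlide O O' p₁ p₂ x) (N : O.DoubleModule k p₁ p₂ x) (b : O'.alg k)
    (c : k) : (N.mat * b.1, c) ∈ O.doubleSubmodule k p₁ p₂ x := by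
  refine ⟨fun i j hij => ?_, fun i hi => ?_⟩
  · obtain ⟨l, h1, h2⟩ := mul_support k hij
    exact le_trans (h.mono (EndOrder.supp b h2)) (N.supp h1)
  · have : ∀ i : V × Bool, i.1 ≠ x.1 → (N.mat * b.1) i i = N.mat i i * b.1 i i := fun i hi =>
      mul_apply_eq i fun l h1 h2 => by
        rcases EndOrder.supp b h2 with h3 | h3
        · exact h3.symm
        · have h4 := h.lt_target hi h3
          rw [le_antisymm (N.supp h1) (Or.inr h4)] at h4
          exact absurd h4 (O.irrefl _)
    exact (this (otherEnd i) hi).trans (.trans (by rw [N.diag hi, EndOrder.diag]) (this i hi).symm)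

/-- The right action. -/
noncomputable def act (h : DoubleSlide O O' p₁ p₂ x) (N : O.DoubleModule k p₁ p₂ x)
    (b : O'.alg k) : O.DoubleModule k p₁ p₂ x :=
  ⟨(N.mat * b.1, N.scal * b.1 x x + N.mat x p₁ * b.1 (otherEnd p₁) x -
    N.mat (otherEnd x) p₂ * b.1 (otherEnd p₂) (otherEnd x)), h.act_mem N b _⟩

theorem mat_act (h : DoubleSlide O O' p₁ p₂ x) (N : O.DoubleModule k p₁ p₂ x) (b : O'.alg k) :
    (h.act N b).mat = N.mat * b.1 := rfl

theorem scal_act (h : DoubleSlide O O' p₁ p₂ x) (N : O.DoubleModule k p₁ p₂ x) (b : O'.alg k) :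
    (h.act N b).scal = N.scal * b.1 x x + N.mat x p₁ * b.1 (otherEnd p₁) x -
      N.mat (otherEnd x) p₂ * b.1 (otherEnd p₂) (otherEnd x) := rfl

/-- In the scalar both sides contain the term `M x p₁ * N p₁ p₁ * b (otherEnd p₁) x`: on the left it
comes from `M * N`, on the right from `N * b`, because the diagonal entries of `N` at `p₁` and
`otherEnd p₁` agree. The same holds for `p₂`, and the other terms match directly. -/
theorem act_smul (h : DoubleSlide O O' p₁ p₂ x) (M : O.alg k) (N : O.DoubleModule k p₁ p₂ x)
    (b : O'.alg k) : h.act (smul M N) b = smul M (h.act N b) := by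
  refine Subtype.ext (Prod.ext (mul_assoc M.1 N.mat b.1) ?_)
  change (M.1 x x * N.scal + M.1 x p₁ * N.mat (otherEnd p₁) x -
      M.1 (otherEnd x) p₂ * N.mat (otherEnd p₂) (otherEnd x)) * b.1 x x +
    (M.1 * N.mat) x p₁ * b.1 (otherEnd p₁) x -
    (M.1 * N.mat) (otherEnd x) p₂ * b.1 (otherEnd p₂) (otherEnd x) =
    M.1 x x * (N.scal * b.1 x x + N.mat x p₁ * b.1 (otherEnd p₁) x -
      N.mat (otherEnd x) p₂ * b.1 (otherEnd p₂) (otherEnd x)) +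
    M.1 x p₁ * (N.mat * b.1) (otherEnd p₁) x -
    M.1 (otherEnd x) p₂ * (N.mat * b.1) (otherEnd p₂) (otherEnd x)
  rw [h.mul_mat_x, h.mul_mat_y, h.mat_mul_qx, h.mat_mul_qy, EndOrder.diag M x]
  ring

theorem act_mul (h : DoubleSlide O O' p₁ p₂ x) (N : O.DoubleModule k p₁ p₂ x) (b b' : O'.alg k) :
    h.act N (b * b') = h.act (h.act N b) b' := by
  refine Subtype.ext (Prod.ext (mul_assoc N.mat b.1 b'.1).symm ?_)
  change N.scal * (b * b').1 x x + N.mat x p₁ * (b * b').1 (otherEnd p₁) x -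
      N.mat (otherEnd x) p₂ * (b * b').1 (otherEnd p₂) (otherEnd x) =
    (N.scal * b.1 x x + N.mat x p₁ * b.1 (otherEnd p₁) x -
      N.mat (otherEnd x) p₂ * b.1 (otherEnd p₂) (otherEnd x)) * b'.1 x x +
    (N.mat * b.1) x p₁ * b'.1 (otherEnd p₁) x -
    (N.mat * b.1) (otherEnd x) p₂ * b'.1 (otherEnd p₂) (otherEnd x)
  rw [mul_diag, h.mat_mul_x, h.mat_mul_y, h.alg'_mul_qx, h.alg'_mul_qy]
  ring

theorem act_add (h : DoubleSlide O O' p₁ p₂ x) (N : O.DoubleModule k p₁ p₂ x) (b b' : O'.alg k) :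
    h.act N (b + b') = h.act N b + h.act N b' := by
  refine Subtype.ext (Prod.ext (mul_add N.mat b.1 b'.1) ?_)
  change N.scal * (b.1 x x + b'.1 x x) +
      N.mat x p₁ * (b.1 (otherEnd p₁) x + b'.1 (otherEnd p₁) x) -
      N.mat (otherEnd x) p₂ *
        (b.1 (otherEnd p₂) (otherEnd x) + b'.1 (otherEnd p₂) (otherEnd x)) =
    N.scal * b.1 x x + N.mat x p₁ * b.1 (otherEnd p₁) x -
      N.mat (otherEnd x) p₂ * b.1 (otherEnd p₂) (otherEnd x) +
    (N.scal * b'.1 x x + N.mat x p₁ * b'.1 (otherEnd p₁) x -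
      N.mat (otherEnd x) p₂ * b'.1 (otherEnd p₂) (otherEnd x))
  ring

theorem add_act (h : DoubleSlide O O' p₁ p₂ x) (N N' : O.DoubleModule k p₁ p₂ x) (b : O'.alg k) :
    h.act (N + N') b = h.act N b + h.act N' b := by
  refine Subtype.ext (Prod.ext (add_mul N.mat N'.mat b.1) ?_)
  change (N.scal + N'.scal) * b.1 x x +
      (N.mat x p₁ + N'.mat x p₁) * b.1 (otherEnd p₁) x -
      (N.mat (otherEnd x) p₂ + N'.mat (otherEnd x) p₂) * b.1 (otherEnd p₂) (otherEnd x) =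
    N.scal * b.1 x x + N.mat x p₁ * b.1 (otherEnd p₁) x -
      N.mat (otherEnd x) p₂ * b.1 (otherEnd p₂) (otherEnd x) +
    (N'.scal * b.1 x x + N'.mat x p₁ * b.1 (otherEnd p₁) x -
      N'.mat (otherEnd x) p₂ * b.1 (otherEnd p₂) (otherEnd x))
  ring

theorem act_zero (h : DoubleSlide O O' p₁ p₂ x) (N : O.DoubleModule k p₁ p₂ x) :
    h.act N (0 : O'.alg k) = 0 := by
  have := h.act_add N (0 : O'.alg k) 0
  rwa [add_zero, left_eq_add] at this

theorem act_algebraMap (h : DoubleSlide O O' p₁ p₂ x) (N : O.DoubleModule k p₁ p₂ x) (c : k) :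
    h.act N (algebraMap k (O'.alg k) c) = c • N := by
  refine Subtype.ext (Prod.ext ?_ ?_)
  · change N.mat * algebraMap k (Matrix (V × Bool) (V × Bool) k) c = c • N.mat
    rw [← Algebra.commutes, Algebra.smul_def]
  · change N.scal * algebraMap k (Matrix (V × Bool) (V × Bool) k) c x x +
      N.mat x p₁ * algebraMap k (Matrix (V × Bool) (V × Bool) k) c (otherEnd p₁) x -
      N.mat (otherEnd x) p₂ *
        algebraMap k (Matrix (V × Bool) (V × Bool) k) c (otherEnd p₂) (otherEnd x) = c * N.scal
    rw [Matrix.algebraMap_matrix_apply, Matrix.algebraMap_matrix_apply,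
      Matrix.algebraMap_matrix_apply, if_pos rfl,
      if_neg (fst_ne_iff (show (otherEnd p₁).1 ≠ x.1 from h.ne₁)).1,
      if_neg (fst_ne_iff (show (otherEnd p₂).1 ≠ x.1 from h.ne₂)).2, Algebra.algebraMap_self_apply]
    ring

theorem act_one (h : DoubleSlide O O' p₁ p₂ x) (N : O.DoubleModule k p₁ p₂ x) :
    h.act N (1 : O'.alg k) = N := by
  rw [← map_one (algebraMap k (O'.alg k)), act_algebraMap, one_smul]

theorem algebraMap_smul (h : DoubleSlide O O' p₁ p₂ x) (N : O.DoubleModule k p₁ p₂ x) (c : k) :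
    smul (algebraMap k (O.alg k) c) N = c • N := by
  refine Subtype.ext (Prod.ext ?_ ?_)
  · change algebraMap k (Matrix (V × Bool) (V × Bool) k) c * N.mat = c • N.mat
    rw [Algebra.smul_def]
  · change algebraMap k (Matrix (V × Bool) (V × Bool) k) c x x * N.scal +
      algebraMap k (Matrix (V × Bool) (V × Bool) k) c x p₁ * N.mat (otherEnd p₁) x -
      algebraMap k (Matrix (V × Bool) (V × Bool) k) c (otherEnd x) p₂ *
        N.mat (otherEnd p₂) (otherEnd x) = c * N.scal
    rw [Matrix.algebraMap_matrix_apply, Matrix.algebraMap_matrix_apply,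
      Matrix.algebraMap_matrix_apply, if_pos rfl, if_neg (fst_ne_iff h.ne₁).1.symm,
      if_neg (fst_ne_iff h.ne₂).2.symm, Algebra.algebraMap_self_apply]
    ring

end DoubleSlide

end Double

end EndOrder

namespace EndOrder

section DoubleSteps

variable {V : Type} [Fintype V] [DecidableEq V] {k : Type u} [Field k] {O O' : EndOrder V}
  {p₁ p₂ x : V × Bool}

theorem unit_mul_idem {i j : V × Bool} (h : O.lt i j) :
    unit k h * O.idem k i.1 = unit k h := by
  refine Subtype.ext (Matrix.ext fun b a => ?_)
  rw [MulMemClass.coe_mul, mul_idem_apply, unit_apply]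
  by_cases ha : i = a
  · rw [ha, if_pos rfl]
  · rw [if_neg (fun h => ha h.2 : ¬ (j = b ∧ i = a)), ite_self]

theorem single_eq_zero {a b i : V × Bool} (j : V × Bool) (h : i.1 ≠ b.1) :
    Matrix.single a b (1 : k) j i = 0 := by
  rw [Matrix.single_apply, if_neg]
  rintro ⟨-, rfl⟩
  exact h rfl

namespace DoubleModule

variable (k O p₁ p₂ x) in
/-- The generator off the vertex `x`. -/
noncomputable def gen₀ : O.DoubleModule k p₁ p₂ x :=
  mk (Matrix.diagonal fun i => if i.1 = x.1 then 0 else 1) 0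
    (fun j h => by
      by_cases hj : j = x
      · subst hj
        rw [Matrix.diagonal_apply_eq, if_pos rfl] at h
        exact absurd rfl h
      · exact absurd (Matrix.diagonal_apply_ne _ hj) h)
    (fun j h => by
      by_cases hj : j = otherEnd x
      · subst hj
        rw [Matrix.diagonal_apply_eq, if_pos (by rfl)] at h
        exact absurd rfl h
      · exact absurd (Matrix.diagonal_apply_ne _ hj) h)
    (fun i j _ h => by
      by_cases hj : j = i
      · exact Or.inl hj.symm
      · exact absurd (Matrix.diagonal_apply_ne _ hj) h)
    (fun i _ => by rw [Matrix.diagonal_apply_eq, Matrix.diagonal_apply_eq]; rfl)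

variable (k O p₁ p₂ x) in
/-- The generator in the column `x`. -/
noncomputable def genx : O.DoubleModule k p₁ p₂ x :=
  mk (Matrix.single (otherEnd p₁) x 1) 0
    (fun j h => by
      rw [Matrix.single_apply] at h
      exact Or.inl (by_contra fun h0 => h (if_neg fun h' => h0 h'.1)))
    (fun j h => absurd (by rw [Matrix.single_apply, if_neg fun h' => otherEnd_ne x h'.2.symm]) h)
    (fun i j hi h => absurd (single_eq_zero j (by exact hi)) h)
    (fun i hi => (single_eq_zero _ (by exact hi)).trans (single_eq_zero _ (by exact hi)).symm)

variable (k O p₁ p₂ x) in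
/-- The generator in the column `otherEnd x`. -/
noncomputable def geny : O.DoubleModule k p₁ p₂ x :=
  mk (Matrix.single (otherEnd p₂) (otherEnd x) 1) 0
    (fun j h => absurd (by rw [Matrix.single_apply, if_neg fun h' => otherEnd_ne x h'.2]) h)
    (fun j h => by
      rw [Matrix.single_apply] at h
      exact Or.inl (by_contra fun h0 => h (if_neg fun h' => h0 h'.1)))
    (fun i j hi h => absurd (single_eq_zero j (by exact hi)) h)
    (fun i hi => (single_eq_zero _ (by exact hi)).trans (single_eq_zero _ (by exact hi)).symm)

theorem mul_gen₀ (M : Matrix (V × Bool) (V × Bool) k) (j i : V × Bool) :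
    (M * (gen₀ k O p₁ p₂ x).mat) j i = if i.1 = x.1 then 0 else M j i := by
  change (M * Matrix.diagonal _ : Matrix _ _ k) j i = _
  rw [Matrix.mul_diagonal]
  split_ifs
  · rw [mul_zero]
  · rw [mul_one]

theorem gen₀_mul (M : Matrix (V × Bool) (V × Bool) k) (j i : V × Bool) :
    ((gen₀ k O p₁ p₂ x).mat * M) j i = if j.1 = x.1 then 0 else M j i := by
  change (Matrix.diagonal _ * M : Matrix _ _ k) j i = _
  rw [Matrix.diagonal_mul]
  split_ifs
  · rw [zero_mul]
  · rw [one_mul]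

theorem mul_genx (M : Matrix (V × Bool) (V × Bool) k) (j i : V × Bool) :
    (M * (genx k O p₁ p₂ x).mat) j i = if i = x then M j (otherEnd p₁) else 0 := by
  change (M * Matrix.single (otherEnd p₁) x 1 : Matrix _ _ k) j i = _
  split_ifs with hi
  · subst hi
    rw [Matrix.mul_single_apply_same, mul_one]
  · rw [Matrix.mul_single_apply_of_ne _ _ _ _ _ hi]

theorem genx_mul (M : Matrix (V × Bool) (V × Bool) k) (j i : V × Bool) :
    ((genx k O p₁ p₂ x).mat * M) j i = if j = otherEnd p₁ then M x i else 0 := by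
  change (Matrix.single (otherEnd p₁) x 1 * M : Matrix _ _ k) j i = _
  split_ifs with hj
  · subst hj
    rw [Matrix.single_mul_apply_same, one_mul]
  · rw [Matrix.single_mul_apply_of_ne _ _ _ _ _ hj]

theorem mul_geny (M : Matrix (V × Bool) (V × Bool) k) (j i : V × Bool) :
    (M * (geny k O p₁ p₂ x).mat) j i = if i = otherEnd x then M j (otherEnd p₂) else 0 := by
  change (M * Matrix.single (otherEnd p₂) (otherEnd x) 1 : Matrix _ _ k) j i = _
  split_ifs with hi
  · subst hi
    rw [Matrix.mul_single_apply_same, mul_one]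
  · rw [Matrix.mul_single_apply_of_ne _ _ _ _ _ hi]

theorem geny_mul (M : Matrix (V × Bool) (V × Bool) k) (j i : V × Bool) :
    ((geny k O p₁ p₂ x).mat * M) j i = if j = otherEnd p₂ then M (otherEnd x) i else 0 := by
  change (Matrix.single (otherEnd p₂) (otherEnd x) 1 * M : Matrix _ _ k) j i = _
  split_ifs with hj
  · subst hj
    rw [Matrix.single_mul_apply_same, one_mul]
  · rw [Matrix.single_mul_apply_of_ne _ _ _ _ _ hj]

theorem gen₀_mat (j i : V × Bool) : (gen₀ k O p₁ p₂ x).mat j i =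
    if j = i then (if i.1 = x.1 then 0 else 1) else 0 := by
  rw [← one_mul (gen₀ k O p₁ p₂ x).mat, mul_gen₀, Matrix.one_apply]
  split_ifs <;> rfl

theorem genx_mat (j i : V × Bool) : (genx k O p₁ p₂ x).mat j i =
    if otherEnd p₁ = j ∧ x = i then 1 else 0 := Matrix.single_apply ..

theorem geny_mat (j i : V × Bool) : (geny k O p₁ p₂ x).mat j i =
    if otherEnd p₂ = j ∧ otherEnd x = i then 1 else 0 := Matrix.single_apply ..

end DoubleModule

open DoubleModule

namespace DoubleSlide

theorem ne_x₁ (h : DoubleSlide O O' p₁ p₂ x) : (otherEnd p₁).1 ≠ x.1 := h.ne₁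
theorem ne_x₂ (h : DoubleSlide O O' p₁ p₂ x) : (otherEnd p₂).1 ≠ x.1 := h.ne₂

theorem scal_smul_gen₀ (h : DoubleSlide O O' p₁ p₂ x) (M : O.alg k) :
    (smul M (gen₀ k O p₁ p₂ x)).scal = 0 := by
  change M.1 x x * 0 + M.1 x p₁ * (gen₀ k O p₁ p₂ x).mat (otherEnd p₁) x -
    M.1 (otherEnd x) p₂ * (gen₀ k O p₁ p₂ x).mat (otherEnd p₂) (otherEnd x) = 0
  rw [gen₀_mat, gen₀_mat, if_neg (fst_ne_iff h.ne_x₁).1, if_neg (fst_ne_iff h.ne_x₂).2]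
  ring

theorem scal_smul_genx (M : O.alg k) : (smul M (genx k O p₁ p₂ x)).scal = M.1 x p₁ := by
  change M.1 x x * 0 + M.1 x p₁ * (genx k O p₁ p₂ x).mat (otherEnd p₁) x -
    M.1 (otherEnd x) p₂ * (genx k O p₁ p₂ x).mat (otherEnd p₂) (otherEnd x) = M.1 x p₁
  rw [genx_mat, genx_mat, if_pos ⟨rfl, rfl⟩, if_neg fun h => otherEnd_ne x h.2.symm]
  ring

theorem scal_smul_geny (M : O.alg k) :
    (smul M (geny k O p₁ p₂ x)).scal = - M.1 (otherEnd x) p₂ := by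
  change M.1 x x * 0 + M.1 x p₁ * (geny k O p₁ p₂ x).mat (otherEnd p₁) x -
    M.1 (otherEnd x) p₂ * (geny k O p₁ p₂ x).mat (otherEnd p₂) (otherEnd x) =
      - M.1 (otherEnd x) p₂
  rw [geny_mat, geny_mat, if_neg fun h => otherEnd_ne x h.2, if_pos ⟨rfl, rfl⟩]
  ring

theorem scal_act_gen₀ (h : DoubleSlide O O' p₁ p₂ x) (b : O'.alg k) :
    (h.act (gen₀ k O p₁ p₂ x) b).scal = 0 := by
  change 0 * b.1 x x + (gen₀ k O p₁ p₂ x).mat x p₁ * b.1 (otherEnd p₁) x -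
    (gen₀ k O p₁ p₂ x).mat (otherEnd x) p₂ * b.1 (otherEnd p₂) (otherEnd x) = 0
  rw [gen₀_mat, gen₀_mat, if_neg (fst_ne_iff h.ne₁).1.symm, if_neg (fst_ne_iff h.ne₂).2.symm]
  ring

theorem scal_act_genx (h : DoubleSlide O O' p₁ p₂ x) (b : O'.alg k) :
    (h.act (genx k O p₁ p₂ x) b).scal = 0 := by
  change 0 * b.1 x x + (genx k O p₁ p₂ x).mat x p₁ * b.1 (otherEnd p₁) x -
    (genx k O p₁ p₂ x).mat (otherEnd x) p₂ * b.1 (otherEnd p₂) (otherEnd x) = 0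
  rw [genx_mat, genx_mat, if_neg fun h' => (fst_ne_iff h.ne_x₁).1 h'.1,
    if_neg fun h' => (fst_ne_iff h.ne_x₁).2 h'.1]
  ring

theorem scal_act_geny (h : DoubleSlide O O' p₁ p₂ x) (b : O'.alg k) :
    (h.act (geny k O p₁ p₂ x) b).scal = 0 := by
  change 0 * b.1 x x + (geny k O p₁ p₂ x).mat x p₁ * b.1 (otherEnd p₁) x -
    (geny k O p₁ p₂ x).mat (otherEnd x) p₂ * b.1 (otherEnd p₂) (otherEnd x) = 0
  rw [geny_mat, geny_mat, if_neg fun h' => (fst_ne_iff h.ne_x₂).1 h'.1,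
    if_neg fun h' => (fst_ne_iff h.ne_x₂).2 h'.1]
  ring

theorem smul_mat (M : O.alg k) (N : O.DoubleModule k p₁ p₂ x) :
    (smul M N).mat = M.1 * N.mat := rfl

theorem exists_gen (h : DoubleSlide O O' p₁ p₂ x) (N : O.DoubleModule k p₁ p₂ x) :
    ∃ a a₁ a₂ : O.alg k, N = smul a (gen₀ k O p₁ p₂ x) + smul a₁ (genx k O p₁ p₂ x) +
      smul a₂ (geny k O p₁ p₂ x) := by
  have hqp₁ := otherEnd_ne p₁
  have hqp₂ := otherEnd_ne p₂
  let A : Matrix (V × Bool) (V × Bool) k := Matrix.of fun j i => if i.1 = x.1 then 0 else N.mat j i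
  have hA : ∀ j i, A j i = if i.1 = x.1 then 0 else N.mat j i := fun _ _ => rfl
  -- The column `otherEnd p₁` produces the column `x` of `N`. The entry at `(p₁, p₁)` is forced, and
  -- the scalar of `N` is put at `(x, p₁)`, the entry that the action on `genx` turns into a scalar.
  let A₁ : Matrix (V × Bool) (V × Bool) k := Matrix.of fun j i =>
    if i = otherEnd p₁ then N.mat j x else if i = p₁ then
      (if j = p₁ then N.mat (otherEnd p₁) x else if j = x then N.scal else 0) else 0
  have hA₁ : ∀ j i, A₁ j i = if i = otherEnd p₁ then N.mat j x else if i = p₁ then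
      (if j = p₁ then N.mat (otherEnd p₁) x else if j = x then N.scal else 0) else 0 :=
    fun _ _ => rfl
  let A₂ : Matrix (V × Bool) (V × Bool) k := Matrix.of fun j i =>
    if i = otherEnd p₂ then N.mat j (otherEnd x) else if i = p₂ ∧ j = p₂ then
      N.mat (otherEnd p₂) (otherEnd x) else 0
  have hA₂ : ∀ j i, A₂ j i = if i = otherEnd p₂ then N.mat j (otherEnd x) else
      if i = p₂ ∧ j = p₂ then N.mat (otherEnd p₂) (otherEnd x) else 0 := fun _ _ => rfl
  refine ⟨⟨A, fun i j hij => ?_, fun i => ?_⟩, ⟨A₁, fun i j hij => ?_, fun i => ?_⟩,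
    ⟨A₂, fun i j hij => ?_, fun i => ?_⟩, DoubleModule.ext (fun j i => ?_) ?_⟩
  · rw [hA] at hij
    by_cases hi : i.1 = x.1
    · exact absurd (if_pos hi) hij
    · rw [if_neg hi] at hij
      exact N.supp_of_ne hi hij
  · rw [hA, hA]
    by_cases hi : i.1 = x.1
    · rw [if_pos hi, if_pos (show (otherEnd i).1 = x.1 from hi)]
    · rw [if_neg hi, if_neg (show ¬ (otherEnd i).1 = x.1 from hi), N.diag hi]
  · rw [hA₁] at hij
    split_ifs at hij with h3 h4 h5 h6
    · rw [h3]
      exact N.supp_x hij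
    · exact Or.inl (h4.trans h5.symm)
    · rw [h4, h6]
      exact Or.inr h.p_lt_x
    · exact absurd rfl hij
    · exact absurd rfl hij
  · rw [hA₁, hA₁]
    by_cases h3 : i = p₁
    · subst h3
      rw [if_pos rfl, if_neg hqp₁.symm, if_pos rfl, if_pos rfl]
    · by_cases h4 : i = otherEnd p₁
      · subst h4
        rw [otherEnd_otherEnd, if_neg hqp₁.symm, if_pos rfl, if_pos rfl, if_pos rfl]
      · rw [if_neg (fun h => h3 (otherEnd_inj.1 h)), if_neg h4, if_neg, if_neg h3]
        exact fun h => h4 (eq_otherEnd_comm.1 h.symm)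
  · rw [hA₂] at hij
    split_ifs at hij with h3 h4
    · rw [h3]
      exact N.supp_y hij
    · exact Or.inl (h4.1.trans h4.2.symm)
    · exact absurd rfl hij
  · rw [hA₂, hA₂]
    by_cases h3 : i = p₂
    · subst h3
      rw [if_pos rfl, if_neg hqp₂.symm, if_pos ⟨rfl, rfl⟩]
    · by_cases h4 : i = otherEnd p₂
      · subst h4
        rw [otherEnd_otherEnd, if_neg hqp₂.symm, if_pos rfl, if_pos ⟨rfl, rfl⟩]
      · rw [if_neg (fun h => h3 (otherEnd_inj.1 h)), if_neg h4, if_neg, if_neg]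
        · exact fun h => h3 h.1
        · exact fun h => h4 (eq_otherEnd_comm.1 h.1.symm)
  · rw [mat_add, mat_add, Matrix.add_apply, Matrix.add_apply, smul_mat, smul_mat, smul_mat,
      mul_gen₀, mul_genx, mul_geny]
    change _ = (if i.1 = x.1 then 0 else A j i) + (if i = x then A₁ j (otherEnd p₁) else 0) +
      (if i = otherEnd x then A₂ j (otherEnd p₂) else 0)
    rw [hA, hA₁, hA₂, if_pos rfl, if_pos rfl]
    by_cases hi : i.1 = x.1
    · rw [if_pos hi, zero_add]
      rcases eq_or_eq_otherEnd hi with h4 | h4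
      · subst h4
        rw [if_pos rfl, if_neg (otherEnd_ne i).symm, add_zero]
      · subst h4
        rw [if_neg (otherEnd_ne x), if_pos rfl, zero_add]
    · rw [if_neg hi, if_neg hi, if_neg (fst_ne_iff hi).1, if_neg (fst_ne_iff hi).2, add_zero,
        add_zero]
  · rw [scal_add, scal_add, h.scal_smul_gen₀, scal_smul_genx, scal_smul_geny]
    change _ = 0 + A₁ x p₁ + -A₂ (otherEnd x) p₂
    rw [hA₁, hA₂, if_neg hqp₁.symm, if_pos rfl, if_neg (fst_ne_iff h.ne₁).1.symm, if_pos rfl,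
      if_neg hqp₂.symm, if_neg fun h' => (fst_ne_iff h.ne₂).2 h'.2.symm]
    ring

/-- The matrix parts vanish, and the scalars are 1 and -1: the sign in the action is chosen for this
cancellation. -/
theorem relation (h : DoubleSlide O O' p₁ p₂ x) :
    smul (unit k h.p_lt_x) (genx k O p₁ p₂ x) + smul (unit k h.p_lt_y) (geny k O p₁ p₂ x) = 0 := by
  refine DoubleModule.ext (fun j i => ?_) ?_
  · have e₁ : (unit k h.p_lt_x).1 j (otherEnd p₁) = 0 := by
      rw [unit_apply, if_neg fun h => otherEnd_ne p₁ h.2.symm]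
    have e₂ : (unit k h.p_lt_y).1 j (otherEnd p₂) = 0 := by
      rw [unit_apply, if_neg fun h => otherEnd_ne p₂ h.2.symm]
    rw [mat_add, Matrix.add_apply, smul_mat, smul_mat, mul_genx, mul_geny, e₁, e₂, ite_self,
      ite_self, add_zero, mat_zero, Matrix.zero_apply]
  · rw [scal_add, scal_smul_genx, scal_smul_geny, unit_apply, unit_apply, if_pos ⟨rfl, rfl⟩,
      if_pos ⟨rfl, rfl⟩, scal_zero]
    ring

theorem idem_smul_gen₀ (h : DoubleSlide O O' p₁ p₂ x) :
    smul (1 - O.idem k x.1) (gen₀ k O p₁ p₂ x) = gen₀ k O p₁ p₂ x := by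
  refine DoubleModule.ext (fun j i => ?_) (h.scal_smul_gen₀ _)
  change ((1 - (O.idem k x.1).1) * (gen₀ k O p₁ p₂ x).mat) j i = (gen₀ k O p₁ p₂ x).mat j i
  rw [sub_mul, one_mul, Matrix.sub_apply, idem_mul_apply, gen₀_mat]
  by_cases hj : j.1 = x.1
  · rw [if_pos hj, sub_self]
    by_cases hji : j = i
    · subst hji
      rw [if_pos rfl, if_pos hj]
    · rw [if_neg hji]
  · rw [if_neg hj, sub_zero]

theorem idem_smul_genx (h : DoubleSlide O O' p₁ p₂ x) :
    smul (O.idem k p₁.1) (genx k O p₁ p₂ x) = genx k O p₁ p₂ x := by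
  refine DoubleModule.ext (fun j i => ?_) ?_
  · rw [smul_mat, idem_mul_apply, genx_mat]
    by_cases hj : otherEnd p₁ = j
    · rw [if_pos (by rw [← hj]; rfl)]
    · rw [if_neg (fun h => hj h.1 : ¬ (otherEnd p₁ = j ∧ x = i)), ite_self]
  · rw [scal_smul_genx, idem_apply, if_neg fun h' => (fst_ne_iff h.ne₁).1 h'.1.symm]
    rfl

theorem idem_smul_geny (h : DoubleSlide O O' p₁ p₂ x) :
    smul (O.idem k p₂.1) (geny k O p₁ p₂ x) = geny k O p₁ p₂ x := by
  refine DoubleModule.ext (fun j i => ?_) ?_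
  · rw [smul_mat, idem_mul_apply, geny_mat]
    by_cases hj : otherEnd p₂ = j
    · rw [if_pos (by rw [← hj]; rfl)]
    · rw [if_neg (fun h => hj h.1 : ¬ (otherEnd p₂ = j ∧ otherEnd x = i)), ite_self]
  · rw [scal_smul_geny, idem_apply, if_neg fun h' => (fst_ne_iff h.ne₂).2 h'.1.symm, neg_zero]
    rfl

theorem act_injective (h : DoubleSlide O O' p₁ p₂ x) {b : O'.alg k}
    (hb : ∀ N : O.DoubleModule k p₁ p₂ x, h.act N b = 0) : b = 0 := by
  have h0 : ∀ (N : O.DoubleModule k p₁ p₂ x) j i, (N.mat * b.1) j i = 0 := fun N j i => by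
    rw [← h.mat_act, hb]
    rfl
  refine Subtype.ext (Matrix.ext fun j i => ?_)
  by_cases hj : j.1 = x.1
  · rcases eq_or_eq_otherEnd hj with rfl | rfl
    · have := h0 (genx k O p₁ p₂ j) (otherEnd p₁) i
      rwa [genx_mul, if_pos rfl] at this
    · have := h0 (geny k O p₁ p₂ x) (otherEnd p₂) i
      rwa [geny_mul, if_pos rfl] at this
  · have := h0 (gen₀ k O p₁ p₂ x) j i
    rwa [gen₀_mul, if_neg hj] at this

/-- An element of the algebra determined by its action on the generators. -/
theorem exists_act (h : DoubleSlide O O' p₁ p₂ x) {N₀ N₁ N₂ : O.DoubleModule k p₁ p₂ x}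
    (h₀ : smul (1 - O.idem k x.1) N₀ = N₀) (h₁ : smul (O.idem k p₁.1) N₁ = N₁)
    (h₂ : smul (O.idem k p₂.1) N₂ = N₂)
    (hrel : smul (unit k h.p_lt_x) N₁ + smul (unit k h.p_lt_y) N₂ = 0) :
    ∃ b : O'.alg k, h.act (gen₀ k O p₁ p₂ x) b = N₀ ∧ h.act (genx k O p₁ p₂ x) b = N₁ ∧
      h.act (geny k O p₁ p₂ x) b = N₂ := by
  have hx : ∀ M : Matrix (V × Bool) (V × Bool) k, ∀ i, ((unit k h.p_lt_x).1 * M) x i = M p₁ i :=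
    fun M i => by rw [unit_mul_apply, if_pos rfl]
  have hrel' := congrArg DoubleModule.mat hrel
  rw [mat_add, smul_mat, smul_mat] at hrel'
  have hN₁p : ∀ i, N₁.mat p₁ i = 0 := fun i => by
    have := congrFun (congrFun hrel' x) i
    rwa [Matrix.add_apply, unit_mul_apply, if_pos rfl, unit_mul_apply,
      if_neg (otherEnd_ne x).symm, add_zero] at this
  have hN₂p : ∀ i, N₂.mat p₂ i = 0 := fun i => by
    have := congrFun (congrFun hrel' (otherEnd x)) i
    rwa [Matrix.add_apply, unit_mul_apply, if_neg (otherEnd_ne x), unit_mul_apply, if_pos rfl,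
      zero_add] at this
  -- The scalar component of the relation makes the future diagonal entries of `b` at `x` and
  -- `otherEnd x` equal. Without it the rows would not fit together to an element of `O'.alg`.
  have hqq : N₁.mat (otherEnd p₁) x = N₂.mat (otherEnd p₂) (otherEnd x) := by
    have h3 := congrArg scal hrel
    rw [scal_add] at h3
    change ((unit k h.p_lt_x).1 x x * N₁.scal +
        (unit k h.p_lt_x).1 x p₁ * N₁.mat (otherEnd p₁) x -
        (unit k h.p_lt_x).1 (otherEnd x) p₂ * N₁.mat (otherEnd p₂) (otherEnd x)) +
      ((unit k h.p_lt_y).1 x x * N₂.scal + (unit k h.p_lt_y).1 x p₁ * N₂.mat (otherEnd p₁) x -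
        (unit k h.p_lt_y).1 (otherEnd x) p₂ * N₂.mat (otherEnd p₂) (otherEnd x)) = 0 at h3
    rw [unit_apply, unit_apply, unit_apply, unit_apply, unit_apply, unit_apply,
      if_neg fun h' => (fst_ne_iff h.ne₁).1 h'.2, if_pos ⟨rfl, rfl⟩,
      if_neg fun h' => (otherEnd_ne x) h'.1.symm, if_neg fun h' => (otherEnd_ne x) h'.1,
      if_neg fun h' => (otherEnd_ne x) h'.1, if_pos ⟨rfl, rfl⟩] at h3
    linear_combination h3
  have hN₁ : ∀ j i, j ≠ otherEnd p₁ → N₁.mat j i = 0 := fun j i hj => by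
    by_cases hjp : j = p₁
    · rw [hjp, hN₁p]
    · rw [← h₁, smul_mat, idem_mul_apply, if_neg fun h3 => (eq_or_eq_otherEnd h3).elim hjp hj]
  have hN₂ : ∀ j i, j ≠ otherEnd p₂ → N₂.mat j i = 0 := fun j i hj => by
    by_cases hjp : j = p₂
    · rw [hjp, hN₂p]
    · rw [← h₂, smul_mat, idem_mul_apply, if_neg fun h3 => (eq_or_eq_otherEnd h3).elim hjp hj]
  have hN₀ : ∀ j i, j.1 = x.1 → N₀.mat j i = 0 := fun j i hj => by
    rw [← h₀]
    change ((1 - (O.idem k x.1).1) * N₀.mat) j i = 0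
    rw [sub_mul, one_mul, Matrix.sub_apply, idem_mul_apply, if_pos hj, sub_self]
  have hc₁ : N₁.scal = 0 := by
    rw [← h₁]
    change (O.idem k p₁.1).1 x x * N₁.scal + (O.idem k p₁.1).1 x p₁ * N₁.mat (otherEnd p₁) x -
      (O.idem k p₁.1).1 (otherEnd x) p₂ * N₁.mat (otherEnd p₂) (otherEnd x) = 0
    rw [idem_apply, idem_apply, idem_apply, if_neg fun h' => h.ne₁ h'.2.symm,
      if_neg fun h' => (fst_ne_iff h.ne₁).1 h'.1.symm,
      if_neg fun h' => (fst_ne_iff h.ne₂).2 h'.1.symm]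
    ring
  have hc₂ : N₂.scal = 0 := by
    rw [← h₂]
    change (O.idem k p₂.1).1 x x * N₂.scal + (O.idem k p₂.1).1 x p₁ * N₂.mat (otherEnd p₁) x -
      (O.idem k p₂.1).1 (otherEnd x) p₂ * N₂.mat (otherEnd p₂) (otherEnd x) = 0
    rw [idem_apply, idem_apply, idem_apply, if_neg fun h' => h.ne₂ h'.2.symm,
      if_neg fun h' => (fst_ne_iff h.ne₁).1 h'.1.symm,
      if_neg fun h' => (fst_ne_iff h.ne₂).2 h'.1.symm]
    ring
  have hc₀ : N₀.scal = 0 := by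
    rw [← h₀]
    change (1 - (O.idem k x.1).1) x x * N₀.scal +
      (1 - (O.idem k x.1).1) x p₁ * N₀.mat (otherEnd p₁) x -
      (1 - (O.idem k x.1).1) (otherEnd x) p₂ * N₀.mat (otherEnd p₂) (otherEnd x) = 0
    rw [Matrix.sub_apply, Matrix.sub_apply, Matrix.sub_apply, Matrix.one_apply_eq,
      Matrix.one_apply_ne (fst_ne_iff h.ne₁).1.symm, Matrix.one_apply_ne (fst_ne_iff h.ne₂).2.symm,
      idem_apply, idem_apply, idem_apply, if_pos ⟨rfl, rfl⟩,
      if_neg fun h' => (fst_ne_iff h.ne₁).1 h'.1.symm,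
      if_neg fun h' => (fst_ne_iff h.ne₂).2 h'.1.symm]
    ring
  -- As for a single slide, the rows of `b` are read off from the images of the generators.
  let B : Matrix (V × Bool) (V × Bool) k := Matrix.of fun j i =>
    if j = x then N₁.mat (otherEnd p₁) i else if j = otherEnd x then N₂.mat (otherEnd p₂) i else
      N₀.mat j i
  have hB : ∀ j i, B j i = if j = x then N₁.mat (otherEnd p₁) i else
    if j = otherEnd x then N₂.mat (otherEnd p₂) i else N₀.mat j i := fun _ _ => rfl
  have hq : otherEnd p₁ ≠ otherEnd p₂ := fun h' => h.ne (otherEnd_inj.1 h')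
  refine ⟨⟨B, fun i j hij => ?_, fun i => ?_⟩, DoubleModule.ext (fun j i => ?_) ?_,
    DoubleModule.ext (fun j i => ?_) ?_, DoubleModule.ext (fun j i => ?_) ?_⟩
  · rw [hB] at hij
    split_ifs at hij with h3 h4
    · subst h3
      by_cases hi : i.1 = j.1
      · rcases eq_or_eq_otherEnd hi with rfl | rfl
        · exact Or.inl rfl
        · exact Or.inr (h.y_lt_x.2 ((N₁.supp_y hij).resolve_left hq.symm))
      · rcases N₁.supp_of_ne hi hij with h6 | h6
        · rw [h6, N₁.diag h.ne₁, hN₁p] at hij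
          exact absurd rfl hij
        · exact Or.inr ((h.lt_x' hi).2 h6)
    · subst h4
      by_cases hi : i.1 = x.1
      · rcases eq_or_eq_otherEnd hi with rfl | rfl
        · exact Or.inr (h.x_lt_y.2 ((N₂.supp_x hij).resolve_left hq))
        · exact Or.inl rfl
      · rcases N₂.supp_of_ne hi hij with h6 | h6
        · rw [h6, N₂.diag h.ne₂, hN₂p] at hij
          exact absurd rfl hij
        · exact Or.inr ((h.lt_y' hi).2 h6)
    · have hj : j.1 ≠ x.1 := fun h5 => (eq_or_eq_otherEnd h5).elim h3 h4
      by_cases hi : i.1 = x.1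
      · rcases eq_or_eq_otherEnd hi with rfl | rfl
        · exact Or.inr ((h.x_lt hj).2 (N₀.supp_x hij))
        · exact Or.inr ((h.y_lt hj).2 (N₀.supp_y hij))
      · exact (N₀.supp_of_ne hi hij).imp_right (h.off hi hj).2
  · rw [hB, hB]
    by_cases hi : i.1 = x.1
    · rcases eq_or_eq_otherEnd hi with rfl | rfl
      · rw [if_neg (otherEnd_ne i), if_pos rfl, if_pos rfl, hqq]
      · rw [otherEnd_otherEnd, if_pos rfl, if_neg (otherEnd_ne x), if_pos rfl, hqq]
    · have hi' : (otherEnd i).1 ≠ x.1 := hi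
      rw [if_neg (fst_ne_iff hi).1, if_neg (fst_ne_iff hi).2, if_neg (fst_ne_iff hi').1,
        if_neg (fst_ne_iff hi').2, N₀.diag hi]
  · rw [mat_act, gen₀_mul]
    change (if j.1 = x.1 then 0 else B j i) = _
    rw [hB]
    by_cases hj : j.1 = x.1
    · rw [if_pos hj, hN₀ j i hj]
    · rw [if_neg hj, if_neg (fst_ne_iff hj).1, if_neg (fst_ne_iff hj).2]
  · rw [scal_act_gen₀, hc₀]
  · rw [mat_act, genx_mul]
    change (if j = otherEnd p₁ then B x i else 0) = _
    rw [hB, if_pos rfl]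
    split_ifs with hj
    · rw [hj]
    · rw [hN₁ j i hj]
  · rw [scal_act_genx, hc₁]
  · rw [mat_act, geny_mul]
    change (if j = otherEnd p₂ then B (otherEnd x) i else 0) = _
    rw [hB, if_neg (otherEnd_ne x), if_pos rfl]
    split_ifs with hj
    · rw [hj]
    · rw [hN₂ j i hj]
  · rw [scal_act_geny, hc₂]

/-- The two units read off the columns `x` and `otherEnd x`, and `m` has no others. -/
theorem eq_zero_of_mul_unit {m : O.alg k} (h : DoubleSlide O O' p₁ p₂ x)
    (hm : m * O.idem k x.1 = m) (h₁ : m * unit k h.p_lt_x = 0) (h₂ : m * unit k h.p_lt_y = 0) :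
    m = 0 := by
  refine Subtype.ext (Matrix.ext fun j i => ?_)
  by_cases hi : i.1 = x.1
  · rcases eq_or_eq_otherEnd hi with rfl | rfl
    · have := congrFun (congrFun (congrArg Subtype.val h₁) j) p₁
      change (m.1 * (unit k h.p_lt_x).1) j p₁ = 0 at this
      rwa [mul_unit_apply, if_pos rfl] at this
    · have := congrFun (congrFun (congrArg Subtype.val h₂) j) p₂
      change (m.1 * (unit k h.p_lt_y).1) j p₂ = 0 at this
      rwa [mul_unit_apply, if_pos rfl] at this
  · rw [← hm, MulMemClass.coe_mul, mul_idem_apply, if_neg hi]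
    rfl

theorem exists_of_relation (h : DoubleSlide O O' p₁ p₂ x) {a a₁ a₂ : O.alg k}
    (ha : a * (1 - O.idem k x.1) = a) (ha₁ : a₁ * O.idem k p₁.1 = a₁)
    (ha₂ : a₂ * O.idem k p₂.1 = a₂)
    (h3 : smul a (gen₀ k O p₁ p₂ x) + smul a₁ (genx k O p₁ p₂ x) +
      smul a₂ (geny k O p₁ p₂ x) = 0) :
    a = 0 ∧ ∃ m : O.alg k, m * O.idem k x.1 = m ∧ a₁ = m * unit k h.p_lt_x ∧
      a₂ = m * unit k h.p_lt_y := by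
  have h4 : ∀ j i, (if i.1 = x.1 then 0 else a.1 j i) + (if i = x then a₁.1 j (otherEnd p₁) else 0)
      + (if i = otherEnd x then a₂.1 j (otherEnd p₂) else 0) = 0 := fun j i => by
    have := congrFun (congrFun (congrArg mat h3) j) i
    rwa [mat_add, mat_add, Matrix.add_apply, Matrix.add_apply, smul_mat, smul_mat, smul_mat,
      mul_gen₀, mul_genx, mul_geny] at this
  -- These two entries become the diagonal entries of `m` at `x` and `otherEnd x`; the scalar
  -- component says that they agree.
  have h5 : a₁.1 x p₁ = a₂.1 (otherEnd x) p₂ := by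
    have := congrArg scal h3
    rw [scal_add, scal_add, h.scal_smul_gen₀, scal_smul_genx, scal_smul_geny, scal_zero] at this
    linear_combination this
  have ha0 : a = 0 := by
    refine Subtype.ext (Matrix.ext fun j i => ?_)
    by_cases hi : i.1 = x.1
    · rw [← ha]
      change (a.1 * (1 - (O.idem k x.1).1)) j i = 0
      rw [mul_sub, mul_one, Matrix.sub_apply, mul_idem_apply, if_pos hi, sub_self]
    · have h6 := h4 j i
      rwa [if_neg hi, if_neg (fst_ne_iff hi).1, if_neg (fst_ne_iff hi).2, add_zero, add_zero] at h6
  have hq₁ : ∀ j, a₁.1 j (otherEnd p₁) = 0 := fun j => by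
    have h6 := h4 j x
    rwa [if_pos rfl, if_pos rfl, if_neg (otherEnd_ne x).symm, add_zero, zero_add] at h6
  have hq₂ : ∀ j, a₂.1 j (otherEnd p₂) = 0 := fun j => by
    have h6 := h4 j (otherEnd x)
    rwa [if_pos (otherEnd_fst x), if_neg (otherEnd_ne x), if_pos rfl, add_zero, zero_add] at h6
  have hp₁ : ∀ j i, i ≠ p₁ → a₁.1 j i = 0 := fun j i hi => by
    by_cases hiq : i = otherEnd p₁
    · rw [hiq, hq₁]
    · rw [← ha₁, MulMemClass.coe_mul, mul_idem_apply,
        if_neg fun h6 => (eq_or_eq_otherEnd h6).elim hi hiq]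
  have hp₂ : ∀ j i, i ≠ p₂ → a₂.1 j i = 0 := fun j i hi => by
    by_cases hiq : i = otherEnd p₂
    · rw [hiq, hq₂]
    · rw [← ha₂, MulMemClass.coe_mul, mul_idem_apply,
        if_neg fun h6 => (eq_or_eq_otherEnd h6).elim hi hiq]
  have hpp₁ : a₁.1 p₁ p₁ = 0 := by rw [← EndOrder.diag, hq₁]
  have hpp₂ : a₂.1 p₂ p₂ = 0 := by rw [← EndOrder.diag, hq₂]
  let B : Matrix (V × Bool) (V × Bool) k := Matrix.of fun j i =>
    if i = x then a₁.1 j p₁ else if i = otherEnd x then a₂.1 j p₂ else 0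
  have hB : ∀ j i, B j i = if i = x then a₁.1 j p₁ else if i = otherEnd x then a₂.1 j p₂ else 0 :=
    fun _ _ => rfl
  refine ⟨ha0, ⟨B, fun i j hij => ?_, fun i => ?_⟩, Subtype.ext (Matrix.ext fun j i => ?_),
    Subtype.ext (Matrix.ext fun j i => ?_), Subtype.ext (Matrix.ext fun j i => ?_)⟩
  · rw [hB] at hij
    split_ifs at hij with h6 h7
    · subst h6
      rcases EndOrder.supp a₁ hij with h7 | h7
      · rw [← h7, hpp₁] at hij
        exact absurd rfl hij
      · exact (h.p_lt j).1 h7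
    · subst h7
      rcases EndOrder.supp a₂ hij with h7 | h7
      · rw [← h7, hpp₂] at hij
        exact absurd rfl hij
      · exact (h.p_lt' j).1 h7
    · exact absurd rfl hij
  · rw [hB, hB]
    by_cases hi : i.1 = x.1
    · rcases eq_or_eq_otherEnd hi with rfl | rfl
      · rw [if_neg (otherEnd_ne i), if_pos rfl, if_pos rfl, h5]
      · rw [otherEnd_otherEnd, if_pos rfl, if_neg (otherEnd_ne x), if_pos rfl, h5]
    · have hi' : (otherEnd i).1 ≠ x.1 := hi
      rw [if_neg (fst_ne_iff hi).1, if_neg (fst_ne_iff hi).2, if_neg (fst_ne_iff hi').1,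
        if_neg (fst_ne_iff hi').2]
  · change (B * (O.idem k x.1).1) j i = B j i
    rw [mul_idem_apply]
    by_cases hi : i.1 = x.1
    · rw [if_pos hi]
    · rw [if_neg hi, hB, if_neg (fst_ne_iff hi).1, if_neg (fst_ne_iff hi).2]
  · change a₁.1 j i = (B * (unit k h.p_lt_x).1) j i
    rw [mul_unit_apply, hB, if_pos rfl]
    split_ifs with hi
    · rw [hi]
    · exact hp₁ j i hi
  · change a₂.1 j i = (B * (unit k h.p_lt_y).1) j i
    rw [mul_unit_apply, hB, if_neg (otherEnd_ne x), if_pos rfl]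
    split_ifs with hi
    · rw [hi]
    · exact hp₂ j i hi

theorem exists_lift (h : DoubleSlide O O' p₁ p₂ x) {N : O.DoubleModule k p₁ p₂ x}
    (hN : smul (O.idem k x.1) N = N) :
    ∃ N₁ N₂ : O.DoubleModule k p₁ p₂ x,
      smul (unit k h.p_lt_x) N₁ + smul (unit k h.p_lt_y) N₂ = N := by
  have hqp₁ := otherEnd_ne p₁
  have hqp₂ := otherEnd_ne p₂
  have hrow : ∀ j i, j.1 ≠ x.1 → N.mat j i = 0 := fun j i hj => by
    rw [← hN, smul_mat, idem_mul_apply, if_neg hj]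
  have low : ∀ {i j}, j.1 = x.1 → N.mat j i ≠ 0 → O.lt (slideTarget p₁ p₂ x i) j :=
    fun {i j} hj hij => (N.supp hij).resolve_left fun h3 => h.target_ne i (h3 ▸ hj)
  -- The units move the rows `p₁` and `p₂` to the rows `x` and `otherEnd x`, so the rows of `N` are
  -- put there. The scalar of `N` goes to `(otherEnd p₁, x)`, which the first unit turns into a
  -- scalar. The entries at `(otherEnd p₁, otherEnd p₁)` and, in `A₂`, at `(otherEnd p₂, otherEnd
  -- p₂)` balance the diagonal.
  let A₁ : Matrix (V × Bool) (V × Bool) k := Matrix.of fun j i => if j = p₁ then N.mat x i else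
    if j = otherEnd p₁ then (if i = otherEnd p₁ then N.mat x p₁ else if i = x then N.scal else 0)
    else 0
  have hA₁ : ∀ j i, A₁ j i = if j = p₁ then N.mat x i else
    if j = otherEnd p₁ then (if i = otherEnd p₁ then N.mat x p₁ else if i = x then N.scal else 0)
    else 0 := fun _ _ => rfl
  let A₂ : Matrix (V × Bool) (V × Bool) k := Matrix.of fun j i =>
    if j = p₂ then N.mat (otherEnd x) i else
    if j = otherEnd p₂ ∧ i = otherEnd p₂ then N.mat (otherEnd x) p₂ else 0
  have hA₂ : ∀ j i, A₂ j i = if j = p₂ then N.mat (otherEnd x) i else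
    if j = otherEnd p₂ ∧ i = otherEnd p₂ then N.mat (otherEnd x) p₂ else 0 := fun _ _ => rfl
  have m₁ : ((A₁, 0) : Matrix (V × Bool) (V × Bool) k × k) ∈ O.doubleSubmodule k p₁ p₂ x := by
    refine ⟨fun i j hij => ?_, fun i hi => ?_⟩
    · change A₁ j i ≠ 0 at hij
      rw [hA₁] at hij
      split_ifs at hij with h3 h4 h5 h6
      · rw [h3]
        exact (h.lt_x _).1 (low rfl hij)
      · rw [h4, h5, target_of_ne h.ne_x₁]
        exact Or.inl rfl
      · rw [h4, h6, target_x]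
        exact Or.inl rfl
      · exact absurd rfl hij
      · exact absurd rfl hij
    · change A₁ (otherEnd i) (otherEnd i) = A₁ i i
      rw [hA₁, hA₁]
      by_cases h3 : i = p₁
      · subst h3
        rw [if_neg hqp₁, if_pos rfl, if_pos rfl, if_pos rfl]
      · by_cases h4 : i = otherEnd p₁
        · subst h4
          rw [otherEnd_otherEnd, if_pos rfl, if_neg hqp₁, if_pos rfl, if_pos rfl]
        · rw [if_neg (fun h => h4 (eq_otherEnd_comm.1 h.symm)),
            if_neg (fun h => h3 (otherEnd_inj.1 h)), if_neg h3, if_neg h4]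
  have m₂ : ((A₂, 0) : Matrix (V × Bool) (V × Bool) k × k) ∈ O.doubleSubmodule k p₁ p₂ x := by
    refine ⟨fun i j hij => ?_, fun i hi => ?_⟩
    · change A₂ j i ≠ 0 at hij
      rw [hA₂] at hij
      split_ifs at hij with h3 h4
      · rw [h3]
        exact (h.lt_y _).1 (low rfl hij)
      · rw [h4.1, h4.2, target_of_ne h.ne_x₂]
        exact Or.inl rfl
      · exact absurd rfl hij
    · change A₂ (otherEnd i) (otherEnd i) = A₂ i i
      rw [hA₂, hA₂]
      by_cases h3 : i = p₂
      · subst h3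
        rw [if_neg hqp₂, if_pos ⟨rfl, rfl⟩, if_pos rfl]
      · by_cases h4 : i = otherEnd p₂
        · subst h4
          rw [otherEnd_otherEnd, if_pos rfl, if_neg hqp₂, if_pos ⟨rfl, rfl⟩]
        · rw [if_neg (fun h => h4 (eq_otherEnd_comm.1 h.symm)),
            if_neg (fun h => h3 (otherEnd_inj.1 h.1)), if_neg h3, if_neg fun h => h4 h.1]
  let N₁ : O.DoubleModule k p₁ p₂ x := ⟨_, m₁⟩
  let N₂ : O.DoubleModule k p₁ p₂ x := ⟨_, m₂⟩
  refine ⟨N₁, N₂, DoubleModule.ext (fun j i => ?_) ?_⟩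
  · rw [mat_add, Matrix.add_apply, smul_mat, smul_mat, unit_mul_apply, unit_mul_apply]
    change (if j = x then A₁ p₁ i else 0) + (if j = otherEnd x then A₂ p₂ i else 0) = _
    rw [hA₁, hA₂, if_pos rfl, if_pos rfl]
    by_cases hj : j.1 = x.1
    · rcases eq_or_eq_otherEnd hj with rfl | rfl
      · rw [if_pos rfl, if_neg (otherEnd_ne j).symm, add_zero]
      · rw [if_pos rfl, if_neg (otherEnd_ne x), zero_add]
    · rw [if_neg (fst_ne_iff hj).1, if_neg (fst_ne_iff hj).2, add_zero, hrow j i hj]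
  · rw [scal_add]
    change ((unit k h.p_lt_x).1 x x * 0 + (unit k h.p_lt_x).1 x p₁ * A₁ (otherEnd p₁) x -
        (unit k h.p_lt_x).1 (otherEnd x) p₂ * A₁ (otherEnd p₂) (otherEnd x)) +
      ((unit k h.p_lt_y).1 x x * 0 + (unit k h.p_lt_y).1 x p₁ * A₂ (otherEnd p₁) x -
        (unit k h.p_lt_y).1 (otherEnd x) p₂ * A₂ (otherEnd p₂) (otherEnd x)) = N.scal
    have e₁ : (unit k h.p_lt_x).1 x p₁ = 1 := by rw [unit_apply, if_pos ⟨rfl, rfl⟩]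
    have e₂ : (unit k h.p_lt_x).1 (otherEnd x) p₂ = 0 := by
      rw [unit_apply, if_neg fun h' => (otherEnd_ne x) h'.1.symm]
    have e₃ : (unit k h.p_lt_y).1 x p₁ = 0 := by
      rw [unit_apply, if_neg fun h' => (otherEnd_ne x) h'.1]
    rw [hA₁ (otherEnd p₁) x, hA₂ (otherEnd p₂) (otherEnd x), if_neg hqp₁, if_pos rfl,
      if_neg (fst_ne_iff h.ne_x₁).1.symm, if_pos rfl, if_neg hqp₂,
      if_neg fun h' => (fst_ne_iff h.ne_x₂).2 h'.2.symm, e₁, e₂, e₃]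
    ring

theorem steps (h : DoubleSlide O O' p₁ p₂ x) (hO : O.Connected) (hO' : O'.Connected) :
    TiltingCotiltingStep k (AlgCat.of k (O.alg k)) (AlgCat.of k (O'.alg k)) ∧
      TiltingCotiltingStep k (AlgCat.of k (O.alg k)ᵐᵒᵖ) (AlgCat.of k (O'.alg k)ᵐᵒᵖ) := by
  let := h.module (k := k)
  have hsmul : ∀ (M : O.alg k) (N : O.DoubleModule k p₁ p₂ x), M • N = smul M N := fun _ _ => rfl
  have : IsScalarTower k (O.alg k) (O.DoubleModule k p₁ p₂ x) := by
    refine IsScalarTower.of_algebraMap_smul fun c N => ?_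
    rw [hsmul, h.algebraMap_smul]
  let act : O'.alg k →+* (Module.End (O.alg k) (O.DoubleModule k p₁ p₂ x))ᵐᵒᵖ :=
    { toFun := fun b => .op
        { toFun := fun N => h.act N b
          map_add' := fun N N' => h.add_act N N' b
          map_smul' := fun M N => h.act_smul M N b }
      map_one' := MulOpposite.unop_injective (LinearMap.ext h.act_one)
      map_mul' := fun b b' => MulOpposite.unop_injective (LinearMap.ext fun N => h.act_mul N b b')
      map_zero' := MulOpposite.unop_injective (LinearMap.ext h.act_zero)
      map_add' := fun b b' => MulOpposite.unop_injective
        (LinearMap.ext fun N => h.act_add N b b') }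
  have act_apply : ∀ b N, (act b).unop N = h.act N b := fun _ _ => rfl
  have inj : Function.Injective act := by
    rw [injective_iff_map_eq_zero]
    intro b hb
    refine h.act_injective fun N => ?_
    rw [← act_apply, hb]
    rfl
  have surj : Function.Surjective act := by
    intro g
    set G : O.DoubleModule k p₁ p₂ x →ₗ[O.alg k] O.DoubleModule k p₁ p₂ x := g.unop with hG
    obtain ⟨b, h₀, h₁, h₂⟩ := h.exists_act (N₀ := G (gen₀ k O p₁ p₂ x))
      (N₁ := G (genx k O p₁ p₂ x)) (N₂ := G (geny k O p₁ p₂ x))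
      (by rw [← hsmul, ← map_smul, hsmul, h.idem_smul_gen₀])
      (by rw [← hsmul, ← map_smul, hsmul, h.idem_smul_genx])
      (by rw [← hsmul, ← map_smul, hsmul, h.idem_smul_geny])
      (by rw [← hsmul, ← hsmul, ← map_smul, ← map_smul, ← map_add, hsmul, hsmul, h.relation,
        map_zero])
    refine ⟨b, MulOpposite.unop_injective (LinearMap.ext fun N => ?_)⟩
    obtain ⟨a, a₁, a₂, rfl⟩ := h.exists_gen N
    rw [← hsmul, ← hsmul, ← hsmul, map_add, map_add, map_smul, map_smul, map_smul, act_apply,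
      act_apply, act_apply, h₀, h₁, h₂, ← map_smul, ← map_smul, ← map_smul, ← map_add, ← map_add]
  exact steps_of_mutation (O.splitBasic k) hO.splitBasic (O'.splitBasic k) hO'.splitBasic
    (O.idem k x.1) (O.idem k p₁.1) (O.idem k p₂.1) (unit k h.p_lt_x) (unit k h.p_lt_y)
    (gen₀ k O p₁ p₂ x) (genx k O p₁ p₂ x) (geny k O p₁ p₂ x) (idem_mul_idem _) (idem_mul_idem _)
    (idem_mul_idem _) (unit_mul_idem _) (unit_mul_idem _) h.exists_gen h.idem_smul_gen₀
    h.idem_smul_genx h.idem_smul_geny h.relation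
    (fun m hm h₁ h₂ => h.eq_zero_of_mul_unit hm h₁ h₂)
    (fun a a₁ a₂ ha ha₁ ha₂ h3 => h.exists_of_relation ha ha₁ ha₂ h3)
    (fun N hN => h.exists_lift hN) (RingEquiv.ofBijective act ⟨inj, surj⟩)
    (fun c N => (h.act_algebraMap N c).trans (h.algebraMap_smul N c).symm)

end DoubleSlide

end DoubleSteps

end EndOrder

/-! ## Equivalence of orders -/

namespace EndOrder

variable {V : Type} [Fintype V] [DecidableEq V] (k : Type u) [Field k]

/-- The two algebras are joined by tilting-cotilting steps in both directions, and so are their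
opposites. -/
def Equi (O O' : EndOrder V) : Prop :=
  (O.Connected ↔ O'.Connected) ∧ (O.Connected →
    TiltingCotiltingEquivalent k (O.alg k) (O'.alg k) ∧
    TiltingCotiltingEquivalent k (O'.alg k) (O.alg k) ∧
    TiltingCotiltingEquivalent k (O.rev.alg k) (O'.rev.alg k) ∧
    TiltingCotiltingEquivalent k (O'.rev.alg k) (O.rev.alg k))

variable {k} {O O' O'' : EndOrder V}

theorem Connected.rev {V : Type} {O : EndOrder V} (h : O.Connected) : O.rev.Connected := by
  refine ⟨h.1, fun v w => ?_⟩
  induction h.2 v w with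
  | refl => exact .refl _
  | symm _ _ _ h => exact .symm _ _ h
  | trans _ _ _ _ _ h1 h2 => exact .trans _ _ _ h1 h2
  | rel v w hvw =>
    obtain ⟨i, j, hij, rfl, rfl⟩ := hvw
    exact .symm _ _ (.rel _ _ ⟨j, i, hij, rfl, rfl⟩)

theorem Equi.refl (O : EndOrder V) : Equi k O O :=
  ⟨Iff.rfl, fun _ => ⟨.refl, .refl, .refl, .refl⟩⟩

theorem Equi.symm (h : Equi k O O') : Equi k O' O :=
  ⟨h.1.symm, fun hO =>
    let ⟨h1, h2, h3, h4⟩ := h.2 (h.1.2 hO)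
    ⟨h2, h1, h4, h3⟩⟩

theorem Equi.trans (h : Equi k O O') (h' : Equi k O' O'') : Equi k O O'' :=
  ⟨h.1.trans h'.1, fun hO =>
    let ⟨h1, h2, h3, h4⟩ := h.2 hO
    let ⟨h1', h2', h3', h4'⟩ := h'.2 (h.1.1 hO)
    ⟨h1.trans h1', h2'.trans h2, h3.trans h3', h4'.trans h4⟩⟩

theorem Equi.rev (h : Equi k O O') : Equi k O.rev O'.rev :=
  ⟨⟨fun hO => (h.1.1 hO.rev).rev, fun hO => (h.1.2 hO.rev).rev⟩, fun hO =>
    let ⟨h1, h2, h3, h4⟩ := h.2 hO.rev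
    ⟨h3, h4, h1, h2⟩⟩

instance : Module.Finite k (O.alg k) :=
  Module.Finite.of_injective (O.alg k).val.toLinearMap Subtype.val_injective

theorem equivalent_of_equiv {A B : Type u} [Ring A] [Algebra k A] [Ring B] [Algebra k B]
    (hO : O.Connected) (f : O.alg k ≃ₐ[k] A) (g : O.alg k ≃ₐ[k] B) :
    TiltingCotiltingEquivalent k A B := by
  have : Module.Finite k A := Module.Finite.equiv f.toLinearEquiv
  exact .single (step_of_equiv ((O.splitBasic k).ofEquiv f) (hO.splitBasic.ofEquiv f)
    (f.symm.trans g))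

theorem equivalent_of_op (hO : O.Connected) (hO' : O'.Connected)
    (h : TiltingCotiltingStep k (AlgCat.of k (O.alg k)ᵐᵒᵖ) (AlgCat.of k (O'.alg k)ᵐᵒᵖ)) :
    TiltingCotiltingEquivalent k (O.rev.alg k) (O'.rev.alg k) :=
  .trans (equivalent_of_equiv hO.rev .refl (O.opEquiv k))
    (.trans (.single h) (equivalent_of_equiv hO'.rev (O'.opEquiv k) .refl))

/-- The second family of steps runs backwards between the reversed orders. Passing to opposites
turns it into steps from `O'` back to `O`, so that all four required directions are covered. -/
theorem Equi.of_steps (hO : O.Connected ↔ O'.Connected)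
    (h : O.Connected →
      TiltingCotiltingStep k (AlgCat.of k (O.alg k)) (AlgCat.of k (O'.alg k)) ∧
      TiltingCotiltingStep k (AlgCat.of k (O.alg k)ᵐᵒᵖ) (AlgCat.of k (O'.alg k)ᵐᵒᵖ))
    (h' : O.Connected →
      TiltingCotiltingStep k (AlgCat.of k (O'.rev.alg k)) (AlgCat.of k (O.rev.alg k)) ∧
      TiltingCotiltingStep k (AlgCat.of k (O'.rev.alg k)ᵐᵒᵖ) (AlgCat.of k (O.rev.alg k)ᵐᵒᵖ)) :
    Equi k O O' :=
  ⟨hO, fun hc => ⟨.single (h hc).1, equivalent_of_op (hO.1 hc).rev hc.rev (h' hc).2,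
    equivalent_of_op hc (hO.1 hc) (h hc).2, .single (h' hc).1⟩⟩

theorem Slide.connected_iff {p x : V × Bool} (h : Slide O O' p x) :
    O.Connected ↔ O'.Connected :=
  ⟨h.connected, fun hO => (h.rev.connected hO.rev).rev⟩

/-- The reversed slide satisfies the same hypotheses, because the partner of `x` remains isolated.
-/
theorem Slide.equi {p x : V × Bool} (h : Slide O O' p x)
    (h1 : ∀ j, ¬ O.lt (otherEnd x) j) (h2 : ∀ j, ¬ O.lt j (otherEnd x)) : Equi k O O' := by
  have hxx := otherEnd_ne x
  refine .of_steps h.connected_iff (fun hO => h.steps_of_lone hO h1 h2) fun hO =>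
    h.rev.steps_of_lone (h.connected hO).rev (fun j hj => ?_) (fun j hj => ?_)
  · have hj : O'.lt j (otherEnd x) := hj
    by_cases hjx : j = x
    · subst hjx
      rcases (h.x_lt' hxx).1 hj with h0 | h0
      · exact h.q_ne' h0
      · exact h2 _ h0
    · exact h2 _ ((h.off hjx hxx).1 hj)
  · have hj : O'.lt (otherEnd x) j := hj
    by_cases hjx : j = x
    · subst hjx
      exact h1 _ ((h.lt_x' hxx).1 hj)
    · exact h1 _ ((h.off hxx hjx).1 hj)

/-- The way back slides `otherEnd x` first and `x` second, in the reversed orders. -/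
theorem Slide.equi₂ {O₁ : EndOrder V} {p₁ p₂ x : V × Bool} (h₁ : Slide O O₁ p₁ x)
    (h₂ : Slide O₁ O' p₂ (otherEnd x)) (hp : p₁ ≠ p₂) : Equi k O O' := by
  refine .of_steps (h₁.connected_iff.trans h₂.connected_iff)
    (fun hO => (DoubleSlide.of_slides h₁ h₂ hp).steps hO (h₂.connected (h₁.connected hO)))
    (fun hO => (DoubleSlide.of_slides h₂.rev (by rw [otherEnd_otherEnd]; exact h₁.rev)
      (fun h => hp (otherEnd_inj.1 h).symm)).steps (h₂.connected (h₁.connected hO)).rev hO.rev)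

theorem Equi.of_relabel (f : V × Bool ≃ V × Bool) (hf : ∀ i, f (otherEnd i) = otherEnd (f i))
    (hlt : ∀ i j, O'.lt (f i) (f j) ↔ O.lt i j) : Equi k O O' := by
  have key : ∀ {O O' : EndOrder V} (f : V × Bool ≃ V × Bool)
      (_ : ∀ i, f (otherEnd i) = otherEnd (f i)) (_ : ∀ i j, O'.lt (f i) (f j) ↔ O.lt i j),
      O.Connected → O'.Connected := by
    intro O O' f hf hlt hO
    have fst : ∀ i j : V × Bool, i.1 = j.1 → (f i).1 = (f j).1 := by
      intro i j h
      rcases eq_or_eq_otherEnd h with rfl | rfl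
      · rfl
      · rw [hf, otherEnd_fst]
    refine ⟨hO.1, fun v w => ?_⟩
    have h : ∀ v w, Relation.EqvGen (fun v w => ∃ i j, O.lt i j ∧ i.1 = v ∧ j.1 = w) v w →
        Relation.EqvGen (fun v w => ∃ i j, O'.lt i j ∧ i.1 = v ∧ j.1 = w)
          (f (v, false)).1 (f (w, false)).1 := by
      intro v w h
      induction h with
      | refl => exact .refl _
      | symm _ _ _ h => exact .symm _ _ h
      | trans _ _ _ _ _ h1 h2 => exact .trans _ _ _ h1 h2
      | rel v w hvw =>
        obtain ⟨i, j, hij, rfl, rfl⟩ := hvw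
        exact .rel _ _ ⟨f i, f j, (hlt i j).2 hij, fst _ _ rfl, fst _ _ rfl⟩
    have := h _ _ (hO.2 (f.symm (v, false)).1 (f.symm (w, false)).1)
    rwa [fst ((f.symm (v, false)).1, false) (f.symm (v, false)) rfl,
      fst ((f.symm (w, false)).1, false) (f.symm (w, false)) rfl, f.apply_symm_apply,
      f.apply_symm_apply] at this
  have hf' : ∀ i, f.symm (otherEnd i) = otherEnd (f.symm i) := fun i => by
    rw [Equiv.symm_apply_eq, hf, f.apply_symm_apply]
  have hiff : O.Connected ↔ O'.Connected :=
    ⟨key f hf hlt, key f.symm hf' fun i j => by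
      rw [← hlt, f.apply_symm_apply, f.apply_symm_apply]⟩
  exact ⟨hiff, fun hO =>
    ⟨equivalent_of_equiv hO .refl (relabelEquiv O O' f hf hlt),
      equivalent_of_equiv hO (relabelEquiv O O' f hf hlt) .refl,
      equivalent_of_equiv hO.rev .refl (relabelEquiv O.rev O'.rev f hf fun i j => hlt j i),
      equivalent_of_equiv hO.rev (relabelEquiv O.rev O'.rev f hf fun i j => hlt j i) .refl⟩⟩

end EndOrder

/-! ## Orders given by lists -/

namespace EndList

variable {V : Type}

/-- Some end of the first block of the list. -/
def Reach : List (Option (V × Bool)) → V × Bool → Prop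
  | [], _ => False
  | none :: _, _ => False
  | some a :: L, j => a = j ∨ Reach L j

/-- The end `i` comes before the end `j` in the same block. -/
def Lt : List (Option (V × Bool)) → V × Bool → V × Bool → Prop
  | [], _, _ => False
  | none :: L, i, j => Lt L i j
  | some a :: L, i, j => a = i ∧ Reach L j ∨ Lt L i j

/-- Some end of the last block of the list. -/
def CoReach (L : List (Option (V × Bool))) (i : V × Bool) : Prop := Reach L.reverse i

variable {A B L : List (Option (V × Bool))} {i j l x : V × Bool}

theorem reach_append : Reach (A ++ B) j ↔ Reach A j ∨ none ∉ A ∧ Reach B j := by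
  induction A with
  | nil => simp [Reach]
  | cons a A ih =>
    cases a with
    | none => simp [Reach]
    | some a => simp [Reach, ih, or_assoc]

theorem Reach.mem (h : Reach L j) : some j ∈ L := by
  induction L with
  | nil => exact h.elim
  | cons a L ih =>
    cases a with
    | none => exact h.elim
    | some a =>
      rcases h with rfl | h
      · exact List.mem_cons_self
      · exact List.mem_cons_of_mem _ (ih h)

theorem CoReach.mem (h : CoReach L j) : some j ∈ L := List.mem_reverse.1 (Reach.mem h)

theorem coReach_append : CoReach (A ++ B) j ↔ CoReach B j ∨ none ∉ B ∧ CoReach A j := by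
  rw [CoReach, List.reverse_append, reach_append, List.mem_reverse]
  rfl

theorem coReach_singleton : CoReach [some i] j ↔ i = j := by simp [CoReach, Reach]

theorem not_coReach_none : ¬ CoReach [none] j := by simp [CoReach, Reach]

theorem lt_append : Lt (A ++ B) i j ↔ Lt A i j ∨ Lt B i j ∨ CoReach A i ∧ Reach B j := by
  induction A with
  | nil => simp [Lt, CoReach, Reach]
  | cons a A ih =>
    rw [List.cons_append, ← List.singleton_append (l := A), coReach_append]
    cases a with
    | none => simp [Lt, not_coReach_none, ih]
    | some a =>
      simp only [List.singleton_append, Lt, ih, reach_append, coReach_singleton]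
      tauto

theorem Lt.mem (h : Lt L i j) : some i ∈ L ∧ some j ∈ L := by
  induction L with
  | nil => exact h.elim
  | cons a L ih =>
    cases a with
    | none => exact ⟨List.mem_cons_of_mem _ (ih h).1, List.mem_cons_of_mem _ (ih h).2⟩
    | some a =>
      rcases h with ⟨rfl, h⟩ | h
      · exact ⟨List.mem_cons_self, List.mem_cons_of_mem _ h.mem⟩
      · exact ⟨List.mem_cons_of_mem _ (ih h).1, List.mem_cons_of_mem _ (ih h).2⟩

theorem lt_reverse : Lt L.reverse i j ↔ Lt L j i := by
  induction L with
  | nil => simp [Lt]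
  | cons a L ih =>
    rw [List.reverse_cons, lt_append, ih]
    cases a with
    | none => simp [Lt, Reach]
    | some a =>
      simp only [Lt, Reach, CoReach, List.reverse_reverse]
      tauto

/-- No end occurs twice. -/
def Nd (L : List (Option (V × Bool))) : Prop := L.reduceOption.Nodup

theorem nd_cons_some : Nd (some i :: L) ↔ some i ∉ L ∧ Nd L := by
  rw [Nd, List.reduceOption_cons_of_some, List.nodup_cons, List.reduceOption_mem_iff, Nd]

theorem nd_cons_none : Nd (none :: L) ↔ Nd L := by
  rw [Nd, List.reduceOption_cons_of_none, Nd]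

theorem nd_perm (h : A.Perm B) : Nd A ↔ Nd B := (h.filterMap id).nodup_iff

theorem reach_trans (h : Nd L) (h1 : Reach L i) (h2 : Lt L i j) : Reach L j := by
  induction L with
  | nil => exact h1.elim
  | cons a L ih =>
    cases a with
    | none => exact h1.elim
    | some a =>
      rw [nd_cons_some] at h
      rcases h2 with ⟨-, h2⟩ | h2
      · exact Or.inr h2
      · rcases h1 with rfl | h1
        · exact absurd h2.mem.1 h.1
        · exact Or.inr (ih h.2 h1 h2)

theorem lt_trans (h : Nd L) (h1 : Lt L i j) (h2 : Lt L j l) : Lt L i l := by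
  induction L with
  | nil => exact h1.elim
  | cons a L ih =>
    cases a with
    | none => exact ih (nd_cons_none.1 h) h1 h2
    | some a =>
      rw [nd_cons_some] at h
      have hj : Lt L j l := by
        rcases h2 with ⟨rfl, -⟩ | h2
        · rcases h1 with ⟨-, h1⟩ | h1
          · exact absurd h1.mem h.1
          · exact absurd h1.mem.2 h.1
        · exact h2
      rcases h1 with ⟨rfl, h1⟩ | h1
      · exact Or.inl ⟨rfl, reach_trans h.2 h1 hj⟩
      · exact Or.inr (ih h.2 h1 hj)

theorem lt_irrefl (h : Nd L) : ¬ Lt L i i := by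
  induction L with
  | nil => exact id
  | cons a L ih =>
    cases a with
    | none => exact ih (nd_cons_none.1 h)
    | some a =>
      rw [nd_cons_some] at h
      rintro (⟨rfl, h1⟩ | h1)
      · exact h.1 h1.mem
      · exact ih h.2 h1

/-- The order given by a list. -/
def order (L : List (Option (V × Bool))) : EndOrder V where
  -- With `Nd L` as part of the relation, every list defines an order; it is the empty one if some
  -- end is repeated.
  lt i j := Nd L ∧ Lt L i j
  trans h1 h2 := ⟨h1.1, lt_trans h1.1 h1.2 h2.2⟩
  irrefl _ h := lt_irrefl h.1 h.2

theorem order_lt (h : Nd L) : (order L).lt i j ↔ Lt L i j := and_iff_right h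

theorem order_rev : (order L).rev = order L.reverse := by
  have : ∀ {O O' : EndOrder V}, O.lt = O'.lt → O = O' := by
    rintro ⟨_, _, _⟩ ⟨_, _, _⟩ h
    cases h
    rfl
  refine this (funext fun i => funext fun j => propext ?_)
  change Nd L ∧ Lt L j i ↔ Nd L.reverse ∧ Lt L.reverse i j
  rw [lt_reverse, nd_perm L.reverse_perm]

theorem nd_middle : Nd (A ++ some x :: B) ↔ some x ∉ A ++ B ∧ Nd (A ++ B) := by
  rw [nd_perm List.perm_middle, nd_cons_some]

theorem lt_middle (hx : some x ∉ A ++ B) : Lt (A ++ some x :: B) i x ↔ CoReach A i := by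
  rw [List.mem_append, not_or] at hx
  rw [lt_append]
  refine ⟨?_, fun h => Or.inr (Or.inr ⟨h, Or.inl rfl⟩)⟩
  rintro (h | (⟨-, h⟩ | h) | h)
  · exact absurd h.mem.2 hx.1
  · exact absurd h.mem hx.2
  · exact absurd h.mem.2 hx.2
  · exact h.1

theorem middle_lt (hx : some x ∉ A ++ B) : Lt (A ++ some x :: B) x j ↔ Reach B j := by
  rw [List.mem_append, not_or] at hx
  rw [lt_append]
  refine ⟨?_, fun h => Or.inr (Or.inl (Or.inl ⟨rfl, h⟩))⟩
  rintro (h | (⟨-, h⟩ | h) | h)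
  · exact absurd h.mem.1 hx.1
  · exact h
  · exact absurd h.mem.1 hx.2
  · exact absurd h.1.mem hx.1

theorem lt_insert (hi : i ≠ x) (hj : j ≠ x) : Lt (A ++ some x :: B) i j ↔ Lt (A ++ B) i j := by
  have h1 : x ≠ i := hi.symm
  have h2 : x ≠ j := hj.symm
  simp [lt_append, Lt, Reach, h1, h2]

/-- Sliding the end `x` from behind `p` to the front of the other end of `p`. -/
theorem slide {A B C D L L' : List (Option (V × Bool))} {p x : V × Bool}
    (hL : L = A ++ some x :: B) (hL' : L' = C ++ some x :: D) (h : A ++ B = C ++ D)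
    {A' : List (Option (V × Bool))} (hA : A = A' ++ [some p])
    {D' : List (Option (V × Bool))} (hD : D = some (otherEnd p) :: D') (hnd : Nd L) :
    (order L).Slide (order L') p x := by
  have hnd' : Nd L' := by
    rw [hL', nd_middle, ← h, ← nd_middle, ← hL]
    exact hnd
  have hx : some x ∉ A ++ B := (nd_middle.1 (hL ▸ hnd)).1
  have hp : p ≠ x := by
    rintro rfl
    exact hx (by simp [hA])
  have hq : otherEnd p ≠ x := by
    rintro rfl
    exact hx (by simp [h, hD])
  have hp' : some p ∉ A' ++ some x :: B := by
    have h0 : L = A' ++ some p :: (some x :: B) := by simp [hL, hA]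
    exact (nd_middle.1 (h0 ▸ hnd)).1
  have hq' : some (otherEnd p) ∉ (C ++ [some x]) ++ D' := by
    have h0 : L' = (C ++ [some x]) ++ some (otherEnd p) :: D' := by simp [hL', hD]
    exact (nd_middle.1 (h0 ▸ hnd')).1
  refine ⟨fun h => ?_, fun {i j} hi hj => ?_, fun i => ?_, fun j => ?_, fun j => ?_, fun i => ?_⟩
  · rcases eq_or_eq_otherEnd h with h | h
    · exact hp h
    · exact hq (eq_otherEnd_comm.1 h).symm
  · rw [order_lt hnd, order_lt hnd', hL, hL', lt_insert hi hj, lt_insert hi hj, h]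
  · rw [EndOrder.le, order_lt hnd, order_lt hnd]
    conv_lhs => rw [hL, lt_middle hx, hA]
    have h0 : L = A' ++ some p :: (some x :: B) := by simp [hL, hA]
    rw [h0, lt_middle hp', coReach_append, coReach_singleton]
    simp [eq_comm]
  · rw [EndOrder.le, order_lt hnd, order_lt hnd]
    conv_rhs => rw [hL, middle_lt hx]
    have h0 : L = A' ++ some p :: (some x :: B) := by simp [hL, hA]
    rw [h0, middle_lt hp']
    rfl
  · rw [EndOrder.le, order_lt hnd', order_lt hnd']
    conv_lhs => rw [hL', middle_lt (h ▸ hx), hD]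
    have h0 : L' = (C ++ [some x]) ++ some (otherEnd p) :: D' := by simp [hL', hD]
    rw [h0, middle_lt hq']
    rfl
  · rw [EndOrder.le, order_lt hnd', order_lt hnd']
    conv_rhs => rw [hL', lt_middle (h ▸ hx)]
    have h0 : L' = (C ++ [some x]) ++ some (otherEnd p) :: D' := by simp [hL', hD]
    rw [h0, lt_middle hq', coReach_append, coReach_singleton]
    simp [eq_comm]

variable [Fintype V] [DecidableEq V] (k : Type u) [Field k]

/-- The algebras of the two lists are tilting-cotilting equivalent in both directions, and so are
their opposites; no end occurs twice in one list if and only if this holds for the other. -/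
def Sim (L L' : List (Option (V × Bool))) : Prop :=
  (Nd L ↔ Nd L') ∧ (Nd L → EndOrder.Equi k (order L) (order L'))

namespace Sim

variable {k} {L L' L'' : List (Option (V × Bool))}

theorem refl (L : List (Option (V × Bool))) : Sim k L L := ⟨Iff.rfl, fun _ => .refl _⟩

theorem symm (h : Sim k L L') : Sim k L' L := ⟨h.1.symm, fun hL => (h.2 (h.1.2 hL)).symm⟩

theorem trans (h : Sim k L L') (h' : Sim k L' L'') : Sim k L L'' :=
  ⟨h.1.trans h'.1, fun hL => (h.2 hL).trans (h'.2 (h.1.1 hL))⟩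

theorem reverse (h : Sim k L L') : Sim k L.reverse L'.reverse := by
  refine ⟨by rw [nd_perm L.reverse_perm, nd_perm L'.reverse_perm]; exact h.1, fun hL => ?_⟩
  rw [nd_perm L.reverse_perm] at hL
  rw [← order_rev, ← order_rev]
  exact (h.2 hL).rev

theorem of_lt (h : Nd L ↔ Nd L') (hlt : ∀ i j, Lt L i j ↔ Lt L' i j) : Sim k L L' := by
  refine ⟨h, fun hL => .of_relabel (.refl _) (fun _ => rfl) fun i j => ?_⟩
  rw [order_lt hL, order_lt (h.1 hL)]
  exact (hlt i j).symm

/-- Ends are compared only within a block, so the order of the blocks does not matter. -/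
theorem rotate (A B : List (Option (V × Bool))) : Sim k (A ++ none :: B) (B ++ none :: A) := by
  refine of_lt (nd_perm ?_) fun i j => ?_
  · exact List.perm_middle.trans ((List.perm_append_comm.cons _).trans List.perm_middle.symm)
  · simp only [lt_append, Lt, Reach]
    tauto

/-- A block with one end creates no comparison. Making an isolated end visible in this way allows
other ends to slide to its front. -/
theorem single (A : List (Option (V × Bool))) (i : V × Bool) (hi : some i ∉ A) :
    Sim k A (A ++ [none, some i]) := by
  refine of_lt ?_ fun i j => ?_
  · rw [nd_perm (List.perm_append_comm (l₁ := A)), List.cons_append, nd_cons_none,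
      List.cons_append, nd_cons_some, List.nil_append, and_iff_right hi]
  · simp [lt_append, Lt, Reach]

theorem slide {A B C D : List (Option (V × Bool))} {p x : V × Bool}
    (h : A ++ some p :: B = C ++ some (otherEnd p) :: D)
    (hx : some (otherEnd x) ∉ A ++ some p :: B) :
    Sim k (A ++ some p :: some x :: B) (C ++ some x :: some (otherEnd p) :: D) := by
  have e₁ : A ++ some p :: some x :: B = (A ++ [some p]) ++ some x :: B := by simp
  have e₂ : (A ++ [some p]) ++ B = C ++ some (otherEnd p) :: D := by simp [h]
  refine ⟨?_, fun hL => ?_⟩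
  · rw [e₁, nd_middle, nd_middle, e₂]
  · have hs := EndList.slide e₁ rfl e₂ rfl rfl hL
    have hx' : some (otherEnd x) ∉ A ++ some p :: some x :: B := fun h => hx (by
      have : some (otherEnd x) ≠ some x := fun h => otherEnd_ne x (Option.some.inj h)
      simpa [this] using h)
    exact hs.equi (fun j hj => hx' hj.2.mem.1) fun j hj => hx' hj.2.mem.2

/-- The intermediate list `L₁` is written in two ways, as the outcome of the slide of `x` and as the
start of the slide of `otherEnd x`. The first slide alone need not be a tilt, only the two together.
-/
theorem slide₂ {L L₁ L' A B C D A₁ B₁ C₁ D₁ : List (Option (V × Bool))} {p p₁ x : V × Bool}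
    (hL : L = A ++ some p :: some x :: B) (hL₁ : L₁ = C ++ some x :: some (otherEnd p) :: D)
    (h : A ++ some p :: B = C ++ some (otherEnd p) :: D)
    (hL₁' : L₁ = A₁ ++ some p₁ :: some (otherEnd x) :: B₁)
    (hL' : L' = C₁ ++ some (otherEnd x) :: some (otherEnd p₁) :: D₁)
    (h' : A₁ ++ some p₁ :: B₁ = C₁ ++ some (otherEnd p₁) :: D₁) (hp : p ≠ p₁) :
    Sim k L L' := by
  have e₁ : L = (A ++ [some p]) ++ some x :: B := by simp [hL]
  have e₂ : (A ++ [some p]) ++ B = C ++ some (otherEnd p) :: D := by simp [h]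
  have e₃ : L₁ = (A₁ ++ [some p₁]) ++ some (otherEnd x) :: B₁ := by simp [hL₁']
  have e₄ : (A₁ ++ [some p₁]) ++ B₁ = C₁ ++ some (otherEnd p₁) :: D₁ := by simp [h']
  have n₁ : Nd L ↔ Nd L₁ := by rw [e₁, hL₁, nd_middle, nd_middle, e₂]
  have n₂ : Nd L₁ ↔ Nd L' := by rw [e₃, hL', nd_middle, nd_middle, e₄]
  exact ⟨n₁.trans n₂, fun hn => (EndList.slide e₁ hL₁ e₂ rfl rfl hn).equi₂
    (EndList.slide e₃ hL' e₄ rfl rfl (n₁.1 hn)) hp⟩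

end Sim

end EndList

/-! ### Lone ends, threads and relabellings -/

namespace EndList

variable {V : Type}

/-- The first end of a vertex. -/
abbrev fstEnd (v : V) : Option (V × Bool) := some (v, false)

/-- The second end of a vertex. -/
abbrev sndEnd (v : V) : Option (V × Bool) := some (v, true)

/-- The first ends of some vertices. -/
def lone (C : List V) : List (Option (V × Bool)) := C.map fstEnd

/-- The vertices whose two ends are separated by the end of a block. -/
def thread (S : List V) : List (Option (V × Bool)) := S.flatMap fun s => [fstEnd s, none, sndEnd s]

@[simp] theorem lone_nil : lone ([] : List V) = [] := rfl
@[simp] theorem lone_cons (c : V) (C : List V) : lone (c :: C) = fstEnd c :: lone C := rfl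
@[simp] theorem lone_append (C D : List V) : lone (C ++ D) = lone C ++ lone D := List.map_append ..
@[simp] theorem thread_nil : thread ([] : List V) = [] := rfl
@[simp] theorem thread_cons (s : V) (S : List V) :
    thread (s :: S) = fstEnd s :: none :: sndEnd s :: thread S := rfl
@[simp] theorem thread_append (S T : List V) : thread (S ++ T) = thread S ++ thread T :=
  List.flatMap_append ..
@[simp] theorem mem_lone {c : V × Bool} {C : List V} :
    some c ∈ lone C ↔ c.1 ∈ C ∧ c.2 = false := by
  obtain ⟨c, b⟩ := c
  simp only [lone, fstEnd, List.mem_map, Option.some.injEq, Prod.mk.injEq]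
  constructor
  · rintro ⟨a, ha, rfl, rfl⟩
    exact ⟨ha, rfl⟩
  · rintro ⟨h, rfl⟩
    exact ⟨c, h, rfl, rfl⟩
@[simp] theorem mem_thread {c : V × Bool} {S : List V} : some c ∈ thread S ↔ c.1 ∈ S := by
  obtain ⟨c, b⟩ := c
  induction S with
  | nil => simp
  | cons s S ih =>
    simp only [thread_cons, List.mem_cons, ih]
    cases b <;> simp

section relabel

/-- The permutation of the ends given by a permutation of the vertices, which moreover exchanges the
two ends of some vertices. -/
def relabel (e : Equiv.Perm V) (σ : V → Bool) : V × Bool ≃ V × Bool where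
  toFun i := (e i.1, xor i.2 (σ i.1))
  invFun i := (e.symm i.1, xor i.2 (σ (e.symm i.1)))
  left_inv i := by simp
  right_inv i := by simp

theorem relabel_otherEnd (e : Equiv.Perm V) (σ : V → Bool) (i : V × Bool) :
    relabel e σ (otherEnd i) = otherEnd (relabel e σ i) := by simp [relabel, otherEnd]

variable {L : List (Option (V × Bool))} {i j : V × Bool}

theorem reach_map (f : V × Bool ≃ V × Bool) : Reach (L.map (Option.map f)) (f j) ↔ Reach L j := by
  induction L with
  | nil => rfl
  | cons a L ih => cases a <;> simp [Reach, ih]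

theorem lt_map (f : V × Bool ≃ V × Bool) : Lt (L.map (Option.map f)) (f i) (f j) ↔ Lt L i j := by
  induction L with
  | nil => rfl
  | cons a L ih => cases a <;> simp [Lt, reach_map, ih]

theorem nd_map (f : V × Bool ≃ V × Bool) : Nd (L.map (Option.map f)) ↔ Nd L := by
  rw [Nd, List.reduceOption_map, List.nodup_map_iff f.injective, Nd]

/-- Relabelling of lists. -/
abbrev relabelList (e : Equiv.Perm V) (σ : V → Bool) (L : List (Option (V × Bool))) :
    List (Option (V × Bool)) := L.map (Option.map (relabel e σ))

variable (e : Equiv.Perm V) (σ : V → Bool)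

theorem relabel_mk (v : V) (b : Bool) : relabel e σ (v, b) = (e v, xor b (σ v)) := rfl

theorem relabel_lone {C : List V} (h : ∀ c ∈ C, σ c = false) :
    relabelList e σ (lone C) = lone (C.map e) := by
  simp only [relabelList, lone, List.map_map]
  refine List.map_congr_left fun c hc => ?_
  simp [relabel_mk, h c hc]

theorem relabel_lone_reverse {C : List V} (h : ∀ c ∈ C, σ c = false) :
    relabelList e σ (lone C).reverse = lone (C.reverse.map e) := by
  rw [← relabel_lone e σ (fun c hc => h c (List.mem_reverse.1 hc)), lone, lone, List.map_reverse]

theorem relabel_thread_reverse {S : List V} (h : ∀ c ∈ S, σ c = true) :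
    relabelList e σ (thread S).reverse = thread (S.reverse.map e) := by
  induction S with
  | nil => rfl
  | cons s S ih =>
    have hs := h s List.mem_cons_self
    have ih := ih fun c hc => h c (List.mem_cons_of_mem _ hc)
    simp only [relabelList, List.map_reverse] at ih
    simp [relabelList, relabel_mk, hs, ih]

/-- Both families of blocks, when joined, enumerate the vertices without repetition, so the `n`-th
entry of one can be sent to the `n`-th entry of the other; equal block lengths make this respect the
blocks. The hypotheses are phrased by multiplicities because these are easily computed for
concatenated and reversed lists. -/
theorem exists_perm_blocks [DecidableEq V] (As Bs : List (List V)) {l : List V} (hd : l.Nodup)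
    (hc : ∀ v, v ∈ l) (hA : ∀ v, As.flatten.count v = l.count v)
    (hBl : ∀ v, Bs.flatten.count v = l.count v)
    (hl : As.map List.length = Bs.map List.length) :
    ∃ e : Equiv.Perm V, As.map (List.map e) = Bs := by
  have hAl := List.perm_iff_count.2 hA
  have hAB := hAl.trans (List.perm_iff_count.2 hBl).symm
  replace hc : ∀ v, v ∈ As.flatten := fun v => hAl.mem_iff.2 (hc v)
  replace hA : As.flatten.Nodup := hAl.nodup_iff.2 hd
  have hB : Bs.flatten.Nodup := hAB.nodup_iff.1 hA
  have hcB : ∀ v, v ∈ Bs.flatten := fun v => hAB.mem_iff.1 (hc v)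
  have hlen : As.flatten.length = Bs.flatten.length := hAB.length_eq
  let e : Equiv.Perm V := (hA.getEquivOfForallMemList _ hc).symm.trans
    ((finCongr hlen).trans (hB.getEquivOfForallMemList _ hcB))
  have he : As.flatten.map e = Bs.flatten := by
    refine List.ext_getElem (List.length_map _ |>.trans hlen) fun n h1 h2 => ?_
    have h3 : n < As.flatten.length := by rwa [List.length_map] at h1
    have h4 : (hA.getEquivOfForallMemList _ hc).symm As.flatten[n] = ⟨n, h3⟩ := by
      rw [Equiv.symm_apply_eq]
      rfl
    rw [List.getElem_map]
    change (hB.getEquivOfForallMemList _ hcB) ((finCongr hlen)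
      ((hA.getEquivOfForallMemList _ hc).symm As.flatten[n])) = _
    rw [h4]
    rfl
  refine ⟨e, ?_⟩
  clear_value e
  clear hA hAB hc hcB hB hlen hAl hBl
  induction As generalizing Bs with
  | nil =>
    cases Bs with
    | nil => rfl
    | cons b Bs => simp at hl
  | cons a As ih =>
    cases Bs with
    | nil => simp at hl
    | cons b Bs =>
      simp only [List.map_cons, List.cons.injEq] at hl
      simp only [List.flatten_cons, List.map_append] at he
      obtain ⟨h1, h2⟩ := List.append_inj he (by simpa using hl.1)
      rw [List.map_cons, h1, ih _ hl.2 h2]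

end relabel

namespace Sim

variable [Fintype V] [DecidableEq V] {k : Type u} [Field k]
  {L L' : List (Option (V × Bool))}

theorem of_eq (h : L = L') : Sim k L L' := h ▸ refl L

theorem relabel (e : Equiv.Perm V) (σ : V → Bool) (L : List (Option (V × Bool))) :
    Sim k L (relabelList e σ L) := by
  have hn : Nd L ↔ Nd (relabelList e σ L) := (nd_map _).symm
  refine ⟨hn, fun hL => .of_relabel (EndList.relabel e σ) (relabel_otherEnd e σ) fun i j => ?_⟩
  rw [order_lt hL, order_lt (hn.1 hL), lt_map]

/-- Sliding some lone ends from behind the end `p` to the front of the other end of `p`, if the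
latter comes later. -/
theorem shift (p : V × Bool) (C : List V) (A B E : List (Option (V × Bool)))
    (hL : L = A ++ some p :: (lone C ++ (B ++ some (otherEnd p) :: E)))
    (hL' : L' = A ++ some p :: (B ++ (lone C ++ some (otherEnd p) :: E)))
    (hC : ∀ c ∈ C, sndEnd c ∉ A ++ some p :: (B ++ some (otherEnd p) :: E)) : Sim k L L' := by
  subst hL hL'
  induction C generalizing B with
  | nil => exact refl _
  | cons c C ih =>
    refine (slide (A := A) (p := p) (x := (c, false)) (B := lone C ++ (B ++ some (otherEnd p) :: E))
      (C := A ++ some p :: (lone C ++ B)) (D := E) (by simp) ?_).trans ?_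
    · have := hC c List.mem_cons_self
      simpa [otherEnd] using this
    · have := ih (B ++ [fstEnd c]) fun c' hc' => by
        simpa using hC c' (List.mem_cons_of_mem _ hc')
      simpa using this

/-- Sliding some lone ends from behind the end `p` to the front of the other end of `p`, if the
latter comes earlier. -/
theorem shift' (p : V × Bool) (C : List V) (A B E : List (Option (V × Bool)))
    (hL : L = A ++ some (otherEnd p) :: (B ++ some p :: (lone C ++ E)))
    (hL' : L' = A ++ (lone C ++ some (otherEnd p) :: (B ++ some p :: E)))
    (hC : ∀ c ∈ C, sndEnd c ∉ A ++ some (otherEnd p) :: (B ++ some p :: E)) : Sim k L L' := by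
  subst hL hL'
  induction C generalizing A with
  | nil => exact refl _
  | cons c C ih =>
    have h := slide (k := k) (A := A ++ some (otherEnd p) :: B) (p := p) (x := (c, false))
      (B := lone C ++ E) (C := A) (D := B ++ some p :: (lone C ++ E)) (by simp) (by
        have := hC c List.mem_cons_self
        simpa [otherEnd] using this)
    have h' := ih (A ++ [fstEnd c]) fun c' hc' => by
        simpa using hC c' (List.mem_cons_of_mem _ hc')
    refine trans (of_eq ?_) (h.trans (trans (of_eq ?_) (h'.trans (of_eq ?_)))) <;> simp

/-- A lone end right behind `s'` slides to the front of `s`, that is, to the other side of the break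
at `s`. Repeating this carries it through the whole thread. -/
theorem thread_lone (S C : List V) (A B : List (Option (V × Bool)))
    (hL : L = A ++ (thread S ++ (lone C ++ B))) (hL' : L' = A ++ (lone C ++ (thread S ++ B)))
    (hC : ∀ c ∈ C, sndEnd c ∉ A ++ (thread S ++ B)) : Sim k L L' := by
  subst hL hL'
  induction S generalizing A with
  | nil => exact refl _
  | cons s S ih =>
    have h := ih (A ++ [fstEnd s, none, sndEnd s]) fun c hc => by
      have := hC c hc
      rwa [List.append_assoc]
    rw [List.append_assoc, List.append_assoc] at h
    refine trans (of_eq ?_) (h.trans ?_)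
    · rfl
    refine shift' (s, true) C A [none] (thread S ++ B) (by simp [otherEnd]) (by simp [otherEnd])
      fun c hc => ?_
    simpa [otherEnd] using hC c hc

theorem rotate' (A B : List (Option (V × Bool))) (hL : L = A ++ none :: B)
    (hL' : L' = B ++ none :: A) : Sim k L L' := by
  subst hL hL'
  exact rotate A B

theorem rotate₃ (A B M : List (Option (V × Bool))) :
    Sim k (A ++ none :: (B ++ none :: M)) (B ++ none :: (A ++ none :: M)) := by
  refine of_lt (nd_perm ?_) fun i j => ?_
  · refine List.perm_middle.trans ((List.Perm.cons _ ?_).trans List.perm_middle.symm)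
    rw [← List.append_assoc, ← List.append_assoc]
    exact List.perm_append_comm.append_right _
  · simp only [lt_append, Lt, Reach]
    tauto

/-- A cyclic sequence of blocks may be cut at any place of a thread. -/
theorem cut {s t : V} {S₁ S₀ : List V} (h : s :: S₁ = S₀ ++ [t]) (K M : List (Option (V × Bool))) :
    Sim k (sndEnd s :: (thread S₁ ++ (K ++ fstEnd s :: none :: M)))
      (sndEnd t :: (K ++ (thread S₀ ++ fstEnd t :: none :: M))) := by
  rcases List.eq_nil_or_concat S₁ with rfl | ⟨S, t', rfl⟩
  · cases S₀ with
    | nil =>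
      simp only [List.nil_append, List.cons.injEq, and_true] at h
      subst h
      simpa using refl _
    | cons a S₀ => simp at h
  · rw [List.concat_eq_append, ← List.cons_append] at h
    obtain ⟨rfl, h2⟩ := List.append_inj' h rfl
    obtain rfl : t' = t := by simpa using h2
    have := rotate₃ (k := k) (sndEnd s :: (thread S ++ [fstEnd t'])) (sndEnd t' :: (K ++ [fstEnd s])) M
    simpa using this

end Sim

end EndList

/-! ### Reversal of the lists of the families -/

namespace EndList

variable {V : Type} [Fintype V] [DecidableEq V] {k : Type u} [Field k]

theorem exists_flip (F : List V) :
    ∃ σ : V → Bool, (∀ v ∈ F, σ v = true) ∧ ∀ v, v ∉ F → σ v = false :=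
  ⟨fun v => decide (v ∈ F), fun v hv => by simpa using hv, fun v hv => by simpa using hv⟩

/-- `y x C S y' x'` becomes `y x S C y' x'`. This is the reversed list after exchanging the vertices
`x` and `y`, reversing the numbering of `C` and `S`, and exchanging the two ends of `x`, `y` and the
vertices of `S`. -/
theorem sim_reverse_zero {x y : V} {C S : List V} (h : (x :: y :: (C ++ S)).Nodup)
    (hc : ∀ v, v ∈ x :: y :: (C ++ S)) {L : List (Option (V × Bool))}
    (hL : L = fstEnd y :: fstEnd x :: (lone C ++ (thread S ++ [sndEnd y, sndEnd x]))) :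
    Sim k L L.reverse := by
  obtain ⟨e, he⟩ := exists_perm_blocks
    [[x], [y], C.reverse, S.reverse]
    [[y], [x], C, S] h hc
    (fun v => by simp [List.count_cons]) (fun v => by simp [List.count_cons]; ring) (by simp)
  simp only [List.map_cons, List.map_nil, List.cons.injEq, and_true] at he
  simp only [List.nodup_cons, List.nodup_append, List.mem_cons, List.mem_append, not_or] at h
  obtain ⟨σ, hσ, hσ'⟩ := exists_flip (x :: y :: S)
  have h₁ := Sim.relabel (k := k) e σ L.reverse
  have h₂ : Sim k L (fstEnd y :: fstEnd x :: (thread S ++ (lone C ++ [sndEnd y, sndEnd x]))) :=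
    (Sim.thread_lone S C [fstEnd y, fstEnd x] [sndEnd y, sndEnd x] (by simp) (by simp [hL])
      (by simp; clear he hc; clear! L; grind)).symm
  refine h₂.trans (.trans (.of_eq ?_) h₁.symm)
  have h₃ := relabel_lone_reverse e σ (C := C) (by clear he hc; clear! L; grind)
  have h₄ := relabel_thread_reverse e σ (S := S) (by clear he hc; clear! L; grind)
  have hx : σ x = true := by clear he hc; clear! L; grind
  have hy : σ y = true := by clear he hc; clear! L; grind
  simp only [relabelList] at h₃ h₄ ⊢
  simp only [hL, List.reverse_append, List.reverse_cons, List.reverse_nil, List.nil_append,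
    List.append_assoc, List.cons_append, List.map_append, List.map_cons, List.map_nil,
    Option.map_some, Option.map_none, relabel_mk, h₃, h₄, he, hx, hy, Bool.xor_self,
    Bool.xor_true, Bool.not_false, Bool.not_true, Bool.xor_false]

/-- In `z y x | z' y' C x'` the lone ends slide over `y'`, which gives `z C y x | z' y' x'`. This is
the reversed list up to exchanging `x` with `z`, reversing `C` and flipping the ends of `x`, `y`,
`z`. -/
theorem sim_reverse_zero' {x y z : V} {C : List V} (h : (x :: y :: z :: C).Nodup)
    (hc : ∀ v, v ∈ x :: y :: z :: C) {L : List (Option (V × Bool))}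
    (hL : L = fstEnd z :: fstEnd y :: fstEnd x :: none :: sndEnd z :: sndEnd y ::
      (lone C ++ [sndEnd x])) :
    Sim k L L.reverse := by
  obtain ⟨e, he⟩ := exists_perm_blocks
    [[x], [y], [z], C.reverse]
    [[z], [y], [x], C] h hc
    (fun v => by simp [List.count_cons]) (fun v => by simp [List.count_cons]; ring) (by simp)
  simp only [List.map_cons, List.map_nil, List.cons.injEq, and_true] at he
  simp only [List.nodup_cons, List.nodup_append, List.mem_cons, List.mem_append, not_or] at h
  obtain ⟨σ, hσ, hσ'⟩ := exists_flip [x, y, z]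
  have h₁ := Sim.relabel (k := k) e σ L.reverse
  have h₂ : Sim k L (fstEnd z :: (lone C ++ fstEnd y :: fstEnd x :: none :: sndEnd z :: sndEnd y ::
      [sndEnd x])) :=
    Sim.shift' (y, true) C [fstEnd z] [fstEnd x, none, sndEnd z] [sndEnd x]
      (by simp [hL, otherEnd]) (by simp [otherEnd]) (by simp [otherEnd]; clear he hc; clear! L; grind)
  refine h₂.trans (.trans (.of_eq ?_) h₁.symm)
  have h₃ := relabel_lone_reverse e σ (C := C) (by clear he hc; clear! L; grind)
  have hx : σ x = true := by clear he hc; clear! L; grind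
  have hy : σ y = true := by clear he hc; clear! L; grind
  have hz : σ z = true := by clear he hc; clear! L; grind
  simp only [relabelList] at h₃ ⊢
  simp only [hL, List.reverse_append, List.reverse_cons, List.reverse_nil, List.nil_append,
    List.append_assoc, List.cons_append, List.map_append, List.map_cons, List.map_nil,
    Option.map_some, Option.map_none, relabel_mk, h₃, he, hx, hy, hz, Bool.xor_self,
    Bool.xor_true, Bool.not_false, Bool.not_true, Bool.xor_false]

/-- The list is `x S F y G z | y' T x' D z'`, and the goal, up to relabelling, is `z D y' T x' | z'
G x F S y`. The ends of `z` have to change blocks: `z` jumps over `y` and `z'` over `x'`. For this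
the lone ends `G` and `D` are first moved out of the way and afterwards brought behind the new
positions of the ends of `z`. -/
theorem sim_reverse_one {x y z : V} {S F G T D : List V}
    (h : (x :: y :: z :: (S ++ (F ++ (G ++ (T ++ D))))).Nodup)
    (hc : ∀ v, v ∈ x :: y :: z :: (S ++ (F ++ (G ++ (T ++ D))))) {L : List (Option (V × Bool))}
    (hL : L = fstEnd x :: (thread S ++ (lone F ++ fstEnd y :: (lone G ++ fstEnd z :: none ::
      sndEnd y :: (thread T ++ sndEnd x :: (lone D ++ [sndEnd z])))))) :
    Sim k L L.reverse := by
  obtain ⟨e, he⟩ := exists_perm_blocks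
    [[x], [y], [z], F.reverse, S.reverse, G.reverse, T.reverse, D.reverse]
    [[y], [x], [z], F, S, G, T, D] h hc
    (fun v => by simp [List.count_cons]; ring) (fun v => by simp [List.count_cons]; ring) (by simp)
  simp only [List.map_cons, List.map_nil, List.cons.injEq, and_true] at he
  simp only [List.nodup_cons, List.nodup_append, List.mem_cons, List.mem_append, not_or] at h
  obtain ⟨σ, hσ, hσ'⟩ := exists_flip (z :: (S ++ T))
  -- `G` slides over `y` to the front of `y'`, so that `z` stands right behind `y`; in the next step
  -- `D` slides over `x'` to the front of `x`.
  have h₁ : Sim k L (fstEnd x :: (thread S ++ (lone F ++ fstEnd y :: fstEnd z :: none ::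
      (lone G ++ sndEnd y :: (thread T ++ sndEnd x :: (lone D ++ [sndEnd z])))))) :=
    Sim.shift (y, false) G (fstEnd x :: (thread S ++ lone F)) [fstEnd z, none]
      (thread T ++ sndEnd x :: (lone D ++ [sndEnd z])) (by simp [hL, otherEnd])
      (by simp [otherEnd]) (by simp [otherEnd]; clear he hc; clear! L; grind)
  have h₂ := h₁.trans (Sim.shift' (x, true) D [] (thread S ++ (lone F ++ fstEnd y :: fstEnd z ::
    none :: (lone G ++ sndEnd y :: thread T))) [sndEnd z] (by simp [otherEnd]) rfl
    (by simp [otherEnd]; clear he hc; clear! L; grind))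
  -- The double slide: the result is `D z' x S F y | G z y' T x'`.
  have h₃ : Sim k L (lone D ++ sndEnd z :: fstEnd x :: (thread S ++ (lone F ++ fstEnd y :: none ::
      (lone G ++ fstEnd z :: sndEnd y :: (thread T ++ [sndEnd x]))))) := by
    refine h₂.trans (Sim.slide₂ (x := (z, false)) (p := (y, false)) (p₁ := (x, true))
      (A := lone D ++ fstEnd x :: (thread S ++ lone F))
      (B := none :: (lone G ++ sndEnd y :: (thread T ++ [sndEnd x, sndEnd z])))
      (C := lone D ++ fstEnd x :: (thread S ++ (lone F ++ fstEnd y :: none :: lone G)))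
      (D := thread T ++ [sndEnd x, sndEnd z])
      (A₁ := lone D ++ fstEnd x :: (thread S ++ (lone F ++ fstEnd y :: none ::
        (lone G ++ fstEnd z :: sndEnd y :: thread T))))
      (B₁ := []) (C₁ := lone D)
      (D₁ := thread S ++ (lone F ++ fstEnd y :: none ::
        (lone G ++ fstEnd z :: sndEnd y :: (thread T ++ [sndEnd x])))) ?_ rfl ?_ ?_ ?_ ?_ ?_) <;>
      simp [otherEnd]
  -- Backwards slides over the ends of `z`: `D` passes from the front of `z'` to behind `z`, and
  -- then `G` from the front of `z` to behind `z'`.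
  have h₄ := h₃.trans (Sim.shift' (z, false) D [] (fstEnd x :: (thread S ++ (lone F ++ fstEnd y ::
    none :: lone G))) (sndEnd y :: (thread T ++ [sndEnd x])) rfl (by simp [otherEnd])
    (by simp [otherEnd]; clear he hc; clear! L; grind)).symm
  have h₅ := h₄.trans (Sim.shift (z, true) G [] (fstEnd x :: (thread S ++ (lone F ++ fstEnd y ::
    [none]))) (lone D ++ sndEnd y :: (thread T ++ [sndEnd x])) rfl (by simp [otherEnd])
    (by simp [otherEnd]; clear he hc; clear! L; grind)).symm
  have h₆ := h₅.trans (Sim.thread_lone S F (sndEnd z :: (lone G ++ [fstEnd x])) (fstEnd y ::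
    none :: fstEnd z :: (lone D ++ sndEnd y :: (thread T ++ [sndEnd x]))) (by simp [otherEnd]) rfl
    (by simp; clear he hc; clear! L; grind))
  have h₇ := h₆.trans (Sim.rotate' (sndEnd z :: (lone G ++ fstEnd x :: (lone F ++ (thread S ++
    [fstEnd y])))) (fstEnd z :: (lone D ++ sndEnd y :: (thread T ++ [sndEnd x]))) (by simp) rfl)
  refine h₇.trans (.trans (.of_eq ?_) (Sim.relabel (k := k) e σ L.reverse).symm)
  have hF := relabel_lone_reverse e σ (C := F) (by clear he hc; clear! L; grind)
  have hG := relabel_lone_reverse e σ (C := G) (by clear he hc; clear! L; grind)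
  have hD := relabel_lone_reverse e σ (C := D) (by clear he hc; clear! L; grind)
  have hS := relabel_thread_reverse e σ (S := S) (by clear he hc; clear! L; grind)
  have hT := relabel_thread_reverse e σ (S := T) (by clear he hc; clear! L; grind)
  simp only [relabelList] at hF hG hD hS hT ⊢
  have hz : σ z = true := by clear he hc; clear! L; grind
  have hx : σ x = false := by clear he hc; clear! L; grind
  have hy : σ y = false := by clear he hc; clear! L; grind
  simp only [hL, List.reverse_append, List.reverse_cons, List.reverse_nil, List.nil_append,
    List.append_assoc, List.cons_append, List.map_append, List.map_cons, List.map_nil,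
    Option.map_some, Option.map_none, relabel_mk, hF, hG, hD, hS, hT, hz, hx, hy, he, Bool.xor_self,
    Bool.xor_true, Bool.not_false, Bool.not_true, Bool.xor_false]

theorem exists_cons_eq_append (s : V) (S₁ : List V) : ∃ S₀ t, s :: S₁ = S₀ ++ [t] :=
  ⟨_, _, (List.dropLast_append_getLast (List.cons_ne_nil s S₁)).symm⟩

/-- The chain `x S F y G x` is closed, so its blocks form a cycle, and the list `s' S₁ F y G x s |
y' T x'` cuts it at the first vertex `s` of the thread. After `F` has been carried through the
thread and around to the front of `s`, the reversed list arises by cutting at the last vertex `t` of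
the thread instead. -/
theorem sim_reverse_one_of_loop {x y s : V} {S₁ F G T : List V}
    (h : (x :: y :: s :: (S₁ ++ (F ++ (G ++ T)))).Nodup)
    (hc : ∀ v, v ∈ x :: y :: s :: (S₁ ++ (F ++ (G ++ T)))) {L : List (Option (V × Bool))}
    (hL : L = sndEnd s :: (thread S₁ ++ (lone F ++ fstEnd y :: (lone G ++ fstEnd x :: fstEnd s ::
      none :: sndEnd y :: (thread T ++ [sndEnd x]))))) :
    Sim k L L.reverse := by
  obtain ⟨S₀, t, hS⟩ := exists_cons_eq_append s S₁
  have hp : (s :: S₁).Perm (S₀ ++ [t]) := .of_eq hS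
  have hlen : S₁.length = S₀.length := by simpa using hp.length_eq
  obtain ⟨e, he⟩ := exists_perm_blocks
    [[x], [y], [s], S₁.reverse, F.reverse, G.reverse, T.reverse]
    [[y], [x], [t], S₀, F, G, T] h hc
    (fun v => by simp [List.count_cons]) (fun v => by have := hp.count_eq v; simp [List.count_cons] at this ⊢; omega) (by simp [hlen])
  simp only [List.map_cons, List.map_nil, List.cons.injEq, and_true] at he
  simp only [List.nodup_cons, List.nodup_append, List.mem_cons, List.mem_append, not_or] at h
  obtain ⟨σ, hσ, hσ'⟩ := exists_flip (s :: (S₁ ++ T))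
  have h₁ := (Sim.of_eq hL).trans (Sim.thread_lone (k := k) S₁ F [sndEnd s] (fstEnd y ::
    (lone G ++ fstEnd x :: fstEnd s :: none :: sndEnd y :: (thread T ++ [sndEnd x]))) (by simp) rfl
    (by simp; clear he hc; clear! L; grind))
  have h₂ := h₁.trans (Sim.shift (s, true) F [] (thread S₁ ++ fstEnd y :: (lone G ++ [fstEnd x]))
    (none :: sndEnd y :: (thread T ++ [sndEnd x])) (by simp [otherEnd]) rfl
    (by simp [otherEnd]; clear he hc; clear! L; grind))
  have h₃ := h₂.trans (.trans (.of_eq (by simp [otherEnd])) (Sim.cut hS (fstEnd y ::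
    (lone G ++ fstEnd x :: lone F)) (sndEnd y :: (thread T ++ [sndEnd x]))))
  have h₄ := h₃.trans (Sim.rotate' (sndEnd t :: fstEnd y :: (lone G ++ fstEnd x :: (lone F ++
    (thread S₀ ++ [fstEnd t])))) (sndEnd y :: (thread T ++ [sndEnd x])) (by simp) rfl)
  refine h₄.trans (.trans (.of_eq ?_) (Sim.relabel (k := k) e σ L.reverse).symm)
  have hF := relabel_lone_reverse e σ (C := F) (by clear he hc; clear! L; grind)
  have hG := relabel_lone_reverse e σ (C := G) (by clear he hc; clear! L; grind)
  have hS₁ := relabel_thread_reverse e σ (S := S₁) (by clear he hc; clear! L; grind)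
  have hT := relabel_thread_reverse e σ (S := T) (by clear he hc; clear! L; grind)
  simp only [relabelList] at hF hG hS₁ hT ⊢
  have hs : σ s = true := by clear he hc; clear! L; grind
  have hx : σ x = false := by clear he hc; clear! L; grind
  have hy : σ y = false := by clear he hc; clear! L; grind
  simp only [hL, List.reverse_append, List.reverse_cons, List.reverse_nil, List.nil_append,
    List.append_assoc, List.cons_append, List.map_append, List.map_cons, List.map_nil,
    Option.map_some, Option.map_none, relabel_mk, hF, hG, hS₁, hT, hs, hx, hy, he, Bool.xor_self,
    Bool.xor_true, Bool.not_false, Bool.not_true, Bool.xor_false]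

/-- Here both chains are closed. The cut of the first is moved from `s` to the last vertex `u` of
its thread, that of the second from `t` to `w`. -/
theorem sim_reverse_one_of_loops {x s t : V} {S₁ F T₁ : List V}
    (h : (x :: s :: t :: (S₁ ++ (F ++ T₁))).Nodup)
    (hc : ∀ v, v ∈ x :: s :: t :: (S₁ ++ (F ++ T₁))) {L : List (Option (V × Bool))}
    (hL : L = sndEnd s :: (thread S₁ ++ (lone F ++ fstEnd x :: fstEnd s ::
      none :: sndEnd t :: (thread T₁ ++ [sndEnd x, fstEnd t])))) :
    Sim k L L.reverse := by
  obtain ⟨S₀, u, hS⟩ := exists_cons_eq_append s S₁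
  obtain ⟨T₀, w, hT⟩ := exists_cons_eq_append t T₁
  have hp : (s :: S₁).Perm (S₀ ++ [u]) := .of_eq hS
  have hlen : S₁.length = S₀.length := by simpa using hp.length_eq
  have hp' : (t :: T₁).Perm (T₀ ++ [w]) := .of_eq hT
  have hlen' : T₁.length = T₀.length := by simpa using hp'.length_eq
  obtain ⟨e, he⟩ := exists_perm_blocks
    [[x], [s], [t], S₁.reverse, F.reverse, T₁.reverse]
    [[x], [u], [w], S₀, F, T₀] h hc
    (fun v => by simp [List.count_cons]) (fun v => by have := hp.count_eq v; have := hp'.count_eq v; simp [List.count_cons] at *; omega) (by simp [hlen, hlen'])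
  simp only [List.map_cons, List.map_nil, List.cons.injEq, and_true] at he
  simp only [List.nodup_cons, List.nodup_append, List.mem_cons, List.mem_append, not_or] at h
  obtain ⟨σ, hσ, hσ'⟩ := exists_flip (s :: t :: (S₁ ++ T₁))
  have h₁ := (Sim.of_eq hL).trans (Sim.thread_lone (k := k) S₁ F [sndEnd s] (fstEnd x ::
    fstEnd s :: none :: sndEnd t :: (thread T₁ ++ [sndEnd x, fstEnd t])) (by simp) rfl
    (by simp; clear he hc; clear! L; grind))
  have h₂ := h₁.trans (Sim.shift (s, true) F [] (thread S₁ ++ [fstEnd x])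
    (none :: sndEnd t :: (thread T₁ ++ [sndEnd x, fstEnd t])) (by simp [otherEnd]) rfl
    (by simp [otherEnd]; clear he hc; clear! L; grind))
  have h₃ := h₂.trans (.trans (.of_eq (by simp [otherEnd])) (Sim.cut hS (fstEnd x :: lone F)
    (sndEnd t :: (thread T₁ ++ [sndEnd x, fstEnd t]))))
  have h₄ := h₃.trans (Sim.rotate' (sndEnd u :: fstEnd x :: (lone F ++
    (thread S₀ ++ [fstEnd u]))) (sndEnd t :: (thread T₁ ++ [sndEnd x, fstEnd t])) (by simp) rfl)
  have h₅ := h₄.trans (.trans (.of_eq (by simp)) (Sim.cut hT [sndEnd x]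
    (sndEnd u :: fstEnd x :: (lone F ++ (thread S₀ ++ [fstEnd u])))))
  refine h₅.trans (.trans (.of_eq ?_) (Sim.relabel (k := k) e σ L.reverse).symm)
  have hF := relabel_lone_reverse e σ (C := F) (by clear he hc; clear! L; grind)
  have hS₁ := relabel_thread_reverse e σ (S := S₁) (by clear he hc; clear! L; grind)
  have hT₁ := relabel_thread_reverse e σ (S := T₁) (by clear he hc; clear! L; grind)
  simp only [relabelList] at hF hS₁ hT₁ ⊢
  have hs : σ s = true := by clear he hc; clear! L; grind
  have ht : σ t = true := by clear he hc; clear! L; grind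
  have hx : σ x = false := by clear he hc; clear! L; grind
  simp only [hL, List.reverse_append, List.reverse_cons, List.reverse_nil, List.nil_append,
    List.append_assoc, List.cons_append, List.map_append, List.map_cons, List.map_nil,
    Option.map_some, Option.map_none, relabel_mk, hF, hS₁, hT₁, hs, ht, hx, he, Bool.xor_self,
    Bool.xor_true, Bool.not_false, Bool.not_true, Bool.xor_false]

/-- A trailing break has no effect; it brings a list whose only cycle ends at its last entry into
the shape required by `Sim.cut`. -/
theorem Sim.append_none (L : List (Option (V × Bool))) : Sim k L (L ++ [none]) := by
  refine of_lt ?_ fun i j => by simp [lt_append, Lt, Reach]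
  rw [nd_perm (List.perm_append_comm (l₁ := L)), List.cons_append, nd_cons_none, List.nil_append]

/-- Two cycles at a common vertex `b` form a single closed chain `s' S₁ F b T E b' s`. The lone ends
are carried through the threads, and the cut moves from `s` to the last vertex of its thread. -/
theorem sim_reverse_two_of_loop {b s : V} {S₁ F T E : List V}
    (h : (b :: s :: (S₁ ++ (F ++ (T ++ E)))).Nodup)
    (hc : ∀ v, v ∈ b :: s :: (S₁ ++ (F ++ (T ++ E)))) {L : List (Option (V × Bool))}
    (hL : L = sndEnd s :: (thread S₁ ++ (lone F ++ fstEnd b :: (thread T ++ (lone E ++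
      [sndEnd b, fstEnd s]))))) :
    Sim k L L.reverse := by
  obtain ⟨S₀, t, hS⟩ := exists_cons_eq_append s S₁
  have hp : (s :: S₁).Perm (S₀ ++ [t]) := .of_eq hS
  have hlen : S₁.length = S₀.length := by simpa using hp.length_eq
  obtain ⟨e, he⟩ := exists_perm_blocks
    [[b], [s], S₁.reverse, F.reverse, T.reverse, E.reverse]
    [[b], [t], S₀, F, T, E] h hc
    (fun v => by simp [List.count_cons]) (fun v => by have := hp.count_eq v; simp [List.count_cons] at this ⊢; omega) (by simp [hlen])
  simp only [List.map_cons, List.map_nil, List.cons.injEq, and_true] at he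
  simp only [List.nodup_cons, List.nodup_append, List.mem_cons, List.mem_append, not_or] at h
  obtain ⟨σ, hσ, hσ'⟩ := exists_flip (b :: s :: (S₁ ++ T))
  have h₁ := (Sim.of_eq hL).trans (Sim.thread_lone (k := k) S₁ F [sndEnd s] (fstEnd b ::
    (thread T ++ (lone E ++ [sndEnd b, fstEnd s]))) (by simp) rfl (by simp; clear he hc; clear! L; grind))
  have h₂ := h₁.trans (Sim.shift (s, true) F [] (thread S₁ ++ fstEnd b ::
    (thread T ++ (lone E ++ [sndEnd b]))) [] (by simp [otherEnd]) rfl (by simp [otherEnd]; clear he hc; clear! L; grind))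
  have h₃ := h₂.trans (Sim.thread_lone T E (sndEnd s :: (thread S₁ ++ [fstEnd b]))
    (sndEnd b :: (lone F ++ [fstEnd s])) (by simp [otherEnd]) rfl (by simp; clear he hc; clear! L; grind))
  have h₄ := (h₃.trans (Sim.append_none _)).trans (.trans (.of_eq (by simp)) (Sim.cut hS
    (fstEnd b :: (lone E ++ (thread T ++ sndEnd b :: lone F))) []))
  have h₅ := h₄.trans (.trans (.of_eq (by simp)) (Sim.append_none (sndEnd t :: fstEnd b ::
    (lone E ++ (thread T ++ sndEnd b :: (lone F ++ (thread S₀ ++ [fstEnd t])))))).symm)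
  refine h₅.trans (.trans (.of_eq ?_) (Sim.relabel (k := k) e σ L.reverse).symm)
  have hF := relabel_lone_reverse e σ (C := F) (by clear he hc; clear! L; grind)
  have hE := relabel_lone_reverse e σ (C := E) (by clear he hc; clear! L; grind)
  have hS₁ := relabel_thread_reverse e σ (S := S₁) (by clear he hc; clear! L; grind)
  have hT := relabel_thread_reverse e σ (S := T) (by clear he hc; clear! L; grind)
  simp only [relabelList] at hF hE hS₁ hT ⊢
  have hb : σ b = true := by clear he hc; clear! L; grind
  have hs : σ s = true := by clear he hc; clear! L; grind
  simp only [hL, List.reverse_append, List.reverse_cons, List.reverse_nil, List.nil_append,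
    List.append_assoc, List.cons_append, List.map_append, List.map_cons, List.map_nil,
    Option.map_some, Option.map_none, relabel_mk, hF, hE, hS₁, hT, hb, hs, he, Bool.xor_self,
    Bool.xor_true, Bool.not_false, Bool.not_true, Bool.xor_false]

/-- No slide is needed: `b b' C a a'` is its own reverse after exchanging `a` with `b`, reversing
`C` and flipping the ends of `a` and `b`. -/
theorem sim_reverse_two_of_eq_one {a b : V} {C : List V} (h : (a :: b :: C).Nodup)
    (hc : ∀ v, v ∈ a :: b :: C) {L : List (Option (V × Bool))}
    (hL : L = fstEnd b :: sndEnd b :: (lone C ++ [fstEnd a, sndEnd a])) :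
    Sim k L L.reverse := by
  obtain ⟨e, he⟩ := exists_perm_blocks
    [[a], [b], C.reverse]
    [[b], [a], C] h hc
    (fun v => by simp [List.count_cons]) (fun v => by simp [List.count_cons]; ring) (by simp)
  simp only [List.map_cons, List.map_nil, List.cons.injEq, and_true] at he
  simp only [List.nodup_cons, List.nodup_append, List.mem_cons, List.mem_append, not_or] at h
  obtain ⟨σ, hσ, hσ'⟩ := exists_flip [a, b]
  refine .trans (.of_eq ?_) (Sim.relabel (k := k) e σ L.reverse).symm
  have hC := relabel_lone_reverse e σ (C := C) (by clear he hc; clear! L; grind)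
  simp only [relabelList] at hC ⊢
  have ha : σ a = true := by clear he hc; clear! L; grind
  have hb : σ b = true := by clear he hc; clear! L; grind
  simp only [hL, List.reverse_append, List.reverse_cons, List.reverse_nil, List.nil_append,
    List.append_assoc, List.cons_append, List.map_append, List.map_cons, List.map_nil,
    Option.map_some, Option.map_none, relabel_mk, hC, ha, hb, he, Bool.xor_self,
    Bool.xor_true, Bool.not_false, Bool.not_true, Bool.xor_false]

end EndList

/-! ### The remaining cases of two cycles joined by a path -/

namespace EndList

variable {V : Type} [Fintype V] [DecidableEq V] {k : Type u} [Field k]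

/-- A double slide of `a` leads from `b T E b' C a F f a'` to `a F b T E b' f C | a' f'`, where `a`
and the last lone vertex `f` play symmetric roles. It is this second list that is compared with its
reverse, by a relabelling that exchanges `a` and `f`. -/
theorem sim_reverse_two_of_eq_zero {a b f : V} {T E C F : List V}
    (h : (a :: b :: f :: (T ++ (E ++ (C ++ F)))).Nodup)
    (hc : ∀ v, v ∈ a :: b :: f :: (T ++ (E ++ (C ++ F)))) {L : List (Option (V × Bool))}
    (hL : L = fstEnd b :: (thread T ++ (lone E ++ sndEnd b :: (lone C ++ fstEnd a ::
      (lone F ++ [fstEnd f, sndEnd a]))))) :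
    Sim k L L.reverse := by
  obtain ⟨e, he⟩ := exists_perm_blocks
    [[a], [b], [f], T.reverse, E.reverse, C.reverse, F.reverse]
    [[f], [b], [a], T, E, C, F] h hc
    (fun v => by simp [List.count_cons]) (fun v => by simp [List.count_cons]; ring) (by simp)
  simp only [List.map_cons, List.map_nil, List.cons.injEq, and_true] at he
  simp only [List.nodup_cons, List.nodup_append, List.mem_cons, List.mem_append, not_or] at h
  obtain ⟨σ, hσ, hσ'⟩ := exists_flip (b :: T)
  have h₁ : Sim k L (fstEnd b :: (thread T ++ (lone E ++ sndEnd b :: fstEnd a ::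
      (lone F ++ fstEnd f :: sndEnd a :: lone C)))) :=
    (Sim.shift' (a, true) C (fstEnd b :: (thread T ++ (lone E ++ [sndEnd b])))
      (lone F ++ [fstEnd f]) [] (by simp [otherEnd]) (by simp [hL, otherEnd])
      (by simp [otherEnd]; clear he hc; clear! L; grind)).symm
  -- The isolated end `f'` is made visible, so that `a'` can slide over `f` to its front.
  have h₂ := h₁.trans (Sim.single _ (f, true) (by simp [otherEnd]; clear he hc; clear! L; grind))
  have h₃ : Sim k L (fstEnd a :: fstEnd b :: (thread T ++ (lone E ++ sndEnd b :: (lone F ++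
      fstEnd f :: (lone C ++ [none, sndEnd a, sndEnd f]))))) := by
    refine h₂.trans (Sim.slide₂ (x := (a, false)) (p := (b, true)) (p₁ := (f, false))
      (A := fstEnd b :: (thread T ++ lone E))
      (B := lone F ++ fstEnd f :: sndEnd a :: (lone C ++ [none, sndEnd f]))
      (C := [])
      (D := thread T ++ (lone E ++ sndEnd b :: (lone F ++ fstEnd f :: sndEnd a ::
        (lone C ++ [none, sndEnd f]))))
      (A₁ := fstEnd a :: fstEnd b :: (thread T ++ (lone E ++ sndEnd b :: lone F)))
      (B₁ := lone C ++ [none, sndEnd f])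
      (C₁ := fstEnd a :: fstEnd b :: (thread T ++ (lone E ++ sndEnd b :: (lone F ++
        fstEnd f :: (lone C ++ [none])))))
      (D₁ := []) ?_ rfl ?_ ?_ ?_ ?_ ?_) <;>
      simp [otherEnd]
  have h₄ := h₃.trans (Sim.shift' (b, true) F [fstEnd a] (thread T ++ lone E)
    (fstEnd f :: (lone C ++ [none, sndEnd a, sndEnd f])) (by simp [otherEnd]) rfl
    (by simp [otherEnd]; clear he hc; clear! L; grind))
  have h₅ := h₄.trans (Sim.shift (f, false) C (fstEnd a :: (lone F ++ fstEnd b :: (thread T ++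
    (lone E ++ [sndEnd b])))) [none, sndEnd a] [] (by simp [otherEnd]) rfl
    (by simp [otherEnd]; clear he hc; clear! L; grind))
  have h₆ := h₅.trans (Sim.shift' (a, true) C [] (lone F ++ fstEnd b :: (thread T ++
    (lone E ++ [sndEnd b, fstEnd f, none]))) [sndEnd f] (by simp [otherEnd]) rfl
    (by simp [otherEnd]; clear he hc; clear! L; grind))
  have h₇ : Sim k L (lone C ++ fstEnd a :: fstEnd b :: (thread T ++ (lone E ++ sndEnd b ::
      (lone F ++ [fstEnd f, none, sndEnd a, sndEnd f])))) :=
    h₆.trans (Sim.shift' (b, true) F (lone C ++ [fstEnd a]) (thread T ++ lone E)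
      [fstEnd f, none, sndEnd a, sndEnd f] (by simp [otherEnd]) (by simp [otherEnd])
      (by simp [otherEnd]; clear he hc; clear! L; grind)).symm
  have h₈ : Sim k L (lone C ++ fstEnd a :: fstEnd b :: (lone E ++ (thread T ++ sndEnd b ::
      (lone F ++ [fstEnd f, none, sndEnd a, sndEnd f])))) :=
    h₇.trans (Sim.thread_lone T E (lone C ++ [fstEnd a, fstEnd b]) (sndEnd b :: (lone F ++
      [fstEnd f, none, sndEnd a, sndEnd f])) (by simp) (by simp)
      (by simp; clear he hc; clear! L; grind))
  have h₉ := h₈.trans (Sim.rotate' (lone C ++ fstEnd a :: fstEnd b :: (lone E ++ (thread T ++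
    sndEnd b :: (lone F ++ [fstEnd f])))) [sndEnd a, sndEnd f] (by simp) rfl)
  -- It suffices to treat the list reached in `h₄`, since reversing the equivalence `h₄` takes care
  -- of the other side.
  refine h₄.trans (Sim.trans ?_ (h₄.reverse.symm))
  refine (h₄.symm.trans h₉).trans (.trans (.of_eq ?_) (Sim.relabel (k := k) e σ _).symm)
  have hC := relabel_lone_reverse e σ (C := C) (by clear he hc; clear! L; grind)
  have hE := relabel_lone_reverse e σ (C := E) (by clear he hc; clear! L; grind)
  have hF := relabel_lone_reverse e σ (C := F) (by clear he hc; clear! L; grind)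
  have hT := relabel_thread_reverse e σ (S := T) (by clear he hc; clear! L; grind)
  have hb : σ b = true := by clear he hc; clear! L; grind
  have ha : σ a = false := by clear he hc; clear! L; grind
  have hf : σ f = false := by clear he hc; clear! L; grind
  simp only [relabelList] at hC hE hF hT ⊢
  simp only [otherEnd, List.reverse_append, List.reverse_cons, List.reverse_nil, List.nil_append,
    List.append_assoc, List.cons_append, List.map_append, List.map_cons, List.map_nil,
    Option.map_some, Option.map_none, relabel_mk, hC, hE, hF, hT, ha, hb, hf, he, Bool.xor_self,
    Bool.xor_true, Bool.not_false, Bool.not_true, Bool.xor_false]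

theorem relabelList_eq_self {e : Equiv.Perm V} {σ : V → Bool} {L : List (Option (V × Bool))}
    (h : ∀ i, some i ∈ L → e i.1 = i.1 ∧ σ i.1 = false) : relabelList e σ L = L := by
  refine (List.map_congr_left fun i hi => ?_).trans (List.map_id L)
  cases i with
  | none => rfl
  | some i =>
    obtain ⟨v, b⟩ := i
    simp [relabel_mk, (h _ hi).1, (h _ hi).2]

/-- Moving a relation from the end of a thread to its beginning. -/
theorem Sim.rotate_thread_aux {a s h : V} {H Y X : List V} {K : List (Option (V × Bool))}
    (hn : (a :: s :: h :: (H ++ (Y ++ X))).Nodup)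
    (hK : ∀ i, some i ∈ K → i.1 ∉ a :: s :: h :: (H ++ (Y ++ X))) :
    Sim k (fstEnd h :: (lone H ++ fstEnd a :: (thread Y ++ (K ++ (thread (X ++ [s]) ++ [sndEnd a])))))
      (lone H ++ fstEnd h :: fstEnd a :: (thread (s :: Y) ++ (K ++ (thread X ++ [sndEnd a])))) := by
  simp only [List.nodup_cons, List.nodup_append, List.mem_cons, List.mem_append, not_or] at hn
  simp only [List.mem_cons, List.mem_append, not_or] at hK
  -- The part `A` between the ends of `a` stays unchanged in all moves; the list is `h H a A s | s'
  -- a'`.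
  obtain ⟨A, hA⟩ : ∃ A, A = thread Y ++ (K ++ thread X) := ⟨_, rfl⟩
  have hA' : ∀ i, some i ∈ A → ¬i.1 = a ∧ ¬i.1 = s ∧ ¬i.1 = h ∧ i.1 ∉ H := by
    intro i hi
    simp only [hA, List.mem_append, mem_thread] at hi
    clear hA
    grind
  clear hK
  replace hn : (¬a = s ∧ ¬a = h ∧ ¬s = h) ∧ a ∉ H ∧ s ∉ H ∧ h ∉ H := by grind
  have h₁ : Sim k (fstEnd h :: (lone H ++ fstEnd a :: (A ++ [fstEnd s, none, sndEnd s, sndEnd a])))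
      (fstEnd h :: fstEnd a :: (A ++ fstEnd s :: none :: sndEnd s :: sndEnd a :: lone H)) :=
    (Sim.shift' (a, true) H [fstEnd h] (A ++ [fstEnd s, none, sndEnd s]) []
      (by simp [otherEnd]) (by simp [otherEnd]) (by simp [otherEnd]; grind)).symm
  have h₂ := h₁.trans (Sim.single _ (h, true) (by simp [otherEnd]; grind))
  -- The double slide of `a`: one end jumps over `h` to the front of the isolated `h'`, the other
  -- over `s'` to the front of `s`. The result is `h A a' s | s' H | a h'`.
  have h₃ : Sim k (fstEnd h :: (lone H ++ fstEnd a :: (A ++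
      [fstEnd s, none, sndEnd s, sndEnd a])))
      (fstEnd h :: (A ++ sndEnd a :: fstEnd s :: none :: sndEnd s :: (lone H ++
        [none, fstEnd a, sndEnd h]))) := by
    refine h₂.trans (Sim.slide₂ (x := (a, false)) (p := (h, false)) (p₁ := (s, true))
      (A := []) (B := A ++ fstEnd s :: none :: sndEnd s :: sndEnd a :: (lone H ++
        [none, sndEnd h]))
      (C := fstEnd h :: (A ++ fstEnd s :: none :: sndEnd s :: sndEnd a :: (lone H ++ [none])))
      (D := []) (A₁ := fstEnd h :: (A ++ [fstEnd s, none]))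
      (B₁ := lone H ++ [none, fstEnd a, sndEnd h]) (C₁ := fstEnd h :: A)
      (D₁ := none :: sndEnd s :: (lone H ++ [none, fstEnd a, sndEnd h])) ?_ rfl ?_ ?_ ?_ ?_ ?_) <;>
      simp [otherEnd]
  have h₄ : Sim k (fstEnd h :: (lone H ++ fstEnd a :: (A ++
      [fstEnd s, none, sndEnd s, sndEnd a])))
      (fstEnd h :: (A ++ sndEnd a :: (lone H ++ [fstEnd s, none, sndEnd s,
        none, fstEnd a, sndEnd h]))) :=
    h₃.trans (Sim.shift' (s, true) H (fstEnd h :: (A ++ [sndEnd a])) [none]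
      [none, fstEnd a, sndEnd h] (by simp [otherEnd]) (by simp [otherEnd])
      (by simp [otherEnd]; grind))
  -- Now `s'` is alone in its block and can be dropped: `s` has become a lone end.
  have h₅ : Sim k (fstEnd h :: (lone H ++ fstEnd a :: (A ++
      [fstEnd s, none, sndEnd s, sndEnd a])))
      (fstEnd h :: (A ++ sndEnd a :: (lone H ++ [fstEnd s, none, fstEnd a, sndEnd h])) ++
        [none, sndEnd s]) :=
    (h₄.trans (.of_eq (by simp))).trans ((Sim.rotate₃ (fstEnd h :: (A ++ sndEnd a :: (lone H ++
      [fstEnd s]))) [sndEnd s] [fstEnd a, sndEnd h]).trans (Sim.rotate' [sndEnd s] (fstEnd h ::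
      (A ++ sndEnd a :: (lone H ++ [fstEnd s, none, fstEnd a, sndEnd h]))) (by simp) (by simp)))
  have h₆ : Sim k (fstEnd h :: (lone H ++ fstEnd a :: (A ++
      [fstEnd s, none, sndEnd s, sndEnd a])))
      (fstEnd h :: (A ++ sndEnd a :: none :: (lone H ++ [fstEnd s, fstEnd a, sndEnd h]))) :=
    (h₅.trans (Sim.single _ (s, true) (by simp; grind)).symm).trans
      (Sim.shift (a, true) (H ++ [s]) (fstEnd h :: A) [none] [sndEnd h]
        (by simp [otherEnd]) (by simp [otherEnd]) (by simp [otherEnd]; grind))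
  have h₇ := h₆.trans (Sim.rotate' (fstEnd h :: (A ++ [sndEnd a])) (lone H ++
    [fstEnd s, fstEnd a, sndEnd h]) (by simp) rfl)
  -- In `H s a h' | h A a'` the vertices `s` and `h` have exchanged roles: `h` is now the one at a
  -- break. The relabelling restores the names.
  obtain ⟨σ, hσ, hσ'⟩ := exists_flip [h]
  have h₈ := h₇.trans (Sim.relabel (Equiv.swap s h) σ _)
  refine .trans (.of_eq (by simp [hA])) (h₈.trans (.of_eq ?_))
  have hAr : relabelList (Equiv.swap s h) σ A = A := relabelList_eq_self fun i hi =>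
    ⟨Equiv.swap_apply_of_ne_of_ne (by grind) (by grind), by grind⟩
  have hHr : relabelList (Equiv.swap s h) σ (lone H) = lone H := relabelList_eq_self fun i hi =>
    ⟨Equiv.swap_apply_of_ne_of_ne (by rintro rfl; simp at hi; grind)
      (by rintro rfl; simp at hi; grind), by simp at hi; grind⟩
  have hs : σ s = false := by grind
  have ha : σ a = false := by grind
  have hh : σ h = true := by grind
  have hae : Equiv.swap s h a = a := Equiv.swap_apply_of_ne_of_ne (by grind) (by grind)
  simp only [relabelList] at hAr hHr ⊢
  simp [relabel_mk, hAr, hHr, hs, ha, hh, hae]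
  simp [hA]

/-- Moving the relations of a thread from its end to its beginning. -/
theorem Sim.rotate_thread {a : V} {H Y X : List V} {K : List (Option (V × Bool))} (hH : H ≠ [])
    (hn : (a :: (H ++ (Y ++ X))).Nodup) (hK : ∀ i, some i ∈ K → i.1 ∉ a :: (H ++ (Y ++ X))) :
    Sim k (lone H ++ fstEnd a :: (thread Y ++ (K ++ (thread X ++ [sndEnd a]))))
      (lone (H.rotate X.length) ++ fstEnd a :: (thread (X ++ Y) ++ (K ++ [sndEnd a]))) := by
  induction X using List.reverseRecOn generalizing H Y with
  | nil => simpa using refl _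
  | append_singleton X s ih =>
    cases H with
    | nil => exact absurd rfl hH
    | cons h H =>
      have hp : (a :: s :: h :: (H ++ (Y ++ X))).Perm (a :: (h :: H ++ (Y ++ (X ++ [s])))) :=
        List.perm_iff_count.2 fun v => by simp [List.count_cons]; ring
      have hp' : (a :: (H ++ [h] ++ (s :: Y ++ X))).Perm (a :: (h :: H ++ (Y ++ (X ++ [s])))) :=
        List.perm_iff_count.2 fun v => by simp [List.count_cons]; ring
      have h₁ := rotate_thread_aux (k := k) (hp.nodup_iff.2 hn)
        fun i hi => hp.mem_iff.not.2 (hK i hi)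
      have h₂ := ih (H := H ++ [h]) (Y := s :: Y) (by simp) (hp'.nodup_iff.2 hn)
        fun i hi => hp'.mem_iff.not.2 (hK i hi)
      refine .trans h₁ (.trans (.of_eq (by simp)) (h₂.trans (.of_eq ?_)))
      simp [List.rotate_cons_succ]

set_option maxHeartbeats 1000000 in
-- A double slide of `a` turns `s` into a lone end, and with `H = C s` one reaches `H a F b T E b' X
-- a'`. By `Sim.rotate_thread` the thread `X` passes to the beginning of the chain from `a` to `a'`,
-- at the price of a rotation of `H`; this gives a normal form. The reverse of the normal form,
-- relabelled, is carried to the normal form by moving `H` in front of `a` and applying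
-- `Sim.rotate_thread` once more. For this reason the relabelling maps the rotated and reversed `H`
-- to `H`.
theorem sim_reverse_two {a b s : V} {T E C X F : List V}
    (h : (a :: b :: s :: (T ++ (E ++ (C ++ (X ++ F))))).Nodup)
    (hc : ∀ v, v ∈ a :: b :: s :: (T ++ (E ++ (C ++ (X ++ F))))) {L : List (Option (V × Bool))}
    (hL : L = fstEnd b :: (thread T ++ (lone E ++ sndEnd b :: (lone C ++ fstEnd a ::
      (thread X ++ fstEnd s :: none :: sndEnd s :: (lone F ++ [sndEnd a])))))) :
    Sim k L L.reverse := by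
  obtain ⟨H, hH⟩ : ∃ H, H = C ++ [s] := ⟨_, rfl⟩
  have hH' : ∀ v, H.count v = C.count v + [s].count v := by simp [hH]
  have hm : ∀ v, v ∈ H ↔ v ∈ C ∨ v = s := by simp [hH]
  have hr : ∀ v, (H.rotate X.length).count v = C.count v + [s].count v := fun v => by
    rw [← hH', (List.rotate_perm H _).count_eq]
  have hmr : ∀ v, v ∈ H.rotate X.length ↔ v ∈ C ∨ v = s := fun v => by
    rw [List.mem_rotate, hm]
  obtain ⟨e, he⟩ := exists_perm_blocks
    [[a], [b], T.reverse, E.reverse, X.reverse, F.reverse, (H.rotate X.length).reverse]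
    [[a], [b], T, E, X, F, H] h hc
    (fun v => by simp [List.count_cons, hr]; ring) (fun v => by simp [List.count_cons, hH']; ring)
    (by simp)
  simp only [List.map_cons, List.map_nil, List.cons.injEq, and_true] at he
  have hn : (a :: (H ++ ([] ++ X))).Nodup := by
    refine List.nodup_iff_count_le_one.2 fun v => ?_
    have := List.nodup_iff_count_le_one.1 h v
    simp only [List.count_cons, List.count_append, List.count_nil, hH'] at this ⊢
    omega
  simp only [List.nodup_cons, List.nodup_append, List.mem_cons, List.mem_append, not_or] at h
  obtain ⟨σ, hσ, hσ'⟩ := exists_flip (a :: b :: (T ++ X))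
  have h₁ : Sim k L (fstEnd b :: (thread T ++ (lone E ++ sndEnd b :: (lone C ++ fstEnd a ::
      (lone F ++ (thread X ++ [fstEnd s, none, sndEnd s, sndEnd a])))))) :=
    Sim.thread_lone (X ++ [s]) F (fstEnd b :: (thread T ++ (lone E ++ sndEnd b :: (lone C ++
      [fstEnd a])))) [sndEnd a] (by simp [hL]) (by simp) (by simp; clear he hc; clear! L; grind)
  have h₂ : Sim k L (fstEnd b :: (thread T ++ (lone E ++ sndEnd b :: fstEnd a :: (lone F ++
      (thread X ++ fstEnd s :: none :: sndEnd s :: sndEnd a :: lone C))))) :=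
    h₁.trans (Sim.shift' (a, true) C (fstEnd b :: (thread T ++ (lone E ++ [sndEnd b])))
      (lone F ++ (thread X ++ [fstEnd s, none, sndEnd s])) [] (by simp [otherEnd])
      (by simp [otherEnd]) (by simp [otherEnd]; clear he hc; clear! L; grind)).symm
  -- The double slide: `a` jumps over `b'` to the front of `b`, and `a'` over `s'` to the front of
  -- `s`.
  have h₃ : Sim k L (fstEnd a :: fstEnd b :: (thread T ++ (lone E ++ sndEnd b :: (lone F ++
      (thread X ++ sndEnd a :: fstEnd s :: none :: sndEnd s :: lone C))))) := by
    refine h₂.trans (Sim.slide₂ (x := (a, false)) (p := (b, true)) (p₁ := (s, true))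
      (A := fstEnd b :: (thread T ++ lone E))
      (B := lone F ++ (thread X ++ fstEnd s :: none :: sndEnd s :: sndEnd a :: lone C))
      (C := [])
      (D := thread T ++ (lone E ++ sndEnd b :: (lone F ++ (thread X ++ fstEnd s :: none ::
        sndEnd s :: sndEnd a :: lone C))))
      (A₁ := fstEnd a :: fstEnd b :: (thread T ++ (lone E ++ sndEnd b :: (lone F ++ (thread X ++
        [fstEnd s, none])))))
      (B₁ := lone C)
      (C₁ := fstEnd a :: fstEnd b :: (thread T ++ (lone E ++ sndEnd b :: (lone F ++ thread X))))
      (D₁ := none :: sndEnd s :: lone C) ?_ rfl ?_ ?_ ?_ ?_ ?_) <;>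
      simp [otherEnd, h.2.1.1]
  have h₄ := h₃.trans (Sim.shift' (b, true) F [fstEnd a] (thread T ++ lone E)
    (thread X ++ sndEnd a :: fstEnd s :: none :: sndEnd s :: lone C) (by simp [otherEnd]) rfl
    (by simp [otherEnd]; clear he hc; clear! L; grind))
  have h₅ : Sim k L (fstEnd a :: (lone F ++ fstEnd b :: (thread T ++ (lone E ++ sndEnd b ::
      (thread X ++ sndEnd a :: (lone C ++ [fstEnd s]))))) ++ [none, sndEnd s]) :=
    h₄.trans (Sim.shift' (s, true) C (fstEnd a :: (lone F ++ fstEnd b :: (thread T ++ (lone E ++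
      sndEnd b :: (thread X ++ [sndEnd a]))))) [none] [] (by simp [otherEnd]) (by simp [otherEnd])
      (by simp [otherEnd]; clear he hc; clear! L; grind))
  -- The isolated `s'` is dropped, and `C` and `s` together slide over `a'` to the front of `a`.
  have h₆ : Sim k L (lone H ++ fstEnd a :: (thread [] ++ ((lone F ++ fstEnd b :: (thread T ++
      (lone E ++ [sndEnd b]))) ++ (thread X ++ [sndEnd a])))) :=
    (h₅.trans (Sim.single _ (s, true) (by simp; clear he hc; clear! L; grind)).symm).trans
      (Sim.shift' (a, true) H [] (lone F ++ fstEnd b :: (thread T ++ (lone E ++ sndEnd b ::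
        thread X))) [] (by simp [otherEnd, hH]) (by simp [otherEnd])
        (by simp [otherEnd]; clear he hc; clear! L; grind))
  have h₇ := h₆.trans (Sim.rotate_thread (by simp [hH]) hn (by
    rintro ⟨i, c⟩
    simp
    clear he hc hn
    clear! L
    grind))
  -- The starting point `a b E T b' F X a' H` is the relabelled reverse of the normal form reached
  -- in `h₇`.
  have h₈ := Sim.shift' (k := k) (a, true) H [] (fstEnd b :: (lone E ++ (thread T ++ sndEnd b ::
    (lone F ++ thread X)))) [] rfl rfl (by simp [otherEnd]; clear he hc; clear! L; grind)
  have h₉ := h₈.trans (.trans (.of_eq (by simp [otherEnd])) (Sim.rotate_thread (K := fstEnd b ::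
    (lone E ++ (thread T ++ sndEnd b :: lone F))) (by simp [hH]) hn (by
    rintro ⟨i, c⟩
    simp
    clear he hc hn
    clear! L
    grind)))
  have hu := h₉.trans (Sim.shift' (b, true) F (lone (H.rotate X.length) ++ fstEnd a :: thread X)
    (lone E ++ thread T) [sndEnd a] (by simp [otherEnd]) rfl
    (by simp [otherEnd]; clear he hc hn; clear! L; grind))
  have hv := hu.trans (Sim.thread_lone T E (lone (H.rotate X.length) ++ fstEnd a :: (thread X ++
    (lone F ++ [fstEnd b]))) [sndEnd b, sndEnd a] rfl (by simp [otherEnd])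
    (by simp; clear he hc hn; clear! L; grind)).symm
  have hw : Sim k (lone (H.rotate X.length) ++ fstEnd a :: (thread (X ++ []) ++ ((lone F ++
      fstEnd b :: (thread T ++ (lone E ++ [sndEnd b]))) ++ [sndEnd a]))) _ :=
    (Sim.of_eq (by simp [otherEnd])).trans hv.symm
  refine h₇.trans (.trans (.trans hw (.trans (.of_eq ?_) (Sim.relabel (k := k) e σ _).symm))
    h₇.reverse.symm)
  have hG := relabel_lone_reverse e σ (C := H.rotate X.length) (by clear he hc; clear! L; grind)
  have hE := relabel_lone_reverse e σ (C := E) (by clear he hc; clear! L; grind)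
  have hF := relabel_lone_reverse e σ (C := F) (by clear he hc; clear! L; grind)
  have hT := relabel_thread_reverse e σ (S := T) (by clear he hc; clear! L; grind)
  have hX := relabel_thread_reverse e σ (S := X) (by clear he hc; clear! L; grind)
  have hb : σ b = true := by clear he hc; clear! L; grind
  have ha : σ a = true := by clear he hc; clear! L; grind
  simp only [relabelList] at hG hE hF hT hX ⊢
  simp only [otherEnd, List.reverse_append, List.reverse_cons, List.reverse_nil, List.nil_append,
    List.append_assoc, List.cons_append, List.map_append, List.map_cons, List.map_nil,
    List.append_nil,
    Option.map_some, Option.map_none, relabel_mk, hG, hE, hF, hT, hX, ha, hb, he, Bool.xor_self,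
    Bool.xor_true, Bool.not_false, Bool.not_true, Bool.xor_false]

end EndList

/-! ### Neighbouring ends of a list -/

namespace EndList

variable {V : Type} {A B L : List (Option (V × Bool))} {i j l c : V × Bool}

/-- The end `i` comes immediately before the end `j` in the list. -/
def Adj : List (Option (V × Bool)) → V × Bool → V × Bool → Prop
  | [], _, _ => False
  | none :: L, i, j => Adj L i j
  | some a :: L, i, j => a = i ∧ L.head? = some (some j) ∨ Adj L i j

theorem Adj.cons (h : Adj L i j) (a : Option (V × Bool)) : Adj (a :: L) i j := by
  cases a with
  | none => exact h
  | some a => exact Or.inr h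

theorem Adj.lt (h : Adj L i j) : Lt L i j := by
  induction L with
  | nil => exact h
  | cons a L ih =>
    cases a with
    | none => exact ih h
    | some a =>
      rcases h with ⟨h1, h2⟩ | h
      · refine Or.inl ⟨h1, ?_⟩
        cases L with
        | nil => simp at h2
        | cons b L =>
          obtain rfl : b = some j := by simpa using h2
          exact Or.inl rfl
      · exact Or.inr (ih h)

theorem Adj.left_unique (hn : Nd L) (h : Adj L i l) (h' : Adj L j l) : i = j := by
  induction L with
  | nil => exact h.elim
  | cons a L ih =>
    cases a with
    | none => exact ih (nd_cons_none.1 hn) h h'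
    | some a =>
      have hn' := (nd_cons_some.1 hn).2
      have key : ∀ {i}, L.head? = some (some l) → ¬ Adj L i l := by
        intro i h1 h2
        cases L with
        | nil => simp at h1
        | cons b L =>
          obtain rfl : b = some l := by simpa using h1
          rcases h2 with ⟨-, h2⟩ | h2
          · exact (nd_cons_some.1 hn').1 (List.mem_of_mem_head? h2)
          · exact (nd_cons_some.1 hn').1 h2.lt.mem.2
      rcases h with ⟨rfl, h⟩ | h <;> rcases h' with ⟨rfl, h'⟩ | h'
      · rfl
      · exact absurd h' (key h)
      · exact absurd h (key h')
      · exact ih hn' h h'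

theorem Reach.transGen (h : Reach L j) : Relation.TransGen (Adj (some c :: L)) c j := by
  induction L generalizing c with
  | nil => exact h.elim
  | cons a L ih =>
    cases a with
    | none => exact h.elim
    | some a =>
      have h1 : Adj (some c :: some a :: L) c a := Or.inl ⟨rfl, rfl⟩
      rcases h with rfl | h
      · exact .single h1
      · exact .head h1 (Relation.TransGen.mono (fun _ _ h => h.cons _) _ _ (ih h))

/-- Neighbours will correspond to arrows, so this says that every comparison is realized by a path.
-/
theorem Lt.transGen (h : Lt L i j) : Relation.TransGen (Adj L) i j := by
  induction L with
  | nil => exact h.elim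
  | cons a L ih =>
    cases a with
    | none => exact Relation.TransGen.mono (fun _ _ h => h.cons _) _ _ (ih h)
    | some a =>
      rcases h with ⟨rfl, h⟩ | h
      · exact h.transGen
      · exact Relation.TransGen.mono (fun _ _ h => h.cons _) _ _ (ih h)

theorem adj_append_cons : Adj (A ++ some c :: B) i j ↔ Adj (A ++ [some c]) i j ∨
    Adj (some c :: B) i j := by
  induction A with
  | nil => simp [Adj]
  | cons a A ih =>
    have : (A ++ some c :: B).head? = (A ++ [some c]).head? := by cases A <;> rfl
    cases a with
    | none => simpa [Adj] using ih
    | some a => simp only [List.cons_append, Adj, ih, this, or_assoc]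

end EndList

/-! ### The algebra of a bound quiver as an algebra of matrices -/

namespace ZeroRelQuiver

open EndList PathAlgebra

/-- A presentation of the quiver `Q` with relations by a list of ends: every arrow leads from an end of
its starting vertex to an end of its terminating vertex which is the next one in the list, and a product
of arrows is a relation unless the two ends in the middle agree. -/
structure Presentation (Q : ZeroRelQuiver) (L : List (Option (Q.V × Bool))) where
  i : Q.E → Q.V × Bool
  j : Q.E → Q.V × Bool
  fst_i : ∀ e, (i e).1 = Q.s e
  fst_j : ∀ e, (j e).1 = Q.t e
  nd : Nd L
  adj : ∀ a b, Adj L a b ↔ ∃ e, i e = a ∧ j e = b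
  inj : Function.Injective i
  rel : ∀ e f, Q.s e = Q.t f → (Q.rel e f ↔ j f ≠ i e)

variable {Q : ZeroRelQuiver} {L : List (Option (Q.V × Bool))}

namespace Presentation

variable (P : Presentation Q L) (k : Type u) [Field k]

theorem lt (e : Q.E) : (order L).lt (P.i e) (P.j e) :=
  ⟨P.nd, ((P.adj _ _).2 ⟨e, rfl, rfl⟩).lt⟩

/-- An end has at most one predecessor in the list, so arrows arriving at the same end also start at
the same end. -/
theorem j_inj {e f : Q.E} (h : P.j e = P.j f) : e = f :=
  P.inj (((P.adj _ _).2 ⟨e, rfl, rfl⟩).left_unique P.nd ((P.adj _ _).2 ⟨f, rfl, h.symm⟩))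

/-- The paths which contain no relation, with the end where they start and the end where they
terminate. -/
inductive Good : ∀ {x y : Q.V}, Quiver.Path x y → Q.V × Bool → Q.V × Bool → Prop
  | single (e : Q.E) : Good (Quiver.Hom.toPath (⟨e, rfl, rfl⟩ : Q.s e ⟶ Q.t e)) (P.i e) (P.j e)
  | cons {x : Q.V} (e : Q.E) (p : Quiver.Path x (Q.s e)) {a : Q.V × Bool} (h : Good p a (P.i e)) :
    Good (p.cons (⟨e, rfl, rfl⟩ : Q.s e ⟶ Q.t e)) a (P.j e)

variable {P} in
theorem Good.lt {x y : Q.V} {p : Quiver.Path x y} {a b : Q.V × Bool} (h : P.Good p a b) :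
    (order L).lt a b := by
  induction h with
  | single e => exact P.lt e
  | cons e p h ih => exact (order L).trans ih (P.lt e)

variable {P} in
-- The last arrow is determined by the end where it arrives, and removing it allows induction. Paths
-- of different lengths cannot share both ends, since the order is strict.
theorem Good.eq {x y : Q.V} {p : Quiver.Path x y} {a b : Q.V × Bool} (h : P.Good p a b)
    {x' y' : Q.V} {p' : Quiver.Path x' y'} {a' b' : Q.V × Bool} (h' : P.Good p' a' b')
    (ha : a = a') (hb : b = b') : (⟨x, y, p⟩ : Q.AnyPath) = ⟨x', y', p'⟩ := by
  induction h generalizing x' y' a' b' with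
  | single e =>
    cases h' with
    | single e' => obtain rfl := P.j_inj hb; rfl
    | cons e' p' h' =>
      obtain rfl := P.j_inj hb
      exact absurd (ha ▸ h'.lt) ((order L).irrefl _)
  | cons e p h ih =>
    cases h' with
    | single e' =>
      obtain rfl := P.j_inj hb
      exact absurd (ha ▸ h.lt) ((order L).irrefl _)
    | cons e' p' h' =>
      obtain rfl := P.j_inj hb
      have := ih h' ha rfl
      simp only [Sigma.mk.injEq] at this
      obtain ⟨rfl, h2⟩ := this
      have h2 := eq_of_heq h2
      simp only [Sigma.mk.injEq, heq_eq_eq, true_and] at h2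
      rw [h2]

theorem exists_good {a b : Q.V × Bool} (h : (order L).lt a b) :
    ∃ (x y : Q.V) (p : Quiver.Path x y), P.Good p a b ∧ b.1 = y := by
  replace h := h.2.transGen
  induction h with
  | single h =>
    obtain ⟨e, rfl, rfl⟩ := (P.adj _ _).1 h
    exact ⟨_, _, _, .single e, P.fst_j e⟩
  | tail _ h ih =>
    obtain ⟨e, rfl, rfl⟩ := (P.adj _ _).1 h
    obtain ⟨x, y, p, hp, hy⟩ := ih
    obtain rfl : Q.s e = y := by rw [← P.fst_i, hy]
    exact ⟨_, _, _, .cons e p hp, P.fst_j e⟩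

/-- The end where the last arrow of a path terminates. -/
def lastEnd {x y : Q.V} : Quiver.Path x y → Option (Q.V × Bool)
  | .nil => none
  | .cons _ e => some (P.j e.1)

variable {P} in
theorem Good.lastEnd_eq {x y : Q.V} {p : Quiver.Path x y} {a b : Q.V × Bool}
    (h : P.Good p a b) : P.lastEnd p = some b := by
  cases h <;> rfl

theorem ofPath_cons {x y z : Q.V} (e : y ⟶ z) (p : Quiver.Path x y) :
    ofPath k (⟨x, z, p.cons e⟩ : Q.AnyPath) = arrow k e.1 * ofPath k ⟨x, y, p⟩ := by
  obtain ⟨e, rfl, rfl⟩ := e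
  rw [arrow, ofPath_mul_ofPath_of_eq]
  rfl

/-- When an arrow is appended to a good path, it either starts at the end where the path arrived,
and the path remains good, or its product with the preceding arrow is a relation. -/
theorem nil_or_good_or_mem {x y : Q.V} (p : Quiver.Path x y) :
    p.length = 0 ∨ (∃ a b, P.Good p a b) ∨ ofPath k (⟨x, y, p⟩ : Q.AnyPath) ∈ Q.relIdeal k := by
  induction p with
  | nil => exact Or.inl rfl
  | cons p e ih =>
    refine Or.inr ?_
    rcases ih with h | ⟨a, b, h⟩ | h
    · cases p with
      | nil =>
        obtain ⟨e, rfl, rfl⟩ := e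
        exact Or.inl ⟨_, _, .single e⟩
      | cons p f => cases h
    · by_cases hb : b = P.i e.1
      · obtain ⟨e, rfl, rfl⟩ := e
        subst hb
        exact Or.inl ⟨_, _, .cons e p h⟩
      · right
        cases p with
        | nil => exact absurd h.lastEnd_eq (by simp [lastEnd])
        | cons p f =>
          have hst : Q.s e.1 = Q.t f.1 := e.2.1.trans f.2.2.symm
          rw [ofPath_cons, ofPath_cons, ← mul_assoc]
          exact (Q.relIdeal k).mul_mem_right _ _ (TwoSidedIdeal.subset_span
            ⟨e.1, f.1, (P.rel _ _ hst).2 fun hj => hb ((Option.some.inj h.lastEnd_eq).symm.trans hj),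
              rfl⟩)
    · right
      rw [ofPath_cons]
      exact (Q.relIdeal k).mul_mem_left _ _ h

theorem connected (P : Presentation Q L) (h : Nonempty Q.V)
    (h' : ∀ v w, Relation.EqvGen (fun v w => ∃ e, Q.s e = v ∧ Q.t e = w) v w) :
    (order L).Connected := by
  refine ⟨h, fun v w => Relation.EqvGen.mono ?_ v w (h' v w)⟩
  rintro _ _ ⟨e, rfl, rfl⟩
  exact ⟨_, _, P.lt e, P.fst_i e, P.fst_j e⟩

variable [DecidableEq Q.V]

/-- The value of a path in the algebra of matrices. -/
noncomputable def eval {x : Q.V} : ∀ {y : Q.V}, Quiver.Path x y → (order L).alg k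
  | _, .nil => (order L).idem k x
  | _, .cons p e => EndOrder.unit k (P.lt e.1) * eval p

theorem idem_mul_eval {x y : Q.V} (p : Quiver.Path x y) :
    (order L).idem k y * P.eval k p = P.eval k p := by
  cases p with
  | nil => exact EndOrder.idem_mul_idem x
  | cons p e =>
    obtain ⟨e, rfl, rfl⟩ := e
    rw [eval, ← mul_assoc]
    congr 1
    refine Subtype.ext (Matrix.ext fun j i => ?_)
    rw [MulMemClass.coe_mul, EndOrder.idem_mul_apply, EndOrder.unit_apply]
    have := P.fst_j e
    grind

theorem eval_mul_idem {x y : Q.V} (p : Quiver.Path x y) :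
    P.eval k p * (order L).idem k x = P.eval k p := by
  induction p with
  | nil => exact EndOrder.idem_mul_idem x
  | cons p e ih => rw [eval, mul_assoc, ih]

theorem eval_comp {x y z : Q.V} (p : Quiver.Path x y) (q : Quiver.Path y z) :
    P.eval k (p.comp q) = P.eval k q * P.eval k p := by
  induction q with
  | nil => exact (P.idem_mul_eval k p).symm
  | cons q e ih => rw [Quiver.Path.comp_cons, eval, ih, eval, mul_assoc]

theorem eval_mul_of_ne {x y x' y' : Q.V} (p : Quiver.Path x y) (q : Quiver.Path x' y')
    (h : y' ≠ x) : P.eval k p * P.eval k q = 0 := by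
  rw [← P.eval_mul_idem, ← P.idem_mul_eval k q, mul_assoc, ← mul_assoc ((order L).idem k x)]
  have : (order L).idem k x * (order L).idem k y' = 0 := by
    refine Subtype.ext (Matrix.ext fun j i => ?_)
    rw [MulMemClass.coe_mul, EndOrder.idem_mul_apply, EndOrder.idem_apply]
    simp
    grind
  rw [this, zero_mul, mul_zero]

variable {P} in
theorem Good.eval_eq {x y : Q.V} {p : Quiver.Path x y} {a b : Q.V × Bool} (h : P.Good p a b) :
    P.eval k p = EndOrder.unit k h.lt := by
  induction h with
  | single e =>
    refine Subtype.ext (Matrix.ext fun j i => ?_)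
    change (EndOrder.unit k (P.lt e) * (order L).idem k (Q.s e)).1 j i = _
    rw [MulMemClass.coe_mul, EndOrder.mul_idem_apply, EndOrder.unit_apply]
    have := P.fst_i e
    grind
  | cons e p h ih =>
    refine Subtype.ext (Matrix.ext fun j i => ?_)
    rw [eval, ih, MulMemClass.coe_mul, EndOrder.unit_mul_apply, EndOrder.unit_apply,
      EndOrder.unit_apply]
    grind

/-- The homomorphism from the path algebra to the algebra of matrices. -/
noncomputable def hom : Q.PathAlgebra k →ₐ[k] (order L).alg k :=
  AlgHom.ofLinearMap ((PathAlgebra.basis k).constr k fun p => P.eval k p.2.2) (by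
    rw [one_def, map_sum]
    simp only [ofPath, Module.Basis.constr_basis, eval]
    refine Subtype.ext (Matrix.ext fun j i => ?_)
    rw [AddSubmonoidClass.coe_finsetSum, Matrix.sum_apply]
    simp only [EndOrder.idem_apply, OneMemClass.coe_one, Matrix.one_apply]
    split_ifs <;> simp [*]) fun f g => by
    induction f using PathAlgebra.induction with
    | zero => simp
    | add f f' hf hf' => rw [add_mul, map_add, hf, hf', map_add, add_mul]
    | basis' a p =>
      induction g using PathAlgebra.induction with
      | zero => simp
      | add g g' hg hg' => rw [mul_add, map_add, hg, hg', map_add, mul_add]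
      | basis' b q =>
        rw [smul_mul_smul_comm, map_smul, map_smul, map_smul, smul_mul_smul_comm]
        congr 1
        obtain ⟨x, y, p⟩ := p
        obtain ⟨x', y', q⟩ := q
        by_cases h : y' = x
        · subst h
          rw [ofPath_mul_ofPath_of_eq]
          simp only [ofPath, Module.Basis.constr_basis, eval_comp]
        · rw [ofPath_mul_ofPath_of_ne k (q := ⟨x', y', q⟩) h, map_zero]
          simp only [ofPath, Module.Basis.constr_basis]
          rw [P.eval_mul_of_ne k p q h]

theorem hom_ofPath (p : Q.AnyPath) : P.hom k (ofPath k p) = P.eval k p.2.2 :=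
  (PathAlgebra.basis k).constr_basis k _ p

theorem hom_eq_zero {f : Q.PathAlgebra k} (hf : f ∈ Q.relIdeal k) : P.hom k f = 0 := by
  have : Q.relIdeal k ≤ TwoSidedIdeal.ker (P.hom k) := by
    refine TwoSidedIdeal.span_le.2 ?_
    rintro _ ⟨e, f, h, rfl⟩
    refine (TwoSidedIdeal.mem_ker _).2 ?_
    by_cases hst : Q.s e = Q.t f
    · have hne := (P.rel e f hst).1 h
      have he : P.hom k (arrow k e) = EndOrder.unit k (P.lt e) :=
        (P.hom_ofPath k _).trans ((Good.single e).eval_eq k)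
      have hf : P.hom k (arrow k f) = EndOrder.unit k (P.lt f) :=
        (P.hom_ofPath k _).trans ((Good.single f).eval_eq k)
      rw [map_mul, he, hf]
      refine Subtype.ext (Matrix.ext fun j i => ?_)
      rw [MulMemClass.coe_mul, EndOrder.unit_mul_apply, EndOrder.unit_apply]
      simp
      grind
    · rw [arrow, arrow, ofPath_mul_ofPath_of_ne, map_zero]
      exact fun h => hst h.symm
  exact (TwoSidedIdeal.mem_ker _).1 (this hf)

/-- A linear section of the homomorphism. -/
noncomputable def linSection : (order L).alg k →ₗ[k] Q.PathAlgebra k where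
  -- Idempotents go to trivial paths, and a matrix unit goes to the good path between its two ends,
  -- which is unique by `Good.eq`.
  toFun M := ∑ v, M.1 (v, false) (v, false) • ofPath k (⟨v, v, .nil⟩ : Q.AnyPath) +
    ∑ a, ∑ b, open Classical in if h : (order L).lt a b then
      M.1 b a • ofPath k (⟨_, _, (P.exists_good h).choose_spec.choose_spec.choose⟩ : Q.AnyPath)
      else 0
  map_add' M N := by
    have (a b : k) (x : Q.PathAlgebra k) : (a + b) • x = a • x + b • x := add_smul a b x
    simp only [AddMemClass.coe_add, Matrix.add_apply, this, Finset.sum_add_distrib]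
    rw [add_add_add_comm]
    congr 1
    simp only [← Finset.sum_add_distrib]
    refine Finset.sum_congr rfl fun a _ => Finset.sum_congr rfl fun b _ => ?_
    split_ifs <;> simp
  map_smul' c M := by
    simp only [RingHom.id_apply, smul_add, Finset.smul_sum, smul_dite, smul_zero, smul_smul]
    rfl

variable {P} in
theorem Good.linSection {x y : Q.V} {p : Quiver.Path x y} {a b : Q.V × Bool} (h : P.Good p a b) :
    P.linSection k (EndOrder.unit k h.lt) = ofPath k (⟨x, y, p⟩ : Q.AnyPath) := by
  have hne : a ≠ b := fun hab => (order L).irrefl a (by simpa [hab] using h.lt)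
  simp only [Presentation.linSection, LinearMap.coe_mk, AddHom.coe_mk, EndOrder.unit_apply]
  rw [Finset.sum_eq_zero, zero_add, Finset.sum_eq_single a, Finset.sum_eq_single b,
    dif_pos h.lt, if_pos ⟨rfl, rfl⟩, one_smul]
  · congr 1
    exact (P.exists_good h.lt).choose_spec.choose_spec.choose_spec.1.eq h rfl rfl
  · intro b' _ hb
    rw [if_neg fun h => hb h.1.symm]
    simp
  · simp
  · intro a' _ ha
    refine Finset.sum_eq_zero fun b' _ => ?_
    rw [if_neg fun h => ha h.2.symm]
    simp
  · simp
  · intro v _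
    rw [if_neg fun h => hne (h.2.trans h.1.symm), zero_smul]

theorem linSection_idem (x : Q.V) :
    P.linSection k ((order L).idem k x) = ofPath k (⟨x, x, .nil⟩ : Q.AnyPath) := by
  simp only [Presentation.linSection, LinearMap.coe_mk, AddHom.coe_mk, EndOrder.idem_apply]
  rw [Finset.sum_eq_single x, if_pos (by simp), one_smul, add_eq_left]
  · refine Finset.sum_eq_zero fun a _ => Finset.sum_eq_zero fun b _ => ?_
    split_ifs with h1 h2
    · exact absurd (h2.1 ▸ h1) ((order L).irrefl _)
    · exact zero_smul k _
    · rfl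
  · intro v _ hv
    rw [if_neg fun h => hv h.2, zero_smul]
  · simp

/-- On the basis of paths: trivial and good paths are recovered exactly, while every other path lies
in the ideal and is mapped to zero by `hom`. Hence the kernel of `hom` is the ideal of relations. -/
theorem mk_section_hom (f : Q.PathAlgebra k) :
    ((Q.relIdeal k).ringCon.mk' (P.linSection k (P.hom k f)) : Q.BoundAlgebra k) =
      (Q.relIdeal k).ringCon.mk' f := by
  have : (((Q.relIdeal k).ringCon.mkₐ (α := k)).toLinearMap.comp
      ((P.linSection k).comp (P.hom k).toLinearMap)) =
      ((Q.relIdeal k).ringCon.mkₐ (α := k)).toLinearMap := by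
    refine (PathAlgebra.basis k).ext fun p => ?_
    have h : P.hom k (PathAlgebra.basis k p) = P.eval k p.2.2 := P.hom_ofPath k p
    simp only [LinearMap.comp_apply, AlgHom.toLinearMap_apply, h]
    obtain ⟨x, y, p⟩ := p
    rcases P.nil_or_good_or_mem k p with h0 | ⟨a, b, h0⟩ | h0
    · cases p with
      | nil => rw [eval, P.linSection_idem]; rfl
      | cons p e => cases h0
    · rw [h0.eval_eq k, h0.linSection k]; rfl
    · have h1 := P.hom_eq_zero k h0
      rw [hom_ofPath] at h1
      rw [h1, map_zero, map_zero]
      exact ((RingCon.eq _).2 ((TwoSidedIdeal.mem_iff _ _).1 h0)).symm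
  exact LinearMap.congr_fun this f

theorem hom_section (M : (order L).alg k) : P.hom k (P.linSection k M) = M := by
  classical
  simp only [Presentation.linSection, LinearMap.coe_mk, AddHom.coe_mk, map_add, map_sum, map_smul,
    hom_ofPath, eval]
  have key : ∀ a b, P.hom k (if h : (order L).lt a b then M.1 b a • ofPath k (⟨_, _,
      (P.exists_good h).choose_spec.choose_spec.choose⟩ : Q.AnyPath) else 0) =
      if h : (order L).lt a b then M.1 b a • EndOrder.unit k h else 0 := by
    intro a b
    split_ifs with h
    · rw [map_smul, hom_ofPath,
        (P.exists_good h).choose_spec.choose_spec.choose_spec.1.eval_eq k]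
    · exact map_zero _
  simp only [key]
  refine Subtype.ext (Matrix.ext fun j i => ?_)
  simp only [AddMemClass.coe_add, AddSubmonoidClass.coe_finsetSum, Matrix.add_apply,
    Matrix.sum_apply]
  have h1 : ∑ v, ((M.1 (v, false) (v, false) • (order L).idem k v : (order L).alg k).1 j i) =
      if j = i then M.1 i i else 0 := by
    have : ∀ v, (M.1 (v, false) (v, false) • (order L).idem k v : (order L).alg k).1 j i =
        M.1 (v, false) (v, false) * if j = i ∧ i.1 = v then 1 else 0 := fun v => by
      rw [← EndOrder.idem_apply]; rfl
    simp only [this]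
    rw [Finset.sum_eq_single i.1]
    · split_ifs with h1 h2 h2
      · rw [mul_one]
        exact EndOrder.diag_of_fst M rfl
      · exact absurd h1.1 h2
      · exact absurd ⟨h2, rfl⟩ h1
      · exact mul_zero _
    · intro v _ hv
      rw [if_neg fun h => hv h.2.symm, mul_zero]
    · simp
  have h2 : ∑ a, ∑ b, ((if h : (order L).lt a b then M.1 b a • EndOrder.unit k h else 0 :
      (order L).alg k).1 j i) = if (order L).lt i j then M.1 j i else 0 := by
    have : ∀ a b, (if h : (order L).lt a b then M.1 b a • EndOrder.unit k h else 0 :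
        (order L).alg k).1 j i =
        if (order L).lt a b ∧ b = j ∧ a = i then M.1 b a else 0 := fun a b => by
      split_ifs with h1 h2 h2
      · change M.1 b a * (EndOrder.unit k h1).1 j i = _
        rw [EndOrder.unit_apply, if_pos h2.2, mul_one]
      · change M.1 b a * (EndOrder.unit k h1).1 j i = _
        rw [EndOrder.unit_apply, if_neg fun h => h2 ⟨h1, h⟩, mul_zero]
      · exact absurd h2.1 h1
      · rfl
    simp only [this]
    rw [Finset.sum_eq_single i, Finset.sum_eq_single j]
    · simp
    · intro b _ hb
      exact if_neg fun h => hb h.2.1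
    · simp
    · intro a _ ha
      exact Finset.sum_eq_zero fun b _ => if_neg fun h => ha h.2.2
    · simp
  rw [h1, h2]
  split_ifs with h3 h4 h4
  · exact absurd (h3 ▸ h4) ((order L).irrefl _)
  · rw [h3, add_zero]
  · exact zero_add _
  · rw [add_zero]
    exact (EndOrder.eq_zero M fun h => h.elim (fun h => h3 h.symm) h4).symm

/-- The algebra of the bound quiver is the algebra of the order given by the list. -/
theorem nonempty_equiv (P : Presentation Q L) : Nonempty ((order L).alg k ≃ₐ[k] Q.BoundAlgebra k) := by
  have hs : Function.Surjective (P.hom k) := fun M => ⟨_, P.hom_section k M⟩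
  let g : (order L).alg k →ₗ[k] Q.BoundAlgebra k :=
    ((Q.relIdeal k).ringCon.mkₐ (α := k)).toLinearMap.comp (P.linSection k)
  have hg : ∀ f, g (P.hom k f) = (Q.relIdeal k).ringCon.mkₐ (α := k) f := P.mk_section_hom k
  let g' : (order L).alg k →ₐ[k] Q.BoundAlgebra k := AlgHom.ofLinearMap g
    (by rw [← map_one (P.hom k), hg, map_one]) fun M N => by
      obtain ⟨M, rfl⟩ := hs M
      obtain ⟨N, rfl⟩ := hs N
      rw [← map_mul, hg, hg, hg, map_mul]
  refine ⟨AlgEquiv.ofBijective g' ⟨(injective_iff_map_eq_zero g').2 fun M hM => ?_, fun f => ?_⟩⟩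
  · obtain ⟨f, rfl⟩ := hs M
    have hf : (Q.relIdeal k).ringCon.mkₐ (α := k) f = 0 := (hg f).symm.trans hM
    exact P.hom_eq_zero k ((TwoSidedIdeal.mem_iff _ _).2 ((RingCon.eq _).1 hf))
  · obtain ⟨f, rfl⟩ := RingCon.mkₐ_surjective (α := k) _ f
    exact ⟨P.hom k f, hg f⟩

/-- The reversed list gives the reversed order, whose algebra is the opposite algebra. -/
theorem equivalent_op (P : Presentation Q L) (hO : (order L).Connected) (hL : Sim k L L.reverse) :
    TiltingCotiltingEquivalent k (Q.BoundAlgebra k) (Q.BoundAlgebra k)ᵐᵒᵖ := by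
  obtain ⟨f⟩ := P.nonempty_equiv k
  have h := ((hL.2 P.nd).2 hO).1
  have hO' := ((hL.2 P.nd).1).1 hO
  refine (EndOrder.equivalent_of_equiv hO f .refl).trans (h.trans
    (EndOrder.equivalent_of_equiv hO' .refl ?_))
  rw [← order_rev]
  exact ((order L).opEquiv k).trans (AlgEquiv.op f)

end Presentation

end ZeroRelQuiver

/-! ### Lists of ends along a line of arrows -/

namespace EndList

variable {V : Type} {A B L : List (Option (V × Bool))} {i j l : V × Bool}

theorem nd_append : Nd (A ++ B) ↔ Nd A ∧ Nd B ∧ ∀ i, some i ∈ A → some i ∉ B := by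
  rw [Nd, List.reduceOption_append, List.nodup_append]
  simp only [List.reduceOption_mem_iff, Nd]
  refine and_congr_right fun _ => and_congr_right fun _ => ⟨fun h i hi hi' => h i hi i hi' rfl, ?_⟩
  rintro h i hi _ hi' rfl
  exact h i hi hi'

theorem nd_lone {C : List V} : Nd (lone C) ↔ C.Nodup := by
  induction C with
  | nil => simp [Nd]
  | cons c C ih => simp [nd_cons_some, ih]

theorem nd_thread {C : List V} : Nd (thread C) ↔ C.Nodup := by
  induction C with
  | nil => simp [Nd]
  | cons c C ih => simp [nd_cons_some, nd_cons_none, ih]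

/-- The vertices `m n, m (n - 1), …` of which there are `d`. -/
def down (m : ℕ → V) : ℕ → ℕ → List V
  | _, 0 => []
  | n, d + 1 => m n :: down m (n - 1) d

variable {m : ℕ → V} {n d : ℕ}

theorem down_add (d' : ℕ) : down m n (d + d') = down m n d ++ down m (n - d) d' := by
  induction d generalizing n with
  | zero => simp [down]
  | succ d ih =>
    rw [Nat.add_right_comm, down, ih, down, List.cons_append]
    congr 3
    omega

theorem mem_down (hd : d ≤ n) {v : V} :
    v ∈ down m n d ↔ ∃ k, n - d < k ∧ k ≤ n ∧ m k = v := by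
  induction d generalizing n with
  | zero =>
    simp only [down, List.not_mem_nil, false_iff, not_exists]
    omega
  | succ d ih =>
    rw [down, List.mem_cons, ih (by omega)]
    constructor
    · rintro (rfl | ⟨k, h1, h2, h3⟩)
      · exact ⟨n, by omega, le_rfl, rfl⟩
      · exact ⟨k, by omega, by omega, h3⟩
    · rintro ⟨k, h1, h2, rfl⟩
      rcases eq_or_ne k n with rfl | h
      · exact Or.inl rfl
      · exact Or.inr ⟨k, by omega, by omega, rfl⟩

theorem nodup_down (hd : d ≤ n) (hm : Set.InjOn m (Set.Ioc (n - d) n)) : (down m n d).Nodup := by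
  induction d generalizing n with
  | zero => simp [down]
  | succ d ih =>
    rw [down, List.nodup_cons, mem_down (by omega)]
    refine ⟨?_, ih (by omega) (hm.mono (Set.Ioc_subset_Ioc (by omega) (by omega)))⟩
    rintro ⟨k, h1, h2, h3⟩
    have := hm (x₁ := k) (x₂ := n) ⟨by omega, by omega⟩ ⟨by omega, by omega⟩ h3
    omega

/-- The ends along the vertices `m n, …, m 0` of a line of arrows: the arrow from `m k` to `m (k - 1)`
leads from the end `b k` to the end `c (k - 1)`. -/
def tail (m : ℕ → V) (b c : ℕ → Bool) : ℕ → List (Option (V × Bool))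
  | 0 => [some (m 0, c 0)]
  | n + 1 => some (m (n + 1), c (n + 1)) ::
    if b (n + 1) = c (n + 1) then tail m b c n
    else none :: some (m (n + 1), b (n + 1)) :: tail m b c n

variable {b c : ℕ → Bool}

theorem head_tail : (tail m b c n).head? = some (some (m n, c n)) := by cases n <;> rfl

theorem adj_tail {n : ℕ} : Adj (some (m (n + 1), b (n + 1)) :: tail m b c n) i j ↔
    ∃ k, 1 ≤ k ∧ k ≤ n + 1 ∧ (m k, b k) = i ∧ (m (k - 1), c (k - 1)) = j := by
  -- The tail from `m n` downwards accounts for the arrows with numbers 1 to `n`; the additional end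
  -- in the statement accounts for the next arrow.
  have key : ∀ n, Adj (tail m b c n) i j ↔
      ∃ k, 1 ≤ k ∧ k ≤ n ∧ (m k, b k) = i ∧ (m (k - 1), c (k - 1)) = j := by
    intro n
    induction n with
    | zero =>
      simp only [tail, Adj, List.head?_nil, reduceCtorEq, and_false, or_false, false_iff,
        not_exists]
      omega
    | succ n ih =>
      have h : (∃ k, 1 ≤ k ∧ k ≤ n + 1 ∧ (m k, b k) = i ∧ (m (k - 1), c (k - 1)) = j) ↔
          (m (n + 1), b (n + 1)) = i ∧ (m n, c n) = j ∨
          ∃ k, 1 ≤ k ∧ k ≤ n ∧ (m k, b k) = i ∧ (m (k - 1), c (k - 1)) = j := by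
        constructor
        · rintro ⟨k, h1, h2, h3⟩
          rcases eq_or_ne k (n + 1) with rfl | h
          · exact Or.inl h3
          · exact Or.inr ⟨k, h1, by omega, h3⟩
        · rintro (h | ⟨k, h1, h2, h3⟩)
          · exact ⟨n + 1, by omega, le_rfl, h⟩
          · exact ⟨k, h1, by omega, h3⟩
      rw [h, ← ih, tail]
      split_ifs with h0
      · simp [Adj, head_tail, h0]
      · simp [Adj, head_tail]
  -- The longer tail starts with the end where a preceding arrow would arrive. It equals the end in
  -- the statement, or is separated from it by a break and has no successor; in both cases the
  -- adjacent pairs are the same.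
  have h := key (n + 1)
  rw [tail] at h
  rw [← h]
  split_ifs with h0
  · rw [h0]
  · simp [Adj]

theorem tail_thread (hd : d ≤ n) (hb : ∀ k, n - d < k → k ≤ n → b k = true ∧ c k = false) :
    tail m b c n = thread (down m n d) ++ tail m b c (n - d) := by
  induction d generalizing n with
  | zero => rfl
  | succ d ih =>
    obtain ⟨n, rfl⟩ : ∃ n', n = n' + 1 := ⟨n - 1, by omega⟩
    obtain ⟨h1, h2⟩ := hb (n + 1) (by omega) le_rfl
    rw [tail, h1, h2, if_neg (by simp), ih (by omega) fun k hk hk' => hb k (by omega) (by omega)]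
    simp [down]

theorem tail_lone (hd : d ≤ n) (hb : ∀ k, n - d < k → k ≤ n → b k = false ∧ c k = false) :
    tail m b c n = lone (down m n d) ++ tail m b c (n - d) := by
  induction d generalizing n with
  | zero => rfl
  | succ d ih =>
    obtain ⟨n, rfl⟩ : ∃ n', n = n' + 1 := ⟨n - 1, by omega⟩
    obtain ⟨h1, h2⟩ := hb (n + 1) (by omega) le_rfl
    rw [tail, h1, h2, if_pos rfl, ih (by omega) fun k hk hk' => hb k (by omega) (by omega)]
    simp [down]

section lineVertex

variable {p : ℕ} {first last : V} {mid : Set.Ioo 0 p → V}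

theorem lineVertex_zero : lineVertex p first last mid 0 = first := by simp [lineVertex]

theorem lineVertex_self (hp : 1 ≤ p) : lineVertex p first last mid p = last := by
  simp [lineVertex]
  omega

theorem lineVertex_mid (k : Set.Ioo 0 p) : lineVertex p first last mid k = mid k :=
  dif_pos k.2

theorem mem_down_lineVertex (hd : d ≤ n) (hn : n < p) {v : V} :
    v ∈ down (lineVertex p first last mid) n d ↔
      ∃ k : Set.Ioo 0 p, n - d < k ∧ (k : ℕ) ≤ n ∧ mid k = v := by
  rw [mem_down hd]
  constructor
  · rintro ⟨k, h1, h2, rfl⟩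
    exact ⟨⟨k, by omega, by omega⟩, h1, h2, (lineVertex_mid _).symm⟩
  · rintro ⟨k, h1, h2, rfl⟩
    exact ⟨k, h1, h2, lineVertex_mid _⟩

theorem nodup_down_lineVertex (hd : d ≤ n) (hn : n < p) (hm : Function.Injective mid) :
    (down (lineVertex p first last mid) n d).Nodup := by
  refine nodup_down hd fun k hk k' hk' h => ?_
  have := hk.1
  have := hk.2
  have := hk'.1
  have := hk'.2
  rw [lineVertex_mid ⟨k, by omega, by omega⟩, lineVertex_mid ⟨k', by omega, by omega⟩] at h
  exact congrArg Subtype.val (hm h)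

variable {α : Set.Icc 1 p → V × Bool} {β : Set.Icc 1 p → V × Bool} {x y : Bool} {d : ℕ}

theorem adj_line (hp : 1 ≤ p) {R : ℕ → Prop} [DecidablePred R]
    (hα : ∀ k : Set.Icc 1 p, α k = (lineVertex p first last mid k,
      if (k : ℕ) = p then x else decide (R k)))
    (hβ : ∀ k : Set.Icc 1 p, β k = (lineVertex p first last mid (k - 1),
      if (k : ℕ) = 1 then y else false)) :
    Adj (some (last, x) :: tail (lineVertex p first last mid)
      (fun k => if k = p then x else decide (R k)) (fun k => if k = 0 then y else false) (p - 1)) i j ↔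
      ∃ k, α k = i ∧ β k = j := by
  have h := adj_tail (m := lineVertex p first last mid)
    (b := fun k => if k = p then x else decide (R k)) (c := fun k => if k = 0 then y else false)
    (n := p - 1) (i := i) (j := j)
  rw [Nat.sub_add_cancel hp, if_pos rfl, lineVertex_self hp] at h
  rw [h]
  have h0 : ∀ k, 1 ≤ k → (k - 1 = 0 ↔ k = 1) := by omega
  constructor
  · rintro ⟨k, h1, h2, rfl, rfl⟩
    refine ⟨⟨k, h1, h2⟩, hα _, ?_⟩
    rw [hβ]
    simp only [h0 k h1]
  · rintro ⟨⟨k, h1, h2⟩, rfl, rfl⟩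
    refine ⟨k, h1, h2, (hα ⟨k, h1, h2⟩).symm, ?_⟩
    rw [hβ]
    simp only [h0 k h1]

theorem nodup_line (hd : d ≤ p - 1) (hm : Function.Injective mid) (hp : 1 ≤ p) :
    (down (lineVertex p first last mid) (p - 1) d ++
      down (lineVertex p first last mid) (p - 1 - d) (p - 1 - d)).Nodup := by
  rw [← down_add, show d + (p - 1 - d) = p - 1 by omega]
  exact nodup_down_lineVertex le_rfl (by omega) hm

theorem mem_line (hd : d ≤ p - 1) (hp : 1 ≤ p) (v : V) :
    v ∈ down (lineVertex p first last mid) (p - 1) d ∨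
      v ∈ down (lineVertex p first last mid) (p - 1 - d) (p - 1 - d) ↔ ∃ k, mid k = v := by
  rw [← List.mem_append, ← down_add, show d + (p - 1 - d) = p - 1 by omega,
    mem_down_lineVertex le_rfl (by omega)]
  refine exists_congr fun k => ⟨fun h => h.2.2, fun h => ⟨?_, ?_, h⟩⟩
  · have := k.2.1
    omega
  · have := k.2.2
    omega

theorem length_down (m : ℕ → V) (n : ℕ) : (down m n d).length = d := by
  induction d generalizing n with
  | zero => rfl
  | succ d ih => simp [down, ih]

/-- The interior vertices of a line of arrows with relations at its beginning. -/
theorem exists_thread_lone (hp : 1 ≤ p) (hd : d ≤ p - 1) (hm : Function.Injective mid)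
    (hα : ∀ k : Set.Icc 1 p, α k = (lineVertex p first last mid k,
      if (k : ℕ) = p then x else decide (p - d ≤ k)))
    (hβ : ∀ k : Set.Icc 1 p, β k = (lineVertex p first last mid (k - 1),
      if (k : ℕ) = 1 then y else false)) :
    ∃ S F : List V, S.length = d ∧ F.length = p - 1 - d ∧ (S ++ F).Nodup ∧
      (∀ v, v ∈ S ∨ v ∈ F ↔ ∃ k, mid k = v) ∧
      ∀ i j, Adj (some (last, x) :: (thread S ++ (lone F ++ [some (first, y)]))) i j ↔
        ∃ k, α k = i ∧ β k = j := by
  refine ⟨down (lineVertex p first last mid) (p - 1) d,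
    down (lineVertex p first last mid) (p - 1 - d) (p - 1 - d), length_down _ _, length_down _ _, nodup_line hd hm hp, mem_line hd hp,
    fun i j => ?_⟩
  rw [← adj_line hp hα hβ, tail_thread (d := d) hd, tail_lone (d := p - 1 - d) le_rfl,
    Nat.sub_self]
  · simp [tail, lineVertex_zero]
  · intro k h1 h2
    rw [if_neg (by omega), if_neg (by omega)]
    simp
    omega
  · intro k h1 h2
    rw [if_neg (by omega), if_neg (by omega)]
    simp
    omega

/-- The interior vertices of a line of arrows with relations at its end. -/
theorem exists_lone_thread (hp : 1 ≤ p) (hd : d ≤ p - 1) (hm : Function.Injective mid)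
    (hα : ∀ k : Set.Icc 1 p, α k = (lineVertex p first last mid k,
      if (k : ℕ) = p then x else decide ((k : ℕ) ≤ d)))
    (hβ : ∀ k : Set.Icc 1 p, β k = (lineVertex p first last mid (k - 1),
      if (k : ℕ) = 1 then y else false)) :
    ∃ F S : List V, (F ++ S).Nodup ∧ (∀ v, v ∈ F ∨ v ∈ S ↔ ∃ k, mid k = v) ∧
      ∀ i j, Adj (some (last, x) :: (lone F ++ (thread S ++ [some (first, y)]))) i j ↔
        ∃ k, α k = i ∧ β k = j := by
  refine ⟨down (lineVertex p first last mid) (p - 1) (p - 1 - d),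
    down (lineVertex p first last mid) (p - 1 - (p - 1 - d)) (p - 1 - (p - 1 - d)),
    nodup_line (by omega) hm hp, mem_line (by omega) hp,
    fun i j => ?_⟩
  rw [← adj_line (R := fun k => k ≤ d) hp hα hβ, tail_lone (d := p - 1 - d) (by omega), tail_thread (d := _) le_rfl,
    Nat.sub_self]
  · simp [tail, lineVertex_zero]
  · intro k h1 h2
    rw [if_neg (by omega), if_neg (by omega)]
    simp
    omega
  · intro k h1 h2
    rw [if_neg (by omega), if_neg (by omega)]
    simp
    omega

theorem eqvGen_line {R : V → V → Prop}
    (hR : ∀ k : Set.Icc 1 p, R (lineVertex p first last mid k) (lineVertex p first last mid (k - 1))) :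
    (1 ≤ p → Relation.EqvGen R last first) ∧ ∀ k, Relation.EqvGen R (mid k) first := by
  have h : ∀ k, k ≤ p → Relation.EqvGen R (lineVertex p first last mid k) first := by
    intro k
    induction k with
    | zero =>
      intro
      rw [lineVertex_zero]
      exact .refl _
    | succ k ih => exact fun hk => .trans _ _ _ (.rel _ _ (hR ⟨k + 1, by omega, hk⟩)) (ih (by omega))
  refine ⟨fun hp => by simpa only [lineVertex_self hp] using h p le_rfl, fun k => ?_⟩
  have := h k k.2.2.le
  rwa [lineVertex_mid] at this

end lineVertex

end EndList

open EndList

namespace EndList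

variable {V : Type} {a c i j : V × Bool} {S F : List V} {B : List (Option (V × Bool))}

theorem nd_nil : Nd ([] : List (Option (V × Bool))) := List.nodup_nil

theorem adj_pair : Adj [some a, some c] i j ↔ a = i ∧ c = j := by
  simp [Adj]

theorem adj_none : Adj (some a :: none :: B) i j ↔ Adj B i j := by
  simp [Adj]

/-- Cutting a list of ends behind an entry other than the last one. -/
theorem adj_cons (_ : B ≠ []) : Adj (some a :: some c :: B) i j ↔
    Adj [some a, some c] i j ∨ Adj (some c :: B) i j :=
  adj_append_cons (A := [some a])

/-- The condition on `B` keeps rewriting from applying again to the first piece on the right, which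
has the shape of the left side with `B` empty. -/
theorem adj_lone (_ : B ≠ []) : Adj (some a :: (lone F ++ some c :: B)) i j ↔
    Adj (some a :: (lone F ++ [some c])) i j ∨ Adj (some c :: B) i j :=
  adj_append_cons (A := some a :: lone F)

theorem adj_thread (_ : B ≠ []) : Adj (some a :: (thread S ++ some c :: B)) i j ↔
    Adj (some a :: (thread S ++ [some c])) i j ∨ Adj (some c :: B) i j :=
  adj_append_cons (A := some a :: thread S)

theorem adj_thread_lone (_ : B ≠ []) :
    Adj (some a :: (thread S ++ (lone F ++ some c :: B))) i j ↔
      Adj (some a :: (thread S ++ (lone F ++ [some c]))) i j ∨ Adj (some c :: B) i j := by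
  simpa using adj_append_cons (A := some a :: (thread S ++ lone F)) (B := B) (c := c)

theorem adj_lone_thread (_ : B ≠ []) :
    Adj (some a :: (lone F ++ (thread S ++ some c :: B))) i j ↔
      Adj (some a :: (lone F ++ (thread S ++ [some c]))) i j ∨ Adj (some c :: B) i j := by
  simpa using adj_append_cons (A := some a :: (lone F ++ thread S)) (B := B) (c := c)

end EndList

/-! ### Choosing an end for every arrow -/

namespace ZeroRelQuiver

/-- The choice of an end of the starting vertex and of an end of the terminating vertex of every arrow,
for which a product of two arrows is a relation unless the two ends in the middle agree. -/
structure Ends (Q : ZeroRelQuiver) where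
  out : Q.E → Bool
  inn : Q.E → Bool
  inj : ∀ e f, Q.s e = Q.s f → out e = out f → e = f
  rel : ∀ e f, Q.s e = Q.t f → (Q.rel e f ↔ inn f ≠ out e)
  nonempty : Nonempty Q.V
  connected : ∀ v w, Relation.EqvGen (fun v w => ∃ e, Q.s e = v ∧ Q.t e = w) v w

namespace Ends

variable {Q : ZeroRelQuiver} (P : Ends Q) {k : Type u} [Field k]

/-- The end where an arrow starts. -/
def i (e : Q.E) : Q.V × Bool := (Q.s e, P.out e)

/-- The end where an arrow terminates. -/
def j (e : Q.E) : Q.V × Bool := (Q.t e, P.inn e)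

theorem equivalent_op [DecidableEq Q.V] {L : List (Option (Q.V × Bool))} (nd : Nd L)
    (adj : ∀ a b, Adj L a b ↔ ∃ e, P.i e = a ∧ P.j e = b) (h : Sim k L L.reverse) :
    TiltingCotiltingEquivalent k (Q.BoundAlgebra k) (Q.BoundAlgebra k)ᵐᵒᵖ :=
  let p : Presentation Q L :=
    { i := P.i
      j := P.j
      fst_i := fun _ => rfl
      fst_j := fun _ => rfl
      nd := nd
      adj := adj
      inj := fun e f h => P.inj e f (congrArg Prod.fst h) (congrArg Prod.snd h)
      rel := fun e f h => by
        rw [P.rel e f h, Ne, Ne, Prod.ext_iff]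
        simp [h, i, j] }
  p.equivalent_op k (p.connected P.nonempty P.connected) h

/-- A line of `p` arrows, with relations at the first `d` of its interior vertices. -/
structure Line (p d : ℕ) (last first : Q.V × Bool) (mid : Set.Ioo 0 p → Q.V)
    (α : Set.Icc 1 p → Q.E) : Prop where
  one_le : 1 ≤ p
  le : d ≤ p - 1
  inj : Function.Injective mid
  i_eq : ∀ k : Set.Icc 1 p, P.i (α k) = (lineVertex p first.1 last.1 mid k,
    if (k : ℕ) = p then last.2 else decide (p - d ≤ k))
  j_eq : ∀ k : Set.Icc 1 p, P.j (α k) = (lineVertex p first.1 last.1 mid (k - 1),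
    if (k : ℕ) = 1 then first.2 else false)

variable {P}

theorem Line.exists {p d : ℕ} {last first : Q.V × Bool} {mid : Set.Ioo 0 p → Q.V}
    {α : Set.Icc 1 p → Q.E} (h : P.Line p d last first mid α) :
    ∃ S F : List Q.V, S.length = d ∧ F.length = p - 1 - d ∧ (S ++ F).Nodup ∧
      (∀ v, v ∈ S ∨ v ∈ F ↔ ∃ k, mid k = v) ∧
      ∀ i j, Adj (some last :: (thread S ++ (lone F ++ [some first]))) i j ↔
        ∃ k, P.i (α k) = i ∧ P.j (α k) = j :=
  exists_thread_lone h.one_le h.le h.inj h.i_eq h.j_eq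

theorem Line.exists_lone {p : ℕ} {last first : Q.V × Bool} {mid : Set.Ioo 0 p → Q.V}
    {α : Set.Icc 1 p → Q.E} (h : P.Line p 0 last first mid α) :
    ∃ F : List Q.V, F.length = p - 1 ∧ F.Nodup ∧ (∀ v, v ∈ F ↔ ∃ k, mid k = v) ∧
      ∀ i j, Adj (some last :: (lone F ++ [some first])) i j ↔
        ∃ k, P.i (α k) = i ∧ P.j (α k) = j := by
  obtain ⟨S, F, hS, hF, h⟩ := h.exists
  obtain rfl := List.length_eq_zero_iff.1 hS
  exact ⟨F, hF, by simpa using h⟩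

theorem Line.exists_thread {p : ℕ} {last first : Q.V × Bool} {mid : Set.Ioo 0 p → Q.V}
    {α : Set.Icc 1 p → Q.E} (h : P.Line p (p - 1) last first mid α) :
    ∃ S : List Q.V, S.length = p - 1 ∧ S.Nodup ∧ (∀ v, v ∈ S ↔ ∃ k, mid k = v) ∧
      ∀ i j, Adj (some last :: (thread S ++ [some first])) i j ↔
        ∃ k, P.i (α k) = i ∧ P.j (α k) = j := by
  obtain ⟨S, F, hS, hF, h⟩ := h.exists
  obtain rfl := List.length_eq_zero_iff.1 (hF.trans (Nat.sub_self _))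
  exact ⟨S, hS, by simpa using h⟩

/-- The whole algebra is one block `y x C S y' x'`, which runs through `γ`, the path of the `α_i`
and `β`. The function `cl` takes different values on different kinds of vertices and thus shows that
they are distinct; it serves the same purpose in the theorems below. -/
theorem equivalent_op_zero {p r : ℕ} {x y : Q.V} {mid : Set.Ioo 0 p → Q.V} {α : Set.Icc 1 p → Q.E}
    {β γ : Q.E} (hp : 1 ≤ p) (hr : r ≤ p - 1) (hm : Function.Injective mid)
    (hαi : ∀ k : Set.Icc 1 p, P.i (α k) = (lineVertex p y x mid k,
      if (k : ℕ) = p then false else decide ((k : ℕ) ≤ r)))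
    (hαj : ∀ k : Set.Icc 1 p, P.j (α k) = (lineVertex p y x mid (k - 1),
      if (k : ℕ) = 1 then true else false))
    (hβ : P.i β = (y, true) ∧ P.j β = (x, true)) (hγ : P.i γ = (y, false) ∧ P.j γ = (x, false))
    (hE : ∀ R : Q.E → Prop, (∃ e, R e) ↔ (∃ k, R (α k)) ∨ R β ∨ R γ)
    (hV : ∀ v, v = x ∨ v = y ∨ ∃ k, mid k = v) (cl : Q.V → ℕ) (hx : cl x = 0) (hy : cl y = 1)
    (hmid : ∀ k, cl (mid k) = 2) :
    TiltingCotiltingEquivalent k (Q.BoundAlgebra k) (Q.BoundAlgebra k)ᵐᵒᵖ := by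
  classical
  obtain ⟨C, S, hn, hCS, ha⟩ := exists_lone_thread hp hr hm hαi hαj
  simp only [← hCS] at hV
  have hC : ∀ v ∈ C, cl v = 2 := by grind
  have hS : ∀ v ∈ S, cl v = 2 := by grind
  have hl : (x :: y :: (C ++ S)).Nodup := by
    simp only [List.nodup_cons, List.mem_cons, List.mem_append]
    grind
  refine P.equivalent_op ?_ (fun a b => ?_) (sim_reverse_zero hl (by grind) rfl)
  · simp only [List.nodup_cons, List.nodup_append] at hl
    simp [nd_nil, nd_cons_some, nd_append, nd_lone, nd_thread]
    grind
  · simp [hE, adj_cons, adj_lone_thread, adj_pair, ← ha, hβ, hγ]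
    exact iff_of_eq (by ac_rfl)

/-- The list is `z y x | z' y' C x'`: `γ` followed by `β`, and `δ` followed by the path of the
`α_i`. -/
theorem equivalent_op_zero' {p₁ : ℕ} {x y z : Q.V} {mα : Set.Ioo 0 p₁ → Q.V}
    {α : Set.Icc 1 p₁ → Q.E} {β γ δ : Q.E}
    (hα : P.Line p₁ 0 (y, true) (x, true) mα α)
    (hβ : P.i β = (y, false) ∧ P.j β = (x, false)) (hγ : P.i γ = (z, false) ∧ P.j γ = (y, false))
    (hδ : P.i δ = (z, true) ∧ P.j δ = (y, true))
    (hE : ∀ R : Q.E → Prop, (∃ e, R e) ↔ (∃ k, R (α k)) ∨ R β ∨ R γ ∨ R δ)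
    (hV : ∀ v, v = x ∨ v = y ∨ v = z ∨ (∃ k, mα k = v)) (cl : Q.V → ℕ) (hx : cl x = 0)
    (hy : cl y = 1) (hz : cl z = 2) (hαm : ∀ k, cl (mα k) = 3) :
    TiltingCotiltingEquivalent k (Q.BoundAlgebra k) (Q.BoundAlgebra k)ᵐᵒᵖ := by
  classical
  obtain ⟨C, lC, nα, mα', aα⟩ := hα.exists_lone
  simp only [← mα'] at hV
  have cC : ∀ v ∈ C, cl v = 3 := fun v hv => by
    obtain ⟨k, rfl⟩ := (mα' v).1 (by simp [hv])
    exact hαm k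
  have hl : (x :: y :: z :: C).Nodup := by
    simp only [List.nodup_cons, List.mem_cons]
    clear hE hV mα' aα hαm hα
    and_intros <;> grind
  have hc : ∀ v, v ∈ x :: y :: z :: C := fun v => by
    have := hV v
    simp at this ⊢
    grind only
  refine P.equivalent_op ?_ (fun i j => ?_) (sim_reverse_zero' hl hc rfl)
  · simp only [List.nodup_cons] at hl
    simp [nd_nil, nd_cons_some, nd_cons_none, nd_append, nd_lone]
    clear hE hV mα' aα hαm hα hc
    and_intros <;> grind
  · simp [hE, adj_none, adj_cons, adj_pair, ← aα, hβ, hγ, hδ]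
    exact iff_of_eq (by ac_rfl)

/-- The list is `x S F y G z | y' T x' D z'`: the paths `α` and `γ` are joined at `y`, and `β` and
`δ` at `x'`. The breaks inside `S` and `T` are the relations in the interior of `α` and `β`. -/
theorem equivalent_op_one {p₁ p₂ p₃ p₄ r₁ : ℕ} {x y z : Q.V} {mα : Set.Ioo 0 p₁ → Q.V}
    {α : Set.Icc 1 p₁ → Q.E}
    {mβ : Set.Ioo 0 p₂ → Q.V} {β : Set.Icc 1 p₂ → Q.E} {mγ : Set.Ioo 0 p₃ → Q.V}
    {γ : Set.Icc 1 p₃ → Q.E}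
    {mδ : Set.Ioo 0 p₄ → Q.V} {δ : Set.Icc 1 p₄ → Q.E}
    (hα : P.Line p₁ r₁ (x, false) (y, false) mα α)
    (hβ : P.Line p₂ (p₂ - 1) (y, true) (x, true) mβ β)
    (hγ : P.Line p₃ 0 (y, false) (z, false) mγ γ) (hδ : P.Line p₄ 0 (x, true) (z, true) mδ δ)
    (hE : ∀ R : Q.E → Prop, (∃ e, R e) ↔ (∃ k, R (α k)) ∨ (∃ k, R (β k)) ∨ (∃ k, R (γ k)) ∨
    (∃ k, R (δ k)))
    (hV : ∀ v, v = x ∨ v = y ∨ v = z ∨ (∃ k, mα k = v) ∨ (∃ k, mβ k = v) ∨ (∃ k, mγ k = v) ∨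
    (∃ k, mδ k = v)) (cl : Q.V → ℕ) (hx : cl x = 0) (hy : cl y = 1) (hz : cl z = 2)
    (hαm : ∀ k, cl (mα k) = 3)
    (hβm : ∀ k, cl (mβ k) = 4) (hγm : ∀ k, cl (mγ k) = 5) (hδm : ∀ k, cl (mδ k) = 6) :
    TiltingCotiltingEquivalent k (Q.BoundAlgebra k) (Q.BoundAlgebra k)ᵐᵒᵖ := by
  classical
  obtain ⟨S, F, lS, lF, nα, mα', aα⟩ := hα.exists
  obtain ⟨T, lT, nβ, mβ', aβ⟩ := hβ.exists_thread
  obtain ⟨G, lG, nγ, mγ', aγ⟩ := hγ.exists_lone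
  obtain ⟨D, lD, nδ, mδ', aδ⟩ := hδ.exists_lone
  simp only [← mα', ← mβ', ← mγ', ← mδ'] at hV
  simp only [List.nodup_append] at nα
  have cS : ∀ v ∈ S, cl v = 3 := fun v hv => by
    obtain ⟨k, rfl⟩ := (mα' v).1 (by simp [hv])
    exact hαm k
  have cF : ∀ v ∈ F, cl v = 3 := fun v hv => by
    obtain ⟨k, rfl⟩ := (mα' v).1 (by simp [hv])
    exact hαm k
  have cT : ∀ v ∈ T, cl v = 4 := fun v hv => by
    obtain ⟨k, rfl⟩ := (mβ' v).1 (by simp [hv])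
    exact hβm k
  have cG : ∀ v ∈ G, cl v = 5 := fun v hv => by
    obtain ⟨k, rfl⟩ := (mγ' v).1 (by simp [hv])
    exact hγm k
  have cD : ∀ v ∈ D, cl v = 6 := fun v hv => by
    obtain ⟨k, rfl⟩ := (mδ' v).1 (by simp [hv])
    exact hδm k
  have hl : (x :: y :: z :: (S ++ (F ++ (G ++ (T ++ D))))).Nodup := by
    simp only [List.nodup_cons, List.nodup_append, List.mem_cons, List.mem_append]
    clear hE hV mα' aα hαm hα mβ' aβ hβm hβ mγ' aγ hγm hγ mδ' aδ hδm hδ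
    and_intros <;> grind
  have hc : ∀ v, v ∈ x :: y :: z :: (S ++ (F ++ (G ++ (T ++ D)))) := fun v => by
    have := hV v
    simp at this ⊢
    grind only
  refine P.equivalent_op ?_ (fun i j => ?_) (sim_reverse_one hl hc rfl)
  · simp only [List.nodup_cons, List.nodup_append] at hl
    simp [nd_nil, nd_cons_some, nd_cons_none, nd_append, nd_lone, nd_thread]
    clear hE hV mα' aα hαm hα mβ' aβ hβm hβ mγ' aγ hγm hγ mδ' aδ hδm hδ hc
    and_intros <;> grind
  · simp [hE, adj_none, adj_lone, adj_thread, adj_thread_lone, ← aα, ← aβ,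
      ← aγ, ← aδ]
    exact iff_of_eq (by ac_rfl)

/-- The paths `α` and `γ` form a closed chain through `x`, which becomes a list only by cutting it
at a relation; `hr` provides the vertex `s` for this. -/
theorem equivalent_op_one_of_loop {p₁ p₂ p₃ r₁ : ℕ} {x y : Q.V} {mα : Set.Ioo 0 p₁ → Q.V}
    {α : Set.Icc 1 p₁ → Q.E}
    {mβ : Set.Ioo 0 p₂ → Q.V} {β : Set.Icc 1 p₂ → Q.E} {mγ : Set.Ioo 0 p₃ → Q.V}
    {γ : Set.Icc 1 p₃ → Q.E}
    (hr : 1 ≤ r₁) (hα : P.Line p₁ r₁ (x, false) (y, false) mα α)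
    (hβ : P.Line p₂ (p₂ - 1) (y, true) (x, true) mβ β) (hγ : P.Line p₃ 0 (y, false) (x, false) mγ γ)
    (hE : ∀ R : Q.E → Prop, (∃ e, R e) ↔ (∃ k, R (α k)) ∨ (∃ k, R (β k)) ∨ (∃ k, R (γ k)))
    (hV : ∀ v, v = x ∨ v = y ∨ (∃ k, mα k = v) ∨ (∃ k, mβ k = v) ∨
    (∃ k, mγ k = v)) (cl : Q.V → ℕ) (hx : cl x = 0) (hy : cl y = 1) (hαm : ∀ k, cl (mα k) = 2)
    (hβm : ∀ k, cl (mβ k) = 3)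
    (hγm : ∀ k, cl (mγ k) = 4) :
    TiltingCotiltingEquivalent k (Q.BoundAlgebra k) (Q.BoundAlgebra k)ᵐᵒᵖ := by
  classical
  obtain ⟨S, F, lS, lF, nα, mα', aα⟩ := hα.exists
  obtain ⟨T, lT, nβ, mβ', aβ⟩ := hβ.exists_thread
  obtain ⟨G, lG, nγ, mγ', aγ⟩ := hγ.exists_lone
  obtain ⟨s, S₁, rfl⟩ := List.exists_cons_of_length_pos (lS ▸ hr)
  simp only [← mα', ← mβ', ← mγ'] at hV
  simp only [List.cons_append, List.nodup_cons, List.nodup_append] at nα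
  have cS₁ : ∀ v ∈ S₁, cl v = 2 := fun v hv => by
    obtain ⟨k, rfl⟩ := (mα' v).1 (by simp [hv])
    exact hαm k
  have cF : ∀ v ∈ F, cl v = 2 := fun v hv => by
    obtain ⟨k, rfl⟩ := (mα' v).1 (by simp [hv])
    exact hαm k
  have cT : ∀ v ∈ T, cl v = 3 := fun v hv => by
    obtain ⟨k, rfl⟩ := (mβ' v).1 (by simp [hv])
    exact hβm k
  have cG : ∀ v ∈ G, cl v = 4 := fun v hv => by
    obtain ⟨k, rfl⟩ := (mγ' v).1 (by simp [hv])
    exact hγm k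
  have cs : cl s = 2 := by
    obtain ⟨k, hk⟩ := (mα' s).1 (by simp)
    exact hk ▸ hαm k
  have hl : (x :: y :: s :: (S₁ ++ (F ++ (G ++ T)))).Nodup := by
    simp only [List.nodup_cons, List.nodup_append, List.mem_cons, List.mem_append]
    clear hE hV mα' aα hαm hα mβ' aβ hβm hβ mγ' aγ hγm hγ
    and_intros <;> grind
  have hc : ∀ v, v ∈ x :: y :: s :: (S₁ ++ (F ++ (G ++ T))) := fun v => by
    have := hV v
    simp at this ⊢
    grind only
  refine P.equivalent_op ?_ (fun i j => ?_) (sim_reverse_one_of_loop hl hc rfl)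
  · simp only [List.nodup_cons, List.nodup_append] at hl
    simp [nd_nil, nd_cons_some, nd_cons_none, nd_append, nd_lone, nd_thread]
    clear hE hV mα' aα hαm hα mβ' aβ hβm hβ mγ' aγ hγm hγ hc
    and_intros <;> grind
  · simp [hE, adj_none, adj_cons, adj_lone, adj_thread_lone, adj_pair, ← aα, ← aβ, ← aγ]
    tauto

/-- Both `α` and `β` are closed at `x`, and each is cut at its first interior relation. -/
theorem equivalent_op_one_of_loops {p₁ p₂ r₁ : ℕ} {x : Q.V} {mα : Set.Ioo 0 p₁ → Q.V}
    {α : Set.Icc 1 p₁ → Q.E}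
    {mβ : Set.Ioo 0 p₂ → Q.V} {β : Set.Icc 1 p₂ → Q.E}
    (hr : 1 ≤ r₁) (hp : 1 ≤ p₂ - 1) (hα : P.Line p₁ r₁ (x, false) (x, false) mα α)
    (hβ : P.Line p₂ (p₂ - 1) (x, true) (x, true) mβ β)
    (hE : ∀ R : Q.E → Prop, (∃ e, R e) ↔ (∃ k, R (α k)) ∨ (∃ k, R (β k)))
    (hV : ∀ v, v = x ∨ (∃ k, mα k = v) ∨ (∃ k, mβ k = v)) (cl : Q.V → ℕ) (hx : cl x = 0)
    (hαm : ∀ k, cl (mα k) = 1) (hβm : ∀ k, cl (mβ k) = 2) :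
    TiltingCotiltingEquivalent k (Q.BoundAlgebra k) (Q.BoundAlgebra k)ᵐᵒᵖ := by
  classical
  obtain ⟨S, F, lS, lF, nα, mα', aα⟩ := hα.exists
  obtain ⟨T, lT, nβ, mβ', aβ⟩ := hβ.exists_thread
  obtain ⟨s, S₁, rfl⟩ := List.exists_cons_of_length_pos (lS ▸ hr)
  obtain ⟨t, T₁, rfl⟩ := List.exists_cons_of_length_pos (lT ▸ hp)
  simp only [← mα', ← mβ'] at hV
  simp only [List.cons_append, List.nodup_cons, List.nodup_append] at nα nβ
  have cS₁ : ∀ v ∈ S₁, cl v = 1 := fun v hv => by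
    obtain ⟨k, rfl⟩ := (mα' v).1 (by simp [hv])
    exact hαm k
  have cF : ∀ v ∈ F, cl v = 1 := fun v hv => by
    obtain ⟨k, rfl⟩ := (mα' v).1 (by simp [hv])
    exact hαm k
  have cT₁ : ∀ v ∈ T₁, cl v = 2 := fun v hv => by
    obtain ⟨k, rfl⟩ := (mβ' v).1 (by simp [hv])
    exact hβm k
  have cs : cl s = 1 := by
    obtain ⟨k, hk⟩ := (mα' s).1 (by simp)
    exact hk ▸ hαm k
  have ct : cl t = 2 := by
    obtain ⟨k, hk⟩ := (mβ' t).1 (by simp)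
    exact hk ▸ hβm k
  have hl : (x :: s :: t :: (S₁ ++ (F ++ T₁))).Nodup := by
    simp only [List.nodup_cons, List.nodup_append, List.mem_cons, List.mem_append]
    clear hE hV mα' aα hαm hα mβ' aβ hβm hβ
    and_intros <;> grind
  have hc : ∀ v, v ∈ x :: s :: t :: (S₁ ++ (F ++ T₁)) := fun v => by
    have := hV v
    simp at this ⊢
    grind only
  refine P.equivalent_op ?_ (fun i j => ?_) (sim_reverse_one_of_loops hl hc rfl)
  · simp only [List.nodup_cons, List.nodup_append] at hl
    simp [nd_nil, nd_cons_some, nd_cons_none, nd_append, nd_lone, nd_thread]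
    clear hE hV mα' aα hαm hα mβ' aβ hβm hβ hc
    and_intros <;> grind
  · simp [hE, adj_none, adj_cons, adj_thread, adj_thread_lone, adj_pair, ← aα, ← aβ]
    exact iff_of_eq (by ac_rfl)

/-- The order of the list is `β`, `γ`, `α`. The last vertex `s` of the thread of `α` is singled out,
because it is the one that a double slide of `a` uses. -/
theorem equivalent_op_two {p₁ p₂ p₃ r₁ r₂ : ℕ} {a b : Q.V} {mα : Set.Ioo 0 p₁ → Q.V}
    {α : Set.Icc 1 p₁ → Q.E}
    {mβ : Set.Ioo 0 p₂ → Q.V} {β : Set.Icc 1 p₂ → Q.E} {mγ : Set.Ioo 0 p₃ → Q.V}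
    {γ : Set.Icc 1 p₃ → Q.E}
    (hr : 1 ≤ r₁) (hα : P.Line p₁ r₁ (a, false) (a, true) mα α)
    (hβ : P.Line p₂ r₂ (b, false) (b, true) mβ β) (hγ : P.Line p₃ 0 (b, true) (a, false) mγ γ)
    (hE : ∀ R : Q.E → Prop, (∃ e, R e) ↔ (∃ k, R (α k)) ∨ (∃ k, R (β k)) ∨ (∃ k, R (γ k)))
    (hV : ∀ v, v = a ∨ v = b ∨ (∃ k, mα k = v) ∨ (∃ k, mβ k = v) ∨
    (∃ k, mγ k = v)) (cl : Q.V → ℕ) (ha : cl a = 0) (hb : cl b = 1) (hαm : ∀ k, cl (mα k) = 2)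
    (hβm : ∀ k, cl (mβ k) = 3)
    (hγm : ∀ k, cl (mγ k) = 4) :
    TiltingCotiltingEquivalent k (Q.BoundAlgebra k) (Q.BoundAlgebra k)ᵐᵒᵖ := by
  classical
  obtain ⟨S, F, lS, lF, nα, mα', aα⟩ := hα.exists
  obtain ⟨T, E, lT, lE, nβ, mβ', aβ⟩ := hβ.exists
  obtain ⟨C, lC, nγ, mγ', aγ⟩ := hγ.exists_lone
  obtain ⟨X, s, rfl⟩ := List.eq_nil_or_concat' S |>.resolve_left (by rintro rfl; simp at lS; omega)
  simp only [← mα', ← mβ', ← mγ'] at hV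
  simp [List.nodup_append] at nα
  have cX : ∀ v ∈ X, cl v = 2 := fun v hv => by
    obtain ⟨k, rfl⟩ := (mα' v).1 (by simp [hv])
    exact hαm k
  have cF : ∀ v ∈ F, cl v = 2 := fun v hv => by
    obtain ⟨k, rfl⟩ := (mα' v).1 (by simp [hv])
    exact hαm k
  have cT : ∀ v ∈ T, cl v = 3 := fun v hv => by
    obtain ⟨k, rfl⟩ := (mβ' v).1 (by simp [hv])
    exact hβm k
  have cE : ∀ v ∈ E, cl v = 3 := fun v hv => by
    obtain ⟨k, rfl⟩ := (mβ' v).1 (by simp [hv])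
    exact hβm k
  have cC : ∀ v ∈ C, cl v = 4 := fun v hv => by
    obtain ⟨k, rfl⟩ := (mγ' v).1 (by simp [hv])
    exact hγm k
  have cs : cl s = 2 := by
    obtain ⟨k, hk⟩ := (mα' s).1 (by simp)
    exact hk ▸ hαm k
  have hl : (a :: b :: s :: (T ++ (E ++ (C ++ (X ++ F))))).Nodup := by
    simp only [List.nodup_cons, List.nodup_append, List.mem_cons, List.mem_append]
    clear hE hV mα' aα hαm hα mβ' aβ hβm hβ mγ' aγ hγm hγ
    and_intros <;> grind
  have hc : ∀ v, v ∈ a :: b :: s :: (T ++ (E ++ (C ++ (X ++ F)))) := fun v => by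
    have := hV v
    simp at this ⊢
    grind only
  refine P.equivalent_op ?_ (fun i j => ?_) (sim_reverse_two hl hc rfl)
  · simp only [List.nodup_cons, List.nodup_append] at hl
    simp [nd_nil, nd_cons_some, nd_cons_none, nd_append, nd_lone, nd_thread]
    clear hE hV mα' aα hαm hα mβ' aβ hβm hβ mγ' aγ hγm hγ hc
    and_intros <;> grind
  · simp [hE, adj_none, adj_lone, adj_thread, adj_thread_lone, ← aα, ← aβ, ← aγ]
    exact iff_of_eq (by ac_rfl)

/-- Without interior relations on `α`, its last interior vertex `f` takes the place of the relation
in the double slide of `a`; `hp` ensures that it exists. -/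
theorem equivalent_op_two_of_eq_zero {p₁ p₂ p₃ r₂ : ℕ} {a b : Q.V} {mα : Set.Ioo 0 p₁ → Q.V}
    {α : Set.Icc 1 p₁ → Q.E}
    {mβ : Set.Ioo 0 p₂ → Q.V} {β : Set.Icc 1 p₂ → Q.E} {mγ : Set.Ioo 0 p₃ → Q.V}
    {γ : Set.Icc 1 p₃ → Q.E}
    (hp : 1 ≤ p₁ - 1) (hα : P.Line p₁ 0 (a, false) (a, true) mα α)
    (hβ : P.Line p₂ r₂ (b, false) (b, true) mβ β) (hγ : P.Line p₃ 0 (b, true) (a, false) mγ γ)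
    (hE : ∀ R : Q.E → Prop, (∃ e, R e) ↔ (∃ k, R (α k)) ∨ (∃ k, R (β k)) ∨ (∃ k, R (γ k)))
    (hV : ∀ v, v = a ∨ v = b ∨ (∃ k, mα k = v) ∨ (∃ k, mβ k = v) ∨
    (∃ k, mγ k = v)) (cl : Q.V → ℕ) (ha : cl a = 0) (hb : cl b = 1) (hαm : ∀ k, cl (mα k) = 2)
    (hβm : ∀ k, cl (mβ k) = 3)
    (hγm : ∀ k, cl (mγ k) = 4) :
    TiltingCotiltingEquivalent k (Q.BoundAlgebra k) (Q.BoundAlgebra k)ᵐᵒᵖ := by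
  classical
  obtain ⟨F₁, lF₁, nα, mα', aα⟩ := hα.exists_lone
  obtain ⟨T, E, lT, lE, nβ, mβ', aβ⟩ := hβ.exists
  obtain ⟨C, lC, nγ, mγ', aγ⟩ := hγ.exists_lone
  obtain ⟨F, f,
    rfl⟩ := List.eq_nil_or_concat' F₁ |>.resolve_left (by rintro rfl; simp at lF₁; omega)
  simp only [← mα', ← mβ', ← mγ'] at hV
  simp [List.nodup_append] at nα
  have cF : ∀ v ∈ F, cl v = 2 := fun v hv => by
    obtain ⟨k, rfl⟩ := (mα' v).1 (by simp [hv])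
    exact hαm k
  have cT : ∀ v ∈ T, cl v = 3 := fun v hv => by
    obtain ⟨k, rfl⟩ := (mβ' v).1 (by simp [hv])
    exact hβm k
  have cE : ∀ v ∈ E, cl v = 3 := fun v hv => by
    obtain ⟨k, rfl⟩ := (mβ' v).1 (by simp [hv])
    exact hβm k
  have cC : ∀ v ∈ C, cl v = 4 := fun v hv => by
    obtain ⟨k, rfl⟩ := (mγ' v).1 (by simp [hv])
    exact hγm k
  have cf : cl f = 2 := by
    obtain ⟨k, hk⟩ := (mα' f).1 (by simp)
    exact hk ▸ hαm k
  have hl : (a :: b :: f :: (T ++ (E ++ (C ++ F)))).Nodup := by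
    simp only [List.nodup_cons, List.nodup_append, List.mem_cons, List.mem_append]
    clear hE hV mα' aα hαm hα mβ' aβ hβm hβ mγ' aγ hγm hγ
    and_intros <;> grind
  have hc : ∀ v, v ∈ a :: b :: f :: (T ++ (E ++ (C ++ F))) := fun v => by
    have := hV v
    simp at this ⊢
    grind only
  refine P.equivalent_op ?_ (fun i j => ?_) (sim_reverse_two_of_eq_zero hl hc rfl)
  · simp only [List.nodup_cons, List.nodup_append] at hl
    simp [nd_nil, nd_cons_some, nd_append, nd_lone, nd_thread]
    clear hE hV mα' aα hαm hα mβ' aβ hβm hβ mγ' aγ hγm hγ hc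
    and_intros <;> grind
  · simp [hE, adj_lone, adj_thread_lone, adj_pair, ← aα, ← aβ, ← aγ]
    exact iff_of_eq (by ac_rfl)

theorem equivalent_op_two_of_eq_one {p₃ : ℕ} {a b : Q.V} {mα : Set.Ioo 0 1 → Q.V}
    {α : Set.Icc 1 1 → Q.E}
    {mβ : Set.Ioo 0 1 → Q.V} {β : Set.Icc 1 1 → Q.E} {mγ : Set.Ioo 0 p₃ → Q.V}
    {γ : Set.Icc 1 p₃ → Q.E}
    (hα : P.Line 1 0 (a, false) (a, true) mα α)
    (hβ : P.Line 1 0 (b, false) (b, true) mβ β) (hγ : P.Line p₃ 0 (b, true) (a, false) mγ γ)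
    (hE : ∀ R : Q.E → Prop, (∃ e, R e) ↔ (∃ k, R (α k)) ∨ (∃ k, R (β k)) ∨ (∃ k, R (γ k)))
    (hV : ∀ v, v = a ∨ v = b ∨ (∃ k, mα k = v) ∨ (∃ k, mβ k = v) ∨
    (∃ k, mγ k = v)) (cl : Q.V → ℕ) (ha : cl a = 0) (hb : cl b = 1)
    (hγm : ∀ k, cl (mγ k) = 4) :
    TiltingCotiltingEquivalent k (Q.BoundAlgebra k) (Q.BoundAlgebra k)ᵐᵒᵖ := by
  classical
  obtain ⟨F, lF, nα, mα', aα⟩ := hα.exists_lone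
  obtain ⟨E, lE, nβ, mβ', aβ⟩ := hβ.exists_lone
  obtain ⟨C, lC, nγ, mγ', aγ⟩ := hγ.exists_lone
  obtain rfl := List.length_eq_zero_iff.1 lF
  obtain rfl := List.length_eq_zero_iff.1 lE
  simp only [← mα', ← mβ', ← mγ'] at hV
  have cC : ∀ v ∈ C, cl v = 4 := fun v hv => by
    obtain ⟨k, rfl⟩ := (mγ' v).1 (by simp [hv])
    exact hγm k
  have hl : (a :: b :: C).Nodup := by
    simp only [List.nodup_cons, List.mem_cons]
    clear hE hV mα' aα hα mβ' aβ hβ mγ' aγ hγm hγ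
    and_intros <;> grind
  have hc : ∀ v, v ∈ a :: b :: C := fun v => by
    have := hV v
    simp at this ⊢
    grind only
  refine P.equivalent_op ?_ (fun i j => ?_) (sim_reverse_two_of_eq_one hl hc rfl)
  · simp only [List.nodup_cons] at hl
    simp [nd_nil, nd_cons_some, nd_append, nd_lone]
    clear hE hV mα' aα hα mβ' aβ hβ mγ' aγ hγm hγ hc
    and_intros <;> grind
  · simp [hE, adj_cons, adj_lone, adj_pair, ← aα, ← aβ, ← aγ]
    exact iff_of_eq (by ac_rfl)

/-- The two cycles share the vertex `b` but use its ends in opposite ways, so that `α` starts where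
`β` arrives and vice versa. The resulting closed chain is cut at an interior relation of `α`. -/
theorem equivalent_op_two_of_loop {p₁ p₂ r₁ r₂ : ℕ} {b : Q.V} {mα : Set.Ioo 0 p₁ → Q.V}
    {α : Set.Icc 1 p₁ → Q.E}
    {mβ : Set.Ioo 0 p₂ → Q.V} {β : Set.Icc 1 p₂ → Q.E}
    (hr : 1 ≤ r₁) (hα : P.Line p₁ r₁ (b, true) (b, false) mα α)
    (hβ : P.Line p₂ r₂ (b, false) (b, true) mβ β)
    (hE : ∀ R : Q.E → Prop, (∃ e, R e) ↔ (∃ k, R (α k)) ∨ (∃ k, R (β k)))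
    (hV : ∀ v, v = b ∨ (∃ k, mα k = v) ∨ (∃ k, mβ k = v)) (cl : Q.V → ℕ) (hb : cl b = 0)
    (hαm : ∀ k, cl (mα k) = 1) (hβm : ∀ k, cl (mβ k) = 2) :
    TiltingCotiltingEquivalent k (Q.BoundAlgebra k) (Q.BoundAlgebra k)ᵐᵒᵖ := by
  classical
  obtain ⟨S, F, lS, lF, nα, mα', aα⟩ := hα.exists
  obtain ⟨T, E, lT, lE, nβ, mβ', aβ⟩ := hβ.exists
  obtain ⟨s, S₁, rfl⟩ := List.exists_cons_of_length_pos (lS ▸ hr)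
  simp only [← mα', ← mβ'] at hV
  simp only [List.cons_append, List.nodup_cons, List.nodup_append] at nα
  have cS₁ : ∀ v ∈ S₁, cl v = 1 := fun v hv => by
    obtain ⟨k, rfl⟩ := (mα' v).1 (by simp [hv])
    exact hαm k
  have cF : ∀ v ∈ F, cl v = 1 := fun v hv => by
    obtain ⟨k, rfl⟩ := (mα' v).1 (by simp [hv])
    exact hαm k
  have cT : ∀ v ∈ T, cl v = 2 := fun v hv => by
    obtain ⟨k, rfl⟩ := (mβ' v).1 (by simp [hv])
    exact hβm k
  have cE : ∀ v ∈ E, cl v = 2 := fun v hv => by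
    obtain ⟨k, rfl⟩ := (mβ' v).1 (by simp [hv])
    exact hβm k
  have cs : cl s = 1 := by
    obtain ⟨k, hk⟩ := (mα' s).1 (by simp)
    exact hk ▸ hαm k
  have hl : (b :: s :: (S₁ ++ (F ++ (T ++ E)))).Nodup := by
    simp only [List.nodup_cons, List.nodup_append, List.mem_cons, List.mem_append]
    clear hE hV mα' aα hαm hα mβ' aβ hβm hβ
    and_intros <;> grind
  have hc : ∀ v, v ∈ b :: s :: (S₁ ++ (F ++ (T ++ E))) := fun v => by
    have := hV v
    simp at this ⊢
    grind only
  refine P.equivalent_op ?_ (fun i j => ?_) (sim_reverse_two_of_loop hl hc rfl)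
  · simp only [List.nodup_cons, List.nodup_append] at hl
    simp [nd_nil, nd_cons_some, nd_append, nd_lone, nd_thread]
    clear hE hV mα' aα hαm hα mβ' aβ hβm hβ hc
    and_intros <;> grind
  · simp [hE, adj_none, adj_cons, adj_thread_lone, adj_pair, ← aα, ← aβ]
    tauto

end Ends

end ZeroRelQuiver

/-! ### The four families -/

open EndList

namespace ZeroRelQuiver.Ends

theorem eqvGen_of_root {V : Type} {R : V → V → Prop} (r : V)
    (h : ∀ v, Relation.EqvGen R v r) (v w : V) : Relation.EqvGen R v w :=
  (h v).trans _ _ _ ((h w).symm)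

/-- The ends of the arrows of `Λ₀(p, r)`. -/
def ofΛ₀ (p r : ℕ) (hp : 1 ≤ p) (hr : r ≤ p - 1) : Ends (quiverΛ₀ p r) where
  out
    -- Between `α_i` and `α_{i+1}` the incoming end is `false`, so there is a relation exactly when
    -- the outgoing end is `true`. At `i = p` the value is `false` because `r < p`; this differs
    -- from the end where `β` arrives, as the relation between `α_p` and `β` requires.
    | .α i => decide ((i : ℕ) ≤ r)
    | .β => true
    | .γ => false
  inn
    | .α i => decide ((i : ℕ) = 1)
    | .β => true
    | .γ => false
  inj e f hs ho := by
    rcases e with ⟨i, hi⟩ | _ | _ <;> rcases f with ⟨j, hj⟩ | _ | _ <;>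
      simp [quiverΛ₀, lineVertex] at hs ho ⊢ <;> grind
  rel e f hs := by
    rcases e with ⟨i, hi⟩ | _ | _ <;> rcases f with ⟨j, hj⟩ | _ | _ <;>
      simp [quiverΛ₀, lineVertex] at hs ⊢ <;> grind
  nonempty := ⟨.inl 0⟩
  connected := by
    have h := eqvGen_line (R := fun v w => ∃ e, (quiverΛ₀ p r).s e = v ∧ (quiverΛ₀ p r).t e = w)
      (p := p) (first := .inl 1) (last := .inl 0) (mid := .inr) fun k => ⟨.α k, rfl, rfl⟩
    refine eqvGen_of_root (.inl 1) ?_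
    rintro (v | v)
    · fin_cases v
      · exact h.1 hp
      · exact .refl _
    · exact h.2 v

/-- The ends of the arrows of `Λ₀'(p, 0)`. -/
def ofΛ₀' (p : ℕ) (hp : 1 ≤ p) : Ends (quiverΛ₀' p 0) where
  out
    | .α i => decide ((i : ℕ) = p)
    | .β => false
    | .γ => false
    | .δ => true
  inn
    | .α i => decide ((i : ℕ) = 1)
    | .β => false
    | .γ => false
    | .δ => true
  inj e f hs ho := by
    rcases e with ⟨i, hi⟩ | _ | _ | _ <;> rcases f with ⟨j, hj⟩ | _ | _ | _ <;>
      simp [quiverΛ₀', lineVertex] at hs ho ⊢ <;> grind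
  rel e f hs := by
    rcases e with ⟨i, hi⟩ | _ | _ | _ <;> rcases f with ⟨j, hj⟩ | _ | _ | _ <;>
      simp [quiverΛ₀', lineVertex] at hs ⊢ <;> grind
  nonempty := ⟨.inl 0⟩
  connected := by
    have h := eqvGen_line (R := fun v w => ∃ e, (quiverΛ₀' p 0).s e = v ∧ (quiverΛ₀' p 0).t e = w)
      (p := p) (first := .inl 0) (last := .inl 1) (mid := .inr) fun k => ⟨.α k, rfl, rfl⟩
    refine eqvGen_of_root (.inl 0) ?_
    rintro (v | v)
    · fin_cases v
      · exact .refl _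
      · exact h.1 hp
      · exact .trans _ _ _ (.rel _ _ ⟨.γ, rfl, rfl⟩) (h.1 hp)
    · exact h.2 v

variable (k : Type u) [Field k]

theorem _root_.equivalent_op_Λ₀ {p r : ℕ} (hp : 1 ≤ p) (hr : r ≤ p - 1) :
    TiltingCotiltingEquivalent k (Λ₀ k p r) (Λ₀ k p r)ᵐᵒᵖ := by
  let cl : Fin 2 ⊕ Set.Ioo 0 p → ℕ := Sum.elim Fin.val fun _ => 2
  refine equivalent_op_zero (P := ofΛ₀ p r hp hr) (x := .inl 0) (y := .inl 1) (mid := .inr)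
    (α := .α) (β := .β) (γ := .γ) hp hr Sum.inr_injective ?_ ?_ ⟨rfl, rfl⟩ ⟨rfl, rfl⟩ ?_ ?_
    cl rfl rfl fun _ => rfl
  · intro k
    refine Prod.ext rfl ?_
    simp only [i, ofΛ₀]
    grind
  · intro k
    refine Prod.ext rfl ?_
    simp only [j, ofΛ₀]
    grind
  · intro R
    constructor
    · rintro ⟨e, h⟩
      cases e <;> grind
    · rintro (⟨k, h⟩ | h | h) <;> exact ⟨_, h⟩
  · rintro (v | v)
    · fin_cases v
      exacts [.inl rfl, .inr (.inl rfl)]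
    · exact .inr (.inr ⟨v, rfl⟩)

theorem _root_.equivalent_op_Λ₀' {p : ℕ} (hp : 1 ≤ p) :
    TiltingCotiltingEquivalent k (Λ₀' k p 0) (Λ₀' k p 0)ᵐᵒᵖ := by
  let cl : Fin 3 ⊕ Set.Ioo 0 p → ℕ := Sum.elim Fin.val fun _ => 3
  refine equivalent_op_zero' (P := ofΛ₀' p hp) (x := .inl 0) (y := .inl 1) (z := .inl 2)
    (mα := .inr) (α := .α) (β := .β) (γ := .γ) (δ := .δ) ⟨hp, Nat.zero_le _, Sum.inr_injective, ?_, ?_⟩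
    ⟨rfl, rfl⟩ ⟨rfl, rfl⟩ ⟨rfl, rfl⟩ ?_ ?_ cl rfl rfl rfl fun _ => rfl
  · intro k
    refine Prod.ext rfl ?_
    simp only [i, ofΛ₀']
    grind
  · intro k
    refine Prod.ext rfl ?_
    simp only [j, ofΛ₀']
    grind
  · intro R
    constructor
    · rintro ⟨e, h⟩
      cases e <;> grind
    · rintro (⟨k, h⟩ | h | h | h) <;> exact ⟨_, h⟩
  · rintro (v | v)
    · fin_cases v
      exacts [.inl rfl, .inr (.inl rfl), .inr (.inr (.inl rfl))]
    · exact .inr (.inr (.inr ⟨v, rfl⟩))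

end ZeroRelQuiver.Ends

open EndList

namespace ZeroRelQuiver.Ends

/-- The ends of the arrows of `Λ₁(p₁, p₂, p₃, p₄, r₁)`. -/
noncomputable def ofΛ₁ (p₁ p₂ p₃ p₄ r₁ : ℕ) (h₁ : 1 ≤ p₁) (h₂ : 1 ≤ p₂) (hr : r₁ ≤ p₁ - 1) :
    Ends (quiverΛ₁ p₁ p₂ p₃ p₄ r₁) where
  out
    | .α i => decide (p₁ - r₁ ≤ (i : ℕ) ∧ (i : ℕ) < p₁)
    | .β _ => true
    | .γ _ => false
    -- The path `δ` has to leave `x` from the end where `β` arrives, and to meet the last vertex at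
    -- the end not used by `γ`. In its interior the ends are `false`, as no relations occur there.
    | .δ i => decide ((i : ℕ) = p₄)
  inn
    | .α _ => false
    | .β i => decide ((i : ℕ) = 1)
    | .γ _ => false
    | .δ i => decide ((i : ℕ) = 1)
  inj e f hs ho := by
    rcases e with ⟨i, hi⟩ | ⟨i, hi⟩ | ⟨i, hi⟩ | ⟨i, hi⟩ <;>
      rcases f with ⟨j, hj⟩ | ⟨j, hj⟩ | ⟨j, hj⟩ | ⟨j, hj⟩ <;>
      simp [quiverΛ₁, lineVertex] at hs ho ⊢ <;>
      first | grind | (split_ifs at hs <;> simp at hs <;> grind)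
  rel e f hs := by
    rcases e with ⟨i, hi⟩ | ⟨i, hi⟩ | ⟨i, hi⟩ | ⟨i, hi⟩ <;>
      rcases f with ⟨j, hj⟩ | ⟨j, hj⟩ | ⟨j, hj⟩ | ⟨j, hj⟩ <;>
      simp [quiverΛ₁, lineVertex] at hs ⊢ <;>
      first | grind | (split_ifs at hs <;> simp at hs <;> grind)
  nonempty := ⟨.inl ⟨0, by simp⟩⟩
  connected := by
    have hα := eqvGen_line (first := .inl ⟨p₃, by simp⟩) (last := .inl ⟨-p₄, by simp⟩)
      (mid := fun v => .inr (.inl v)) (R := fun v w => ∃ e,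
        (quiverΛ₁ p₁ p₂ p₃ p₄ r₁).s e = v ∧ (quiverΛ₁ p₁ p₂ p₃ p₄ r₁).t e = w)
      fun k => ⟨.α k, rfl, rfl⟩
    have hβ := eqvGen_line (first := .inl ⟨-p₄, by simp⟩) (last := .inl ⟨p₃, by simp⟩)
      (mid := fun v => .inr (.inr v)) (R := fun v w => ∃ e,
        (quiverΛ₁ p₁ p₂ p₃ p₄ r₁).s e = v ∧ (quiverΛ₁ p₁ p₂ p₃ p₄ r₁).t e = w)
      fun k => ⟨.β k, rfl, rfl⟩
    have hγ : ∀ (n : ℕ) (h : n ≤ p₃), Relation.EqvGen (fun v w => ∃ e,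
        (quiverΛ₁ p₁ p₂ p₃ p₄ r₁).s e = v ∧ (quiverΛ₁ p₁ p₂ p₃ p₄ r₁).t e = w)
        (.inl ⟨n, by constructor <;> omega⟩) (.inl ⟨0, by simp⟩) := by
      intro n
      induction n with
      | zero => exact fun _ => .refl _
      | succ n ih =>
        refine fun h => .trans _ _ _ (.rel _ _ ⟨.γ ⟨n + 1, by omega, h⟩, rfl, ?_⟩) (ih (by omega))
        simp [quiverΛ₁]
    have hδ : ∀ (n : ℕ) (h : n ≤ p₄), Relation.EqvGen (fun v w => ∃ e,
        (quiverΛ₁ p₁ p₂ p₃ p₄ r₁).s e = v ∧ (quiverΛ₁ p₁ p₂ p₃ p₄ r₁).t e = w)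
        (.inl ⟨-n, by constructor <;> omega⟩) (.inl ⟨0, by simp⟩) := by
      intro n
      induction n with
      | zero => exact fun _ => .refl _
      | succ n ih =>
        refine fun h => .trans _ _ _ (.rel _ _ ⟨.δ ⟨n + 1, by omega, h⟩, rfl, ?_⟩) (ih (by omega))
        simp [quiverΛ₁]
    refine eqvGen_of_root (.inl ⟨0, by simp⟩) ?_
    rintro (⟨v, hv, hv'⟩ | v | v)
    · rcases le_total 0 v with h | h
      · obtain ⟨n, rfl⟩ := Int.eq_ofNat_of_zero_le h
        exact hγ n (by omega)
      · obtain ⟨n, hn⟩ := Int.eq_ofNat_of_zero_le (a := -v) (by omega)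
        obtain rfl : v = -n := by omega
        exact hδ n (by omega)
    · exact .trans _ _ _ (hα.2 v) (hγ p₃ le_rfl)
    · exact .trans _ _ _ (hβ.2 v) (hδ p₄ le_rfl)

/-- The ends of the arrows of `Λ₂(p₁, p₂, p₃, r₁, r₂)`; `c` is the end of the vertex `0` at which the
cycle of the `α_i` starts, and `d` is the end of the vertex `p₃` at which the cycle of the `β_i`
starts. -/
def ofΛ₂ (p₁ p₂ p₃ r₁ r₂ : ℕ) (h₁ : 1 ≤ p₁) (h₂ : 1 ≤ p₂) (hr₁ : r₁ ≤ p₁ - 1)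
    (hr₂ : r₂ ≤ p₂ - 1) (c d : Bool) (h : (p₃ = 0 ∧ d = !c) ∨ (0 < p₃ ∧ c = false ∧ d = false)) :
    Ends (quiverΛ₂ p₁ p₂ p₃ r₁ r₂) where
  out
    | .α i => if (i : ℕ) = p₁ then c else decide (p₁ - r₁ ≤ (i : ℕ))
    | .β i => if (i : ℕ) = p₂ then d else decide (p₂ - r₂ ≤ (i : ℕ))
    | .γ i => decide ((i : ℕ) = p₃)
  inn
    | .α i => if (i : ℕ) = 1 then !c else false
    | .β i => if (i : ℕ) = 1 then !d else false
    | .γ _ => false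
  inj e f hs ho := by
    rcases e with ⟨i, hi⟩ | ⟨i, hi⟩ | ⟨i, hi⟩ <;>
      rcases f with ⟨j, hj⟩ | ⟨j, hj⟩ | ⟨j, hj⟩ <;>
      simp [quiverΛ₂, lineVertex] at hs ho ⊢ <;> grind
  rel e f hs := by
    rcases e with ⟨i, hi⟩ | ⟨i, hi⟩ | ⟨i, hi⟩ <;>
      rcases f with ⟨j, hj⟩ | ⟨j, hj⟩ | ⟨j, hj⟩ <;>
      simp [quiverΛ₂, lineVertex] at hs ⊢ <;> grind
  nonempty := ⟨.inl ⟨0, by simp⟩⟩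
  connected := by
    have hα := eqvGen_line (first := .inl ⟨0, by simp⟩) (last := .inl ⟨0, by simp⟩)
      (mid := fun v => .inr (.inl v)) (R := fun v w => ∃ e,
        (quiverΛ₂ p₁ p₂ p₃ r₁ r₂).s e = v ∧ (quiverΛ₂ p₁ p₂ p₃ r₁ r₂).t e = w)
      fun k => ⟨.α k, rfl, rfl⟩
    have hβ := eqvGen_line (first := .inl ⟨p₃, by simp⟩) (last := .inl ⟨p₃, by simp⟩)
      (mid := fun v => .inr (.inr v)) (R := fun v w => ∃ e,
        (quiverΛ₂ p₁ p₂ p₃ r₁ r₂).s e = v ∧ (quiverΛ₂ p₁ p₂ p₃ r₁ r₂).t e = w)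
      fun k => ⟨.β k, rfl, rfl⟩
    have hγ : ∀ (n : ℕ) (h : n ≤ p₃), Relation.EqvGen (fun v w => ∃ e,
        (quiverΛ₂ p₁ p₂ p₃ r₁ r₂).s e = v ∧ (quiverΛ₂ p₁ p₂ p₃ r₁ r₂).t e = w)
        (.inl ⟨n, by constructor <;> omega⟩) (.inl ⟨0, by simp⟩) := by
      intro n
      induction n with
      | zero => exact fun _ => .refl _
      | succ n ih =>
        exact fun h => .trans _ _ _ (.rel _ _ ⟨.γ ⟨n + 1, by omega, h⟩, rfl, rfl⟩) (ih (by omega))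
    refine eqvGen_of_root (.inl ⟨0, by simp⟩) ?_
    rintro (⟨v, hv, hv'⟩ | v | v)
    · exact hγ v hv'
    · exact hα.2 v
    · exact .trans _ _ _ (hβ.2 v) (hγ p₃ le_rfl)

end ZeroRelQuiver.Ends

open EndList

namespace ZeroRelQuiver.Ends

section Λ₁

variable {p₁ p₂ p₃ p₄ r₁ : ℕ} (h₁ : 1 ≤ p₁) (h₂ : 1 ≤ p₂) (hr : r₁ ≤ p₁ - 1)

theorem lineα₁ : (ofΛ₁ p₁ p₂ p₃ p₄ r₁ h₁ h₂ hr).Line p₁ r₁ (.inl ⟨-p₄, by simp⟩, false)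
    (.inl ⟨p₃, by simp⟩, false) (fun v => .inr (.inl v)) .α where
  one_le := h₁
  le := hr
  inj := Sum.inr_injective.comp Sum.inl_injective
  i_eq k := by
    refine Prod.ext rfl ?_
    simp only [i, ofΛ₁]
    grind
  j_eq k := by
    refine Prod.ext rfl ?_
    simp only [j, ofΛ₁]
    grind

theorem lineβ₁ : (ofΛ₁ p₁ p₂ p₃ p₄ r₁ h₁ h₂ hr).Line p₂ (p₂ - 1) (.inl ⟨p₃, by simp⟩, true)
    (.inl ⟨-p₄, by simp⟩, true) (fun v => .inr (.inr v)) .β where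
  one_le := h₂
  le := le_rfl
  inj := Sum.inr_injective.comp Sum.inr_injective
  i_eq k := by
    refine Prod.ext rfl ?_
    simp only [i, ofΛ₁]
    grind
  j_eq k := by
    refine Prod.ext rfl ?_
    simp only [j, ofΛ₁]
    grind

theorem lineγ₁ (h₃ : 1 ≤ p₃) : (ofΛ₁ p₁ p₂ p₃ p₄ r₁ h₁ h₂ hr).Line p₃ 0
    (.inl ⟨p₃, by simp⟩, false) (.inl ⟨0, by simp⟩, false)
    (fun v => .inl ⟨(v : ℕ), by have := v.2.2; constructor <;> omega⟩) .γ where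
  one_le := h₃
  le := Nat.zero_le _
  inj v w h := by
    have := congrArg Subtype.val (Sum.inl_injective h)
    exact Subtype.ext (by simpa using this)
  i_eq k := by
    obtain ⟨k, hk, hk'⟩ := k
    refine Prod.ext ?_ ?_
    · simp only [i, quiverΛ₁, lineVertex]
      grind
    · simp only [i, ofΛ₁]
      grind
  j_eq k := by
    obtain ⟨k, hk, hk'⟩ := k
    refine Prod.ext ?_ ?_
    · simp only [j, quiverΛ₁, lineVertex]
      grind
    · simp only [j, ofΛ₁]
      grind

theorem lineδ₁ (h₄ : 1 ≤ p₄) : (ofΛ₁ p₁ p₂ p₃ p₄ r₁ h₁ h₂ hr).Line p₄ 0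
    (.inl ⟨-p₄, by simp⟩, true) (.inl ⟨0, by simp⟩, true)
    (fun v => .inl ⟨-(v : ℕ), by have := v.2.2; constructor <;> omega⟩) .δ where
  one_le := h₄
  le := Nat.zero_le _
  inj v w h := by
    have := congrArg Subtype.val (Sum.inl_injective h)
    exact Subtype.ext (by simpa using this)
  i_eq k := by
    obtain ⟨k, hk, hk'⟩ := k
    refine Prod.ext ?_ ?_
    · simp only [i, quiverΛ₁, lineVertex]
      grind
    · simp only [i, ofΛ₁]
      grind
  j_eq k := by
    obtain ⟨k, hk, hk'⟩ := k
    refine Prod.ext ?_ ?_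
    · simp only [j, quiverΛ₁, lineVertex]
      grind
    · simp only [j, ofΛ₁]
      grind

/-- Coincidences among `x`, `y`, `z` decide the shape of the list. For `p₄ = 0` the chain of `α` and
`γ` is closed, and the parameters force `r₁ ≥ 1`; if also `p₃ = 0`, then `β` is closed too and `p₂ ≥
2` gives it an interior relation. For `p₄ > 0` also `p₃ > 0`, and the three vertices are distinct.
-/
theorem _root_.equivalent_op_Λ₁ (k : Type u) [Field k] (h₁ : 1 ≤ p₁) (h₂ : 1 ≤ p₂)
    (hr : r₁ ≤ p₁ - 1) (h₂₃ : 2 ≤ p₂ + p₃) (h₄ : 1 ≤ p₄ + r₁) (h : p₄ ≤ p₃) :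
    TiltingCotiltingEquivalent k (Λ₁ k p₁ p₂ p₃ p₄ r₁) (Λ₁ k p₁ p₂ p₃ p₄ r₁)ᵐᵒᵖ := by
  rcases Nat.eq_zero_or_pos p₄ with rfl | hp₄
  · rcases Nat.eq_zero_or_pos p₃ with rfl | hp₃
    · let cl : Set.Icc (-(0 : ℕ) : ℤ) (0 : ℕ) ⊕ Set.Ioo 0 p₁ ⊕ Set.Ioo 0 p₂ → ℕ :=
        Sum.elim (fun _ => 0) (Sum.elim (fun _ => 1) fun _ => 2)
      refine equivalent_op_one_of_loops (by omega) (by omega)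
        (lineα₁ h₁ h₂ hr) (lineβ₁ h₁ h₂ hr) ?_ ?_ cl rfl (fun _ => rfl) (fun _ => rfl)
      · intro R
        constructor
        · rintro ⟨⟨i, hi⟩ | ⟨i, hi⟩ | ⟨i, hi⟩ | ⟨i, hi⟩, h⟩ <;> grind
        · rintro (⟨k, h⟩ | ⟨k, h⟩) <;> exact ⟨_, h⟩
      · rintro (⟨v, hv, hv'⟩ | v | v)
        · exact .inl (congrArg Sum.inl (Subtype.ext (by simp at *; omega)))
        · exact .inr (.inl ⟨v, rfl⟩)
        · exact .inr (.inr ⟨v, rfl⟩)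
    · let cl : Set.Icc (-(0 : ℕ) : ℤ) p₃ ⊕ Set.Ioo 0 p₁ ⊕ Set.Ioo 0 p₂ → ℕ :=
        Sum.elim (fun v => if v.1 = 0 then 0 else if v.1 = p₃ then 1 else 4)
          (Sum.elim (fun _ => 2) fun _ => 3)
      refine equivalent_op_one_of_loop (by omega) (lineα₁ h₁ h₂ hr) (lineβ₁ h₁ h₂ hr)
        (lineγ₁ h₁ h₂ hr hp₃) ?_ ?_ cl ?_ ?_ (fun _ => rfl) (fun _ => rfl) ?_
      · intro R
        constructor
        · rintro ⟨⟨i, hi⟩ | ⟨i, hi⟩ | ⟨i, hi⟩ | ⟨i, hi⟩, h⟩ <;> grind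
        · rintro (⟨k, h⟩ | ⟨k, h⟩ | ⟨k, h⟩) <;> exact ⟨_, h⟩
      · rintro (⟨v, hv, hv'⟩ | v | v)
        · obtain ⟨n, rfl⟩ := Int.eq_ofNat_of_zero_le (by simpa using hv)
          rcases Nat.eq_zero_or_pos n with rfl | hn
          · exact .inl rfl
          · rcases eq_or_ne n p₃ with rfl | hn'
            · exact .inr (.inl rfl)
            · exact .inr (.inr (.inr (.inr ⟨⟨n, hn, by omega⟩, rfl⟩)))
        · exact .inr (.inr (.inl ⟨v, rfl⟩))
        · exact .inr (.inr (.inr (.inl ⟨v, rfl⟩)))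
      · rfl
      · simp [cl]
        grind
      · rintro ⟨k, hk, hk'⟩
        simp [cl]
        grind
  · let cl : Set.Icc (-p₄ : ℤ) p₃ ⊕ Set.Ioo 0 p₁ ⊕ Set.Ioo 0 p₂ → ℕ :=
      Sum.elim (fun v => if v.1 = -p₄ then 0 else if v.1 = p₃ then 1 else if v.1 = 0 then 2 else
        if 0 < v.1 then 5 else 6) (Sum.elim (fun _ => 3) fun _ => 4)
    refine equivalent_op_one (lineα₁ h₁ h₂ hr) (lineβ₁ h₁ h₂ hr)
      (lineγ₁ h₁ h₂ hr (by omega)) (lineδ₁ h₁ h₂ hr hp₄) ?_ ?_ cl ?_ ?_ ?_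
        (fun _ => rfl) (fun _ => rfl) ?_ ?_
    · intro R
      constructor
      · rintro ⟨⟨i, hi⟩ | ⟨i, hi⟩ | ⟨i, hi⟩ | ⟨i, hi⟩, h⟩ <;> grind
      · rintro (⟨k, h⟩ | ⟨k, h⟩ | ⟨k, h⟩ | ⟨k, h⟩) <;> exact ⟨_, h⟩
    · rintro (⟨v, hv, hv'⟩ | v | v)
      · rcases lt_trichotomy v 0 with hz | rfl | hz
        · obtain ⟨n, hn⟩ := Int.eq_ofNat_of_zero_le (a := -v) (by omega)
          obtain rfl : v = -n := by omega
          rcases eq_or_ne n p₄ with rfl | hn'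
          · exact .inl rfl
          · exact .inr (.inr (.inr (.inr (.inr (.inr ⟨⟨n, by omega, by omega⟩, rfl⟩)))))
        · exact .inr (.inr (.inl rfl))
        · obtain ⟨n, rfl⟩ := Int.eq_ofNat_of_zero_le hz.le
          rcases eq_or_ne n p₃ with rfl | hn'
          · exact .inr (.inl rfl)
          · exact .inr (.inr (.inr (.inr (.inr (.inl ⟨⟨n, by omega, by omega⟩, rfl⟩)))))
      · exact .inr (.inr (.inr (.inl ⟨v, rfl⟩)))
      · exact .inr (.inr (.inr (.inr (.inl ⟨v, rfl⟩))))
    · simp [cl]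
    · simp [cl]
      grind
    · simp [cl]
      grind
    · rintro ⟨k, hk, hk'⟩
      simp [cl]
      grind
    · rintro ⟨k, hk, hk'⟩
      simp [cl]
      grind

end Λ₁

section Λ₂

variable {p₁ p₂ p₃ : ℕ}

theorem exists_arrow₂ (R : Arrow₂ p₁ p₂ p₃ → Prop) :
    (∃ e, R e) ↔ (∃ k, R (.α k)) ∨ (∃ k, R (.β k)) ∨ ∃ k, R (.γ k) := by
  constructor
  · rintro ⟨⟨i, hi⟩ | ⟨i, hi⟩ | ⟨i, hi⟩, h⟩ <;> grind
  · rintro (⟨k, h⟩ | ⟨k, h⟩ | ⟨k, h⟩) <;> exact ⟨_, h⟩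

theorem exists_vertex₂ (v : Set.Icc 0 p₃ ⊕ Set.Ioo 0 p₁ ⊕ Set.Ioo 0 p₂) :
    v = .inl ⟨0, by simp⟩ ∨ v = .inl ⟨p₃, by simp⟩ ∨
      (∃ k : Set.Ioo 0 p₁, .inr (.inl k) = v) ∨ (∃ k : Set.Ioo 0 p₂, .inr (.inr k) = v) ∨
      ∃ k : Set.Ioo 0 p₃, .inl ⟨k, by have := k.2.2; constructor <;> omega⟩ = v := by
  rcases v with ⟨n, hn, hn'⟩ | v | v
  · rcases Nat.eq_zero_or_pos n with rfl | hn
    · exact .inl rfl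
    · rcases eq_or_ne n p₃ with rfl | hne
      · exact .inr (.inl rfl)
      · exact .inr (.inr (.inr (.inr ⟨⟨n, hn, by omega⟩, rfl⟩)))
  · exact .inr (.inr (.inl ⟨v, rfl⟩))
  · exact .inr (.inr (.inr (.inl ⟨v, rfl⟩)))

/-- A numbering of the kinds of vertices of the quiver of `Λ₂`. -/
def kind₂ : Set.Icc 0 p₃ ⊕ Set.Ioo 0 p₁ ⊕ Set.Ioo 0 p₂ → ℕ :=
  Sum.elim (fun v => if v.1 = 0 then 0 else if v.1 = p₃ then 1 else 4)
    (Sum.elim (fun _ => 2) fun _ => 3)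

variable {r₁ r₂ : ℕ} (h₁ : 1 ≤ p₁) (h₂ : 1 ≤ p₂) (hr₁ : r₁ ≤ p₁ - 1) (hr₂ : r₂ ≤ p₂ - 1)
  {c d : Bool} (h : (p₃ = 0 ∧ d = !c) ∨ (0 < p₃ ∧ c = false ∧ d = false))

theorem lineα₂ : (ofΛ₂ p₁ p₂ p₃ r₁ r₂ h₁ h₂ hr₁ hr₂ c d h).Line p₁ r₁ (.inl ⟨0, by simp⟩, c)
    (.inl ⟨0, by simp⟩, !c) (fun v => .inr (.inl v)) .α :=
  ⟨h₁, hr₁, Sum.inr_injective.comp Sum.inl_injective, fun _ => rfl, fun _ => rfl⟩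

theorem lineβ₂ : (ofΛ₂ p₁ p₂ p₃ r₁ r₂ h₁ h₂ hr₁ hr₂ c d h).Line p₂ r₂ (.inl ⟨p₃, by simp⟩, d)
    (.inl ⟨p₃, by simp⟩, !d) (fun v => .inr (.inr v)) .β :=
  ⟨h₂, hr₂, Sum.inr_injective.comp Sum.inr_injective, fun _ => rfl, fun _ => rfl⟩

theorem lineγ₂ (h₃ : 1 ≤ p₃) : (ofΛ₂ p₁ p₂ p₃ r₁ r₂ h₁ h₂ hr₁ hr₂ c d h).Line p₃ 0
    (.inl ⟨p₃, by simp⟩, true) (.inl ⟨0, by simp⟩, false)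
    (fun v => .inl ⟨v, by have := v.2.2; constructor <;> omega⟩) .γ where
  one_le := h₃
  le := Nat.zero_le _
  inj v w h := Subtype.ext (congrArg Subtype.val (Sum.inl_injective h) :)
  i_eq k := by
    obtain ⟨k, hk, hk'⟩ := k
    refine Prod.ext ?_ ?_
    · simp only [i, quiverΛ₂, lineVertex]
      grind
    · simp only [i, ofΛ₂]
      grind
  j_eq k := by
    obtain ⟨k, hk, hk'⟩ := k
    refine Prod.ext ?_ ?_
    · simp only [j, quiverΛ₂, lineVertex]
      grind
    · simp only [j, ofΛ₂]
      grind

/-- For `p₃ = 0` the cycles share a vertex and one of them has an interior relation. For `p₃ > 0`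
the double slide of `a` needs an interior vertex of the cycle `α`, at a relation if possible; if
there is none, both cycles are loops. -/
theorem _root_.equivalent_op_Λ₂ (k : Type u) [Field k] (h₁ : 1 ≤ p₁) (h₂ : 1 ≤ p₂)
    (hr₁ : r₁ ≤ p₁ - 1) (hr₂ : r₂ ≤ p₂ - 1) (h₃ : 1 ≤ p₃ + r₁ + r₂) (h : p₂ ≤ p₁) :
    TiltingCotiltingEquivalent k (Λ₂ k p₁ p₂ p₃ r₁ r₂) (Λ₂ k p₁ p₂ p₃ r₁ r₂)ᵐᵒᵖ := by
  rcases Nat.eq_zero_or_pos p₃ with rfl | hp₃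
  · let cl : Set.Icc 0 0 ⊕ Set.Ioo 0 p₁ ⊕ Set.Ioo 0 p₂ → ℕ :=
      Sum.elim (fun _ => 0) (Sum.elim (fun _ => 1) fun _ => 2)
    let cl' : Set.Icc 0 0 ⊕ Set.Ioo 0 p₁ ⊕ Set.Ioo 0 p₂ → ℕ :=
      Sum.elim (fun _ => 0) (Sum.elim (fun _ => 2) fun _ => 1)
    -- The closed chain is cut at a relation in the interior of one cycle. If `α` has none, `β` has
    -- one, and the two cycles exchange their roles.
    rcases Nat.eq_zero_or_pos r₁ with rfl | hr₁'
    · refine equivalent_op_two_of_loop (by omega)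
        (lineβ₂ h₁ h₂ hr₁ hr₂ (c := false) (d := true) (by simp))
        (lineα₂ h₁ h₂ hr₁ hr₂ (by simp)) (fun R => ?_) (fun v => ?_) cl' rfl (fun _ => rfl)
        (fun _ => rfl)
      · have := exists_arrow₂ R
        grind
      · have := exists_vertex₂ v
        grind
    · refine equivalent_op_two_of_loop hr₁'
        (lineα₂ h₁ h₂ hr₁ hr₂ (c := true) (d := false) (by simp))
        (lineβ₂ h₁ h₂ hr₁ hr₂ (by simp)) (fun R => ?_) (fun v => ?_) cl rfl (fun _ => rfl)
        (fun _ => rfl)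
      · have := exists_arrow₂ R
        grind
      · have := exists_vertex₂ v
        grind
  · have hc : (p₃ = 0 ∧ false = !false) ∨ (0 < p₃ ∧ false = false ∧ false = false) := by simp [hp₃]
    have ha := lineα₂ h₁ h₂ hr₁ hr₂ hc
    have hb := lineβ₂ h₁ h₂ hr₁ hr₂ hc
    have hγ := lineγ₂ h₁ h₂ hr₁ hr₂ hc hp₃
    have h0 : kind₂ (p₁ := p₁) (p₂ := p₂) (p₃ := p₃) (.inl ⟨0, by simp⟩) = 0 := rfl
    have h1 : kind₂ (p₁ := p₁) (p₂ := p₂) (p₃ := p₃) (.inl ⟨p₃, by simp⟩) = 1 := by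
      simp [kind₂]
      grind
    have h4 (k : Set.Ioo 0 p₃) : kind₂ (p₁ := p₁) (p₂ := p₂) (p₃ := p₃)
        (.inl ⟨k, by have := k.2.2; constructor <;> omega⟩) = 4 := by
      obtain ⟨k, hk, hk'⟩ := k
      simp [kind₂]
      grind
    rcases Nat.eq_zero_or_pos r₁ with rfl | hr₁'
    -- A loop `α` forces `p₂ = 1` by `p₂ ≤ p₁`, so `β` is a loop as well.
    · rcases h₁.eq_or_lt with rfl | h₁'
      · obtain rfl : p₂ = 1 := by omega
        obtain rfl : r₂ = 0 := by omega
        exact equivalent_op_two_of_eq_one ha hb hγ exists_arrow₂ exists_vertex₂ kind₂ h0 h1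
          h4
      · exact equivalent_op_two_of_eq_zero (by omega) ha hb hγ exists_arrow₂ exists_vertex₂ kind₂
          h0 h1 (fun _ => rfl) (fun _ => rfl) h4
    · exact equivalent_op_two hr₁' ha hb hγ exists_arrow₂ exists_vertex₂ kind₂ h0 h1
        (fun _ => rfl) (fun _ => rfl) h4

end Λ₂

end ZeroRelQuiver.Ends

theorem mainTheorem5 (k : Type u) [Field k] [IsAlgClosed k] :
    (∀ p₁ p₂ p₃ p₄ r₁ : ℕ, 1 ≤ p₁ → 1 ≤ p₂ → r₁ ≤ p₁ - 1 → 2 ≤ p₂ + p₃ → 1 ≤ p₄ + r₁ →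
      (p₄ < p₃ ∨ p₃ = p₄ ∧ r₁ < p₂) →
      TiltingCotiltingEquivalent k (Λ₁ k p₁ p₂ p₃ p₄ r₁) (Λ₁ k p₁ p₂ p₃ p₄ r₁)ᵐᵒᵖ) ∧
    (∀ p₁ p₂ p₃ r₁ r₂ : ℕ, 1 ≤ p₁ → 1 ≤ p₂ → r₁ ≤ p₁ - 1 → r₂ ≤ p₂ - 1 → 1 ≤ p₃ + r₁ + r₂ →
      (p₂ < p₁ ∨ p₁ = p₂ ∧ r₂ ≤ r₁) →
      TiltingCotiltingEquivalent k (Λ₂ k p₁ p₂ p₃ r₁ r₂) (Λ₂ k p₁ p₂ p₃ r₁ r₂)ᵐᵒᵖ) ∧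
    (∀ p r : ℕ, 1 ≤ p → r ≤ p - 1 →
      TiltingCotiltingEquivalent k (Λ₀ k p r) (Λ₀ k p r)ᵐᵒᵖ) ∧
    (∀ p : ℕ, 1 ≤ p →
      TiltingCotiltingEquivalent k (Λ₀' k p 0) (Λ₀' k p 0)ᵐᵒᵖ) := by
  exact ⟨fun _ _ _ _ _ h₁ h₂ hr h₂₃ h₄ h => equivalent_op_Λ₁ k h₁ h₂ hr h₂₃ h₄ (by omega),
    fun _ _ _ _ _ h₁ h₂ hr₁ hr₂ h₃ h => equivalent_op_Λ₂ k h₁ h₂ hr₁ hr₂ h₃ (by omega),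
    fun _ _ hp hr => equivalent_op_Λ₀ k hp hr, fun _ hp => equivalent_op_Λ₀' k hp⟩
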